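/- Let $k$ be an algebraically closed field of characteristic $0$ and let $\mathcal A$ be a premodular category over $k$, i.e. a ribbon (= braided, spherical pivotal) fusion category, with braiding $c$ and pivotal isomorphism $\delta : X \simeq X^{**}$. Let $(X_i)_{i\in \mathrm{Irr}}$ represent the simple objects, $d_i=\dim X_i$, $\mathcal D=\sum_i d_i^2$, and fix square roots $\sqrt{d_i}$, $\sqrt{\mathcal D}$. For dual bases $\alpha$ of $\mathrm{Hom}(X_j,V)$ and $\mathrm{Hom}(V,X_j)$ under the trace pairing $(f,g)\mapsto \mathrm{tr}(gf)$, a sum over $\alpha$ is understood below, one member of each pair being rotated to the duals by means of $\delta$. A half-braiding on $X$ is written $\gamma_A : A\otimes X\to X\otimes A$. *Horizontal trace.* $\hat{\mathcal A}$ has the objects of $\mathcal A$, and $\mathrm{Hom}_{\hat{\mathcal A}}(X,X')=\int^{A}\mathrm{Hom}_{\mathcal A}(A\otimes X,X'\otimes A)$, with composition of $\varphi: A\otimes X\to X'\otimes A$ and $\psi: B\otimes X'\to X''\otimes B$ given by $(\psi\otimes 1_A)(1_B\otimes\varphi)$. The tensor product $\hat\otimes$ is $\otimes$ on objects, and for $\varphi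 : A\otimes X\to X'\otimes A$, $\psi : B\otimes Y\to Y'\otimes B$ it is the class of $A B X Y\to A X B Y\to X' A Y' B\to X'Y'AB$, where $X$ passes over $B$, then $\varphi\otimes\psi$ is applied, and then $A$ passes over $Y'$. Unit, constraints, duals and pivotal structure are those of $\mathcal A$. *Reduced tensor product.* For objects $(X,\gamma),(Y,\mu)$ of the Drinfeld center $\mathcal Z(\mathcal A)$, let $Q_{\gamma,\mu}=\frac1{\mathcal D}\sum_i d_i\,Q^i$, where $Q^i$ is the composite $$XY\to X X_iX_i^*Y\to X_iX X_i^*Y\xrightarrow{\mu_{X_i^*}}X_iX Y X_i^*\xrightarrow{\gamma_{X_i}} X X_iYX_i^*\to XX_iX_i^*Y\to XY$$ (coevaluation of $X_i$; $X$ passes over $X_i$; $\mu$; $\gamma$; $X_i^*$ passes over $Y$; evaluation). It is an idempotent, and $(X,\gamma)\,\overline\otimes\,(Y,\mu)$ is its image, with the half-braiding given by the same picture in which the strand $A$ enters the loop on the left, $A\otimes X_i\to X_j$, and leaves it on the right, $X_i^*\to X_j^*\otimes A$: $$\textstyle\frac1{\mathcal D}\sum_{i,j}d_id_j\sum_\alpha(\cdots).$$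 The associativity constraint is that of $\mathcal A$. The unit is $I(\mathbf 1)$, where $I(A)=\bigoplus_i X_i\otimes A\otimes X_i^*$ with half-braiding $$\textstyle\Gamma_B=\sum_{i,j}\sqrt{d_i}\sqrt{d_j}\sum_\alpha\ (B X_iAX_i^*\to X_jAX_i^*\to X_jAX_j^*B);$$ its unit constraints are $\sum_i\frac{\sqrt{d_i}}{\sqrt{\mathcal D}}(X_iX_i^*X\to X_iXX_i^*\to XX_iX_i^*\to X)$, where $X_i^*$ passes over $X$ and then $\gamma_{X_i}$ is applied, and $\sum_i\frac{\sqrt{d_i}}{\sqrt{\mathcal D}}(XX_iX_i^*\to X_iXX_i^*\to XX_iX_i^*\to X)$, where $X$ passes over $X_i$ and then $\gamma_{X_i}$ is applied. The dual is $(X,\gamma)^\vee=(X^*,\gamma^\vee)$ with $$\gamma^\vee_A : AX^*\to X^*A\to X^*AXX^*\xrightarrow{\gamma_A}X^*XAX^*\to AX^*\to X^*A$$ ($X^*$ passes over $A$; coevaluation; $\gamma_A$; evaluation; $A$ passes over $X^*$); the evaluation and coevaluation are $$\textstyle\sum_i\frac{\sqrt{d_i}}{\sqrt{\mathcal D}}(X^*X\to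 X^*X_iX_i^*X\to X_iX^*X_i^*X\xrightarrow{\gamma_{X_i^*}}X_iX^*XX_i^*\to X_iX_i^*),$$ $$\textstyle\sum_i\frac{\sqrt{d_i}}{\sqrt{\mathcal D}}(X_iX_i^*\to X_iXX^*X_i^*\to X_iXX_i^*X^*\xrightarrow{\gamma_{X_i}}XX_iX_i^*X^*\to XX^*)$$ ($X^*$ over $X_i$ in the first, $X_i^*$ over $X^*$ in the second). The pivotal structure is $\delta$. *The functor.* Let $G(X)=I(X)$, and for $\psi : A\otimes X\to X'\otimes A$ let $$\textstyle G(\psi)=\sum_{i,j}\sqrt{d_i}\sqrt{d_j}\sum_\alpha\ (X_iXX_i^*\to X_jAXX_i^*\xrightarrow{\psi}X_jX'AX_i^*\to X_jX'X_j^*).$$ Let $J_{X,Y}: I(X)\,\overline\otimes\, I(Y)\to I(X\otimes Y)$ be the restriction of $$\textstyle\sum_{i,j,l}\sqrt{d_i}\sqrt{d_j}\sqrt{d_l}\sum_\alpha\ (X_iXX_i^*X_lYX_l^*\to X_iX_lXYX_l^*X_i^*\to X_jXYX_j^*),$$ where $X$ and $X_i^*$ pass over $X_l$, and $X_i^*$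 passes over $Y X_l^*$. **Proposition.** These formulas define a pivotal multifusion category $(\mathcal Z(\mathcal A),\overline\otimes)$, a pivotal tensor category $(\hat{\mathcal A},\hat\otimes)$ and a $k$-linear functor $G:\hat{\mathcal A}\to\mathcal Z(\mathcal A)$, and $$(G,J):(\hat{\mathcal A},\hat\otimes)\to(\mathcal Z(\mathcal A),\overline\otimes)$$ is a pivotal tensor functor. The Karoubi envelope $\mathrm{Kar}(\hat{\mathcal A})$, with the induced tensor product, duals and pivotal structure, is a pivotal multifusion category, and the extension $\mathrm{Kar}(G):\mathrm{Kar}(\hat{\mathcal A})\to(\mathcal Z(\mathcal A),\overline\otimes)$ of $(G,J)$ is a $k$-linear pivotal tensor functor and an equivalence; i.e. it is an equivalence of pivotal multifusion categories. -/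

import Mathlib

open CategoryTheory MonoidalCategory Limits

universe w v u v₁ u₁ v₂ u₂

set_option linter.unusedSectionVars false

noncomputable section

namespace CategoryTheory

/-! ### Pivotal structures and pivotal functors -/
section Pivotal

variable {C : Type u₁} [Category.{v₁} C] [MonoidalCategory C]

/-- The canonical morphism `Yᘁ ⊗ Xᘁ ⟶ (X ⊗ Y)ᘁ` (an isomorphism). -/
def dualTensor [RightRigidCategory C] (X Y : C) : (Yᘁ : C) ⊗ Xᘁ ⟶ (X ⊗ Y)ᘁ :=
  𝟙 _ ⊗≫ ((Yᘁ : C) ⊗ Xᘁ) ◁ η_ (X ⊗ Y) ((X ⊗ Y)ᘁ) ⊗≫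
    (Yᘁ : C) ◁ ε_ X (Xᘁ) ▷ (Y ⊗ (X ⊗ Y)ᘁ) ⊗≫ ε_ Y (Yᘁ) ▷ ((X ⊗ Y)ᘁ) ⊗≫ 𝟙 _

variable (C) in
/-- A pivotal structure: a monoidal natural isomorphism from the identity to the double dual. -/
structure PivotalStructure [RightRigidCategory C] where
  iso : ∀ X : C, X ≅ ((Xᘁ : C)ᘁ : C)
  naturality : ∀ {X Y : C} (f : X ⟶ Y), (iso X).hom ≫ (fᘁᘁ) = f ≫ (iso Y).hom
  tensor : ∀ X Y : C, (iso (X ⊗ Y)).hom ≫ ((dualTensor X Y)ᘁ) =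
    ((iso X).hom ⊗ₘ (iso Y).hom) ≫ dualTensor (Yᘁ) (Xᘁ)

variable {D : Type u₂} [Category.{v₂} D] [MonoidalCategory D]

open Functor.LaxMonoidal Functor.OplaxMonoidal in
/-- The canonical morphism `F (Xᘁ) ⟶ (F X)ᘁ` (an isomorphism) of a monoidal functor `F`. -/
def dualComparison [RightRigidCategory C] [RightRigidCategory D] (F : C ⥤ D) [F.Monoidal]
    (X : C) : F.obj (Xᘁ) ⟶ (F.obj X)ᘁ :=
  𝟙 _ ⊗≫ F.obj (Xᘁ) ◁ η_ (F.obj X) ((F.obj X)ᘁ) ⊗≫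
    (μ F (Xᘁ) X ≫ F.map (ε_ X (Xᘁ)) ≫ η F) ▷ ((F.obj X)ᘁ) ⊗≫ 𝟙 _

/-- A monoidal functor is pivotal if it carries the pivotal structure of the source to that of the
target, up to the canonical comparison of duals. -/
def IsPivotalFunctor [RightRigidCategory C] [RightRigidCategory D]
    (P : PivotalStructure C) (P' : PivotalStructure D) (F : C ⥤ D) [F.Monoidal] : Prop :=
  ∀ X : C, F.map (P.iso X).hom ≫ dualComparison F (Xᘁ) =
    (P'.iso (F.obj X)).hom ≫ ((dualComparison F X)ᘁ)

end Pivotal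

/-- The semisimplicity and finiteness part -/
structure IsFiniteSemisimple (k : Type w) [Field k] (D : Type u₁) [Category.{v₁} D] [Preadditive D]
    [Linear k D] : Prop where
  hasFiniteProducts : HasFiniteProducts D
  hasKernels : HasKernels D
  hasCokernels : HasCokernels D
  normalMono : IsNormalMonoCategory D
  normalEpi : IsNormalEpiCategory D
  finiteDimensional : ∀ X Y : D, FiniteDimensional k (X ⟶ Y)
  semisimple : ∀ X : D, ∃ (n : ℕ) (S : Fin n → D) (b : Limits.Bicone S), (∀ i, Simple (S i)) ∧
    Nonempty b.IsBilimit ∧ Nonempty (X ≅ b.pt)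
  finiteSimples : ∃ (n : ℕ) (S : Fin n → D), ∀ Y : D, Simple Y → ∃ i, Nonempty (Y ≅ S i)

/-- A multifusion category over `k`. -/
structure IsMultifusion (k : Type w) [Field k] (D : Type u₁) [Category.{v₁} D] [Preadditive D]
    [Linear k D] [MonoidalCategory D] : Prop extends IsFiniteSemisimple k D where
  monoidalPreadditive : MonoidalPreadditive D
  monoidalLinear : MonoidalLinear k D
  hasRightDual : ∀ X : D, Nonempty (HasRightDual X)
  hasLeftDual : ∀ X : D, Nonempty (HasLeftDual X)

/-! ### Karoubi -/
namespace Idempotents.Karoubi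
variable {D : Type u₁} [Category.{v₁} D]

instance {k : Type w} [Ring k] [Preadditive D] [Linear k D] (P Q : Karoubi D) :
    Module k (P ⟶ Q) where
  smul r f := ⟨r • f.f, by simp⟩
  one_smul f := Karoubi.hom_ext _ _ (one_smul k f.f)
  mul_smul a b f := Karoubi.hom_ext _ _ (mul_smul a b f.f)
  smul_zero a := Karoubi.hom_ext _ _ (smul_zero a)
  smul_add a f g := Karoubi.hom_ext _ _ (smul_add a f.f g.f)
  add_smul a b f := Karoubi.hom_ext _ _ (add_smul a b f.f)
  zero_smul f := Karoubi.hom_ext _ _ (zero_smul k f.f)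

instance {k : Type w} [Ring k] [Preadditive D] [Linear k D] : Linear k (Karoubi D) where
  smul_comp _ _ _ r f g := Karoubi.hom_ext _ _ (Linear.smul_comp _ _ _ r f.f g.f)
  comp_smul _ _ _ f r g := Karoubi.hom_ext _ _ (Linear.comp_smul _ _ _ f.f r g.f)

variable [MonoidalCategory D]

/-- An isomorphism of `D` commuting with the idempotents, as an isomorphism of formal images. -/
def isoOfIso (P Q : Karoubi D) (e : P.X ≅ Q.X) (h : P.p ≫ e.hom = e.hom ≫ Q.p) : P ≅ Q where
  hom := ⟨P.p ≫ e.hom, by rw [h, Category.assoc, Q.idem, ← h, ← Category.assoc, P.idem]⟩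
  inv := ⟨e.inv ≫ P.p, by
    have h' : Q.p ≫ e.inv = e.inv ≫ P.p := by
      rw [← cancel_epi e.hom, ← Category.assoc, ← h]; simp
    rw [← h', Category.assoc, ← h', ← Category.assoc, Q.idem, ← Category.assoc, Q.idem]⟩
  hom_inv_id := Karoubi.hom_ext _ _ (by
    change (P.p ≫ e.hom) ≫ e.inv ≫ P.p = P.p
    simp)
  inv_hom_id := Karoubi.hom_ext _ _ (by
    change (e.inv ≫ P.p) ≫ P.p ≫ e.hom = Q.p
    rw [Category.assoc, ← Category.assoc P.p, P.idem, h]; simp)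

def tensorObj' (P Q : Karoubi D) : Karoubi D :=
  ⟨P.X ⊗ Q.X, P.p ⊗ₘ Q.p, by rw [tensorHom_comp_tensorHom, P.idem, Q.idem]⟩

def tensorHom' {P P' Q Q' : Karoubi D} (f : P ⟶ P') (g : Q ⟶ Q') :
    tensorObj' P Q ⟶ tensorObj' P' Q' :=
  ⟨f.f ⊗ₘ g.f, by
    change (P.p ⊗ₘ Q.p) ≫ (f.f ⊗ₘ g.f) ≫ (P'.p ⊗ₘ Q'.p) = _
    rw [tensorHom_comp_tensorHom, tensorHom_comp_tensorHom, f.comm, g.comm]⟩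

/-- The tensor product of formal images: `(X, p) ⊗ (Y, q) = (X ⊗ Y, p ⊗ q)`. -/
instance : MonoidalCategoryStruct (Karoubi D) where
  tensorObj P Q := tensorObj' P Q
  tensorHom f g := tensorHom' f g
  whiskerLeft P _ _ f := tensorHom' (𝟙 P) f
  whiskerRight f Q := tensorHom' f (𝟙 Q)
  tensorUnit := ⟨𝟙_ D, 𝟙 _, Category.comp_id _⟩
  associator P Q R := isoOfIso _ _ (α_ P.X Q.X R.X) (associator_naturality _ _ _)
  leftUnitor P := isoOfIso _ P (λ_ P.X) (by
    change (𝟙 (𝟙_ D) ⊗ₘ P.p) ≫ (λ_ P.X).hom = (λ_ P.X).hom ≫ P.p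
    simp)
  rightUnitor P := isoOfIso _ P (ρ_ P.X) (by
    change (P.p ⊗ₘ 𝟙 (𝟙_ D)) ≫ (ρ_ P.X).hom = (ρ_ P.X).hom ≫ P.p
    simp)

section
variable {P P' Q Q' R : Karoubi D}
theorem tensorHom_f (f : P ⟶ P') (g : Q ⟶ Q') : (f ⊗ₘ g).f = f.f ⊗ₘ g.f := rfl
theorem whiskerLeft_f (f : P ⟶ P') : (Q ◁ f).f = Q.p ⊗ₘ f.f := rfl
theorem whiskerRight_f (f : P ⟶ P') : (f ▷ Q).f = f.f ⊗ₘ Q.p := rfl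
theorem tensor_X : (P ⊗ Q).X = (P.X ⊗ Q.X) := rfl
theorem tensor_p : (P ⊗ Q).p = P.p ⊗ₘ Q.p := rfl
theorem unit_p : (𝟙_ (Karoubi D)).p = 𝟙 _ := rfl
theorem associator_hom_f : (α_ P Q R).hom.f = ((P.p ⊗ₘ Q.p) ⊗ₘ R.p) ≫ (α_ P.X Q.X R.X).hom := rfl
theorem associator_hom_f' : (α_ P Q R).hom.f = (α_ P.X Q.X R.X).hom ≫ (P.p ⊗ₘ (Q.p ⊗ₘ R.p)) :=
  associator_naturality _ _ _
theorem associator_inv_f : (α_ P Q R).inv.f = (α_ P.X Q.X R.X).inv ≫ ((P.p ⊗ₘ Q.p) ⊗ₘ R.p) := rfl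
theorem leftUnitor_hom_f : (λ_ P).hom.f = (𝟙 (𝟙_ D) ⊗ₘ P.p) ≫ (λ_ P.X).hom := rfl
theorem rightUnitor_hom_f : (ρ_ P).hom.f = (P.p ⊗ₘ 𝟙 (𝟙_ D)) ≫ (ρ_ P.X).hom := rfl
theorem leftUnitor_inv_f : (λ_ P).inv.f = (λ_ P.X).inv ≫ (𝟙 (𝟙_ D) ⊗ₘ P.p) := rfl
theorem rightUnitor_inv_f : (ρ_ P).inv.f = (ρ_ P.X).inv ≫ (P.p ⊗ₘ 𝟙 (𝟙_ D)) := rfl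
end

instance : MonoidalCategory (Karoubi D) :=
  MonoidalCategory.ofTensorHom
    (id_tensorHom_id := fun _ _ => rfl)
    (id_tensorHom := fun _ _ _ _ => rfl)
    (tensorHom_id := fun _ _ => rfl)
    (tensorHom_comp_tensorHom := fun f₁ f₂ g₁ g₂ => Karoubi.hom_ext _ _
      (tensorHom_comp_tensorHom f₁.f f₂.f g₁.f g₂.f))
    (associator_naturality := fun {X₁ X₂ X₃ Y₁ Y₂ Y₃} f₁ f₂ f₃ => Karoubi.hom_ext _ _ (by
      change ((f₁.f ⊗ₘ f₂.f) ⊗ₘ f₃.f) ≫ ((Y₁.p ⊗ₘ Y₂.p) ⊗ₘ Y₃.p) ≫ (α_ Y₁.X Y₂.X Y₃.X).hom =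
        (((X₁.p ⊗ₘ X₂.p) ⊗ₘ X₃.p) ≫ (α_ X₁.X X₂.X X₃.X).hom) ≫ (f₁.f ⊗ₘ (f₂.f ⊗ₘ f₃.f))
      rw [Category.assoc, ← associator_naturality, ← Category.assoc, ← Category.assoc]
      simp only [tensorHom_comp_tensorHom, p_comp, comp_p]))
    (leftUnitor_naturality := fun {X Y} f => Karoubi.hom_ext _ _ (by
      change (𝟙 (𝟙_ D) ⊗ₘ f.f) ≫ (𝟙 (𝟙_ D) ⊗ₘ Y.p) ≫ (λ_ Y.X).hom =
        ((𝟙 (𝟙_ D) ⊗ₘ X.p) ≫ (λ_ X.X).hom) ≫ f.f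
      simp))
    (rightUnitor_naturality := fun {X Y} f => Karoubi.hom_ext _ _ (by
      change (f.f ⊗ₘ 𝟙 (𝟙_ D)) ≫ (Y.p ⊗ₘ 𝟙 (𝟙_ D)) ≫ (ρ_ Y.X).hom =
        ((X.p ⊗ₘ 𝟙 (𝟙_ D)) ≫ (ρ_ X.X).hom) ≫ f.f
      simp))
    (pentagon := fun W X Y Z => Karoubi.hom_ext _ _ (by
      change ((((W.p ⊗ₘ X.p) ⊗ₘ Y.p) ≫ (α_ W.X X.X Y.X).hom) ⊗ₘ Z.p) ≫
          (((W.p ⊗ₘ (X.p ⊗ₘ Y.p)) ⊗ₘ Z.p) ≫ (α_ W.X (X.X ⊗ Y.X) Z.X).hom) ≫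
          (W.p ⊗ₘ (((X.p ⊗ₘ Y.p) ⊗ₘ Z.p) ≫ (α_ X.X Y.X Z.X).hom)) =
        ((((W.p ⊗ₘ X.p) ⊗ₘ Y.p) ⊗ₘ Z.p) ≫ (α_ (W.X ⊗ X.X) Y.X Z.X).hom) ≫
          ((W.p ⊗ₘ X.p) ⊗ₘ (Y.p ⊗ₘ Z.p)) ≫ (α_ W.X X.X (Y.X ⊗ Z.X)).hom
      have h1 : (((W.p ⊗ₘ X.p) ⊗ₘ Y.p) ≫ (α_ W.X X.X Y.X).hom) ⊗ₘ Z.p =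
          (((W.p ⊗ₘ X.p) ⊗ₘ Y.p) ⊗ₘ Z.p) ≫ (α_ W.X X.X Y.X).hom ▷ Z.X := by
        rw [← tensorHom_id, tensorHom_comp_tensorHom, Category.comp_id]
      have h2 : W.p ⊗ₘ (((X.p ⊗ₘ Y.p) ⊗ₘ Z.p) ≫ (α_ X.X Y.X Z.X).hom) =
          W.X ◁ (α_ X.X Y.X Z.X).hom ≫ (W.p ⊗ₘ (X.p ⊗ₘ (Y.p ⊗ₘ Z.p))) := by
        rw [← id_tensorHom, tensorHom_comp_tensorHom, Category.id_comp, associator_naturality]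
      have h3 : (α_ W.X X.X Y.X).hom ▷ Z.X ≫ ((W.p ⊗ₘ (X.p ⊗ₘ Y.p)) ⊗ₘ Z.p) =
          (((W.p ⊗ₘ X.p) ⊗ₘ Y.p) ⊗ₘ Z.p) ≫ (α_ W.X X.X Y.X).hom ▷ Z.X := by
        rw [← tensorHom_id, tensorHom_comp_tensorHom, tensorHom_comp_tensorHom,
          Category.comp_id, Category.id_comp, associator_naturality]
      have h4 : (((W.p ⊗ₘ X.p) ⊗ₘ Y.p) ⊗ₘ Z.p) ≫ (((W.p ⊗ₘ X.p) ⊗ₘ Y.p) ⊗ₘ Z.p) =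
          (((W.p ⊗ₘ X.p) ⊗ₘ Y.p) ⊗ₘ Z.p) := by
        simp only [tensorHom_comp_tensorHom, idem]
      rw [h1, h2, Category.assoc, Category.assoc, reassoc_of% h3,
        reassoc_of% h4, pentagon_assoc, Category.assoc]
      rw [← associator_naturality, ← associator_naturality_assoc, reassoc_of% h4]))
    (triangle := fun X Y => Karoubi.hom_ext _ _ (by
      change (((X.p ⊗ₘ 𝟙 (𝟙_ D)) ⊗ₘ Y.p) ≫ (α_ X.X (𝟙_ D) Y.X).hom) ≫
          (X.p ⊗ₘ ((𝟙 (𝟙_ D) ⊗ₘ Y.p) ≫ (λ_ Y.X).hom)) =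
        ((X.p ⊗ₘ 𝟙 (𝟙_ D)) ≫ (ρ_ X.X).hom) ⊗ₘ Y.p
      have h1 : X.p ⊗ₘ ((𝟙 (𝟙_ D) ⊗ₘ Y.p) ≫ (λ_ Y.X).hom) =
        (X.p ⊗ₘ (𝟙 (𝟙_ D) ⊗ₘ Y.p)) ≫ X.X ◁ (λ_ Y.X).hom := by
        rw [← id_tensorHom, tensorHom_comp_tensorHom, Category.comp_id]
      rw [h1, Category.assoc, ← associator_naturality_assoc, triangle,
        ← Category.assoc, tensorHom_comp_tensorHom, tensorHom_comp_tensorHom, X.idem, Y.idem,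
        Category.comp_id, ← tensorHom_id, tensorHom_comp_tensorHom, Category.comp_id]))

instance : (toKaroubi D).Monoidal :=
  Functor.CoreMonoidal.toMonoidal
    { εIso := Iso.refl _
      μIso := fun X Y => isoOfIso (P := (toKaroubi D).obj X ⊗ (toKaroubi D).obj Y)
        (Q := (toKaroubi D).obj (X ⊗ Y)) (Iso.refl (X ⊗ Y)) (by
          change (𝟙 X ⊗ₘ 𝟙 Y) ≫ 𝟙 (X ⊗ Y) = 𝟙 (X ⊗ Y) ≫ 𝟙 (X ⊗ Y)
          simp)
      μIso_hom_natural_left := fun {X Y} f Z => Karoubi.hom_ext _ _ (by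
        change (f ⊗ₘ 𝟙 Z) ≫ (𝟙 Y ⊗ₘ 𝟙 Z) ≫ 𝟙 (Y ⊗ Z) = ((𝟙 X ⊗ₘ 𝟙 Z) ≫ 𝟙 (X ⊗ Z)) ≫ f ▷ Z
        simp)
      μIso_hom_natural_right := fun {X Y} Z f => Karoubi.hom_ext _ _ (by
        change (𝟙 Z ⊗ₘ f) ≫ (𝟙 Z ⊗ₘ 𝟙 Y) ≫ 𝟙 (Z ⊗ Y) = ((𝟙 Z ⊗ₘ 𝟙 X) ≫ 𝟙 (Z ⊗ X)) ≫ Z ◁ f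
        simp)
      associativity := fun X Y Z => Karoubi.hom_ext _ _ (by
        change (((𝟙 X ⊗ₘ 𝟙 Y) ≫ 𝟙 (X ⊗ Y)) ⊗ₘ 𝟙 Z) ≫ ((𝟙 (X ⊗ Y) ⊗ₘ 𝟙 Z) ≫ 𝟙 ((X ⊗ Y) ⊗ Z)) ≫
            (α_ X Y Z).hom =
          (((𝟙 X ⊗ₘ 𝟙 Y) ⊗ₘ 𝟙 Z) ≫ (α_ X Y Z).hom) ≫ (𝟙 X ⊗ₘ ((𝟙 Y ⊗ₘ 𝟙 Z) ≫ 𝟙 (Y ⊗ Z))) ≫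
            ((𝟙 X ⊗ₘ 𝟙 (Y ⊗ Z)) ≫ 𝟙 (X ⊗ (Y ⊗ Z)))
        simp)
      left_unitality := fun X => Karoubi.hom_ext _ _ (by
        change (𝟙 (𝟙_ D) ⊗ₘ 𝟙 X) ≫ (λ_ X).hom =
          (𝟙 (𝟙_ D) ⊗ₘ 𝟙 X) ≫ ((𝟙 (𝟙_ D) ⊗ₘ 𝟙 X) ≫ 𝟙 (𝟙_ D ⊗ X)) ≫ (λ_ X).hom
        simp)
      right_unitality := fun X => Karoubi.hom_ext _ _ (by
        change (𝟙 X ⊗ₘ 𝟙 (𝟙_ D)) ≫ (ρ_ X).hom =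
          (𝟙 X ⊗ₘ 𝟙 (𝟙_ D)) ≫ ((𝟙 X ⊗ₘ 𝟙 (𝟙_ D)) ≫ 𝟙 (X ⊗ 𝟙_ D)) ≫ (ρ_ X).hom
        simp) }

variable [RightRigidCategory D]

/-- The dual of a formal image: `(X, p)ᘁ = (Xᘁ, pᘁ)`. -/
def dual (P : Karoubi D) : Karoubi D :=
  ⟨(P.X)ᘁ, (P.p)ᘁ, by rw [← comp_rightAdjointMate, P.idem]⟩

def dualCoev (P : Karoubi D) : 𝟙_ (Karoubi D) ⟶ P ⊗ dual P where
  f := η_ P.X ((P.X)ᘁ) ≫ (P.p ⊗ₘ ((P.p)ᘁ))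
  comm := by
    change 𝟙 (𝟙_ D) ≫ (η_ P.X ((P.X)ᘁ) ≫ (P.p ⊗ₘ ((P.p)ᘁ))) ≫ (P.p ⊗ₘ ((P.p)ᘁ)) = _
    rw [Category.id_comp, Category.assoc, tensorHom_comp_tensorHom, ← comp_rightAdjointMate, P.idem]
    rfl

def dualEv (P : Karoubi D) : dual P ⊗ P ⟶ 𝟙_ (Karoubi D) where
  f := (((P.p)ᘁ) ⊗ₘ P.p) ≫ ε_ P.X ((P.X)ᘁ)
  comm := by
    change (((P.p)ᘁ) ⊗ₘ P.p) ≫ ((((P.p)ᘁ) ⊗ₘ P.p) ≫ ε_ P.X ((P.X)ᘁ)) ≫ 𝟙 (𝟙_ D) = _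
    rw [Category.comp_id, tensorHom_comp_tensorHom_assoc, ← comp_rightAdjointMate, P.idem]
    rfl

theorem mate_idem (P : Karoubi D) : ((P.p)ᘁ) ≫ ((P.p)ᘁ) = ((P.p)ᘁ) := by
  rw [← comp_rightAdjointMate, P.idem]

theorem coev_mate (P : Karoubi D) :
    η_ P.X ((P.X)ᘁ) ≫ (P.p ⊗ₘ ((P.p)ᘁ)) = η_ P.X ((P.X)ᘁ) ≫ P.X ◁ ((P.p)ᘁ) := by
  rw [MonoidalCategory.tensorHom_def, ← coevaluation_comp_rightAdjointMate_assoc,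
    ← MonoidalCategory.whiskerLeft_comp, mate_idem]

theorem coev_mate' (P : Karoubi D) :
    η_ P.X ((P.X)ᘁ) ≫ (P.p ⊗ₘ ((P.p)ᘁ)) = η_ P.X ((P.X)ᘁ) ≫ P.p ▷ ((P.X)ᘁ : D) := by
  rw [coev_mate, coevaluation_comp_rightAdjointMate]

theorem ev_mate (P : Karoubi D) :
    (((P.p)ᘁ) ⊗ₘ P.p) ≫ ε_ P.X ((P.X)ᘁ) = ((P.p)ᘁ) ▷ P.X ≫ ε_ P.X ((P.X)ᘁ) := by
  rw [MonoidalCategory.tensorHom_def, Category.assoc, ← rightAdjointMate_comp_evaluation,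
    ← comp_whiskerRight_assoc, mate_idem]

theorem ev_mate' (P : Karoubi D) :
    (((P.p)ᘁ) ⊗ₘ P.p) ≫ ε_ P.X ((P.X)ᘁ) = ((P.X)ᘁ : D) ◁ P.p ≫ ε_ P.X ((P.X)ᘁ) := by
  rw [ev_mate, rightAdjointMate_comp_evaluation]

instance (P : Karoubi D) : HasRightDual P where
  rightDual := dual P
  exact :=
    { coevaluation' := dualCoev P
      evaluation' := dualEv P
      coevaluation_evaluation' := Karoubi.hom_ext _ _ (by
        change (((P.p)ᘁ) ⊗ₘ (η_ P.X ((P.X)ᘁ) ≫ (P.p ⊗ₘ ((P.p)ᘁ)))) ≫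
          ((α_ _ _ _).inv ≫ ((((P.p)ᘁ) ⊗ₘ P.p) ⊗ₘ ((P.p)ᘁ))) ≫
            (((((P.p)ᘁ) ⊗ₘ P.p) ≫ ε_ P.X ((P.X)ᘁ)) ⊗ₘ ((P.p)ᘁ)) =
          ((((P.p)ᘁ) ⊗ₘ 𝟙 (𝟙_ D)) ≫ (ρ_ ((P.X)ᘁ : D)).hom) ≫
            ((λ_ ((P.X)ᘁ : D)).inv ≫ (𝟙 (𝟙_ D) ⊗ₘ ((P.p)ᘁ)))
        have h := ExactPairing.coevaluation_evaluation P.X ((P.X)ᘁ)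
        have hm := mate_idem P
        have e1 : (((P.p)ᘁ) ⊗ₘ (η_ P.X ((P.X)ᘁ) ≫ (P.p ⊗ₘ ((P.p)ᘁ)))) =
            ((P.p)ᘁ) ▷ 𝟙_ D ≫ ((P.X)ᘁ : D) ◁ η_ P.X ((P.X)ᘁ) ≫
              ((P.X)ᘁ : D) ◁ P.X ◁ ((P.p)ᘁ) := by
          rw [coev_mate, MonoidalCategory.tensorHom_def, MonoidalCategory.whiskerLeft_comp]
        have e2 : ((((P.p)ᘁ) ⊗ₘ P.p) ⊗ₘ ((P.p)ᘁ)) ≫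
            (((((P.p)ᘁ) ⊗ₘ P.p) ≫ ε_ P.X ((P.X)ᘁ)) ⊗ₘ ((P.p)ᘁ)) =
            ((P.p)ᘁ) ▷ P.X ▷ ((P.X)ᘁ : D) ≫ ε_ P.X ((P.X)ᘁ) ▷ ((P.X)ᘁ : D) ≫
              𝟙_ D ◁ ((P.p)ᘁ) := by
          rw [tensorHom_comp_tensorHom, tensorHom_comp_tensorHom_assoc, hm, P.idem, ev_mate,
            MonoidalCategory.tensorHom_def, comp_whiskerRight, Category.assoc]
        have e3 : ((P.X)ᘁ : D) ◁ P.X ◁ ((P.p)ᘁ) ≫ (α_ _ _ _).inv ≫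
            ((P.p)ᘁ) ▷ P.X ▷ ((P.X)ᘁ : D) ≫ ε_ P.X ((P.X)ᘁ) ▷ ((P.X)ᘁ : D) ≫
              𝟙_ D ◁ ((P.p)ᘁ) =
            ((P.p)ᘁ) ▷ (P.X ⊗ ((P.X)ᘁ : D)) ≫ (α_ _ _ _).inv ≫
              ε_ P.X ((P.X)ᘁ) ▷ ((P.X)ᘁ : D) ≫ 𝟙_ D ◁ ((P.p)ᘁ) := by
          rw [associator_inv_naturality_right_assoc, whisker_exchange_assoc,
            whisker_exchange_assoc, ← MonoidalCategory.whiskerLeft_comp, hm,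
            associator_inv_naturality_left_assoc]
        rw [e1, Category.assoc, Category.assoc, Category.assoc, e2, e3, whisker_exchange_assoc,
          ← comp_whiskerRight_assoc, hm, reassoc_of% h, tensorHom_id, id_tensorHom, Category.assoc])
      evaluation_coevaluation' := Karoubi.hom_ext _ _ (by
        change ((η_ P.X ((P.X)ᘁ) ≫ (P.p ⊗ₘ ((P.p)ᘁ))) ⊗ₘ P.p) ≫
          (((P.p ⊗ₘ ((P.p)ᘁ)) ⊗ₘ P.p) ≫ (α_ _ _ _).hom) ≫
            (P.p ⊗ₘ ((((P.p)ᘁ) ⊗ₘ P.p) ≫ ε_ P.X ((P.X)ᘁ))) =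
          ((𝟙 (𝟙_ D) ⊗ₘ P.p) ≫ (λ_ P.X).hom) ≫ ((ρ_ P.X).inv ≫ (P.p ⊗ₘ 𝟙 (𝟙_ D)))
        have h := ExactPairing.evaluation_coevaluation P.X ((P.X)ᘁ)
        have hm := mate_idem P
        have e1 : ((η_ P.X ((P.X)ᘁ) ≫ (P.p ⊗ₘ ((P.p)ᘁ))) ⊗ₘ P.p) ≫
            ((P.p ⊗ₘ ((P.p)ᘁ)) ⊗ₘ P.p) =
            𝟙_ D ◁ P.p ≫ η_ P.X ((P.X)ᘁ) ▷ P.X ≫ P.p ▷ ((P.X)ᘁ : D) ▷ P.X := by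
          rw [tensorHom_comp_tensorHom, Category.assoc, tensorHom_comp_tensorHom, hm, P.idem,
            coev_mate', MonoidalCategory.tensorHom_def', comp_whiskerRight]
        have e2 : (P.p ⊗ₘ ((((P.p)ᘁ) ⊗ₘ P.p) ≫ ε_ P.X ((P.X)ᘁ))) =
            P.X ◁ ((P.X)ᘁ : D) ◁ P.p ≫ P.X ◁ ε_ P.X ((P.X)ᘁ) ≫ P.p ▷ 𝟙_ D := by
          rw [ev_mate', MonoidalCategory.tensorHom_def', MonoidalCategory.whiskerLeft_comp,
            Category.assoc]
        have e3 : P.p ▷ ((P.X)ᘁ : D) ▷ P.X ≫ (α_ _ _ _).hom ≫ P.X ◁ ((P.X)ᘁ : D) ◁ P.p ≫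
              P.X ◁ ε_ P.X ((P.X)ᘁ) ≫ P.p ▷ 𝟙_ D =
            (P.X ⊗ ((P.X)ᘁ : D)) ◁ P.p ≫ (α_ _ _ _).hom ≫
              P.X ◁ ε_ P.X ((P.X)ᘁ) ≫ P.p ▷ 𝟙_ D := by
          rw [associator_naturality_left_assoc, ← whisker_exchange_assoc,
            ← whisker_exchange_assoc, ← comp_whiskerRight, P.idem,
            associator_naturality_right_assoc]
        rw [Category.assoc, reassoc_of% e1, e2, e3, ← whisker_exchange_assoc,
          ← MonoidalCategory.whiskerLeft_comp_assoc, P.idem, reassoc_of% h, tensorHom_id,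
          id_tensorHom, Category.assoc]) }

instance : RightRigidCategory (Karoubi D) where

end Idempotents.Karoubi
/-! ### The linear structure of the Drinfeld center -/
namespace Center
variable {C : Type u₁} [Category.{v₁} C] [MonoidalCategory C] [Preadditive C]
  [MonoidalPreadditive C]

/-- The morphisms of the center, as a subgroup of the morphisms of `C`. -/
def homSubgroup (X Y : Center C) : AddSubgroup (X.1 ⟶ Y.1) where
  carrier := {f | ∀ U, (f ▷ U) ≫ (Y.2.β U).hom = (X.2.β U).hom ≫ (U ◁ f)}
  zero_mem' U := by simp
  add_mem' hf hg U := by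
    simp only [MonoidalPreadditive.add_whiskerRight, MonoidalPreadditive.whiskerLeft_add,
      Preadditive.add_comp, Preadditive.comp_add, hf U, hg U]
  neg_mem' {f} hf U := by
    have h1 := (tensorLeft U).map_neg (f := f)
    have h2 := (tensorRight U).map_neg (f := f)
    change U ◁ (-f) = -(U ◁ f) at h1
    change (-f) ▷ U = -(f ▷ U) at h2
    rw [h1, h2, Preadditive.neg_comp, Preadditive.comp_neg, hf U]

def homEquiv (X Y : Center C) : (X ⟶ Y) ≃ homSubgroup X Y where
  toFun f := ⟨f.f, f.comm⟩
  invFun f := ⟨f.1, f.2⟩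
  left_inv _ := rfl
  right_inv _ := rfl

instance (X Y : Center C) : AddCommGroup (X ⟶ Y) := (homEquiv X Y).addCommGroup

theorem add_f {X Y : Center C} (f g : X ⟶ Y) : (f + g).f = f.f + g.f := rfl
theorem zero_f {X Y : Center C} : (0 : X ⟶ Y).f = 0 := rfl

instance : Preadditive (Center C) where
  add_comp _ _ _ f g h := Center.ext _ _ (Preadditive.add_comp _ _ _ f.f g.f h.f)
  comp_add _ _ _ f g h := Center.ext _ _ (Preadditive.comp_add _ _ _ f.f g.f h.f)

variable {k : Type w} [Ring k] [Linear k C] [MonoidalLinear k C]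

instance (X Y : Center C) : Module k (X ⟶ Y) where
  smul r f := ⟨r • f.f, fun U => by
    simp only [MonoidalLinear.smul_whiskerRight, MonoidalLinear.whiskerLeft_smul,
      Linear.smul_comp, Linear.comp_smul, f.comm]⟩
  one_smul f := Center.ext _ _ (one_smul k f.f)
  mul_smul a b f := Center.ext _ _ (mul_smul a b f.f)
  smul_zero a := Center.ext _ _ (smul_zero a)
  smul_add a f g := Center.ext _ _ (smul_add a f.f g.f)
  add_smul a b f := Center.ext _ _ (add_smul a b f.f)
  zero_smul f := Center.ext _ _ (zero_smul k f.f)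

theorem smul_f {X Y : Center C} (r : k) (f : X ⟶ Y) : (r • f).f = r • f.f := rfl

instance : Linear k (Center C) where
  smul_comp _ _ _ r f g := Center.ext _ _ (Linear.smul_comp _ _ _ r f.f g.f)
  comp_smul _ _ _ f r g := Center.ext _ _ (Linear.comp_smul _ _ _ f.f r g.f)

end Center

/-! ### The horizontal trace -/

/-- The objects of the horizontal trace of `C` are those of `C`. -/
structure HTr (k : Type w) (C : Type u₁) where
  obj : C

namespace HTr
open Classical in
section
variable (k : Type w) [CommRing k] {C : Type u₁} [Category.{v₁} C] [MonoidalCategory C]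
  [Preadditive C] [Linear k C]

/-- `⨁_A Hom (A ⊗ X, Y ⊗ A)`, the sum over all objects `A`. -/
abbrev PreHom (X Y : C) : Type (max u₁ v₁) := DirectSum C fun A => (A ⊗ X ⟶ Y ⊗ A)

/-- Sliding `f : A ⟶ B` around: for `g : B ⊗ X ⟶ Y ⊗ A`, the morphism `g ∘ (f ⊗ 1)` in the
summand of `A` is identified with `(1 ⊗ f) ∘ g` in the summand of `B`. -/
def relations (X Y : C) : Submodule k (PreHom X Y) :=
  Submodule.span k {x | ∃ (A B : C) (f : A ⟶ B) (g : B ⊗ X ⟶ Y ⊗ A),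
    x = DirectSum.lof k C (fun A => (A ⊗ X ⟶ Y ⊗ A)) A (f ▷ X ≫ g) -
      DirectSum.lof k C (fun A => (A ⊗ X ⟶ Y ⊗ A)) B (g ≫ Y ◁ f)}

/-- The coend of `Hom (A ⊗ X, Y ⊗ A)` over `A`. -/
abbrev CoendHom (X Y : C) : Type (max u₁ v₁) := PreHom X Y ⧸ relations k X Y

/-- The class of `φ : A ⊗ X ⟶ Y ⊗ A`. -/
def cls {X Y : C} (A : C) : (A ⊗ X ⟶ Y ⊗ A) →ₗ[k] CoendHom k X Y :=
  (relations k X Y).mkQ ∘ₗ DirectSum.lof k C (fun A => (A ⊗ X ⟶ Y ⊗ A)) A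

variable {k}

theorem cls_slide {X Y A B : C} (f : A ⟶ B) (g : B ⊗ X ⟶ Y ⊗ A) :
    cls k A (f ▷ X ≫ g) = cls k B (g ≫ Y ◁ f) := by
  rw [cls, LinearMap.comp_apply, cls, LinearMap.comp_apply, ← sub_eq_zero, ← map_sub,
    Submodule.mkQ_apply, Submodule.Quotient.mk_eq_zero]
  exact Submodule.subset_span ⟨A, B, f, g, rfl⟩

variable {M : Type*} [AddCommGroup M] [Module k M]

/-- The universal property of the coend. -/
def lift {X Y : C} (F : ∀ A, (A ⊗ X ⟶ Y ⊗ A) →ₗ[k] M)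
    (hF : ∀ (A B : C) (f : A ⟶ B) (g : B ⊗ X ⟶ Y ⊗ A), F A (f ▷ X ≫ g) = F B (g ≫ Y ◁ f)) :
    CoendHom k X Y →ₗ[k] M :=
  (relations k X Y).liftQ (DirectSum.toModule k C M F) (by
    rw [relations, Submodule.span_le]
    rintro _ ⟨A, B, f, g, rfl⟩
    simp [hF])

theorem lift_cls {X Y : C} (F : ∀ A, (A ⊗ X ⟶ Y ⊗ A) →ₗ[k] M) (hF) (A : C)
    (φ : A ⊗ X ⟶ Y ⊗ A) : lift F hF (cls k A φ) = F A φ := by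
  simp [lift, cls]

theorem hom_ext {X Y : C} {F G : CoendHom k X Y →ₗ[k] M}
    (h : ∀ A φ, F (cls k A φ) = G (cls k A φ)) : F = G := by
  apply Submodule.linearMap_qext
  apply DirectSum.linearMap_ext
  intro A
  ext φ
  exact h A φ

theorem induction {X Y : C} {P : CoendHom k X Y → Prop} (x : CoendHom k X Y)
    (h : ∀ A φ, P (cls k A φ)) (h0 : P 0) (hadd : ∀ x y, P x → P y → P (x + y)) : P x := by
  obtain ⟨x, rfl⟩ := Submodule.mkQ_surjective _ x
  induction x using DirectSum.induction_on with
  | zero => simpa using h0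
  | of A φ => exact h A φ
  | add x y hx hy => rw [map_add]; exact hadd _ _ hx hy

variable [MonoidalPreadditive C] [MonoidalLinear k C]

/-- Composition: first `φ`, then `ψ`. -/
def compAux {X Y Z : C} {A B : C} (φ : A ⊗ X ⟶ Y ⊗ A) (ψ : B ⊗ Y ⟶ Z ⊗ B) :
    (B ⊗ A) ⊗ X ⟶ Z ⊗ (B ⊗ A) :=
  𝟙 _ ⊗≫ B ◁ φ ⊗≫ ψ ▷ A ⊗≫ 𝟙 _

variable (k) in
/-- `compAux` as a bilinear map. -/
def compAuxₗ (X Y Z A B : C) :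
    (A ⊗ X ⟶ Y ⊗ A) →ₗ[k] (B ⊗ Y ⟶ Z ⊗ B) →ₗ[k] ((B ⊗ A) ⊗ X ⟶ Z ⊗ (B ⊗ A)) :=
  LinearMap.mk₂ k compAux (by simp [compAux, monoidalComp]) (by simp [compAux, monoidalComp])
    (by simp [compAux, monoidalComp]) (by simp [compAux, monoidalComp])

theorem compAux_slide_right {X Y Z A B B' : C} (φ : A ⊗ X ⟶ Y ⊗ A) (f : B ⟶ B')
    (g : B' ⊗ Y ⟶ Z ⊗ B) :
    cls k (B ⊗ A) (compAux φ (f ▷ Y ≫ g)) = cls k (B' ⊗ A) (compAux φ (g ≫ Z ◁ f)) := by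
  have h1 : compAux φ (f ▷ Y ≫ g) = (f ▷ A) ▷ X ≫ (𝟙 _ ⊗≫ B' ◁ φ ⊗≫ g ▷ A ⊗≫ 𝟙 _) := by
    calc _ = 𝟙 _ ⊗≫ (B ◁ φ ≫ f ▷ (Y ⊗ A)) ⊗≫ g ▷ A ⊗≫ 𝟙 _ := by dsimp only [compAux]; monoidal
      _ = _ := by rw [whisker_exchange]; monoidal
  have h2 : compAux φ (g ≫ Z ◁ f) =
      (𝟙 _ ⊗≫ B' ◁ φ ⊗≫ g ▷ A ⊗≫ 𝟙 _ : (B' ⊗ A) ⊗ X ⟶ Z ⊗ (B ⊗ A)) ≫ Z ◁ (f ▷ A) := by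
    dsimp only [compAux]; monoidal
  rw [h1, h2, cls_slide]

theorem compAux_slide_left {X Y Z A A' B : C} (ψ : B ⊗ Y ⟶ Z ⊗ B) (f : A ⟶ A')
    (g : A' ⊗ X ⟶ Y ⊗ A) :
    cls k (B ⊗ A) (compAux (f ▷ X ≫ g) ψ) = cls k (B ⊗ A') (compAux (g ≫ Y ◁ f) ψ) := by
  have h1 : compAux (f ▷ X ≫ g) ψ = (B ◁ f) ▷ X ≫ (𝟙 _ ⊗≫ B ◁ g ⊗≫ ψ ▷ A ⊗≫ 𝟙 _) := by
    dsimp only [compAux]; monoidal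
  have h2 : compAux (g ≫ Y ◁ f) ψ =
      (𝟙 _ ⊗≫ B ◁ g ⊗≫ ψ ▷ A ⊗≫ 𝟙 _ : (B ⊗ A') ⊗ X ⟶ Z ⊗ (B ⊗ A)) ≫ Z ◁ (B ◁ f) := by
    calc _ = 𝟙 _ ⊗≫ B ◁ g ⊗≫ ((B ⊗ Y) ◁ f ≫ ψ ▷ A') ⊗≫ 𝟙 _ := by dsimp only [compAux]; monoidal
      _ = _ := by rw [whisker_exchange]; monoidal
  rw [h1, h2, cls_slide]

variable (k) in
/-- Composition in the horizontal trace. -/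
def compₗ (X Y Z : C) : CoendHom k X Y →ₗ[k] CoendHom k Y Z →ₗ[k] CoendHom k X Z :=
  lift (fun A => LinearMap.flip (lift (fun B => LinearMap.flip
      ((LinearMap.compr₂ (compAuxₗ k X Y Z A B) (cls k (B ⊗ A)))))
    (fun B B' f g => by
      ext φ
      exact compAux_slide_right φ f g)))
    (fun A A' f g => by
      apply hom_ext
      intro B ψ
      simp only [LinearMap.flip_apply, lift_cls]
      exact compAux_slide_left ψ f g)

theorem compₗ_cls {X Y Z A B : C} (φ : A ⊗ X ⟶ Y ⊗ A) (ψ : B ⊗ Y ⟶ Z ⊗ B) :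
    compₗ k X Y Z (cls k A φ) (cls k B ψ) = cls k (B ⊗ A) (compAux φ ψ) := by
  rw [compₗ, lift_cls, LinearMap.flip_apply, lift_cls]
  rfl

variable (k) in
/-- The image of `f : X ⟶ Y` in `Hom (𝟙 ⊗ X, Y ⊗ 𝟙)`. -/
def incl {X Y : C} (f : X ⟶ Y) : CoendHom k X Y := cls k (𝟙_ C) ((λ_ X).hom ≫ f ≫ (ρ_ Y).inv)

/-- Isomorphic labels. -/
theorem cls_iso {X Y A B : C} (e : A ≅ B) (φ : A ⊗ X ⟶ Y ⊗ A) :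
    cls k A φ = cls k B (e.inv ▷ X ≫ φ ≫ Y ◁ e.hom) := by
  have := cls_slide (k := k) e.hom (e.inv ▷ X ≫ φ)
  simpa using this

theorem compₗ_incl {X Y Z A : C} (φ : A ⊗ X ⟶ Y ⊗ A) (f : Y ⟶ Z) :
    compₗ k X Y Z (cls k A φ) (incl k f) = cls k A (φ ≫ f ▷ A) := by
  rw [incl, compₗ_cls, cls_iso (λ_ A)]
  congr 1
  dsimp only [compAux]; monoidal

theorem incl_compₗ {X Y Z A : C} (f : X ⟶ Y) (φ : A ⊗ Y ⟶ Z ⊗ A) :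
    compₗ k X Y Z (incl k f) (cls k A φ) = cls k A (A ◁ f ≫ φ) := by
  rw [incl, compₗ_cls, cls_iso (ρ_ A)]
  congr 1
  dsimp only [compAux]; monoidal

/-- The horizontal trace of `C`. -/
instance : Category.{max u₁ v₁} (HTr k C) where
  Hom X Y := CoendHom k X.obj Y.obj
  id X := incl k (𝟙 X.obj)
  comp {X Y Z} f g := compₗ k X.obj Y.obj Z.obj f g
  id_comp {X Y} f := by
    have : compₗ k X.obj X.obj Y.obj (incl k (𝟙 X.obj)) = LinearMap.id := by
      apply hom_ext
      intro A φ
      simp [incl_compₗ]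
    exact LinearMap.congr_fun this f
  comp_id {X Y} f := by
    have : (compₗ k X.obj Y.obj Y.obj).flip (incl k (𝟙 Y.obj)) = LinearMap.id := by
      apply hom_ext
      intro A φ
      simp [compₗ_incl]
    exact LinearMap.congr_fun this f
  assoc {W X Y Z} f g h := by
    induction f using induction with
    | h0 => simp
    | hadd x y hx hy => simp only [map_add, LinearMap.add_apply, hx, hy]
    | h A φ =>
    induction g using induction with
    | h0 => simp
    | hadd x y hx hy => simp only [map_add, LinearMap.add_apply, hx, hy]
    | h B ψ =>
    induction h using induction with
    | h0 => simp
    | hadd x y hx hy => simp only [map_add, hx, hy]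
    | h D χ =>
    simp only [compₗ_cls]
    rw [cls_iso (α_ D B A).symm]
    congr 1
    dsimp only [compAux, Iso.symm_hom, Iso.symm_inv]; monoidal

instance : Preadditive (HTr k C) where
  homGroup X Y := inferInstanceAs (AddCommGroup (CoendHom k X.obj Y.obj))
  add_comp X Y Z f g h := by exact LinearMap.map_add₂ (compₗ k X.obj Y.obj Z.obj) f g h
  comp_add X Y Z f g h := by exact (compₗ k X.obj Y.obj Z.obj f).map_add g h

instance : Linear k (HTr k C) where
  homModule X Y := inferInstanceAs (Module k (CoendHom k X.obj Y.obj))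
  smul_comp X Y Z r f g := by exact LinearMap.map_smul₂ (compₗ k X.obj Y.obj Z.obj) r f g
  comp_smul X Y Z f r g := by exact (compₗ k X.obj Y.obj Z.obj f).map_smul r g

variable (k) in
/-- The morphism of the horizontal trace represented by `φ : A ⊗ X ⟶ Y ⊗ A`. -/
def rep {X Y : C} (A : C) (φ : A ⊗ X ⟶ Y ⊗ A) : (⟨X⟩ : HTr k C) ⟶ ⟨Y⟩ := cls k A φ

variable (k C) in
/-- The inclusion functor `htr`. -/
def htr : C ⥤ HTr k C where
  obj X := ⟨X⟩
  map f := incl k f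
  map_id _ := rfl
  map_comp f g := by
    refine Eq.trans ?_ (compₗ_incl _ g).symm
    rw [incl]
    congr 1
    monoidal

theorem htr_map {X Y : C} (f : X ⟶ Y) : (htr k C).map f = incl k f := rfl
theorem comp_eq {X Y Z : HTr k C} (f : X ⟶ Y) (g : Y ⟶ Z) :
    f ≫ g = compₗ k X.obj Y.obj Z.obj f g := rfl

/-! ### The tensor product of the horizontal trace -/
variable [BraidedCategory C]

/-- The tensor product of `φ` and `ψ`: the strand of `B` passes under `X`, and the strand of `A`
passes over `Y'`. -/
def tensorAux {X X' Y Y' A B : C} (φ : A ⊗ X ⟶ X' ⊗ A) (ψ : B ⊗ Y ⟶ Y' ⊗ B) :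
    (A ⊗ B) ⊗ (X ⊗ Y) ⟶ (X' ⊗ Y') ⊗ (A ⊗ B) :=
  𝟙 _ ⊗≫ A ◁ (β_ B X).hom ▷ Y ⊗≫ (φ ⊗ₘ ψ) ⊗≫ X' ◁ (β_ Y' A).inv ▷ B ⊗≫ 𝟙 _

def leftAux (X : C) {Y Y' B : C} (ψ : B ⊗ Y ⟶ Y' ⊗ B) : B ⊗ (X ⊗ Y) ⟶ (X ⊗ Y') ⊗ B :=
  𝟙 _ ⊗≫ (β_ B X).hom ▷ Y ⊗≫ X ◁ ψ ⊗≫ 𝟙 _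

def rightAux {X X' A : C} (φ : A ⊗ X ⟶ X' ⊗ A) (Y : C) : A ⊗ (X ⊗ Y) ⟶ (X' ⊗ Y) ⊗ A :=
  𝟙 _ ⊗≫ φ ▷ Y ⊗≫ X' ◁ (β_ Y A).inv ⊗≫ 𝟙 _

theorem tensorAux_eq {X X' Y Y' A B : C} (φ : A ⊗ X ⟶ X' ⊗ A) (ψ : B ⊗ Y ⟶ Y' ⊗ B) :
    tensorAux φ ψ = compAux (leftAux X ψ) (rightAux φ Y') := by
  dsimp only [tensorAux, compAux, leftAux, rightAux]
  rw [tensorHom_def']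
  monoidal

theorem exchangeAux {X X' Y Y' A B : C} (φ : A ⊗ X ⟶ X' ⊗ A) (ψ : B ⊗ Y ⟶ Y' ⊗ B) :
    (β_ B A).hom ▷ (X ⊗ Y) ≫ tensorAux φ ψ =
      compAux (rightAux φ Y) (leftAux X' ψ) ≫ (X' ⊗ Y') ◁ (β_ B A).hom := by
  have h1 : 𝟙 (B ⊗ (A ⊗ X)) ⊗≫ (β_ B A).hom ▷ X ⊗≫ A ◁ (β_ B X).hom ⊗≫ φ ▷ B ⊗≫
        𝟙 (X' ⊗ (A ⊗ B)) =
      B ◁ φ ⊗≫ (β_ B X').hom ▷ A ⊗≫ X' ◁ (β_ B A).hom := by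
    have := BraidedCategory.braiding_naturality_right B φ
    rw [BraidedCategory.braiding_tensor_right_hom, BraidedCategory.braiding_tensor_right_hom] at this
    calc _ = ((α_ B A X).inv ≫ (β_ B A).hom ▷ X ≫ (α_ A B X).hom ≫ A ◁ (β_ B X).hom ≫
            (α_ A X B).inv) ≫ φ ▷ B ⊗≫ 𝟙 (X' ⊗ (A ⊗ B)) := by monoidal
      _ = (B ◁ φ ≫ (α_ B X' A).inv ≫ (β_ B X').hom ▷ A ≫ (α_ X' B A).hom ≫ X' ◁ (β_ B A).hom ≫
            (α_ X' A B).inv) ⊗≫ 𝟙 (X' ⊗ (A ⊗ B)) := by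
        rw [this]; monoidal
      _ = _ := by monoidal
  have h2 : (β_ B A).hom ▷ Y ⊗≫ A ◁ ψ ⊗≫ (β_ Y' A).inv ▷ B ⊗≫ 𝟙 (Y' ⊗ (A ⊗ B)) =
      𝟙 _ ⊗≫ B ◁ (β_ Y A).inv ⊗≫ ψ ▷ A ⊗≫ Y' ◁ (β_ B A).hom := by
    have := BraidedCategory.braiding_naturality_left ψ A
    rw [BraidedCategory.braiding_tensor_left_hom, BraidedCategory.braiding_tensor_left_hom] at this
    calc _ = 𝟙 _ ⊗≫ B ◁ ((β_ Y A).inv ≫ (β_ Y A).hom) ⊗≫ (β_ B A).hom ▷ Y ⊗≫ A ◁ ψ ⊗≫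
            (β_ Y' A).inv ▷ B ⊗≫ 𝟙 (Y' ⊗ (A ⊗ B)) := by rw [Iso.inv_hom_id]; monoidal
      _ = 𝟙 _ ⊗≫ B ◁ (β_ Y A).inv ⊗≫ (((α_ B Y A).hom ≫ B ◁ (β_ Y A).hom ≫ (α_ B A Y).inv ≫
            (β_ B A).hom ▷ Y ≫ (α_ A B Y).hom) ≫ A ◁ ψ) ⊗≫
            (β_ Y' A).inv ▷ B ⊗≫ 𝟙 (Y' ⊗ (A ⊗ B)) := by monoidal
      _ = 𝟙 _ ⊗≫ B ◁ (β_ Y A).inv ⊗≫ ψ ▷ A ⊗≫ Y' ◁ (β_ B A).hom ⊗≫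
            ((β_ Y' A).hom ≫ (β_ Y' A).inv) ▷ B ⊗≫ 𝟙 (Y' ⊗ (A ⊗ B)) := by
        rw [← this]; monoidal
      _ = _ := by rw [Iso.hom_inv_id]; monoidal
  calc _ = 𝟙 _ ⊗≫ (𝟙 (B ⊗ (A ⊗ X)) ⊗≫ (β_ B A).hom ▷ X ⊗≫ A ◁ (β_ B X).hom ⊗≫ φ ▷ B ⊗≫
        𝟙 (X' ⊗ (A ⊗ B))) ▷ Y ⊗≫ X' ◁ (A ◁ ψ ⊗≫ (β_ Y' A).inv ▷ B) ⊗≫ 𝟙 _ := by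
        dsimp only [tensorAux]; rw [MonoidalCategory.tensorHom_def]; monoidal
    _ = 𝟙 _ ⊗≫ B ◁ φ ▷ Y ⊗≫ (β_ B X').hom ▷ A ▷ Y ⊗≫ X' ◁
        ((β_ B A).hom ▷ Y ⊗≫ A ◁ ψ ⊗≫ (β_ Y' A).inv ▷ B ⊗≫ 𝟙 (Y' ⊗ (A ⊗ B))) ⊗≫ 𝟙 _ := by
        rw [h1]; monoidal
    _ = 𝟙 _ ⊗≫ B ◁ φ ▷ Y ⊗≫ ((β_ B X').hom ▷ (A ⊗ Y) ≫ (X' ⊗ B) ◁ (β_ Y A).inv) ⊗≫ X' ◁ ψ ▷ A ⊗≫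
        X' ◁ Y' ◁ (β_ B A).hom ⊗≫ 𝟙 _ := by
        rw [h2]; monoidal
    _ = _ := by
        rw [← whisker_exchange]; dsimp only [compAux, leftAux, rightAux]; monoidal

/-! Linear versions -/
section linear
variable (k)

def leftAuxₗ (X Y Y' B : C) : (B ⊗ Y ⟶ Y' ⊗ B) →ₗ[k] (B ⊗ (X ⊗ Y) ⟶ (X ⊗ Y') ⊗ B) where
  toFun := leftAux X
  map_add' _ _ := by simp [leftAux, monoidalComp]
  map_smul' _ _ := by simp [leftAux, monoidalComp]

def rightAuxₗ (X X' Y A : C) : (A ⊗ X ⟶ X' ⊗ A) →ₗ[k] (A ⊗ (X ⊗ Y) ⟶ (X' ⊗ Y) ⊗ A) where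
  toFun φ := rightAux φ Y
  map_add' _ _ := by simp [rightAux, monoidalComp]
  map_smul' _ _ := by simp [rightAux, monoidalComp]

def tensorAuxₗ (X X' Y Y' A B : C) : (A ⊗ X ⟶ X' ⊗ A) →ₗ[k] (B ⊗ Y ⟶ Y' ⊗ B) →ₗ[k]
    ((A ⊗ B) ⊗ (X ⊗ Y) ⟶ (X' ⊗ Y') ⊗ (A ⊗ B)) :=
  LinearMap.mk₂ k tensorAux
    (by simp [tensorAux, monoidalComp, MonoidalPreadditive.add_tensor])
    (by simp [tensorAux, monoidalComp, MonoidalCategory.tensorHom_def])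
    (by simp [tensorAux, monoidalComp, MonoidalPreadditive.tensor_add])
    (by simp [tensorAux, monoidalComp, MonoidalCategory.tensorHom_def])

end linear

theorem leftAux_slide (X : C) {Y Y' B B' : C} (f : B ⟶ B') (g : B' ⊗ Y ⟶ Y' ⊗ B) :
    cls k B (leftAux X (f ▷ Y ≫ g)) = cls k B' (leftAux X (g ≫ Y' ◁ f)) := by
  have h1 : leftAux X (f ▷ Y ≫ g) =
      f ▷ (X ⊗ Y) ≫ (𝟙 _ ⊗≫ (β_ B' X).hom ▷ Y ⊗≫ X ◁ g ⊗≫ 𝟙 _) := by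
    calc _ = 𝟙 _ ⊗≫ ((β_ B X).hom ≫ X ◁ f) ▷ Y ⊗≫ X ◁ g ⊗≫ 𝟙 _ := by
          dsimp only [leftAux]; monoidal
      _ = _ := by rw [← BraidedCategory.braiding_naturality_left]; monoidal
  have h2 : leftAux X (g ≫ Y' ◁ f) =
      (𝟙 _ ⊗≫ (β_ B' X).hom ▷ Y ⊗≫ X ◁ g ⊗≫ 𝟙 ((X ⊗ Y') ⊗ B)) ≫ (X ⊗ Y') ◁ f := by
    dsimp only [leftAux]; monoidal
  rw [h1, h2, cls_slide]

theorem rightAux_slide {X X' : C} (Y : C) {A A' : C} (f : A ⟶ A') (g : A' ⊗ X ⟶ X' ⊗ A) :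
    cls k A (rightAux (f ▷ X ≫ g) Y) = cls k A' (rightAux (g ≫ X' ◁ f) Y) := by
  have h1 : rightAux (f ▷ X ≫ g) Y =
      f ▷ (X ⊗ Y) ≫ (𝟙 _ ⊗≫ g ▷ Y ⊗≫ X' ◁ (β_ Y A).inv ⊗≫ 𝟙 _) := by
    dsimp only [rightAux]; monoidal
  have h2 : rightAux (g ≫ X' ◁ f) Y =
      (𝟙 _ ⊗≫ g ▷ Y ⊗≫ X' ◁ (β_ Y A).inv ⊗≫ 𝟙 ((X' ⊗ Y) ⊗ A)) ≫ (X' ⊗ Y) ◁ f := by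
    calc _ = 𝟙 _ ⊗≫ g ▷ Y ⊗≫ X' ◁ (f ▷ Y ≫ (β_ Y A').inv) ⊗≫ 𝟙 _ := by
          dsimp only [rightAux]; monoidal
      _ = _ := by rw [BraidedCategory.braiding_inv_naturality_left]; monoidal
  rw [h1, h2, cls_slide]

theorem cls_tensorAux {X X' Y Y' A B : C} (φ : A ⊗ X ⟶ X' ⊗ A) (ψ : B ⊗ Y ⟶ Y' ⊗ B) :
    cls k (A ⊗ B) (tensorAux φ ψ) = cls k (B ⊗ A) (compAux (rightAux φ Y) (leftAux X' ψ)) := by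
  rw [cls_iso (β_ B A) (compAux _ _), ← exchangeAux, ← comp_whiskerRight_assoc]
  simp

section
variable (k)
/-- The morphism `X ⊗ -` on the coend. -/
def leftₗ (X Y Y' : C) : CoendHom k Y Y' →ₗ[k] CoendHom k (X ⊗ Y) (X ⊗ Y') :=
  lift (fun B => cls k B ∘ₗ leftAuxₗ k X Y Y' B) (fun _ _ f g => by exact leftAux_slide X f g)

/-- The morphism `- ⊗ Y` on the coend. -/
def rightₗ (X X' Y : C) : CoendHom k X X' →ₗ[k] CoendHom k (X ⊗ Y) (X' ⊗ Y) :=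
  lift (fun A => cls k A ∘ₗ rightAuxₗ k X X' Y A) (fun _ _ f g => by exact rightAux_slide Y f g)

theorem leftₗ_cls (X : C) {Y Y' B : C} (ψ : B ⊗ Y ⟶ Y' ⊗ B) :
    leftₗ k X Y Y' (cls k B ψ) = cls k B (leftAux X ψ) := by
  exact lift_cls _ _ _ _

theorem rightₗ_cls {X X' A : C} (Y : C) (φ : A ⊗ X ⟶ X' ⊗ A) :
    rightₗ k X X' Y (cls k A φ) = cls k A (rightAux φ Y) := by
  exact lift_cls _ _ _ _

/-- The tensor product of morphisms of the horizontal trace. -/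
def tensorₗ (X X' Y Y' : C) :
    CoendHom k X X' →ₗ[k] CoendHom k Y Y' →ₗ[k] CoendHom k (X ⊗ Y) (X' ⊗ Y') :=
  lift (fun A => LinearMap.flip (lift (fun B => LinearMap.flip
      ((LinearMap.compr₂ (tensorAuxₗ k X X' Y Y' A B) (cls k (A ⊗ B)))))
    (fun B B' f g => by
      ext φ
      change cls k (A ⊗ B) (tensorAux φ (f ▷ Y ≫ g)) = cls k (A ⊗ B') (tensorAux φ (g ≫ Y' ◁ f))
      rw [cls_tensorAux, cls_tensorAux, ← compₗ_cls, ← compₗ_cls, leftAux_slide])))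
    (fun A A' f g => by
      apply hom_ext
      intro B ψ
      simp only [LinearMap.flip_apply, lift_cls]
      change cls k (A ⊗ B) (tensorAux (f ▷ X ≫ g) ψ) = cls k (A' ⊗ B) (tensorAux (g ≫ X' ◁ f) ψ)
      rw [cls_tensorAux, cls_tensorAux, ← compₗ_cls, ← compₗ_cls, rightAux_slide])

theorem tensorₗ_cls {X X' Y Y' A B : C} (φ : A ⊗ X ⟶ X' ⊗ A) (ψ : B ⊗ Y ⟶ Y' ⊗ B) :
    tensorₗ k X X' Y Y' (cls k A φ) (cls k B ψ) = cls k (A ⊗ B) (tensorAux φ ψ) := by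
  rw [tensorₗ, lift_cls, LinearMap.flip_apply, lift_cls]
  rfl
end

variable (k) in
theorem leftₗ_incl (X : C) {Y Y' : C} (f : Y ⟶ Y') :
    leftₗ k X Y Y' (incl k f) = incl k (X ◁ f) := by
  rw [incl, leftₗ_cls, incl, leftAux, braiding_tensorUnit_left]
  congr 1
  monoidal

variable (k) in
theorem rightₗ_incl {X X' : C} (f : X ⟶ X') (Y : C) :
    rightₗ k X X' Y (incl k f) = incl k (f ▷ Y) := by
  rw [incl, rightₗ_cls, incl, rightAux, braiding_inv_tensorUnit_right]
  congr 1
  monoidal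

/-- The tensor product of the horizontal trace: that of `C` on objects, `tensorAux` on morphisms;
the structure isomorphisms are those of `C`. -/
instance : MonoidalCategoryStruct (HTr k C) where
  tensorObj X Y := ⟨X.obj ⊗ Y.obj⟩
  tensorHom {X X' Y Y'} f g := tensorₗ k X.obj X'.obj Y.obj Y'.obj f g
  whiskerLeft X {Y Y'} f := leftₗ k X.obj Y.obj Y'.obj f
  whiskerRight {X X'} f Y := rightₗ k X.obj X'.obj Y.obj f
  tensorUnit := ⟨𝟙_ C⟩
  associator X Y Z := (htr k C).mapIso (α_ X.obj Y.obj Z.obj)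
  leftUnitor X := (htr k C).mapIso (λ_ X.obj)
  rightUnitor X := (htr k C).mapIso (ρ_ X.obj)

section laws
variable {X X' Y Y' Z Z' : HTr k C}

theorem whiskerLeft_comp' (X : HTr k C) (f : Y ⟶ Y') (g : Y' ⟶ Z) :
    X ◁ (f ≫ g) = X ◁ f ≫ X ◁ g := by
  change leftₗ k _ _ _ (compₗ k _ _ _ f g) = compₗ k _ _ _ (leftₗ k _ _ _ f) (leftₗ k _ _ _ g)
  induction f using induction with
  | h0 => simp
  | hadd x y hx hy => simp only [map_add, LinearMap.add_apply, hx, hy]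
  | h A φ =>
  induction g using induction with
  | h0 => simp
  | hadd x y hx hy => simp only [map_add, hx, hy]
  | h B ψ =>
  simp only [compₗ_cls, leftₗ_cls]
  congr 1
  calc _ = 𝟙 _ ⊗≫ B ◁ (β_ A X.obj).hom ▷ Y.obj ⊗≫
        ((β_ B X.obj).hom ▷ (A ⊗ Y.obj) ≫ (X.obj ⊗ B) ◁ φ) ⊗≫ X.obj ◁ ψ ▷ A ⊗≫ 𝟙 _ := by
        dsimp only [leftAux, compAux]; rw [BraidedCategory.braiding_tensor_left_hom]; monoidal
    _ = _ := by rw [← whisker_exchange]; dsimp only [leftAux, compAux]; monoidal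

theorem comp_whiskerRight' (f : X ⟶ X') (g : X' ⟶ Z) (Y : HTr k C) :
    (f ≫ g) ▷ Y = f ▷ Y ≫ g ▷ Y := by
  change rightₗ k _ _ _ (compₗ k _ _ _ f g) = compₗ k _ _ _ (rightₗ k _ _ _ f) (rightₗ k _ _ _ g)
  induction f using induction with
  | h0 => simp
  | hadd x y hx hy => simp only [map_add, LinearMap.add_apply, hx, hy]
  | h A φ =>
  induction g using induction with
  | h0 => simp
  | hadd x y hx hy => simp only [map_add, hx, hy]
  | h B ψ =>
  simp only [compₗ_cls, rightₗ_cls]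
  congr 1
  calc _ = 𝟙 _ ⊗≫ B ◁ φ ▷ Y.obj ⊗≫ (ψ ▷ (A ⊗ Y.obj) ≫ (Z.obj ⊗ B) ◁ (β_ Y.obj A).inv) ⊗≫
        Z.obj ◁ (β_ Y.obj B).inv ▷ A ⊗≫ 𝟙 _ := by
        dsimp only [rightAux, compAux]; rw [BraidedCategory.braiding_tensor_right_inv]; monoidal
    _ = _ := by rw [← whisker_exchange]; dsimp only [rightAux, compAux]; monoidal

theorem tensorHom_def₁ (f : X ⟶ X') (g : Y ⟶ Y') : f ⊗ₘ g = f ▷ Y ≫ X' ◁ g := by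
  change tensorₗ k _ _ _ _ f g = compₗ k _ _ _ (rightₗ k _ _ _ f) (leftₗ k _ _ _ g)
  induction f using induction with
  | h0 => simp
  | hadd x y hx hy => simp only [map_add, LinearMap.add_apply, hx, hy]
  | h A φ =>
  induction g using induction with
  | h0 => simp
  | hadd x y hx hy => simp only [map_add, hx, hy]
  | h B ψ =>
  simp only [compₗ_cls, rightₗ_cls, leftₗ_cls, tensorₗ_cls, cls_tensorAux]

theorem tensorHom_def₂ (f : X ⟶ X') (g : Y ⟶ Y') : f ⊗ₘ g = X ◁ g ≫ f ▷ Y' := by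
  change tensorₗ k _ _ _ _ f g = compₗ k _ _ _ (leftₗ k _ _ _ g) (rightₗ k _ _ _ f)
  induction f using induction with
  | h0 => simp
  | hadd x y hx hy => simp only [map_add, LinearMap.add_apply, hx, hy]
  | h A φ =>
  induction g using induction with
  | h0 => simp
  | hadd x y hx hy => simp only [map_add, LinearMap.add_apply, hx, hy]
  | h B ψ =>
  simp only [compₗ_cls, rightₗ_cls, leftₗ_cls, tensorₗ_cls, tensorAux_eq]

theorem whiskerLeft_id' (X Y : HTr k C) : X ◁ 𝟙 Y = 𝟙 (X ⊗ Y) := by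
  change leftₗ k X.obj Y.obj Y.obj (incl k (𝟙 Y.obj)) = incl k (𝟙 (X.obj ⊗ Y.obj))
  rw [leftₗ_incl, MonoidalCategory.whiskerLeft_id]

theorem id_whiskerRight' (X Y : HTr k C) : 𝟙 X ▷ Y = 𝟙 (X ⊗ Y) := by
  change rightₗ k X.obj X.obj Y.obj (incl k (𝟙 X.obj)) = incl k (𝟙 (X.obj ⊗ Y.obj))
  rw [rightₗ_incl, MonoidalCategory.id_whiskerRight]

theorem assoc_left (f : X ⟶ X') (Y Z : HTr k C) :
    (f ▷ Y) ▷ Z ≫ (α_ X' Y Z).hom = (α_ X Y Z).hom ≫ f ▷ (Y ⊗ Z) := by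
  change compₗ k _ _ _ (rightₗ k _ _ _ (rightₗ k _ _ _ f)) (incl k (α_ X'.obj Y.obj Z.obj).hom) =
    compₗ k _ _ _ (incl k (α_ X.obj Y.obj Z.obj).hom) (rightₗ k _ _ (Y.obj ⊗ Z.obj) f)
  induction f using induction with
  | h0 => simp
  | hadd x y hx hy => simp only [map_add, LinearMap.add_apply, hx, hy]
  | h A φ =>
  simp only [rightₗ_cls, compₗ_incl, incl_compₗ]
  congr 1
  dsimp only [rightAux]
  rw [BraidedCategory.braiding_tensor_left_inv]
  monoidal

theorem assoc_middle (X : HTr k C) (f : Y ⟶ Y') (Z : HTr k C) :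
    (X ◁ f) ▷ Z ≫ (α_ X Y' Z).hom = (α_ X Y Z).hom ≫ X ◁ (f ▷ Z) := by
  change compₗ k _ _ _ (rightₗ k _ _ _ (leftₗ k _ _ _ f)) (incl k (α_ X.obj Y'.obj Z.obj).hom) =
    compₗ k _ _ _ (incl k (α_ X.obj Y.obj Z.obj).hom) (leftₗ k _ _ _ (rightₗ k _ _ _ f))
  induction f using induction with
  | h0 => simp
  | hadd x y hx hy => simp only [map_add, LinearMap.add_apply, hx, hy]
  | h A φ =>
  simp only [rightₗ_cls, leftₗ_cls, compₗ_incl, incl_compₗ]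
  congr 1
  dsimp only [rightAux, leftAux]
  monoidal

theorem assoc_right (X Y : HTr k C) (f : Z ⟶ Z') :
    (X ⊗ Y) ◁ f ≫ (α_ X Y Z').hom = (α_ X Y Z).hom ≫ X ◁ (Y ◁ f) := by
  change compₗ k _ _ _ (leftₗ k (X.obj ⊗ Y.obj) _ _ f) (incl k (α_ X.obj Y.obj Z'.obj).hom) =
    compₗ k _ _ _ (incl k (α_ X.obj Y.obj Z.obj).hom) (leftₗ k _ _ _ (leftₗ k _ _ _ f))
  induction f using induction with
  | h0 => simp
  | hadd x y hx hy => simp only [map_add, LinearMap.add_apply, hx, hy]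
  | h A φ =>
  simp only [leftₗ_cls, compₗ_incl, incl_compₗ]
  congr 1
  dsimp only [leftAux]
  rw [BraidedCategory.braiding_tensor_right_hom]
  monoidal

theorem left_unit (f : X ⟶ Y) : 𝟙_ (HTr k C) ◁ f ≫ (λ_ Y).hom = (λ_ X).hom ≫ f := by
  change compₗ k _ _ _ (leftₗ k (𝟙_ C) _ _ f) (incl k (λ_ Y.obj).hom) =
    compₗ k _ _ _ (incl k (λ_ X.obj).hom) f
  induction f using induction with
  | h0 => simp
  | hadd x y hx hy => simp only [map_add, LinearMap.add_apply, hx, hy]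
  | h A φ =>
  simp only [leftₗ_cls, compₗ_incl, incl_compₗ]
  congr 1
  dsimp only [leftAux]
  rw [braiding_tensorUnit_right]
  monoidal

theorem right_unit (f : X ⟶ Y) : f ▷ 𝟙_ (HTr k C) ≫ (ρ_ Y).hom = (ρ_ X).hom ≫ f := by
  change compₗ k _ _ _ (rightₗ k _ _ (𝟙_ C) f) (incl k (ρ_ Y.obj).hom) =
    compₗ k _ _ _ (incl k (ρ_ X.obj).hom) f
  induction f using induction with
  | h0 => simp
  | hadd x y hx hy => simp only [map_add, LinearMap.add_apply, hx, hy]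
  | h A φ =>
  simp only [rightₗ_cls, compₗ_incl, incl_compₗ]
  congr 1
  dsimp only [rightAux]
  rw [braiding_inv_tensorUnit_left]
  monoidal

theorem exchange' (f : X ⟶ X') (g : Y ⟶ Y') : X ◁ g ≫ f ▷ Y' = f ▷ Y ≫ X' ◁ g := by
  rw [← tensorHom_def₁, tensorHom_def₂]

theorem htr_whiskerLeft (X : C) {Y Y' : C} (f : Y ⟶ Y') :
    (htr k C).obj X ◁ (htr k C).map f = (htr k C).map (X ◁ f) := leftₗ_incl k X f

theorem htr_whiskerRight {X X' : C} (f : X ⟶ X') (Y : C) :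
    (htr k C).map f ▷ (htr k C).obj Y = (htr k C).map (f ▷ Y) := rightₗ_incl k f Y

end laws

instance : MonoidalCategory (HTr k C) where
  tensorHom_def := tensorHom_def₁
  id_tensorHom_id X Y := by
    rw [tensorHom_def₁, whiskerLeft_id', id_whiskerRight', Category.comp_id]
  tensorHom_comp_tensorHom f₁ f₂ g₁ g₂ := by
    simp only [tensorHom_def₁, whiskerLeft_comp', comp_whiskerRight', Category.assoc]
    rw [← Category.assoc (_ ◁ f₂), exchange', Category.assoc]
  whiskerLeft_id := whiskerLeft_id'
  id_whiskerRight := id_whiskerRight'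
  associator_naturality f g h := by
    simp only [tensorHom_def₁, whiskerLeft_comp', comp_whiskerRight', Category.assoc]
    rw [assoc_right, reassoc_of% (assoc_middle _ g _), reassoc_of% (assoc_left f _ _)]
  leftUnitor_naturality := left_unit
  rightUnitor_naturality := right_unit
  pentagon W X Y Z := by
    have := congrArg (htr k C).map (MonoidalCategory.pentagon W.obj X.obj Y.obj Z.obj)
    simp only [Functor.map_comp, ← htr_whiskerLeft, ← htr_whiskerRight] at this
    exact this
  triangle X Y := by
    have := congrArg (htr k C).map (MonoidalCategory.triangle X.obj Y.obj)
    simp only [Functor.map_comp, ← htr_whiskerLeft, ← htr_whiskerRight] at this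
    exact this

/-- The dual of `X` in the horizontal trace is the dual of `X` in `C`, with the images of the
evaluation and coevaluation of `C`. -/
instance [RightRigidCategory C] (X : HTr k C) : HasRightDual X where
  rightDual := ⟨(X.obj)ᘁ⟩
  exact :=
    { coevaluation' := (htr k C).map (η_ X.obj ((X.obj)ᘁ))
      evaluation' := (htr k C).map (ε_ X.obj ((X.obj)ᘁ))
      coevaluation_evaluation' := by
        have := congrArg (htr k C).map (ExactPairing.coevaluation_evaluation X.obj ((X.obj)ᘁ))
        simp only [Functor.map_comp, ← htr_whiskerLeft, ← htr_whiskerRight] at this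
        exact this
      evaluation_coevaluation' := by
        have := congrArg (htr k C).map (ExactPairing.evaluation_coevaluation X.obj ((X.obj)ᘁ))
        simp only [Functor.map_comp, ← htr_whiskerLeft, ← htr_whiskerRight] at this
        exact this }

instance [RightRigidCategory C] : RightRigidCategory (HTr k C) where

end
end HTr

/-! ### Traces and dimensions -/
namespace PivotalStructure
variable {C : Type u} [Category.{v} C] [MonoidalCategory C] [RightRigidCategory C]
  (P : PivotalStructure C)

/-- The other evaluation `X ⊗ Xᘁ ⟶ 𝟙`, through the pivotal structure. -/
def ev (X : C) : X ⊗ (Xᘁ : C) ⟶ 𝟙_ C := (P.iso X).hom ▷ (Xᘁ : C) ≫ ε_ (Xᘁ : C) ((Xᘁ)ᘁ)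

/-- The other coevaluation `𝟙 ⟶ Xᘁ ⊗ X`, through the pivotal structure. -/
def coev (X : C) : 𝟙_ C ⟶ (Xᘁ : C) ⊗ X := η_ (Xᘁ : C) ((Xᘁ)ᘁ) ≫ (Xᘁ : C) ◁ (P.iso X).inv

/-- The closure of an endomorphism of `X` to an endomorphism of the unit. -/
def leftTrace {X : C} (f : X ⟶ X) : 𝟙_ C ⟶ 𝟙_ C := η_ X (Xᘁ) ≫ f ▷ (Xᘁ : C) ≫ P.ev X

/-- The closure of an endomorphism of `X` on the other side. -/
def rightTrace {X : C} (f : X ⟶ X) : 𝟙_ C ⟶ 𝟙_ C := P.coev X ≫ (Xᘁ : C) ◁ f ≫ ε_ X (Xᘁ)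

end PivotalStructure

/-- A premodular category over `k`: a finite semisimple `k`-linear abelian rigid braided monoidal
category with simple unit, with a spherical pivotal structure (for a braided fusion category, this
is the same as a ribbon structure). -/
class PremodularCategory (k : Type w) [Field k] (C : Type u) [Category.{v} C] [Abelian C]
    [Linear k C] [MonoidalCategory C] [MonoidalPreadditive C] [MonoidalLinear k C]
    [BraidedCategory C] [RightRigidCategory C] where
  piv : PivotalStructure C
  spherical : ∀ {X : C} (f : X ⟶ X), piv.leftTrace f = piv.rightTrace f
  semisimple : IsFiniteSemisimple k C
  simple_unit : Simple (𝟙_ C)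

section premodular
variable (k : Type w) [Field k] {C : Type u} [Category.{v} C] [Abelian C]
    [Linear k C] [MonoidalCategory C] [MonoidalPreadditive C] [MonoidalLinear k C]
    [BraidedCategory C] [RightRigidCategory C]

open Classical in
/-- The scalar by which an endomorphism of the unit acts (`0` if it is no scalar). -/
def scalar (f : 𝟙_ C ⟶ 𝟙_ C) : k := if h : ∃ c : k, c • 𝟙 (𝟙_ C) = f then h.choose else 0

variable [PremodularCategory k C]

/-- The trace of an endomorphism. -/
def tr {X : C} (f : X ⟶ X) : k := scalar k ((PremodularCategory.piv k).leftTrace f)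

/-- The dimension of an object. -/
def dim (X : C) : k := tr k (𝟙 X)

/-! Dual bases -/
variable {k}

theorem exists_split {S V : C} (hk : IsFiniteSemisimple k C) [Simple S] (f : S ⟶ V) (hf : f ≠ 0) :
    ∃ g : V ⟶ S, f ≫ g = 𝟙 S := by
  obtain ⟨n, T, b, hT, ⟨hb⟩, ⟨e⟩⟩ := hk.semisimple V
  have : ∃ i, f ≫ e.hom ≫ b.π i ≠ 0 := by
    by_contra! h
    apply hf
    rw [← cancel_mono e.hom, zero_comp]
    apply hb.isLimit.hom_ext
    rintro ⟨i⟩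
    simpa using h i
  obtain ⟨i, hi⟩ := this
  have := hT i
  have := isIso_of_hom_simple hi
  exact ⟨e.hom ≫ b.π i ≫ inv (f ≫ e.hom ≫ b.π i), by
    have := IsIso.hom_inv_id (f ≫ e.hom ≫ b.π i)
    rwa [Category.assoc, Category.assoc] at this⟩

variable [IsAlgClosed k]

theorem exists_smul {S : C} (hk : IsFiniteSemisimple k C) [Simple S] (f : S ⟶ S) :
    ∃ c : k, c • 𝟙 S = f := by
  have := hk.finiteDimensional S S
  exact endomorphism_simple_eq_smul_id k f

theorem smul_id_inj {S : C} [Simple S] {a b : k} (h : a • 𝟙 S = b • 𝟙 S) : a = b := by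
  rw [← sub_eq_zero, ← sub_smul, smul_eq_zero] at h
  exact sub_eq_zero.1 (h.resolve_right (id_nonzero S))

theorem scalar_smul [Simple (𝟙_ C)] (c : k) : scalar k (c • 𝟙 (𝟙_ C)) = c := by
  have h : ∃ d : k, d • 𝟙 (𝟙_ C) = c • 𝟙 (𝟙_ C) := ⟨c, rfl⟩
  rw [scalar, dif_pos h]
  exact smul_id_inj h.choose_spec

theorem tr_smul {S : C} (c : k) : tr k (c • 𝟙 S) = c * dim k S := by
  have hk := PremodularCategory.semisimple (k := k) (C := C)
  have := PremodularCategory.simple_unit k (C := C)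
  obtain ⟨d, hd⟩ := exists_smul hk ((PremodularCategory.piv k).leftTrace (𝟙 S))
  have : (PremodularCategory.piv k).leftTrace (c • 𝟙 S) = (c * d) • 𝟙 (𝟙_ C) := by
    rw [mul_smul, hd]
    simp [PivotalStructure.leftTrace]
  rw [dim, tr, tr, this, ← hd, scalar_smul, scalar_smul]

theorem dim_ne_zero {S : C} [Simple S] : dim k S ≠ 0 := by
  have hk := PremodularCategory.semisimple (k := k) (C := C)
  have := PremodularCategory.simple_unit k (C := C)
  set P := PremodularCategory.piv k (C := C)
  have h1 : η_ S (Sᘁ) ≠ 0 := by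
    intro h
    have h2 := ExactPairing.evaluation_coevaluation S (Sᘁ)
    rw [h, MonoidalPreadditive.zero_whiskerRight, zero_comp] at h2
    apply id_nonzero S
    have h3 : (λ_ S).inv ≫ ((λ_ S).hom ≫ (ρ_ S).inv) ≫ (ρ_ S).hom = 0 := by
      rw [← h2, zero_comp, comp_zero]
    simpa using h3
  obtain ⟨r, hr⟩ := exists_split hk _ h1
  obtain ⟨c, hc⟩ := exists_smul hk
    (tensorRightHomEquiv S (Sᘁ) ((Sᘁ)ᘁ) (𝟙_ C) r ≫ (λ_ _).hom ≫ (P.iso S).inv)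
  have h2 : tensorRightHomEquiv S (Sᘁ) ((Sᘁ)ᘁ) (𝟙_ C) r =
      (c • 𝟙 S) ≫ (P.iso S).hom ≫ (λ_ _).inv := by
    rw [hc]; simp
  have h3 : r = c • P.ev S := by
    rw [← Equiv.eq_symm_apply] at h2
    rw [h2, tensorRightHomEquiv_symm_naturality, tensorRightHomEquiv_symm_naturality]
    have : (tensorRightHomEquiv (((Sᘁ)ᘁ) : C) (Sᘁ) ((Sᘁ)ᘁ) (𝟙_ C)).symm (λ_ _).inv =
        ε_ (Sᘁ : C) ((Sᘁ)ᘁ) := by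
      simp [tensorRightHomEquiv, ← unitors_equal]
    rw [this, PivotalStructure.ev]
    simp
  intro h
  obtain ⟨d, hd⟩ := exists_smul hk (P.leftTrace (𝟙 S))
  have h4 : d = 0 := by
    rw [← h, dim, tr, ← scalar_smul (C := C) d, hd]
  rw [h4, zero_smul] at hd
  apply id_nonzero (𝟙_ C)
  rw [← hr, h3, Linear.comp_smul]
  rw [PivotalStructure.leftTrace, id_whiskerRight, Category.id_comp] at hd
  rw [← hd, smul_zero]

theorem exists_dualBasis (S V : C) [Simple S] [FiniteDimensional k (S ⟶ V)] :
    ∃ g : Fin (Module.finrank k (S ⟶ V)) → (V ⟶ S), ∀ α β,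
      tr k (Module.finBasis k (S ⟶ V) α ≫ g β) = if α = β then 1 else 0 := by
  have hk := PremodularCategory.semisimple (k := k) (C := C)
  have hex : ∀ f : S ⟶ S, ∃ c : k, c • 𝟙 S = f := exists_smul hk
  choose c hc using hex
  let B : (V ⟶ S) →ₗ[k] Module.Dual k (S ⟶ V) := LinearMap.flip
    (LinearMap.mk₂ k (fun (f : S ⟶ V) (g : V ⟶ S) => c (f ≫ g))
      (fun f f' g => smul_id_inj (S := S) (by simp [add_smul, hc]))
      (fun a f g => smul_id_inj (S := S) (by simp [mul_smul, hc]))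
      (fun f g g' => smul_id_inj (S := S) (by simp [add_smul, hc]))
      (fun a f g => smul_id_inj (S := S) (by simp [mul_smul, hc])))
  have hB : Function.Surjective B := by
    rw [← LinearMap.range_eq_top]
    by_contra hne
    obtain ⟨f, hf, hf'⟩ : ∃ f : S ⟶ V, f ≠ 0 ∧ ∀ g, B g f = 0 := by
      have hlt : LinearMap.range B < ⊤ := lt_of_le_of_ne le_top hne
      obtain ⟨φ, hφ, hφ'⟩ := Submodule.exists_le_ker_of_lt_top _ hlt
      obtain ⟨f, rfl⟩ := (Module.evalEquiv k (S ⟶ V)).surjective φ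
      refine ⟨f, fun h => hφ (by simp [h]), fun g => ?_⟩
      exact hφ' ⟨g, rfl⟩
    obtain ⟨g, hg⟩ := exists_split hk f hf
    have h1 : c (f ≫ g) = 0 := hf' g
    have h2 := hc (f ≫ g)
    rw [h1, hg, zero_smul] at h2
    exact id_nonzero S h2.symm
  choose g hg using fun β => hB ((dim k S)⁻¹ • (Module.finBasis k (S ⟶ V)).coord β)
  refine ⟨g, fun α β => ?_⟩
  rw [← hc (Module.finBasis k (S ⟶ V) α ≫ g β), tr_smul]
  have h1 : c (Module.finBasis k (S ⟶ V) α ≫ g β) =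
      ((dim k S)⁻¹ • (Module.finBasis k (S ⟶ V)).coord β) (Module.finBasis k (S ⟶ V) α) := by
    rw [← hg]; rfl
  rw [h1]
  simp [Finsupp.single_apply, dim_ne_zero (k := k) (S := S)]

end premodular

section data
variable (k : Type w) [Field k] (C : Type u) [Category.{v} C] [Abelian C]
    [Linear k C] [MonoidalCategory C] [MonoidalPreadditive C] [MonoidalLinear k C]
    [BraidedCategory C] [RightRigidCategory C] [PremodularCategory k C]

/-- Representatives `X i` of the isomorphism classes of simple objects, with a square root of each
`dim (X i)` and a square root of the total dimension `∑ i, dim (X i) ^ 2`. -/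
structure IrrData where
  ι : Type
  fintype : Fintype ι
  X : ι → C
  simple : ∀ i, Simple (X i)
  eq_of_iso : ∀ i j, Nonempty (X i ≅ X j) → i = j
  exists_iso : ∀ Y : C, Simple Y → ∃ i, Nonempty (Y ≅ X i)
  sqrtDim : ι → k
  sqrtDim_sq : ∀ i, sqrtDim i ^ 2 = dim k (X i)
  sqrtTot : k
  sqrtTot_sq : sqrtTot ^ 2 = ∑ i, dim k (X i) ^ 2

attribute [instance] IrrData.fintype
end data

namespace IrrData
variable {k : Type w} [Field k] [IsAlgClosed k] {C : Type u} [Category.{v} C] [Abelian C]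
    [Linear k C] [MonoidalCategory C] [MonoidalPreadditive C] [MonoidalLinear k C]
    [BraidedCategory C] [RightRigidCategory C] [PremodularCategory k C] (D : IrrData k C)

/-- The total dimension. -/
def tot : k := ∑ i, dim k (D.X i) ^ 2

/-- The number of elements of a basis of `Hom (X j, V)`. -/
def mult (_ : IrrData k C) (S V : C) : ℕ := Module.finrank k (S ⟶ V)

/-- A basis of `Hom (X j, V)`. -/
def bas (j : D.ι) (V : C) (α : Fin (D.mult (D.X j) V)) : D.X j ⟶ V :=
  haveI := (PremodularCategory.semisimple (k := k) (C := C)).finiteDimensional (D.X j) V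
  Module.finBasis k (D.X j ⟶ V) α

theorem exists_dua (j : D.ι) (V : C) : ∃ g : Fin (D.mult (D.X j) V) → (V ⟶ D.X j), ∀ α β,
    tr k (D.bas j V α ≫ g β) = if α = β then 1 else 0 :=
  haveI := (PremodularCategory.semisimple (k := k) (C := C)).finiteDimensional (D.X j) V
  haveI := D.simple j
  exists_dualBasis (D.X j) V

/-- The basis of `Hom (V, X j)` dual to `bas` under the pairing `(f, g) ↦ tr (g ∘ f)`. -/
def dua (j : D.ι) (V : C) (β : Fin (D.mult (D.X j) V)) : V ⟶ D.X j := (D.exists_dua j V).choose β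

/-! Rotations of morphisms, using the pivotal structure -/

/-- The evaluation `X ⊗ Xᘁ ⟶ 𝟙`. -/
abbrev evR (_ : IrrData k C) (X : C) : X ⊗ (Xᘁ : C) ⟶ 𝟙_ C := (PremodularCategory.piv k).ev X

/-- The coevaluation `𝟙 ⟶ Xᘁ ⊗ X`. -/
abbrev coevR (_ : IrrData k C) (X : C) : 𝟙_ C ⟶ (Xᘁ : C) ⊗ X := (PremodularCategory.piv k).coev X

/-- `f : W ⟶ B ⊗ U` rotated to `Uᘁ ⟶ Wᘁ ⊗ B`. -/
def rotOut {B U W : C} (f : W ⟶ B ⊗ U) : (Uᘁ : C) ⟶ (Wᘁ : C) ⊗ B :=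
  𝟙 _ ⊗≫ D.coevR W ▷ (Uᘁ : C) ⊗≫ (Wᘁ : C) ◁ f ▷ (Uᘁ : C) ⊗≫ ((Wᘁ : C) ⊗ B) ◁ D.evR U ⊗≫ 𝟙 _

/-- `g : W ⊗ A ⟶ U` rotated to `A ⊗ Uᘁ ⟶ Wᘁ`. -/
def rotIn {A U W : C} (g : W ⊗ A ⟶ U) : A ⊗ (Uᘁ : C) ⟶ (Wᘁ : C) :=
  𝟙 _ ⊗≫ D.coevR W ▷ (A ⊗ (Uᘁ : C)) ⊗≫ (Wᘁ : C) ◁ g ▷ (Uᘁ : C) ⊗≫ (Wᘁ : C) ◁ D.evR U ⊗≫ 𝟙 _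

/-- `f : W ⟶ U ⊗ V` rotated to `Vᘁ ⊗ Uᘁ ⟶ Wᘁ`. -/
def rotPair {U V W : C} (f : W ⟶ U ⊗ V) : (Vᘁ : C) ⊗ (Uᘁ : C) ⟶ (Wᘁ : C) :=
  𝟙 _ ⊗≫ D.coevR W ▷ ((Vᘁ : C) ⊗ (Uᘁ : C)) ⊗≫ (Wᘁ : C) ◁ f ▷ ((Vᘁ : C) ⊗ (Uᘁ : C)) ⊗≫
    ((Wᘁ : C) ⊗ U) ◁ D.evR V ▷ (Uᘁ : C) ⊗≫ (Wᘁ : C) ◁ D.evR U ⊗≫ 𝟙 _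

/-! ### The induction functor on objects, and the functor `G` on representatives -/

attribute [local instance] Abelian.hasFiniteBiproducts

/-- The object underlying the induction of `A`: `⨁ i, X i ⊗ A ⊗ (X i)ᘁ`. -/
def IObj (A : C) : C := ⨁ fun i => D.X i ⊗ (A ⊗ ((D.X i)ᘁ : C))

/-- The inclusion of a summand of `IObj`. -/
def inI (A : C) (i : D.ι) : D.X i ⊗ (A ⊗ ((D.X i)ᘁ : C)) ⟶ D.IObj A :=
  biproduct.ι (fun i => D.X i ⊗ (A ⊗ ((D.X i)ᘁ : C))) i

/-- The projection to a summand of `IObj`. -/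
def prI (A : C) (i : D.ι) : D.IObj A ⟶ D.X i ⊗ (A ⊗ ((D.X i)ᘁ : C)) :=
  biproduct.π (fun i => D.X i ⊗ (A ⊗ ((D.X i)ᘁ : C))) i

/-- The `(i, j)` component of the half-braiding of the induced object. -/
def gammaComp (A B : C) (i j : D.ι) :
    B ⊗ (D.X i ⊗ (A ⊗ ((D.X i)ᘁ : C))) ⟶ (D.X j ⊗ (A ⊗ ((D.X j)ᘁ : C))) ⊗ B :=
  (D.sqrtDim i * D.sqrtDim j) • ∑ α, (𝟙 _ ⊗≫ D.dua j (B ⊗ D.X i) α ▷ (A ⊗ ((D.X i)ᘁ : C)) ⊗≫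
    (D.X j ⊗ A) ◁ D.rotOut (D.bas j (B ⊗ D.X i) α) ⊗≫ 𝟙 _)

/-- The half-braiding `B ⊗ I(A) ⟶ I(A) ⊗ B` of the induced object. -/
def gammaRaw (A B : C) : B ⊗ D.IObj A ⟶ D.IObj A ⊗ B :=
  ∑ i, ∑ j, B ◁ D.prI A i ≫ D.gammaComp A B i j ≫ D.inI A j ▷ B

/-- The `(i, j)` component of `G (ψ)`, where `ψ : A ⊗ X ⟶ X' ⊗ A`. -/
def traceComp {X X' : C} (A : C) (ψ : A ⊗ X ⟶ X' ⊗ A) (i j : D.ι) :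
    D.X i ⊗ (X ⊗ ((D.X i)ᘁ : C)) ⟶ D.X j ⊗ (X' ⊗ ((D.X j)ᘁ : C)) :=
  (D.sqrtDim i * D.sqrtDim j) • ∑ α,
    (𝟙 _ ⊗≫ D.bas i (D.X j ⊗ A) α ▷ (X ⊗ ((D.X i)ᘁ : C)) ⊗≫
      D.X j ◁ ψ ▷ ((D.X i)ᘁ : C) ⊗≫
      (D.X j ⊗ X') ◁ D.rotIn (D.dua i (D.X j ⊗ A) α) ⊗≫ 𝟙 _)

/-- The morphism `I(X) ⟶ I(X')` underlying `G (ψ)`. -/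
def traceRaw {X X' : C} (A : C) (ψ : A ⊗ X ⟶ X' ⊗ A) : D.IObj X ⟶ D.IObj X' :=
  ∑ i, ∑ j, D.prI X i ≫ D.traceComp A ψ i j ≫ D.inI X' j

/-! ### The reduced tensor product -/

/-- The half-braiding of an object of the center, as `A ⊗ X ⟶ X ⊗ A`. -/
abbrev hb (X : Center C) (A : C) : A ⊗ X.1 ⟶ X.1 ⊗ A := (X.2.β A).inv

/-- The projection of `X ⊗ Y` whose image is the reduced tensor product: `X` and `Y` encircled by
the regular colour, through their half-braidings on the inner sides. -/
def Q (X Y : Center C) : X.1 ⊗ Y.1 ⟶ X.1 ⊗ Y.1 :=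
  (D.tot)⁻¹ • ∑ i, dim k (D.X i) •
    (𝟙 _ ⊗≫ X.1 ◁ η_ (D.X i) ((D.X i)ᘁ) ▷ Y.1 ⊗≫
      (β_ (D.X i) X.1).inv ▷ (((D.X i)ᘁ : C) ⊗ Y.1) ⊗≫
      (D.X i ⊗ X.1) ◁ hb Y ((D.X i)ᘁ) ⊗≫
      hb X (D.X i) ▷ (Y.1 ⊗ ((D.X i)ᘁ : C)) ⊗≫
      (X.1 ⊗ D.X i) ◁ (β_ Y.1 ((D.X i)ᘁ)).hom ⊗≫
      X.1 ◁ D.evR (D.X i) ▷ Y.1 ⊗≫ 𝟙 _)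

/-- The object underlying the reduced tensor product. -/
def redObj (X Y : Center C) : C := image (D.Q X Y)

/-- The inclusion of the reduced tensor product. -/
def redι (X Y : Center C) : D.redObj X Y ⟶ X.1 ⊗ Y.1 := image.ι (D.Q X Y)

/-- The projection to the reduced tensor product. -/
def redπ (X Y : Center C) : X.1 ⊗ Y.1 ⟶ D.redObj X Y := factorThruImage (D.Q X Y)

/-- The half-braiding of the reduced tensor product, on `X ⊗ Y`: the strand `A` is fused into the
encircling regular colour. -/
def redHb (X Y : Center C) (A : C) : A ⊗ (X.1 ⊗ Y.1) ⟶ (X.1 ⊗ Y.1) ⊗ A :=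
  (D.tot)⁻¹ • ∑ i, ∑ j, (dim k (D.X i) * dim k (D.X j)) • ∑ α,
    (𝟙 _ ⊗≫ A ◁ X.1 ◁ η_ (D.X i) ((D.X i)ᘁ) ▷ Y.1 ⊗≫
      A ◁ (β_ (D.X i) X.1).inv ▷ (((D.X i)ᘁ : C) ⊗ Y.1) ⊗≫
      (A ⊗ D.X i ⊗ X.1) ◁ hb Y ((D.X i)ᘁ) ⊗≫
      D.dua j (A ⊗ D.X i) α ▷ ((X.1 ⊗ Y.1) ⊗ ((D.X i)ᘁ : C)) ⊗≫
      (D.X j ⊗ X.1 ⊗ Y.1) ◁ D.rotOut (D.bas j (A ⊗ D.X i) α) ⊗≫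
      hb X (D.X j) ▷ (Y.1 ⊗ ((D.X j)ᘁ : C) ⊗ A) ⊗≫
      (X.1 ⊗ D.X j) ◁ (β_ Y.1 ((D.X j)ᘁ)).hom ▷ A ⊗≫
      X.1 ◁ D.evR (D.X j) ▷ (Y.1 ⊗ A) ⊗≫ 𝟙 _)

/-- The left unit constraint `I(𝟙) ⊗ X ⟶ X`, before restriction to the reduced tensor product. -/
def leftUnitRaw (X : Center C) : D.IObj (𝟙_ C) ⊗ X.1 ⟶ X.1 :=
  ∑ i, (D.sqrtDim i / D.sqrtTot) •
    (D.prI (𝟙_ C) i ▷ X.1 ⊗≫ D.X i ◁ (β_ X.1 ((D.X i)ᘁ)).inv ⊗≫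
      hb X (D.X i) ▷ ((D.X i)ᘁ : C) ⊗≫ X.1 ◁ D.evR (D.X i) ⊗≫ 𝟙 _)

/-- The right unit constraint `X ⊗ I(𝟙) ⟶ X`, before restriction to the reduced tensor product. -/
def rightUnitRaw (X : Center C) : X.1 ⊗ D.IObj (𝟙_ C) ⟶ X.1 :=
  ∑ i, (D.sqrtDim i / D.sqrtTot) •
    (X.1 ◁ D.prI (𝟙_ C) i ⊗≫ (β_ (D.X i) X.1).inv ▷ ((D.X i)ᘁ : C) ⊗≫
      hb X (D.X i) ▷ ((D.X i)ᘁ : C) ⊗≫ X.1 ◁ D.evR (D.X i) ⊗≫ 𝟙 _)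

/-- The half-braiding `A ⊗ Xᘁ ⟶ Xᘁ ⊗ A` of the dual for the reduced tensor product. -/
def dualHb (X : Center C) (A : C) : A ⊗ ((X.1)ᘁ : C) ⟶ ((X.1)ᘁ : C) ⊗ A :=
  (β_ A ((X.1)ᘁ)).hom ⊗≫ (((X.1)ᘁ : C) ⊗ A) ◁ η_ X.1 ((X.1)ᘁ) ⊗≫
    ((X.1)ᘁ : C) ◁ hb X A ▷ ((X.1)ᘁ : C) ⊗≫ ε_ X.1 ((X.1)ᘁ) ▷ (A ⊗ ((X.1)ᘁ : C)) ⊗≫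
    (β_ ((X.1)ᘁ : C) A).inv

/-- The evaluation `Xᘁ ⊗ X ⟶ I(𝟙)` for the reduced tensor product, before restriction. -/
def evRaw (X : Center C) : ((X.1)ᘁ : C) ⊗ X.1 ⟶ D.IObj (𝟙_ C) :=
  ∑ i, (D.sqrtDim i / D.sqrtTot) •
    (𝟙 _ ⊗≫ ((X.1)ᘁ : C) ◁ η_ (D.X i) ((D.X i)ᘁ) ▷ X.1 ⊗≫
      (β_ (D.X i) ((X.1)ᘁ)).inv ▷ (((D.X i)ᘁ : C) ⊗ X.1) ⊗≫
      (D.X i ⊗ ((X.1)ᘁ : C)) ◁ hb X ((D.X i)ᘁ) ⊗≫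
      D.X i ◁ ε_ X.1 ((X.1)ᘁ) ▷ ((D.X i)ᘁ : C) ⊗≫ D.inI (𝟙_ C) i)

/-- The coevaluation `I(𝟙) ⟶ X ⊗ Xᘁ` for the reduced tensor product, before projection. -/
def coevRaw (X : Center C) : D.IObj (𝟙_ C) ⟶ X.1 ⊗ ((X.1)ᘁ : C) :=
  ∑ i, (D.sqrtDim i / D.sqrtTot) •
    (D.prI (𝟙_ C) i ⊗≫ D.X i ◁ η_ X.1 ((X.1)ᘁ) ▷ ((D.X i)ᘁ : C) ⊗≫
      (D.X i ⊗ X.1) ◁ (β_ ((X.1)ᘁ : C) ((D.X i)ᘁ)).hom ⊗≫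
      hb X (D.X i) ▷ (((D.X i)ᘁ : C) ⊗ ((X.1)ᘁ : C)) ⊗≫
      X.1 ◁ D.evR (D.X i) ▷ ((X.1)ᘁ : C) ⊗≫ 𝟙 _)

/-- The `(i, l) → j` component of the tensor structure `J` of the induction functor. -/
def JComp (X Y : C) (i l j : D.ι) :
    (D.X i ⊗ (X ⊗ ((D.X i)ᘁ : C))) ⊗ (D.X l ⊗ (Y ⊗ ((D.X l)ᘁ : C))) ⟶
      D.X j ⊗ ((X ⊗ Y) ⊗ ((D.X j)ᘁ : C)) :=
  (D.sqrtDim i * D.sqrtDim j * D.sqrtDim l) • ∑ α,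
    (𝟙 _ ⊗≫ D.X i ◁ (β_ (D.X l) (X ⊗ ((D.X i)ᘁ : C))).inv ▷ (Y ⊗ ((D.X l)ᘁ : C)) ⊗≫
      (D.X i ⊗ D.X l ⊗ X) ◁ (β_ (Y ⊗ ((D.X l)ᘁ : C)) ((D.X i)ᘁ)).inv ⊗≫
      D.dua j (D.X i ⊗ D.X l) α ▷ (X ⊗ Y ⊗ ((D.X l)ᘁ : C) ⊗ ((D.X i)ᘁ : C)) ⊗≫
      (D.X j ⊗ X ⊗ Y) ◁ D.rotPair (D.bas j (D.X i ⊗ D.X l) α) ⊗≫ 𝟙 _)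

/-- The tensor structure `J : I(X) ⊗ I(Y) ⟶ I(X ⊗ Y)`, before restriction to the reduced tensor
product. -/
def JRaw (X Y : C) : D.IObj X ⊗ D.IObj Y ⟶ D.IObj (X ⊗ Y) :=
  ∑ i, ∑ l, ∑ j, (D.prI X i ⊗ₘ D.prI Y l) ≫ D.JComp X Y i l j ≫ D.inI (X ⊗ Y) j

end IrrData

/-! ### The reduced tensor category

The formulas above determine the following structures; that they have the properties listed as
fields is part of the assertion that such a structure exists. -/
section reduced
variable {k : Type w} [Field k] [IsAlgClosed k] {C : Type u} [Category.{v} C] [Abelian C]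
    [Linear k C] [MonoidalCategory C] [MonoidalPreadditive C] [MonoidalLinear k C]
    [BraidedCategory C] [RightRigidCategory C] [PremodularCategory k C]

/-- The half-braidings of induced objects, of reduced tensor products and of duals. -/
structure ReducedObjects (D : IrrData k C) where
  indHB : ∀ A : C, HalfBraiding (D.IObj A)
  indHB_inv : ∀ A B, ((indHB A).β B).inv = D.gammaRaw A B
  tensorHB : ∀ X Y : Center C, HalfBraiding (D.redObj X Y)
  tensorHB_inv : ∀ X Y A, ((tensorHB X Y).β A).inv =
    A ◁ D.redι X Y ≫ D.redHb X Y A ≫ D.redπ X Y ▷ A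
  dualHB : ∀ X : Center C, HalfBraiding ((X.1)ᘁ : C)
  dualHB_inv : ∀ X A, ((dualHB X).β A).inv = IrrData.dualHb X A

namespace ReducedObjects
variable {D : IrrData k C} (R : ReducedObjects D)

/-- The induced object `I(A)` of the center. -/
def ind (A : C) : Center C := ⟨D.IObj A, R.indHB A⟩

/-- The reduced tensor product of objects of the center. -/
def tens (X Y : Center C) : Center C := ⟨D.redObj X Y, R.tensorHB X Y⟩

/-- The dual for the reduced tensor product. -/
def dual (X : Center C) : Center C := ⟨(X.1)ᘁ, R.dualHB X⟩

/-- The unit for the reduced tensor product. -/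
def unit : Center C := R.ind (𝟙_ C)

end ReducedObjects

/-- The monoidal structure of the reduced tensor product, with its duals. -/
structure ReducedMonoidal (D : IrrData k C) extends ReducedObjects D where
  tensorMap : ∀ {X X' Y Y' : Center C}, (X ⟶ X') → (Y ⟶ Y') →
    (toReducedObjects.tens X Y ⟶ toReducedObjects.tens X' Y')
  tensorMap_f : ∀ {X X' Y Y' : Center C} (f : X ⟶ X') (g : Y ⟶ Y'),
    (tensorMap f g).f = D.redι X Y ≫ (f.f ⊗ₘ g.f) ≫ D.redπ X' Y'
  assoc : ∀ X Y Z : Center C,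
    toReducedObjects.tens (toReducedObjects.tens X Y) Z ≅
      toReducedObjects.tens X (toReducedObjects.tens Y Z)
  assoc_hom_f : ∀ X Y Z, (assoc X Y Z).hom.f =
    D.redι (toReducedObjects.tens X Y) Z ≫ D.redι X Y ▷ Z.1 ≫ (α_ X.1 Y.1 Z.1).hom ≫
      X.1 ◁ D.redπ Y Z ≫ D.redπ X (toReducedObjects.tens Y Z)
  leftUnit : ∀ X : Center C, toReducedObjects.tens toReducedObjects.unit X ≅ X
  leftUnit_hom_f : ∀ X, (leftUnit X).hom.f = D.redι toReducedObjects.unit X ≫ D.leftUnitRaw X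
  rightUnit : ∀ X : Center C, toReducedObjects.tens X toReducedObjects.unit ≅ X
  rightUnit_hom_f : ∀ X, (rightUnit X).hom.f = D.redι X toReducedObjects.unit ≫ D.rightUnitRaw X
  tensorMap_id : ∀ X Y : Center C, tensorMap (𝟙 X) (𝟙 Y) = 𝟙 _
  tensorMap_comp : ∀ {X X' X'' Y Y' Y'' : Center C} (f : X ⟶ X') (f' : X' ⟶ X'') (g : Y ⟶ Y')
    (g' : Y' ⟶ Y''), tensorMap (f ≫ f') (g ≫ g') = tensorMap f g ≫ tensorMap f' g'
  assoc_naturality : ∀ {X X' Y Y' Z Z' : Center C} (f : X ⟶ X') (g : Y ⟶ Y') (h : Z ⟶ Z'),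
    tensorMap (tensorMap f g) h ≫ (assoc X' Y' Z').hom =
      (assoc X Y Z).hom ≫ tensorMap f (tensorMap g h)
  leftUnit_naturality : ∀ {X Y : Center C} (f : X ⟶ Y),
    tensorMap (𝟙 toReducedObjects.unit) f ≫ (leftUnit Y).hom = (leftUnit X).hom ≫ f
  rightUnit_naturality : ∀ {X Y : Center C} (f : X ⟶ Y),
    tensorMap f (𝟙 toReducedObjects.unit) ≫ (rightUnit Y).hom = (rightUnit X).hom ≫ f
  pentagon : ∀ W X Y Z : Center C,
    tensorMap (assoc W X Y).hom (𝟙 Z) ≫ (assoc W (toReducedObjects.tens X Y) Z).hom ≫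
        tensorMap (𝟙 W) (assoc X Y Z).hom =
      (assoc (toReducedObjects.tens W X) Y Z).hom ≫ (assoc W X (toReducedObjects.tens Y Z)).hom
  triangle : ∀ X Y : Center C,
    (assoc X toReducedObjects.unit Y).hom ≫ tensorMap (𝟙 X) (leftUnit Y).hom =
      tensorMap (rightUnit X).hom (𝟙 Y)

namespace ReducedMonoidal
variable {D : IrrData k C} (R : ReducedMonoidal D)

/-- The category `Z(C)`, to be equipped with the reduced tensor product. -/
def Cat (_ : ReducedMonoidal D) : Type (max u v) := Center C

instance : Category.{v} R.Cat := inferInstanceAs (Category (Center C))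
instance : Preadditive R.Cat := inferInstanceAs (Preadditive (Center C))
instance : Linear k R.Cat := inferInstanceAs (Linear k (Center C))

instance : MonoidalCategoryStruct R.Cat where
  tensorObj X Y := R.tens X Y
  tensorHom f g := R.tensorMap f g
  whiskerLeft X _ _ f := R.tensorMap (𝟙 X) f
  whiskerRight f Y := R.tensorMap f (𝟙 Y)
  tensorUnit := R.unit
  associator X Y Z := R.assoc X Y Z
  leftUnitor X := R.leftUnit X
  rightUnitor X := R.rightUnit X

/-- The reduced tensor product. -/
instance : MonoidalCategory R.Cat :=
  MonoidalCategory.ofTensorHom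
    (id_tensorHom_id := R.tensorMap_id)
    (id_tensorHom := fun _ _ _ _ => rfl)
    (tensorHom_id := fun _ _ => rfl)
    (tensorHom_comp_tensorHom := fun f₁ f₂ g₁ g₂ => (R.tensorMap_comp f₁ g₁ f₂ g₂).symm)
    (associator_naturality := R.assoc_naturality)
    (leftUnitor_naturality := R.leftUnit_naturality)
    (rightUnitor_naturality := R.rightUnit_naturality)
    (pentagon := R.pentagon)
    (triangle := R.triangle)

end ReducedMonoidal

/-- The rigid monoidal category of the reduced tensor product. -/
structure ReducedRigid (D : IrrData k C) extends ReducedMonoidal D where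
  pairing : ∀ X : toReducedMonoidal.Cat,
    @ExactPairing toReducedMonoidal.Cat _ _ X (toReducedMonoidal.dual X)
  coev_f : ∀ X : Center C, Center.Hom.f (X := toReducedMonoidal.unit)
    (Y := toReducedMonoidal.tens X (toReducedMonoidal.dual X)) (pairing X).coevaluation' =
      D.coevRaw X ≫ D.redπ X (toReducedMonoidal.dual X)
  ev_f : ∀ X : Center C, Center.Hom.f (Y := toReducedMonoidal.unit)
    (X := toReducedMonoidal.tens (toReducedMonoidal.dual X) X) (pairing X).evaluation' =
      D.redι (toReducedMonoidal.dual X) X ≫ D.evRaw X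

namespace ReducedRigid
variable {D : IrrData k C} (R : ReducedRigid D)

instance (X : R.Cat) : HasRightDual X where
  rightDual := R.dual X
  exact := R.pairing X

instance : RightRigidCategory R.Cat where

end ReducedRigid
end reduced
section trace
variable {k : Type w} [Field k] [IsAlgClosed k] {C : Type u} [Category.{v} C] [Abelian C]
    [Linear k C] [MonoidalCategory C] [MonoidalPreadditive C] [MonoidalLinear k C]
    [BraidedCategory C] [RightRigidCategory C] [PremodularCategory k C]

/-- The functor `G` from the horizontal trace of `C` to the center: it sends `X` to the induced
object `I(X)`, and the class of `ψ : A ⊗ X ⟶ X' ⊗ A` to `traceRaw A ψ`. -/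
structure TraceFunctor {D : IrrData k C} (R : ReducedRigid D) where
  map : ∀ {X Y : HTr k C}, (X ⟶ Y) →ₗ[k] (R.ind X.obj ⟶ R.ind Y.obj)
  map_rep : ∀ {X Y : C} (A : C) (ψ : A ⊗ X ⟶ Y ⊗ A),
    (map (HTr.rep k A ψ)).f = D.traceRaw A ψ
  map_id : ∀ X : HTr k C, map (𝟙 X) = 𝟙 _
  map_comp : ∀ {X Y Z : HTr k C} (f : X ⟶ Y) (g : Y ⟶ Z), map (f ≫ g) = map f ≫ map g

namespace TraceFunctor
variable {D : IrrData k C} {R : ReducedRigid D} (G : TraceFunctor R)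

/-- `G` as a functor. -/
def functor : HTr k C ⥤ R.Cat where
  obj X := R.ind X.obj
  map f := G.map f
  map_id := G.map_id
  map_comp := G.map_comp

/-- The tensor structure of a monoidal structure on `G` is the one induced by `J`. -/
def HasTensorStructure [G.functor.Monoidal] : Prop :=
  ∀ X Y : C, Center.Hom.f (X := R.tens (R.ind X) (R.ind Y)) (Y := R.ind (X ⊗ Y))
    (Functor.LaxMonoidal.μ G.functor (⟨X⟩ : HTr k C) ⟨Y⟩) =
      D.redι (R.ind X) (R.ind Y) ≫ D.JRaw X Y

end TraceFunctor

/-- The pivotal structure of the reduced tensor category is that of `C`. -/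
def ReducedRigid.IsInducedPivotal {D : IrrData k C} (R : ReducedRigid D)
    (P : PivotalStructure R.Cat) : Prop :=
  ∀ X : Center C, Center.Hom.f (X := X) (Y := R.dual (R.dual X)) (P.iso X).hom =
    ((PremodularCategory.piv k).iso X.1).hom

/-- The pivotal structure of the horizontal trace is that of `C`. -/
def HTr.IsInducedPivotal (T : PivotalStructure (HTr k C)) : Prop :=
  ∀ X : C, (T.iso ⟨X⟩).hom = (HTr.htr k C).map ((PremodularCategory.piv k).iso X).hom

end trace

/-- The pivotal structure of the Karoubi envelope extending that of `D`. -/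
def Idempotents.Karoubi.IsInducedPivotal {D : Type u₁} [Category.{v₁} D] [MonoidalCategory D]
    [RightRigidCategory D] (T : PivotalStructure D)
    (P : PivotalStructure (Idempotents.Karoubi D)) : Prop :=
  ∀ X : Idempotents.Karoubi D, (P.iso X).hom.f = X.p ≫ (T.iso X.X).hom

end CategoryTheory

end

-- Write `D` for the total dimension. An object `(X, γ)` of the center gives an endomorphism of `X`
-- in the horizontal trace, `e_X = D⁻¹ ∑ d_i [γ_{X_i}]`: the strand `X` encircled by the regular
-- colour (`encircle`). The theorem holds because `(X, γ) ↦ (X, e_X)` is an equivalence `toKar` from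
-- the center to the Karoubi envelope of the horizontal trace, under which the formulas for the
-- reduced tensor product become the ordinary structure of the Karoubi envelope. The functor `K` of
-- the statement is its inverse.
--
-- Full faithfulness rests on absorption, `rep_comp_encircle`: a class with label `Bᘁ` followed by
-- `e_Y` equals a morphism of `C`, its closure along `B`, followed by `e_Y`. Applied to the
-- half-braiding itself this gives idempotency of `e_Y` (`encircle_idem`), and duality gives
-- absorption on the other side (`exists_encircle_comp`). Conversely the components of a class at
-- the simple labels are well defined on the coend, so an equation `f e_Y = e_X f'` between
-- morphisms of `C` forces `f = f'` and makes `f` central (`central_of_eq`). Division by `D` is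
-- legitimate in characteristic zero (`tot_ne_zero`).
--
-- Essential surjectivity comes from the cups and caps `toInd` and `fromInd` between `A` and `I(A)`:
-- one composite is `D` times the identity, the other `D` times the idempotent of `I(A)`
-- (`toInd_fromInd`, `fromInd_toInd`). Hence `A` and `toKar (I(A))` are isomorphic; and idempotents
-- of the center split.
--
-- For the tensor product, whiskering `e_X` by `Y` gives the idempotent of `X ⊗ Y` with the
-- half-braiding that uses only `γ` and the crossing with `Y` (`encircle_twist`). Absorbing the loop
-- around `Y` into the loop around `X` expresses `e_X ⊗ e_Y` as `Q` followed by that idempotent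
-- (`wl_encircle_comp`). So `Q` is a central idempotent, and its image corresponds to the tensor
-- product of formal images. The unit constraints, associativity, evaluation and coevaluation are
-- verified by exhibiting the given formulas as representatives of the structure morphisms of the
-- Karoubi envelope (`Represents`, `f_eq_of_represents`). Coherence and duality are pulled back
-- along a fully faithful functor instead of being checked on diagrams.
--
-- The maps `toInd` are natural and, up to the scalar `D`, multiplicative (`toInd_traceRaw`,
-- `toInd_JRaw`). Thus `G` followed by `toKar` is the inclusion of the horizontal trace in its
-- Karoubi envelope, with `J` corresponding to the identity of `X ⊗ Y`; the formal lemma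
-- `exists_monoidal_factorization` does the rest.
--
-- The pivotal structure of the horizontal trace is natural because every class is built from
-- morphisms of `C` and the classes of identities of `A ⊗ A` (`cls_eq_loop`), and for the latter one
-- only slides isomorphisms around the loop (`PivotalNatural.rep_id`). It passes to the Karoubi
-- envelope through retracts and then to the center through `toKar`. Semisimplicity is obtained from
-- von Neumann regularity, which the center inherits from `C` by averaging a pseudoinverse with the
-- idempotents `e_X`.

universe v₃ u₃

noncomputable section

namespace CategoryTheory

/-! ### Duals in rigid categories -/

section

section rigid
variable {C : Type u₁} [Category.{v₁} C] [MonoidalCategory C]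

/-- A morphism into a right dual is determined by its pairing with the evaluation. -/
theorem rightDual_hom_ext {X Y Z : C} [ExactPairing X Y] {f g : Z ⟶ Y}
    (h : f ▷ X ≫ ε_ X Y = g ▷ X ≫ ε_ X Y) : f = g := by
  have key : ∀ f : Z ⟶ Y,
      f = 𝟙 _ ⊗≫ Z ◁ η_ X Y ⊗≫ (f ▷ X ≫ ε_ X Y) ▷ Y ⊗≫ 𝟙 _ := by
    intro f
    symm
    calc _ = 𝟙 _ ⊗≫ (Z ◁ η_ X Y ≫ f ▷ (X ⊗ Y)) ⊗≫ ε_ X Y ▷ Y ⊗≫ 𝟙 _ := by monoidal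
      _ = f ⊗≫ (Y ◁ η_ X Y ≫ (α_ _ _ _).inv ≫ ε_ X Y ▷ Y) ⊗≫ 𝟙 _ := by
        rw [whisker_exchange]; monoidal
      _ = f := by rw [ExactPairing.coevaluation_evaluation]; monoidal
  rw [key f, key g, h]

/-- The transpose of a pairing with `X`, and its defining property. -/
theorem transpose_comp_ev {X Y Z : C} [ExactPairing X Y] (m : Z ⊗ X ⟶ 𝟙_ C) :
    (𝟙 _ ⊗≫ Z ◁ η_ X Y ⊗≫ m ▷ Y ⊗≫ 𝟙 _ : Z ⟶ Y) ▷ X ≫ ε_ X Y = m := by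
  have h : η_ X Y ▷ X ⊗≫ X ◁ ε_ X Y = (λ_ _).hom ≫ (ρ_ _).inv := by
    rw [← ExactPairing.evaluation_coevaluation X Y]; monoidal
  calc _ = 𝟙 _ ⊗≫ Z ◁ η_ X Y ▷ X ⊗≫ (m ▷ (Y ⊗ X) ≫ 𝟙_ C ◁ ε_ X Y) ⊗≫ 𝟙 _ := by monoidal
    _ = 𝟙 _ ⊗≫ Z ◁ (η_ X Y ▷ X ⊗≫ X ◁ ε_ X Y) ⊗≫ m ⊗≫ 𝟙 _ := by
        rw [← whisker_exchange]; monoidal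
    _ = _ := by rw [h]; monoidal

/-- Uniqueness of duals: the transpose of the second evaluation is the inverse, since both
composites preserve an evaluation. -/
theorem isIso_of_comp_ev {X Y Y' : C} [ExactPairing X Y] [ExactPairing X Y'] (c : Y ⟶ Y')
    (h : c ▷ X ≫ ε_ X Y' = ε_ X Y) : IsIso c := by
  have h' := transpose_comp_ev (Y := Y) (ε_ X Y')
  set d : Y' ⟶ Y := 𝟙 _ ⊗≫ Y' ◁ η_ X Y ⊗≫ ε_ X Y' ▷ Y ⊗≫ 𝟙 _
  refine ⟨d, rightDual_hom_ext (X := X) ?_, rightDual_hom_ext (X := X) ?_⟩ <;> simp [h, h']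

/-- The evaluation of `Yᘁ ⊗ Xᘁ` on `X ⊗ Y`. -/
def evPair [RightRigidCategory C] (X Y : C) : ((Yᘁ : C) ⊗ Xᘁ) ⊗ (X ⊗ Y) ⟶ 𝟙_ C :=
  𝟙 _ ⊗≫ (Yᘁ : C) ◁ ε_ X (Xᘁ) ▷ Y ⊗≫ ε_ Y (Yᘁ)

/-- `dualTensor` is the transpose of `evPair`; with this, identities about it are checked on
pairings. -/
theorem dualTensor_comp_ev [RightRigidCategory C] (X Y : C) :
    dualTensor X Y ▷ (X ⊗ Y) ≫ ε_ (X ⊗ Y) ((X ⊗ Y)ᘁ) = evPair X Y := by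
  rw [← transpose_comp_ev (X := X ⊗ Y) (Y := ((X ⊗ Y)ᘁ)) (evPair X Y)]
  congr 2
  dsimp only [dualTensor, evPair]
  monoidal

theorem evPair_natural [RightRigidCategory C] {X X' Y Y' : C} (f : X ⟶ X') (g : Y ⟶ Y') :
    ((gᘁ) ⊗ₘ (fᘁ)) ▷ (X ⊗ Y) ≫ evPair X Y = (((Y')ᘁ : C) ⊗ X'ᘁ) ◁ (f ⊗ₘ g) ≫ evPair X' Y' := by
  rw [MonoidalCategory.tensorHom_def, MonoidalCategory.tensorHom_def]
  dsimp only [evPair]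
  calc _ = 𝟙 _ ⊗≫ (gᘁ) ▷ (X'ᘁ ⊗ X ⊗ Y) ⊗≫ (Yᘁ : C) ◁ ((fᘁ) ▷ X ≫ ε_ X (Xᘁ)) ▷ Y ⊗≫
        ε_ Y (Yᘁ) := by monoidal
    _ = 𝟙 _ ⊗≫ ((gᘁ) ▷ (X'ᘁ ⊗ X ⊗ Y) ≫ (Yᘁ : C) ◁ (X'ᘁ ◁ f ▷ Y ⊗≫ ε_ X' (X'ᘁ) ▷ Y)) ⊗≫
        ε_ Y (Yᘁ) := by rw [rightAdjointMate_comp_evaluation]; monoidal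
    _ = 𝟙 _ ⊗≫ (Y'ᘁ : C) ◁ (X'ᘁ ◁ f ▷ Y ⊗≫ ε_ X' (X'ᘁ) ▷ Y) ⊗≫ ((gᘁ) ▷ Y ≫ ε_ Y (Yᘁ)) := by
        rw [← whisker_exchange]; monoidal
    _ = 𝟙 _ ⊗≫ (Y'ᘁ : C) ◁ X'ᘁ ◁ f ▷ Y ⊗≫ (Y'ᘁ : C) ◁ (ε_ X' (X'ᘁ) ▷ Y ≫ 𝟙_ C ◁ g) ⊗≫
        ε_ Y' (Y'ᘁ) := by
        rw [rightAdjointMate_comp_evaluation]; monoidal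
    _ = _ := by rw [← whisker_exchange]; monoidal

theorem dualTensor_natural [RightRigidCategory C] {X X' Y Y' : C} (f : X ⟶ X') (g : Y ⟶ Y') :
    ((gᘁ) ⊗ₘ (fᘁ)) ≫ dualTensor X Y = dualTensor X' Y' ≫ ((f ⊗ₘ g)ᘁ) := by
  apply rightDual_hom_ext (X := X ⊗ Y) (Y := (X ⊗ Y)ᘁ)
  rw [comp_whiskerRight, Category.assoc, dualTensor_comp_ev, comp_whiskerRight, Category.assoc,
    rightAdjointMate_comp_evaluation, ← whisker_exchange_assoc, dualTensor_comp_ev, evPair_natural]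

theorem mate_comp_whiskerRight_ev [RightRigidCategory C] {X Y Z : C} (f : X ⟶ Y) (h : Z ⟶ Yᘁ) :
    (h ≫ (fᘁ)) ▷ X ≫ ε_ X (Xᘁ) = Z ◁ f ≫ h ▷ Y ≫ ε_ Y (Yᘁ) := by
  rw [comp_whiskerRight, Category.assoc, rightAdjointMate_comp_evaluation, ← whisker_exchange_assoc]

/-- A cup and a cap rotate the mate back to the morphism. Together with `mate_surjective` this makes
duality fully faithful, so that statements about precomposition can be deduced from statements about
postcomposition. -/
theorem mate_injective [RightRigidCategory C] {X Y : C} {f g : X ⟶ Y} (h : (fᘁ) = (gᘁ)) :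
    f = g := by
  have key : ∀ f : X ⟶ Y, f = 𝟙 _ ⊗≫ η_ Y (Yᘁ) ▷ X ⊗≫ Y ◁ ((fᘁ) ▷ X ≫ ε_ X (Xᘁ)) ⊗≫ 𝟙 _ := by
    intro f
    rw [rightAdjointMate_comp_evaluation]
    symm
    calc _ = 𝟙 _ ⊗≫ (η_ Y (Yᘁ) ▷ X ≫ (Y ⊗ Yᘁ) ◁ f) ⊗≫ Y ◁ ε_ Y (Yᘁ) ⊗≫ 𝟙 _ := by monoidal
      _ = f ⊗≫ (η_ Y (Yᘁ) ▷ Y ≫ (α_ _ _ _).hom ≫ Y ◁ ε_ Y (Yᘁ)) ⊗≫ 𝟙 _ := by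
        rw [← whisker_exchange]; monoidal
      _ = f := by rw [ExactPairing.evaluation_coevaluation]; monoidal
  rw [key f, key g, h]

theorem mate_surjective [RightRigidCategory C] {X Y : C} (f : (Yᘁ : C) ⟶ Xᘁ) :
    ∃ g : X ⟶ Y, (gᘁ) = f := by
  refine ⟨𝟙 _ ⊗≫ η_ Y (Yᘁ) ▷ X ⊗≫ Y ◁ (f ▷ X ≫ ε_ X (Xᘁ)) ⊗≫ 𝟙 _, ?_⟩
  apply rightDual_hom_ext (X := X) (Y := Xᘁ)
  rw [rightAdjointMate_comp_evaluation]
  calc _ = 𝟙 _ ⊗≫ (Yᘁ : C) ◁ η_ Y (Yᘁ) ▷ X ⊗≫ ((Yᘁ ⊗ Y) ◁ (f ▷ X ≫ ε_ X (Xᘁ)) ≫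
        ε_ Y (Yᘁ) ▷ 𝟙_ C) ⊗≫ 𝟙 _ := by monoidal
    _ = 𝟙 _ ⊗≫ ((Yᘁ : C) ◁ η_ Y (Yᘁ) ≫ (α_ _ _ _).inv ≫ ε_ Y (Yᘁ) ▷ Yᘁ) ▷ X ⊗≫
        (f ▷ X ≫ ε_ X (Xᘁ)) ⊗≫ 𝟙 _ := by
      rw [whisker_exchange]; monoidal
    _ = _ := by rw [ExactPairing.coevaluation_evaluation]; monoidal

instance [RightRigidCategory C] {X Y : C} (f : X ⟶ Y) [IsIso f] : IsIso (fᘁ) :=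
  ⟨(inv f)ᘁ, by rw [← comp_rightAdjointMate]; simp, by rw [← comp_rightAdjointMate]; simp⟩

variable (C) in
/-- A pivotal category has left duals. -/
theorem PivotalStructure.hasLeftDual [RightRigidCategory C] (P : PivotalStructure C) (X : C) :
    Nonempty (HasLeftDual X) :=
  ⟨{ leftDual := Xᘁ, exact := exactPairingCongrRight (P.iso X) }⟩

end rigid

/-! ### Duals under monoidal functors -/

section functors
open Functor.LaxMonoidal Functor.OplaxMonoidal
variable {C : Type u₁} [Category.{v₁} C] [MonoidalCategory C] [RightRigidCategory C]
  {D : Type u₂} [Category.{v₂} D] [MonoidalCategory D] [RightRigidCategory D]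
  {E : Type u₃} [Category.{v₃} E] [MonoidalCategory E] [RightRigidCategory E]

/-- The comparison is a transpose. This characterization by the pairing gives its naturality and its
behaviour under composition and monoidal isomorphism. -/
theorem dualComparison_comp_ev (F : C ⥤ D) [F.Monoidal] (X : C) :
    dualComparison F X ▷ F.obj X ≫ ε_ (F.obj X) ((F.obj X)ᘁ) =
      μ F (Xᘁ) X ≫ F.map (ε_ X (Xᘁ)) ≫ η F := by
  exact transpose_comp_ev (X := F.obj X) (Y := ((F.obj X)ᘁ)) _

theorem dualComparison_natural (F : C ⥤ D) [F.Monoidal] {X Y : C} (f : X ⟶ Y) :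
    F.map (fᘁ) ≫ dualComparison F X = dualComparison F Y ≫ ((F.map f)ᘁ) := by
  apply rightDual_hom_ext (X := F.obj X) (Y := (F.obj X)ᘁ)
  rw [mate_comp_whiskerRight_ev, comp_whiskerRight, Category.assoc, dualComparison_comp_ev,
    dualComparison_comp_ev, μ_natural_left_assoc, ← F.map_comp_assoc,
    rightAdjointMate_comp_evaluation, μ_natural_right_assoc, ← F.map_comp_assoc]

theorem dualComparison_eq_of_ev (F : C ⥤ D) [F.Monoidal] {X : C} (c : F.obj (Xᘁ) ⟶ (F.obj X)ᘁ)
    (h : c ▷ F.obj X ≫ ε_ (F.obj X) ((F.obj X)ᘁ) = μ F (Xᘁ) X ≫ F.map (ε_ X (Xᘁ)) ≫ η F) :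
    dualComparison F X = c :=
  rightDual_hom_ext (X := F.obj X) ((dualComparison_comp_ev F X).trans h.symm)

theorem dualComparison_comp (F : C ⥤ D) [F.Monoidal] (G : D ⥤ E) [G.Monoidal] (X : C) :
    dualComparison (F ⋙ G) X = G.map (dualComparison F X) ≫ dualComparison G (F.obj X) := by
  apply dualComparison_eq_of_ev
  rw [comp_whiskerRight, Category.assoc]
  erw [dualComparison_comp_ev G (F.obj X)]
  have h := μ_natural_left G (dualComparison F X) (F.obj X)
  change G.map (dualComparison F X) ▷ G.obj (F.obj X) ≫ _ = _
  rw [reassoc_of% h, ← G.map_comp_assoc, dualComparison_comp_ev]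
  simp

/-- Both sides have the same pairing with `F.obj X`, because a monoidal transformation respects the
images of the evaluation. -/
theorem dualComparison_iso {F G : C ⥤ D} [F.Monoidal] [G.Monoidal] (e : F ≅ G)
    [NatTrans.IsMonoidal e.hom] (X : C) :
    e.hom.app (Xᘁ) ≫ dualComparison G X ≫ ((e.hom.app X)ᘁ) = dualComparison F X := by
  symm
  apply dualComparison_eq_of_ev
  rw [← Category.assoc, mate_comp_whiskerRight_ev, comp_whiskerRight, Category.assoc,
    dualComparison_comp_ev, ← MonoidalCategory.tensorHom_def'_assoc]
  have h := NatTrans.IsMonoidal.tensor (τ := e.hom) (Xᘁ) X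
  rw [← reassoc_of% h, ← e.hom.naturality_assoc]
  congr 2
  have h2 := NatTrans.IsMonoidal.unit (τ := e.hom)
  -- Monoidality of `e` concerns `ε`, whereas the goal concerns its inverse `η`.
  rw [← cancel_epi (Functor.LaxMonoidal.ε F), reassoc_of% h2]
  simp

/-- The image of an exact pairing. -/
@[reducible]
def mapExactPairing (F : C ⥤ D) [F.Monoidal] (X : C) : ExactPairing (F.obj X) (F.obj (Xᘁ)) where
  coevaluation' := ε F ≫ F.map (η_ X (Xᘁ)) ≫ δ F _ _
  evaluation' := μ F _ _ ≫ F.map (ε_ X (Xᘁ)) ≫ η F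
  coevaluation_evaluation' := by
    have := congrArg F.map (ExactPairing.coevaluation_evaluation X (Xᘁ))
    simp only [Functor.map_comp, Functor.Monoidal.map_whiskerLeft,
      Functor.Monoidal.map_whiskerRight, Functor.Monoidal.map_associator_inv,
      Functor.Monoidal.map_rightUnitor, Functor.Monoidal.map_leftUnitor_inv, Category.assoc,
      Functor.Monoidal.μ_δ_assoc, cancel_epi] at this
    simp only [← Category.assoc, cancel_mono] at this
    simp only [Category.assoc] at this
    simp only [MonoidalCategory.whiskerLeft_comp, comp_whiskerRight, Category.assoc]
    rw [← cancel_mono (ε F ▷ F.obj (Xᘁ))]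
    simp only [Category.assoc, ← comp_whiskerRight, Functor.Monoidal.η_ε, Category.comp_id]
    simp at this ⊢
    rw [this]
  evaluation_coevaluation' := by
    have := congrArg F.map (ExactPairing.evaluation_coevaluation X (Xᘁ))
    simp only [Functor.map_comp, Functor.Monoidal.map_whiskerLeft,
      Functor.Monoidal.map_whiskerRight, Functor.Monoidal.map_associator,
      Functor.Monoidal.map_rightUnitor_inv, Functor.Monoidal.map_leftUnitor, Category.assoc,
      Functor.Monoidal.μ_δ_assoc, cancel_epi] at this
    simp only [← Category.assoc, cancel_mono] at this
    simp only [Category.assoc] at this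
    simp only [MonoidalCategory.whiskerLeft_comp, comp_whiskerRight, Category.assoc]
    rw [← cancel_mono (F.obj X ◁ ε F)]
    simp at this ⊢
    rw [this]

/-- By `mapExactPairing`, `F (Xᘁ)` is a second dual of `F X`. -/
instance (F : C ⥤ D) [F.Monoidal] (X : C) : IsIso (dualComparison F X) := by
  let p := mapExactPairing F X
  exact isIso_of_comp_ev (X := F.obj X) _ (dualComparison_comp_ev F X)

end functors

end

/-! ### Pivotal functors -/

section

section functors
open Functor.LaxMonoidal Functor.OplaxMonoidal
variable {C : Type u₁} [Category.{v₁} C] [MonoidalCategory C] [RightRigidCategory C]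
  {D : Type u₂} [Category.{v₂} D] [MonoidalCategory D] [RightRigidCategory D]
  {E : Type u₃} [Category.{v₃} E] [MonoidalCategory E] [RightRigidCategory E]

theorem IsPivotalFunctor.comp {P : PivotalStructure C} {P' : PivotalStructure D}
    {P'' : PivotalStructure E} {F : C ⥤ D} [F.Monoidal] {G : D ⥤ E} [G.Monoidal]
    (hF : IsPivotalFunctor P P' F) (hG : IsPivotalFunctor P' P'' G) :
    IsPivotalFunctor P P'' (F ⋙ G) := by
  intro X
  rw [dualComparison_comp, dualComparison_comp]
  change G.map (F.map (P.iso X).hom) ≫ G.map _ ≫ _ = (P''.iso (G.obj (F.obj X))).hom ≫ _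
  rw [← G.map_comp_assoc, hF X, G.map_comp_assoc, dualComparison_natural, reassoc_of% (hG (F.obj X)),
    ← comp_rightAdjointMate]

/-- Used for the inverse `F` of a pivotal equivalence `G`, where the composite is isomorphic to the
identity. -/
theorem IsPivotalFunctor.of_comp {P : PivotalStructure C} {P' : PivotalStructure D}
    {P'' : PivotalStructure E} {F : C ⥤ D} [F.Monoidal] {G : D ⥤ E} [G.Monoidal] [G.Faithful]
    (hG : IsPivotalFunctor P' P'' G) (h : IsPivotalFunctor P P'' (F ⋙ G)) :
    IsPivotalFunctor P P' F := by
  intro X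
  apply G.map_injective
  rw [← cancel_mono (dualComparison G (F.obj (Xᘁ)))]
  have := h X
  rw [dualComparison_comp, dualComparison_comp] at this
  change G.map (F.map (P.iso X).hom) ≫ G.map _ ≫ _ = (P''.iso (G.obj (F.obj X))).hom ≫ _ at this
  rw [G.map_comp, G.map_comp, Category.assoc, Category.assoc, this, dualComparison_natural,
    reassoc_of% (hG (F.obj X)), ← comp_rightAdjointMate]

theorem IsPivotalFunctor.of_iso {P : PivotalStructure C} {P' : PivotalStructure D}
    {F G : C ⥤ D} [F.Monoidal] [G.Monoidal] (e : F ≅ G) [NatTrans.IsMonoidal e.hom]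
    (hF : IsPivotalFunctor P P' F) : IsPivotalFunctor P P' G := by
  intro X
  have h := hF X
  rw [← dualComparison_iso e X, ← dualComparison_iso e (Xᘁ), comp_rightAdjointMate,
    comp_rightAdjointMate, e.hom.naturality_assoc] at h
  rw [← cancel_epi (e.hom.app X), ← cancel_mono ((e.hom.app (Xᘁ))ᘁ)]
  simp only [Category.assoc]
  rw [h, ← Category.assoc (P'.iso _).hom, ← Category.assoc (P'.iso _).hom, P'.naturality]
  simp

theorem isPivotalFunctor_id (P : PivotalStructure C) : IsPivotalFunctor P P (𝟭 C) := by
  have h (X : C) : dualComparison (𝟭 C) X = 𝟙 (Xᘁ) :=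
    dualComparison_eq_of_ev (𝟭 C) (X := X) (𝟙 (Xᘁ)) (by simp)
  intro X
  rw [h, h]
  simp

/-- Nested evaluations are compatible with a monoidal functor; taking transposes yields the
compatibility of `dualTensor` with `F` in `map_dualTensor`. -/
theorem map_evPair (F : C ⥤ D) [F.Monoidal] (X Y : C) :
    (μ F (Yᘁ) (Xᘁ) ⊗ₘ μ F X Y) ≫ μ F _ _ ≫ F.map (evPair X Y) ≫ η F =
      (dualComparison F Y ⊗ₘ dualComparison F X) ▷ (F.obj X ⊗ F.obj Y) ≫
        evPair (F.obj X) (F.obj Y) := by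
  have h : evPair X Y = (α_ _ _ _).hom ≫ (Yᘁ : C) ◁ ((α_ _ _ _).inv ≫ ε_ X (Xᘁ) ▷ Y ≫ (λ_ _).hom)
      ≫ ε_ Y (Yᘁ) := by dsimp only [evPair]; monoidal
  calc _ = 𝟙 _ ⊗≫ F.obj (Yᘁ) ◁ (μ F (Xᘁ) X ≫ F.map (ε_ X (Xᘁ)) ≫ η F) ▷ F.obj Y ⊗≫
        (μ F (Yᘁ) Y ≫ F.map (ε_ Y (Yᘁ)) ≫ η F) := by
        have h1 : F.obj (Xᘁ) ◁ μ F X Y ≫ μ F _ _ ≫ F.map ((α_ _ _ _).inv ≫ ε_ X (Xᘁ) ▷ Y ≫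
            (λ_ _).hom) = (α_ _ _ _).inv ≫ (μ F (Xᘁ) X ≫ F.map (ε_ X (Xᘁ)) ≫ η F) ▷ F.obj Y ≫
              (λ_ _).hom := by
          rw [F.map_comp, Functor.LaxMonoidal.associativity_inv_assoc, F.map_comp,
            ← μ_natural_left_assoc, Functor.LaxMonoidal.left_unitality]
          simp
        rw [h, F.map_comp, F.map_comp, MonoidalCategory.tensorHom_def'_assoc]
        simp only [Category.assoc]
        rw [Functor.LaxMonoidal.associativity_assoc, ← μ_natural_right_assoc,
          associator_naturality_right_assoc, ← whiskerLeft_comp_assoc, ← whiskerLeft_comp_assoc,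
          Category.assoc, h1]
        monoidal
    _ = 𝟙 _ ⊗≫ F.obj (Yᘁ) ◁ (dualComparison F X ▷ F.obj X ≫ ε_ (F.obj X) ((F.obj X)ᘁ)) ▷ F.obj Y
        ⊗≫ dualComparison F Y ▷ F.obj Y ≫ ε_ (F.obj Y) ((F.obj Y)ᘁ) := by
        rw [dualComparison_comp_ev, dualComparison_comp_ev]
    _ = 𝟙 _ ⊗≫ F.obj (Yᘁ) ◁ dualComparison F X ▷ (F.obj X ⊗ F.obj Y) ⊗≫
        (F.obj (Yᘁ) ◁ ε_ (F.obj X) ((F.obj X)ᘁ) ▷ F.obj Y ≫ dualComparison F Y ▷ (𝟙_ D ⊗ F.obj Y)) ⊗≫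
          ε_ (F.obj Y) ((F.obj Y)ᘁ) := by monoidal
    _ = 𝟙 _ ⊗≫ (F.obj (Yᘁ) ◁ dualComparison F X ≫ dualComparison F Y ▷ _) ▷ (F.obj X ⊗ F.obj Y) ⊗≫
        (F.obj Y)ᘁ ◁ ε_ (F.obj X) ((F.obj X)ᘁ) ▷ F.obj Y ⊗≫
          ε_ (F.obj Y) ((F.obj Y)ᘁ) := by
        rw [whisker_exchange]; monoidal
    _ = _ := by rw [← MonoidalCategory.tensorHom_def']; dsimp only [evPair]; monoidal

theorem map_dualTensor (F : C ⥤ D) [F.Monoidal] (X Y : C) :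
    μ F (Yᘁ) (Xᘁ) ≫ F.map (dualTensor X Y) ≫ dualComparison F (X ⊗ Y) ≫ ((μ F X Y)ᘁ) =
      (dualComparison F Y ⊗ₘ dualComparison F X) ≫ dualTensor (F.obj X) (F.obj Y) := by
  apply rightDual_hom_ext (X := F.obj X ⊗ F.obj Y) (Y := (F.obj X ⊗ F.obj Y)ᘁ)
  rw [comp_whiskerRight (_ ⊗ₘ _), Category.assoc, dualTensor_comp_ev, ← map_evPair,
    ← Category.assoc, ← Category.assoc, mate_comp_whiskerRight_ev, comp_whiskerRight,
    Category.assoc, dualComparison_comp_ev, comp_whiskerRight, Category.assoc,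
    μ_natural_left_assoc, ← F.map_comp_assoc, dualTensor_comp_ev,
    MonoidalCategory.tensorHom_def'_assoc]

/-- The monoidality of a pivotal isomorphism at `X` and `Y` is equivalent to that at the images of
`X` and `Y` under a faithful monoidal functor. -/
theorem pivotal_tensor_iff (F : C ⥤ D) [F.Monoidal] (P : ∀ X : C, X ⟶ ((Xᘁ : C)ᘁ : C))
    (P' : ∀ X : D, X ⟶ ((Xᘁ : D)ᘁ : D))
    (hP' : ∀ {X Y : D} (f : X ⟶ Y), P' X ≫ (fᘁᘁ) = f ≫ P' Y)
    (h : ∀ X, F.map (P X) ≫ dualComparison F (Xᘁ) = P' (F.obj X) ≫ ((dualComparison F X)ᘁ))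
    (X Y : C) :
    F.map (P (X ⊗ Y) ≫ ((dualTensor X Y)ᘁ)) = F.map ((P X ⊗ₘ P Y) ≫ dualTensor (Yᘁ) (Xᘁ)) ↔
      P' (F.obj X ⊗ F.obj Y) ≫ ((dualTensor (F.obj X) (F.obj Y))ᘁ) =
        (P' (F.obj X) ⊗ₘ P' (F.obj Y)) ≫ dualTensor ((F.obj Y)ᘁ) ((F.obj X)ᘁ) := by
  -- `h1` and `h2` carry the left and right sides of one equation to those of the other by
  -- composition with the same invertible morphisms.
  have h1 : μ F X Y ≫ F.map (P (X ⊗ Y) ≫ ((dualTensor X Y)ᘁ)) ≫ dualComparison F _ ≫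
      ((μ F (Yᘁ) (Xᘁ))ᘁ) = (P' (F.obj X ⊗ F.obj Y) ≫ ((dualTensor (F.obj X) (F.obj Y))ᘁ)) ≫
        ((dualComparison F Y ⊗ₘ dualComparison F X)ᘁ) := by
    rw [Category.assoc (P' _), ← comp_rightAdjointMate, ← map_dualTensor, comp_rightAdjointMate,
      comp_rightAdjointMate, comp_rightAdjointMate, ← Category.assoc (P' _),
      ← Category.assoc (P' _), ← Category.assoc (P' _)]
    simp only [Category.assoc]
    rw [reassoc_of% (hP' (μ F X Y)), ← reassoc_of% (h (X ⊗ Y)), F.map_comp, Category.assoc,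
      ← Category.assoc (F.map ((dualTensor X Y)ᘁ)), dualComparison_natural, Category.assoc]
  have h2 : μ F X Y ≫ F.map ((P X ⊗ₘ P Y) ≫ dualTensor (Yᘁ) (Xᘁ)) ≫ dualComparison F _ ≫
      ((μ F (Yᘁ) (Xᘁ))ᘁ) =
        ((P' (F.obj X) ⊗ₘ P' (F.obj Y)) ≫ dualTensor ((F.obj Y)ᘁ) ((F.obj X)ᘁ)) ≫
        ((dualComparison F Y ⊗ₘ dualComparison F X)ᘁ) := by
    rw [F.map_comp, Category.assoc, ← μ_natural_assoc, map_dualTensor, Category.assoc,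
      ← dualTensor_natural, tensorHom_comp_tensorHom_assoc, h, h, tensorHom_comp_tensorHom_assoc]
  have : IsIso ((dualComparison F Y ⊗ₘ dualComparison F X)ᘁ) := inferInstance
  have h3 : IsIso ((μ F (Yᘁ) (Xᘁ))ᘁ) := inferInstance
  rw [← cancel_mono ((dualComparison F Y ⊗ₘ dualComparison F X)ᘁ), ← h1, ← h2,
    cancel_epi, cancel_mono]

/-- The pivotal structure pulled back along a fully faithful monoidal functor. -/
def PivotalStructure.ofFullyFaithful (F : C ⥤ D) [F.Monoidal] [F.Full] [F.Faithful]
    (P' : PivotalStructure D) : PivotalStructure C where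
  iso X := F.preimageIso (P'.iso (F.obj X) ≪≫ asIso ((dualComparison F X)ᘁ) ≪≫
    (asIso (dualComparison F (Xᘁ))).symm)
  naturality f := F.map_injective (by
    rw [F.map_comp, F.map_comp]
    simp only [Functor.preimageIso_hom, Functor.map_preimage, Iso.trans_hom, asIso_hom,
      Iso.symm_hom, asIso_inv, Category.assoc]
    rw [← reassoc_of% (P'.naturality (F.map f)), ← comp_rightAdjointMate_assoc,
      ← dualComparison_natural, comp_rightAdjointMate_assoc]
    congr 2
    rw [IsIso.inv_comp_eq, ← Category.assoc, IsIso.eq_comp_inv, dualComparison_natural])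
  tensor X Y := F.map_injective (by
    refine (pivotal_tensor_iff F (fun X => (F.preimageIso (P'.iso (F.obj X) ≪≫
      asIso ((dualComparison F X)ᘁ) ≪≫ (asIso (dualComparison F (Xᘁ))).symm)).hom) (fun X => (P'.iso X).hom) P'.naturality ?_ X Y).2
      (P'.tensor _ _)
    intro X
    simp)

theorem PivotalStructure.isPivotalFunctor_ofFullyFaithful (F : C ⥤ D) [F.Monoidal] [F.Full]
    [F.Faithful] (P' : PivotalStructure D) :
    IsPivotalFunctor (PivotalStructure.ofFullyFaithful F P') P' F := by
  intro X
  simp [PivotalStructure.ofFullyFaithful]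

end functors

end

/-! ### The pivotal structure of the Karoubi envelope -/

section

namespace Idempotents.Karoubi
open Functor.LaxMonoidal Functor.OplaxMonoidal
variable {D : Type u₁} [Category.{v₁} D] [MonoidalCategory D] [RightRigidCategory D]

/-- The mate taken in `D` is a morphism of formal images, and it has the right pairing because `f`
absorbs the idempotents on both sides. -/
theorem mate_f {P Q : Karoubi D} (f : P ⟶ Q) : Hom.f (fᘁ) = ((f.f)ᘁ) := by
  let g : (Qᘁ : Karoubi D) ⟶ Pᘁ := ⟨(f.f)ᘁ, by
    change ((Q.p)ᘁ) ≫ ((f.f)ᘁ) ≫ ((P.p)ᘁ) = _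
    rw [← comp_rightAdjointMate, ← comp_rightAdjointMate, Category.assoc, f.comm]⟩
  have : (fᘁ) = g := by
    apply rightDual_hom_ext (X := P) (Y := Pᘁ)
    rw [rightAdjointMate_comp_evaluation]
    apply Karoubi.hom_ext
    change (((Q.p)ᘁ) ⊗ₘ f.f) ≫ (((Q.p)ᘁ) ⊗ₘ Q.p) ≫ ε_ Q.X ((Q.X)ᘁ) =
      (((f.f)ᘁ) ⊗ₘ P.p) ≫ (((P.p)ᘁ) ⊗ₘ P.p) ≫ ε_ P.X ((P.X)ᘁ)
    rw [tensorHom_comp_tensorHom_assoc, tensorHom_comp_tensorHom_assoc, mate_idem,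
      Karoubi.comp_p f, P.idem, ← comp_rightAdjointMate, Karoubi.p_comp f,
      MonoidalCategory.tensorHom_def'_assoc, MonoidalCategory.tensorHom_def_assoc,
      rightAdjointMate_comp_evaluation Q.p, ← whiskerLeft_comp_assoc, Karoubi.comp_p f,
      ← rightAdjointMate_comp_evaluation P.p, ← comp_whiskerRight_assoc, ← comp_rightAdjointMate,
      Karoubi.p_comp f, rightAdjointMate_comp_evaluation]
  rw [this]

variable (T : PivotalStructure D)

theorem pivotalIso_comm (P : Karoubi D) :
    P.p ≫ (T.iso P.X).hom = (T.iso P.X).hom ≫ ((Pᘁ : Karoubi D)ᘁ).p :=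
  (T.naturality P.p).symm

/-- The pivotal isomorphisms of the Karoubi envelope. -/
def pivotalIso (P : Karoubi D) : P ≅ ((Pᘁ : Karoubi D)ᘁ : Karoubi D) :=
  isoOfIso _ _ (T.iso P.X) (pivotalIso_comm T P)

theorem pivotalIso_natural {P Q : Karoubi D} (f : P ⟶ Q) :
    (pivotalIso T P).hom ≫ (fᘁᘁ) = f ≫ (pivotalIso T Q).hom := by
  apply Karoubi.hom_ext
  rw [comp_f, comp_f, mate_f, mate_f]
  change (P.p ≫ (T.iso P.X).hom) ≫ (((f.f)ᘁ)ᘁ) = f.f ≫ (Q.p ≫ (T.iso Q.X).hom)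
  rw [Category.assoc, T.naturality, Karoubi.p_comp_assoc f, Karoubi.comp_p_assoc f]

theorem dualComparison_toKaroubi_f (X : D) :
    (dualComparison (toKaroubi D) X).f = 𝟙 (Xᘁ) := by
  let c : (toKaroubi D).obj (Xᘁ) ⟶ ((toKaroubi D).obj X)ᘁ := ⟨𝟙 _, by
    change 𝟙 (Xᘁ) ≫ 𝟙 (Xᘁ) ≫ ((𝟙 X)ᘁ) = 𝟙 (Xᘁ)
    simp⟩
  have : dualComparison (toKaroubi D) X = c := by
    apply dualComparison_eq_of_ev
    apply Karoubi.hom_ext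
    change (𝟙 (Xᘁ) ⊗ₘ 𝟙 X) ≫ ((((𝟙 X)ᘁ) ⊗ₘ 𝟙 X) ≫ ε_ X (Xᘁ)) =
      ((𝟙 (Xᘁ) ⊗ₘ 𝟙 X) ≫ 𝟙 _) ≫ ε_ X (Xᘁ) ≫ 𝟙 _
    simp
  rw [this]
  rfl

theorem toKaroubi_dualComparison (X : D) :
    (toKaroubi D).map (T.iso X).hom ≫ dualComparison (toKaroubi D) (Xᘁ) =
      (pivotalIso T ((toKaroubi D).obj X)).hom ≫ ((dualComparison (toKaroubi D) X)ᘁ) := by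
  apply Karoubi.hom_ext
  rw [comp_f, comp_f, mate_f, dualComparison_toKaroubi_f, dualComparison_toKaroubi_f]
  change (T.iso X).hom ≫ 𝟙 _ = (𝟙 X ≫ (T.iso X).hom) ≫ ((𝟙 (Xᘁ))ᘁ)
  simp

/-- The pivotal structure of the Karoubi envelope. -/
def pivotalStructure : PivotalStructure (Karoubi D) where
  iso := pivotalIso T
  naturality := pivotalIso_natural T
  tensor P Q := by
    -- The axiom holds for the underlying objects `P.X` and `Q.X`. Since `P` and `Q` are retracts of
    -- these, naturality of both sides along the inclusions reduces the general case to this one.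
    have h := (pivotal_tensor_iff (toKaroubi D) (fun X => (T.iso X).hom)
      (fun P => (pivotalIso T P).hom) (pivotalIso_natural T) (toKaroubi_dualComparison T)
      P.X Q.X).1 (by rw [T.tensor])
    have hi (P : Karoubi D) : P.decompId_i ≫ P.decompId_p = 𝟙 P := P.decompId.symm
    have hm : Mono (((Q.decompId_iᘁ) ⊗ₘ (P.decompId_iᘁ))ᘁ) := by
      have h1 : (((Q.decompId_iᘁ) ⊗ₘ (P.decompId_iᘁ))ᘁ) ≫
          (((Q.decompId_pᘁ) ⊗ₘ (P.decompId_pᘁ))ᘁ) = 𝟙 _ := by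
        rw [← comp_rightAdjointMate, tensorHom_comp_tensorHom, ← comp_rightAdjointMate,
          ← comp_rightAdjointMate, hi, hi]
        simp
      exact (SplitMono.mk _ h1).mono
    rw [← cancel_mono (((Q.decompId_iᘁ) ⊗ₘ (P.decompId_iᘁ))ᘁ), Category.assoc,
      ← comp_rightAdjointMate, dualTensor_natural, comp_rightAdjointMate, Category.assoc,
      ← dualTensor_natural, tensorHom_comp_tensorHom_assoc, pivotalIso_natural, pivotalIso_natural,
      reassoc_of% (pivotalIso_natural T (P.decompId_i ⊗ₘ Q.decompId_i)),
      ← tensorHom_comp_tensorHom_assoc]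
    congr 1

theorem pivotalStructure_isInducedPivotal : IsInducedPivotal T (pivotalStructure T) :=
  fun _ => rfl

theorem isPivotalFunctor_toKaroubi :
    IsPivotalFunctor T (pivotalStructure T) (toKaroubi D) := toKaroubi_dualComparison T

end Idempotents.Karoubi

end

/-! ### Von Neumann regular categories -/

section

section semisimple
variable {k : Type w} [Field k] {D : Type u₁} [Category.{v₁} D] [Preadditive D] [Linear k D]

/-- Von Neumann regularity of a category. -/
def IsRegularCat (D : Type u₁) [Category.{v₁} D] : Prop :=
  ∀ {X Y : D} (f : X ⟶ Y), ∃ g : Y ⟶ X, f ≫ g ≫ f = f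

namespace IsRegularCat
variable [IsIdempotentComplete D] (hD : IsRegularCat D)
include hD

/-- If `f ≫ g ≫ f = f`, the idempotent `𝟙 - f ≫ g` is killed by `f`, and every morphism killed by
`f` is fixed by it; so its image is a kernel. -/
theorem hasKernels : HasKernels D := ⟨fun {X Y} f => by
  obtain ⟨g, hg⟩ := hD f
  obtain ⟨K, i, e, h1, h2⟩ := IsIdempotentComplete.idempotents_split X (𝟙 X - f ≫ g) (by
    simp [reassoc_of% hg])
  have h3 : i ≫ f = 0 := by
    have : i ≫ (e ≫ i) ≫ f = i ≫ f := by simp [reassoc_of% h1]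
    rw [← this, h2]
    simp [hg]
  exact ⟨⟨⟨_, KernelFork.IsLimit.ofι i h3 (fun g' _ => g' ≫ e)
    (fun g' h => by rw [Category.assoc, h2]; simp [reassoc_of% h])
    (fun g' _ m hm => by rw [← hm, Category.assoc, h1, Category.comp_id])⟩⟩⟩⟩

theorem hasCokernels : HasCokernels D := ⟨fun {X Y} f => by
  obtain ⟨g, hg⟩ := hD f
  obtain ⟨K, i, e, h1, h2⟩ := IsIdempotentComplete.idempotents_split Y (𝟙 Y - g ≫ f) (by
    simp [hg])
  have h3 : f ≫ e = 0 := by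
    have : f ≫ (e ≫ i) ≫ e = f ≫ e := by simp [h1]
    rw [← this, h2]
    simp [reassoc_of% hg]
  exact ⟨⟨⟨_, CokernelCofork.IsColimit.ofπ e h3 (fun g' _ => i ≫ g')
    (fun g' h => by rw [← Category.assoc, h2]; simp [h])
    (fun g' _ m hm => by rw [← hm, reassoc_of% h1])⟩⟩⟩⟩

omit [IsIdempotentComplete D] in
theorem exists_retraction {X Y : D} (f : X ⟶ Y) [Mono f] : ∃ g : Y ⟶ X, f ≫ g = 𝟙 X := by
  obtain ⟨g, hg⟩ := hD f
  exact ⟨g, by rw [← cancel_mono f]; simpa using hg⟩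

-- A split monomorphism is the kernel of the complementary idempotent.
omit [IsIdempotentComplete D] in
theorem isNormalMonoCategory : IsNormalMonoCategory D := ⟨fun {X Y} f _ => by
  obtain ⟨g, hg⟩ := hD.exists_retraction f
  exact ⟨⟨Y, 𝟙 Y - g ≫ f, by simp [reassoc_of% hg],
    KernelFork.IsLimit.ofι f _ (fun g' _ => g' ≫ g)
      (fun g' h => by
        rw [Preadditive.comp_sub, sub_eq_zero, Category.comp_id] at h
        rw [Category.assoc, ← h])
      (fun g' _ m hm => by rw [← hm, Category.assoc, hg, Category.comp_id])⟩⟩⟩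

omit [IsIdempotentComplete D] in
theorem isNormalEpiCategory : IsNormalEpiCategory D := ⟨fun {X Y} f _ => by
  obtain ⟨g, hg⟩ := hD f
  have hg : g ≫ f = 𝟙 Y := by rw [← cancel_epi f]; simpa using hg
  exact ⟨⟨X, 𝟙 X - f ≫ g, by simp [hg],
    CokernelCofork.IsColimit.ofπ f _ (fun g' _ => g ≫ g')
      (fun g' h => by
        rw [Preadditive.sub_comp, sub_eq_zero, Category.id_comp, Category.assoc] at h
        exact h.symm)
      (fun g' _ m hm => by rw [← hm, reassoc_of% hg])⟩⟩⟩

-- The endomorphisms of a retract embed in those of the object, and the image contains the identity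
-- only if the retract is the whole object. This is the measure that decreases in the decomposition
-- into simples.
omit hD [IsIdempotentComplete D] in
theorem finrank_end_lt [∀ X Y : D, FiniteDimensional k (X ⟶ Y)] {X Y : D} (f : Y ⟶ X) (g : X ⟶ Y)
    (h : f ≫ g = 𝟙 Y) (h' : g ≫ f ≠ 𝟙 X) :
    Module.finrank k (Y ⟶ Y) < Module.finrank k (X ⟶ X) := by
  let L : (Y ⟶ Y) →ₗ[k] (X ⟶ X) :=
    { toFun := fun x => g ≫ x ≫ f
      map_add' := by simp
      map_smul' := by simp }
  have hL : Function.Injective L := by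
    intro x y hxy
    have := congrArg (fun z => f ≫ z ≫ g) hxy
    simpa [L, h, reassoc_of% h] using this
  rw [← LinearMap.finrank_range_of_inj hL]
  apply Submodule.finrank_lt
  intro htop
  have : 𝟙 X ∈ LinearMap.range L := by rw [htop]; trivial
  obtain ⟨x, hx⟩ := this
  have h2 : f ≫ (g ≫ x ≫ f) ≫ g = x := by simp [h, reassoc_of% h]
  change g ≫ x ≫ f = 𝟙 X at hx
  rw [hx] at h2
  simp only [Category.id_comp, h] at h2
  rw [← h2] at hx
  simp only [Category.id_comp] at hx
  exact h' hx

/-- A decomposition of an object as a finite direct sum of simple objects. -/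
structure SimpleDecomposition (X : D) where
  J : Type
  fintype : Fintype J
  S : J → D
  simple : ∀ j, Simple (S j)
  ι : ∀ j, S j ⟶ X
  π : ∀ j, X ⟶ S j
  ι_π : ∀ j, ι j ≫ π j = 𝟙 _
  ι_π_ne : ∀ i j, i ≠ j → ι i ≫ π j = 0
  total : ∑ j, π j ≫ ι j = 𝟙 X

attribute [instance] SimpleDecomposition.fintype

/-- Induction on the dimension of the endomorphism algebra: if `X` is neither zero nor simple,
regularity splits off a proper nonzero subobject, and both it and its complement have smaller
endomorphism algebras. -/
theorem exists_simpleDecomposition [∀ X Y : D, FiniteDimensional k (X ⟶ Y)] (X : D) :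
    Nonempty (SimpleDecomposition X) := by
  induction hn : Module.finrank k (X ⟶ X) using Nat.strong_induction_on generalizing X with
  | _ n ih =>
  by_cases h0 : 𝟙 X = 0
  · exact ⟨{ J := Empty, fintype := inferInstance, S := Empty.elim, simple := fun j => j.elim,
             ι := fun j => j.elim, π := fun j => j.elim, ι_π := fun j => j.elim,
             ι_π_ne := fun j => j.elim, total := by simp [h0] }⟩
  by_cases hs : Simple X
  · exact ⟨{ J := Unit, fintype := inferInstance, S := fun _ => X, simple := fun _ => hs,
             ι := fun _ => 𝟙 X, π := fun _ => 𝟙 X, ι_π := fun _ => by simp,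
             ι_π_ne := fun i j h => absurd rfl h, total := by simp }⟩
  obtain ⟨Y, f, hf, hf0, hfi⟩ : ∃ (Y : D) (f : Y ⟶ X), Mono f ∧ f ≠ 0 ∧ ¬ IsIso f := by
    by_contra! hcon
    refine hs ⟨fun {Y} f _ => ⟨fun hi h => h0 ?_, fun h => hcon Y f inferInstance h⟩⟩
    rw [← cancel_epi f, h]
    simp
  obtain ⟨g, hg⟩ := hD.exists_retraction f
  have hne : g ≫ f ≠ 𝟙 X := fun h => hfi ⟨g, hg, h⟩
  obtain ⟨K, i, e, h1, h2⟩ := IsIdempotentComplete.idempotents_split X (𝟙 X - g ≫ f) (by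
    simp [reassoc_of% hg])
  have hne' : e ≫ i ≠ 𝟙 X := fun h => hf0 (by
    have h3 : g ≫ f = 0 := by rw [h] at h2; simpa using (sub_eq_self.1 h2.symm)
    rw [← Category.id_comp f, ← hg, Category.assoc, h3, comp_zero])
  have hfe : f ≫ e = 0 := by
    have : f ≫ (e ≫ i) ≫ e = f ≫ e := by simp [h1]
    rw [← this, h2]; simp [reassoc_of% hg]
  have hig : i ≫ g = 0 := by
    have : i ≫ (e ≫ i) ≫ g = i ≫ g := by simp [reassoc_of% h1]
    rw [← this, h2]; simp [hg]
  obtain ⟨A⟩ := ih _ (by rw [← hn]; exact finrank_end_lt f g hg hne) Y rfl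
  obtain ⟨B⟩ := ih _ (by rw [← hn]; exact finrank_end_lt i e h1 hne') K rfl
  refine ⟨{ J := A.J ⊕ B.J, fintype := inferInstance, S := Sum.elim A.S B.S,
            simple := ?_
            ι := Sum.rec (fun a => A.ι a ≫ f) (fun b => B.ι b ≫ i)
            π := Sum.rec (fun a => g ≫ A.π a) (fun b => e ≫ B.π b)
            ι_π := ?_, ι_π_ne := ?_, total := ?_ }⟩
  · rintro (a | b)
    exacts [A.simple a, B.simple b]
  · rintro (a | b)
    · simp [reassoc_of% hg, A.ι_π]
    · simp [reassoc_of% h1, B.ι_π]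
  · rintro (a | b) (a' | b') h
    · simp [reassoc_of% hg, A.ι_π_ne a a' (by simpa using h)]; rfl
    · simp [reassoc_of% hfe]; rfl
    · simp [reassoc_of% hig]; rfl
    · simp [reassoc_of% h1, B.ι_π_ne b b' (by simpa using h)]; rfl
  · have hA : ∑ a, (g ≫ A.π a) ≫ A.ι a ≫ f = g ≫ f := by
      conv_rhs => rw [← Category.id_comp f, ← A.total]
      simp [Preadditive.sum_comp, Preadditive.comp_sum]
    have hB : ∑ b, (e ≫ B.π b) ≫ B.ι b ≫ i = e ≫ i := by
      conv_rhs => rw [← Category.id_comp i, ← B.total]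
      simp [Preadditive.sum_comp, Preadditive.comp_sum]
    rw [Fintype.sum_sum_type]
    erw [hA, hB]
    rw [h2]
    simp

/-- A regular, idempotent complete, finite additive category is semisimple. -/
theorem isFiniteSemisimple [HasFiniteProducts D]
    (hfd : ∀ X Y : D, FiniteDimensional k (X ⟶ Y)) {J : Type} [Fintype J] (S : J → D)
    (hS : ∀ Y : D, 𝟙 Y ≠ 0 → ∃ (j : J) (f : S j ⟶ Y), f ≠ 0) : IsFiniteSemisimple k D where
  hasFiniteProducts := inferInstance
  hasKernels := hD.hasKernels
  hasCokernels := hD.hasCokernels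
  normalMono := hD.isNormalMonoCategory
  normalEpi := hD.isNormalEpiCategory
  finiteDimensional := hfd
  semisimple X := by
    obtain ⟨A⟩ := hD.exists_simpleDecomposition (k := k) X
    let e := (Fintype.equivFin A.J).symm
    let b : Limits.Bicone (fun i => A.S (e i)) :=
      { pt := X, ι := fun i => A.ι (e i), π := fun i => A.π (e i)
        ι_π := fun i j => by
          split_ifs with h
          · subst h; simpa using A.ι_π (e i)
          · exact A.ι_π_ne _ _ (fun h' => h (e.injective h')) }
    refine ⟨_, _, b, fun i => A.simple _, ⟨isBilimitOfTotal b ?_⟩, ⟨Iso.refl _⟩⟩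
    rw [← A.total]
    exact e.sum_comp (fun j => A.π j ≫ A.ι j)
  finiteSimples := by
    -- A simple object receives a nonzero morphism from some `S j`, hence from one of its simple
    -- summands, and is isomorphic to it. So the summands of all the `S j` exhaust the simple
    -- objects.
    let A := fun j => (hD.exists_simpleDecomposition (k := k) (S j)).some
    let e := (Fintype.equivFin (Σ j, (A j).J)).symm
    refine ⟨_, fun i => (A (e i).1).S (e i).2, fun Y hY => ?_⟩
    obtain ⟨j, f, hf⟩ := hS Y (fun h => by
      have := (Simple.mono_isIso_iff_nonzero (𝟙 Y)).1 inferInstance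
      exact this h)
    obtain ⟨a, ha⟩ : ∃ a, (A j).ι a ≫ f ≠ 0 := by
      by_contra! h
      apply hf
      rw [← Category.id_comp f, ← (A j).total, Preadditive.sum_comp]
      simp [h]
    have := (A j).simple a
    have := hD.hasKernels
    have := isIso_of_hom_simple ha
    obtain ⟨i, hi⟩ := e.surjective ⟨j, a⟩
    exact ⟨i, ⟨(asIso ((A j).ι a ≫ f)).symm ≪≫ eqToIso (by dsimp only; rw [hi])⟩⟩

omit [IsIdempotentComplete D] in
theorem of_equivalence {E : Type u₂} [Category.{v₂} E] (F : D ⥤ E) [F.Full] [F.EssSurj] : IsRegularCat E := by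
  intro X Y f
  obtain ⟨f', hf'⟩ := F.map_surjective ((F.objObjPreimageIso X).hom ≫ f ≫
    (F.objObjPreimageIso Y).inv)
  obtain ⟨g, hg⟩ := hD f'
  refine ⟨(F.objObjPreimageIso Y).inv ≫ F.map g ≫ (F.objObjPreimageIso X).hom, ?_⟩
  have := congrArg F.map hg
  simp only [F.map_comp, hf'] at this
  rw [← cancel_epi (F.objObjPreimageIso X).hom, ← cancel_mono (F.objObjPreimageIso Y).inv]
  simpa using this

end IsRegularCat
end semisimple

end

/-! ### Traces -/

section

section zigzag
variable {C : Type u₁} [Category.{v₁} C] [MonoidalCategory C]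

theorem evaluation_zigzag (X Y : C) [ExactPairing X Y] :
    η_ X Y ▷ X ⊗≫ X ◁ ε_ X Y = (λ_ _).hom ≫ (ρ_ _).inv := by
  rw [← ExactPairing.evaluation_coevaluation X Y]; monoidal

theorem coevaluation_zigzag (X Y : C) [ExactPairing X Y] :
    Y ◁ η_ X Y ⊗≫ ε_ X Y ▷ Y = (ρ_ _).hom ≫ (λ_ _).inv := by
  rw [← ExactPairing.coevaluation_evaluation X Y]; monoidal

end zigzag

section traces
variable {C : Type u₁} [Category.{v₁} C] [MonoidalCategory C] [RightRigidCategory C]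

/-- The coevaluation of a tensor product through those of the factors. -/
theorem coevPair_comp_dualTensor (X Y : C) :
    η_ X (Xᘁ) ⊗≫ X ◁ η_ Y (Yᘁ) ▷ (Xᘁ : C) ⊗≫ (X ⊗ Y) ◁ dualTensor X Y =
      η_ (X ⊗ Y) ((X ⊗ Y)ᘁ) := by
  calc _ = η_ X (Xᘁ) ⊗≫ X ◁ η_ Y (Yᘁ) ▷ (Xᘁ : C) ⊗≫
        (X ⊗ Y) ◁ ((Yᘁ : C) ⊗ Xᘁ) ◁ η_ (X ⊗ Y) ((X ⊗ Y)ᘁ) ⊗≫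
        (X ⊗ Y ⊗ (Yᘁ : C)) ◁ ε_ X (Xᘁ) ▷ (Y ⊗ ((X ⊗ Y)ᘁ : C)) ⊗≫
        (X ⊗ Y) ◁ ε_ Y (Yᘁ) ▷ ((X ⊗ Y)ᘁ : C) ⊗≫ 𝟙 _ := by
        dsimp only [dualTensor]; monoidal
    _ = 𝟙 _ ⊗≫ η_ X (Xᘁ) ⊗≫ X ◁ (η_ Y (Yᘁ) ▷ ((Xᘁ : C) ⊗ 𝟙_ C) ≫
        (Y ⊗ (Yᘁ : C)) ◁ (Xᘁ : C) ◁ η_ (X ⊗ Y) ((X ⊗ Y)ᘁ)) ⊗≫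
        (X ⊗ Y ⊗ (Yᘁ : C)) ◁ ε_ X (Xᘁ) ▷ (Y ⊗ ((X ⊗ Y)ᘁ : C)) ⊗≫
        (X ⊗ Y) ◁ ε_ Y (Yᘁ) ▷ ((X ⊗ Y)ᘁ : C) ⊗≫ 𝟙 _ := by monoidal
    _ = 𝟙 _ ⊗≫ (η_ X (Xᘁ) ▷ 𝟙_ C ≫ (X ⊗ (Xᘁ : C)) ◁ η_ (X ⊗ Y) ((X ⊗ Y)ᘁ)) ⊗≫
        X ◁ (η_ Y (Yᘁ) ▷ ((Xᘁ : C) ⊗ X) ≫ (Y ⊗ (Yᘁ : C)) ◁ ε_ X (Xᘁ)) ▷ (Y ⊗ ((X ⊗ Y)ᘁ : C)) ⊗≫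
        (X ⊗ Y) ◁ ε_ Y (Yᘁ) ▷ ((X ⊗ Y)ᘁ : C) ⊗≫ 𝟙 _ := by
        rw [← whisker_exchange]; monoidal
    _ = η_ (X ⊗ Y) ((X ⊗ Y)ᘁ) ⊗≫ (η_ X (Xᘁ) ▷ X ⊗≫ X ◁ ε_ X (Xᘁ)) ▷ (Y ⊗ ((X ⊗ Y)ᘁ : C)) ⊗≫
        X ◁ (η_ Y (Yᘁ) ▷ Y ⊗≫ Y ◁ ε_ Y (Yᘁ)) ▷ ((X ⊗ Y)ᘁ : C) ⊗≫ 𝟙 _ := by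
        rw [← whisker_exchange, ← whisker_exchange]; monoidal
    _ = _ := by rw [evaluation_zigzag, evaluation_zigzag]; monoidal

namespace PivotalStructure
variable (P : PivotalStructure C)

/-- Monoidality of the pivotal structure enters here: it makes the reversed evaluation of a tensor
product the nesting of those of the factors. -/
theorem dualTensor_comp_ev' (X Y : C) :
    (X ⊗ Y) ◁ dualTensor X Y ≫ P.ev (X ⊗ Y) =
      𝟙 _ ⊗≫ X ◁ P.ev Y ▷ (Xᘁ : C) ⊗≫ P.ev X := by
  rw [ev, whisker_exchange_assoc, ← rightAdjointMate_comp_evaluation, ← comp_whiskerRight_assoc,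
    P.tensor, comp_whiskerRight, Category.assoc, dualTensor_comp_ev,
    MonoidalCategory.tensorHom_def']
  dsimp only [evPair, ev]
  calc _ = 𝟙 _ ⊗≫ X ◁ (P.iso Y).hom ▷ ((Yᘁ : C) ⊗ (Xᘁ : C)) ⊗≫
          ((P.iso X).hom ▷ ((((Yᘁ : C)ᘁ : C) ⊗ (Yᘁ : C)) ⊗ (Xᘁ : C)) ≫
         ((Xᘁ : C)ᘁ : C) ◁ ε_ (Yᘁ : C) ((Yᘁ)ᘁ) ▷ (Xᘁ : C)) ⊗≫ ε_ (Xᘁ : C) ((Xᘁ)ᘁ) := by monoidal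
    _ = _ := by rw [← whisker_exchange]; monoidal

/-- The partial trace over the second factor. -/
def partialTrace {X Y : C} (B : C) (f : X ⊗ B ⟶ Y ⊗ B) : X ⟶ Y :=
  𝟙 _ ⊗≫ X ◁ η_ B (Bᘁ) ⊗≫ f ▷ (Bᘁ : C) ⊗≫ Y ◁ P.ev B ⊗≫ 𝟙 _

/-- The cups and caps of the two closures are nested, and `coevPair_comp_dualTensor` and
`dualTensor_comp_ev'` identify them with those of `X ⊗ B`. -/
theorem leftTrace_partialTrace {X B : C} (f : X ⊗ B ⟶ X ⊗ B) :
    P.leftTrace (P.partialTrace B f) = P.leftTrace f := by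
  calc _ = η_ X (Xᘁ) ⊗≫ X ◁ η_ B (Bᘁ) ▷ (Xᘁ : C) ⊗≫ f ▷ ((Bᘁ : C) ⊗ (Xᘁ : C)) ⊗≫
        ((X ⊗ B) ◁ 𝟙 ((Bᘁ : C) ⊗ (Xᘁ : C)) ⊗≫ X ◁ P.ev B ▷ (Xᘁ : C) ⊗≫ P.ev X) := by
        dsimp only [leftTrace, partialTrace]; monoidal
    _ = η_ X (Xᘁ) ⊗≫ X ◁ η_ B (Bᘁ) ▷ (Xᘁ : C) ⊗≫ (f ▷ ((Bᘁ : C) ⊗ (Xᘁ : C)) ≫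
        (X ⊗ B) ◁ dualTensor X B) ≫ P.ev (X ⊗ B) := by
        rw [Category.assoc, dualTensor_comp_ev']; monoidal
    _ = (η_ X (Xᘁ) ⊗≫ X ◁ η_ B (Bᘁ) ▷ (Xᘁ : C) ⊗≫ (X ⊗ B) ◁ dualTensor X B) ≫
        f ▷ ((X ⊗ B)ᘁ : C) ≫ P.ev (X ⊗ B) := by
        rw [← whisker_exchange]; monoidal
    _ = _ := by rw [coevPair_comp_dualTensor, leftTrace]

theorem ev_natural {X Y : C} (f : X ⟶ Y) :
    f ▷ (Yᘁ : C) ≫ P.ev Y = X ◁ (fᘁ) ≫ P.ev X := by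
  rw [ev, ev, whisker_exchange_assoc, ← rightAdjointMate_comp_evaluation,
    ← comp_whiskerRight_assoc, ← comp_whiskerRight_assoc, P.naturality]

/-- One factor travels around the loop as its mate. -/
theorem leftTrace_comp {X Y : C} (f : X ⟶ Y) (g : Y ⟶ X) :
    P.leftTrace (f ≫ g) = P.leftTrace (g ≫ f) := by
  rw [leftTrace, leftTrace, comp_whiskerRight, Category.assoc, ev_natural,
    ← whisker_exchange_assoc, comp_whiskerRight, Category.assoc,
    ← coevaluation_comp_rightAdjointMate_assoc]

/-- The second zigzag identities, for the other evaluation and coevaluation. -/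
theorem coev_zigzag (X : C) : X ◁ P.coev X ⊗≫ P.ev X ▷ X = (ρ_ X).hom ≫ (λ_ X).inv := by
  dsimp only [coev, ev]
  calc _ = 𝟙 _ ⊗≫ X ◁ η_ (Xᘁ : C) ((Xᘁ)ᘁ) ⊗≫ (X ◁ ((Xᘁ : C) ◁ (P.iso X).inv) ≫
        (P.iso X).hom ▷ ((Xᘁ : C) ⊗ X)) ⊗≫ ε_ (Xᘁ : C) ((Xᘁ)ᘁ) ▷ X := by monoidal
    _ = 𝟙 _ ⊗≫ (X ◁ η_ (Xᘁ : C) ((Xᘁ)ᘁ) ≫ (P.iso X).hom ▷ ((Xᘁ : C) ⊗ ((Xᘁ : C)ᘁ : C))) ⊗≫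
        ((((Xᘁ : C)ᘁ : C) ⊗ (Xᘁ : C)) ◁ (P.iso X).inv ≫ ε_ (Xᘁ : C) ((Xᘁ)ᘁ) ▷ X) := by
        rw [whisker_exchange]; monoidal
    _ = (P.iso X).hom ▷ 𝟙_ C ≫ (((Xᘁ : C)ᘁ : C) ◁ η_ (Xᘁ : C) ((Xᘁ)ᘁ) ⊗≫
        ε_ (Xᘁ : C) ((Xᘁ)ᘁ) ▷ ((Xᘁ : C)ᘁ : C)) ⊗≫ (P.iso X).inv ⊗≫ 𝟙 _ := by
        rw [whisker_exchange, whisker_exchange]; monoidal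
    _ = 𝟙 _ ⊗≫ ((P.iso X).hom ≫ (P.iso X).inv) ⊗≫ 𝟙 _ := by rw [coevaluation_zigzag]; monoidal
    _ = _ := by rw [Iso.hom_inv_id]; monoidal

theorem ev_zigzag (X : C) : P.coev X ▷ (Xᘁ : C) ⊗≫ (Xᘁ : C) ◁ P.ev X =
    (λ_ _).hom ≫ (ρ_ _).inv := by
  dsimp only [coev, ev]
  calc _ = η_ (Xᘁ : C) ((Xᘁ)ᘁ) ▷ (Xᘁ : C) ⊗≫ (Xᘁ : C) ◁ ((P.iso X).inv ≫ (P.iso X).hom) ▷ (Xᘁ : C)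
        ⊗≫ (Xᘁ : C) ◁ ε_ (Xᘁ : C) ((Xᘁ)ᘁ) := by monoidal
    _ = _ := by rw [Iso.inv_hom_id, ← evaluation_zigzag (Xᘁ : C) ((Xᘁ)ᘁ)]; monoidal

/-- The canonical isomorphism of the unit `J` with its dual. -/
def unitDual {J : C} (e : 𝟙_ C ≅ J) : J ⟶ (Jᘁ : C) :=
  𝟙 _ ⊗≫ J ◁ η_ J (Jᘁ) ⊗≫ ((e.inv ⊗ₘ e.inv) ≫ (λ_ _).hom) ▷ (Jᘁ : C) ⊗≫ 𝟙 _

omit P in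
theorem unitDual_comp_ev {J : C} (e : 𝟙_ C ≅ J) :
    unitDual e ▷ J ≫ ε_ J (Jᘁ) = (e.inv ⊗ₘ e.inv) ≫ (λ_ _).hom :=
  transpose_comp_ev _

omit P in
theorem isIso_unitDual {J : C} (e : 𝟙_ C ≅ J) : IsIso (unitDual e) := by
  let p : ExactPairing J J := exactPairingCongr e.symm e.symm
  exact isIso_of_comp_ev (X := J) _ ((unitDual_comp_ev e).trans (by
    change _ = J ◁ e.inv ≫ e.inv ▷ 𝟙_ C ≫ (ρ_ _).hom
    rw [MonoidalCategory.tensorHom_def', Category.assoc, unitors_equal]))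

omit P in
theorem evPair_coev (X : C) :
    ((((Xᘁ : C)ᘁ : C)ᘁ : C) ⊗ ((Xᘁ : C)ᘁ : C)) ◁ η_ (Xᘁ : C) ((Xᘁ)ᘁ) ≫
      evPair (Xᘁ : C) ((Xᘁ : C)ᘁ : C) = (ρ_ _).hom ≫ ε_ ((Xᘁ)ᘁ : C) (((Xᘁ)ᘁ)ᘁ) := by
  calc _ = 𝟙 _ ⊗≫ (((Xᘁ : C)ᘁ : C)ᘁ : C) ◁ (((Xᘁ : C)ᘁ : C) ◁ η_ (Xᘁ : C) ((Xᘁ)ᘁ) ⊗≫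
        ε_ (Xᘁ : C) ((Xᘁ)ᘁ) ▷ ((Xᘁ : C)ᘁ : C)) ⊗≫ ε_ ((Xᘁ)ᘁ : C) (((Xᘁ)ᘁ)ᘁ) := by
        dsimp only [evPair]; monoidal
    _ = _ := by rw [coevaluation_zigzag]; monoidal

omit P in
theorem coev_evPair (X : C) :
    η_ (Xᘁ : C) ((Xᘁ)ᘁ) ▷ ((Xᘁ : C) ⊗ X) ≫ evPair (Xᘁ : C) X = (λ_ _).hom ≫ ε_ X (Xᘁ) := by
  calc _ = 𝟙 _ ⊗≫ (η_ (Xᘁ : C) ((Xᘁ)ᘁ) ▷ (Xᘁ : C) ⊗≫ (Xᘁ : C) ◁ ε_ (Xᘁ : C) ((Xᘁ)ᘁ)) ▷ X ⊗≫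
        ε_ X (Xᘁ) := by
        dsimp only [evPair]; monoidal
    _ = _ := by rw [evaluation_zigzag]; monoidal

/-- The pairing of `Xᘁᘁᘁ` with `Xᘁᘁ`, carried back to `Xᘁ ⊗ X`. -/
theorem iso_rightDual_comp_ev {J : C} (e : 𝟙_ C ≅ J) (X : C) :
    ε_ X (Xᘁ) ≫ e.hom ≫ (P.iso J).hom ≫ ((unitDual e)ᘁ) =
      ((P.iso (Xᘁ)).hom ⊗ₘ (P.iso X).hom) ≫ ε_ ((Xᘁ)ᘁ : C) (((Xᘁ)ᘁ)ᘁ) ≫ e.hom ≫ unitDual e := by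
  -- The claim is naturality of the pivotal isomorphism at the evaluation of `X`, combined with its
  -- monoidality at `Xᘁ` and `X`; `h1` and `h2` compute the two mates that occur.
  have h1 : dualTensor (Xᘁ : C) ((Xᘁ : C)ᘁ : C) ≫ ((e.inv ≫ η_ (Xᘁ : C) ((Xᘁ)ᘁ))ᘁ) =
      ε_ ((Xᘁ)ᘁ : C) (((Xᘁ)ᘁ)ᘁ) ≫ e.hom ≫ unitDual e := by
    apply rightDual_hom_ext (X := J) (Y := Jᘁ)
    rw [mate_comp_whiskerRight_ev, dualTensor_comp_ev, MonoidalCategory.whiskerLeft_comp,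
      Category.assoc, evPair_coev, comp_whiskerRight, comp_whiskerRight,
      Category.assoc, Category.assoc, unitDual_comp_ev, MonoidalCategory.tensorHom_def,
      Category.assoc, hom_inv_whiskerRight_assoc, ← whisker_exchange_assoc]
    simp [unitors_equal]
  have h2 : unitDual e ≫ ((ε_ X (Xᘁ) ≫ e.hom)ᘁ) =
      e.inv ≫ η_ (Xᘁ : C) ((Xᘁ)ᘁ) ≫ dualTensor (Xᘁ : C) X := by
    apply rightDual_hom_ext (X := (Xᘁ : C) ⊗ X) (Y := ((Xᘁ : C) ⊗ X)ᘁ)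
    rw [mate_comp_whiskerRight_ev, unitDual_comp_ev, comp_whiskerRight, comp_whiskerRight,
      Category.assoc, Category.assoc,
      dualTensor_comp_ev, coev_evPair, MonoidalCategory.whiskerLeft_comp, Category.assoc,
      MonoidalCategory.tensorHom_def', Category.assoc, whiskerLeft_hom_inv_assoc,
      whisker_exchange_assoc]
    simp
  have h3 := P.naturality (ε_ X (Xᘁ) ≫ e.hom)
  rw [Category.assoc] at h3
  rw [← reassoc_of% h3, ← comp_rightAdjointMate, h2, ← Category.assoc e.inv,
    comp_rightAdjointMate, reassoc_of% (P.tensor (Xᘁ) X), h1]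

end PivotalStructure
end traces

end

/-! ### Dual bases in a premodular category -/

section

section premodular
variable {k : Type w} [Field k] [IsAlgClosed k] {C : Type u} [Category.{v} C] [Abelian C]
    [Linear k C] [MonoidalCategory C] [MonoidalPreadditive C] [MonoidalLinear k C]
    [BraidedCategory C] [RightRigidCategory C] [PremodularCategory k C]

/-- The pivotal structure as a term not depending on the choice of a basis field in notation. -/
theorem leftTrace_eq {X : C} (f : X ⟶ X) :
    (PremodularCategory.piv k).leftTrace f = tr k f • 𝟙 (𝟙_ C) := by
  have := PremodularCategory.simple_unit k (C := C)
  obtain ⟨c, hc⟩ := exists_smul (PremodularCategory.semisimple (k := k) (C := C))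
    ((PremodularCategory.piv k).leftTrace f)
  rw [tr, ← hc, scalar_smul]

theorem smul_unit_injective {a b : k} (h : a • 𝟙 (𝟙_ C) = b • 𝟙 (𝟙_ C)) : a = b := by
  have := PremodularCategory.simple_unit k (C := C)
  exact smul_id_inj h

theorem tr_add {X : C} (f g : X ⟶ X) : tr k (f + g) = tr k f + tr k g := by
  apply smul_unit_injective (C := C)
  rw [← leftTrace_eq, add_smul, ← leftTrace_eq, ← leftTrace_eq]
  simp [PivotalStructure.leftTrace]

theorem tr_smul' {X : C} (c : k) (f : X ⟶ X) : tr k (c • f) = c * tr k f := by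
  apply smul_unit_injective (C := C)
  rw [← leftTrace_eq, mul_smul, ← leftTrace_eq]
  simp [PivotalStructure.leftTrace]

theorem tr_comp {X Y : C} (f : X ⟶ Y) (g : Y ⟶ X) : tr k (f ≫ g) = tr k (g ≫ f) := by
  apply smul_unit_injective (C := C)
  rw [← leftTrace_eq, ← leftTrace_eq, PivotalStructure.leftTrace_comp]

variable (k) in
/-- The trace as a linear form. -/
def trₗ (X : C) : (X ⟶ X) →ₗ[k] k where
  toFun f := tr k f
  map_add' := tr_add
  map_smul' := tr_smul'

theorem tr_sum {X : C} {ι : Type*} (s : Finset ι) (f : ι → (X ⟶ X)) :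
    tr k (∑ i ∈ s, f i) = ∑ i ∈ s, tr k (f i) := map_sum (trₗ k X) f s

theorem dim_eq_of_iso {X Y : C} (e : X ≅ Y) : dim k X = dim k Y := by
  rw [dim, dim, ← e.hom_inv_id, tr_comp, e.inv_hom_id]

theorem endo_simple {S : C} [Simple S] (f : S ⟶ S) : f = (tr k f / dim k S) • 𝟙 S := by
  obtain ⟨c, rfl⟩ := exists_smul (PremodularCategory.semisimple (k := k) (C := C)) f
  rw [tr_smul, mul_div_cancel_right₀ _ dim_ne_zero]

theorem tr_partialTrace {X B : C} (f : X ⊗ B ⟶ X ⊗ B) :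
    tr k ((PremodularCategory.piv k).partialTrace B f) = tr k f := by
  apply smul_unit_injective (C := C)
  rw [← leftTrace_eq, ← leftTrace_eq, PivotalStructure.leftTrace_partialTrace]

/-- Closing the second factor alone leaves `dim k B` times the identity of `X`. -/
theorem dim_tensor (X B : C) : dim k (X ⊗ B) = dim k X * dim k B := by
  have h : (PremodularCategory.piv k).partialTrace B (𝟙 (X ⊗ B)) = dim k B • 𝟙 X := by
    have h1 := leftTrace_eq (k := k) (𝟙 B)
    rw [PivotalStructure.leftTrace, id_whiskerRight, Category.id_comp] at h1
    calc _ = 𝟙 _ ⊗≫ X ◁ (η_ B (Bᘁ) ≫ (PremodularCategory.piv k).ev B) ⊗≫ 𝟙 _ := by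
          dsimp only [PivotalStructure.partialTrace]; monoidal
      _ = _ := by rw [h1]; simp [monoidalComp, dim]
  rw [dim, ← tr_partialTrace, h, tr_smul, mul_comm]

variable (k C) in
theorem dim_unit_ne_zero : dim k (𝟙_ C) ≠ 0 := by
  have := PremodularCategory.simple_unit k (C := C)
  exact dim_ne_zero

/-- Carried back along the pivotal isomorphisms, the pairing of `Xᘁᘁᘁ` with `Xᘁᘁ` is `c` times the
evaluation of `X`, with a scalar `c` independent of `X` (`iso_rightDual_comp_ev`). Sphericality
turns this into `dim Xᘁ = c * dim X`, and the unit, being isomorphic to its dual, shows that `c =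
1`. -/
theorem dim_rightDual (X : C) : dim k (Xᘁ : C) = dim k X := by
  have := PremodularCategory.simple_unit k (C := C)
  let P := PremodularCategory.piv k (C := C)
  have key : ∀ J : C, ∀ e : 𝟙_ C ≅ J, ∃ c : k, ∀ X : C, dim k (Xᘁ : C) = c * dim k X := by
    intro J e
    have hu := PivotalStructure.isIso_unitDual e
    obtain ⟨c, hc⟩ := exists_smul (PremodularCategory.semisimple (k := k) (C := C))
      (e.hom ≫ (P.iso J).hom ≫ ((PivotalStructure.unitDual e)ᘁ) ≫
        inv (PivotalStructure.unitDual e) ≫ e.inv)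
    refine ⟨c, fun X => ?_⟩
    have h := P.iso_rightDual_comp_ev e X
    have h1 : ((P.iso (Xᘁ)).hom ⊗ₘ (P.iso X).hom) ≫ ε_ ((Xᘁ)ᘁ : C) (((Xᘁ)ᘁ)ᘁ) = c • ε_ X (Xᘁ) := by
      have h2 : e.hom ≫ (P.iso J).hom ≫ ((PivotalStructure.unitDual e)ᘁ) =
          c • (e.hom ≫ PivotalStructure.unitDual e) := by
        have := congrArg (· ≫ e.hom ≫ PivotalStructure.unitDual e) hc
        simpa using this.symm
      rw [← cancel_mono (e.hom ≫ PivotalStructure.unitDual e), Category.assoc, ← h, h2,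
        Linear.smul_comp, Linear.comp_smul]
    apply smul_unit_injective (C := C)
    rw [mul_smul, dim, dim, ← leftTrace_eq, ← leftTrace_eq, PremodularCategory.spherical (𝟙 X),
      PivotalStructure.leftTrace, PivotalStructure.rightTrace]
    have h2 : (P.coev X ≫ (P.iso (Xᘁ)).hom ▷ X ≫ _ ◁ (P.iso X).hom) =
      η_ (Xᘁ : C) ((Xᘁ)ᘁ) ≫ (P.iso (Xᘁ)).hom ▷ ((Xᘁ)ᘁ : C) := by
      rw [← whisker_exchange, PivotalStructure.coev]
      simp
    rw [PivotalStructure.ev, id_whiskerRight, Category.id_comp, whiskerLeft_id, Category.id_comp,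
      ← Linear.comp_smul, ← h1, MonoidalCategory.tensorHom_def, ← Category.assoc, ← h2,
      Category.assoc, Category.assoc]
  have key2 : ∀ J : C, ∀ e : 𝟙_ C ≅ J, dim k (Jᘁ : C) = dim k J := fun J e => by
    have hu := PivotalStructure.isIso_unitDual e
    exact (dim_eq_of_iso (asIso (PivotalStructure.unitDual e))).symm
  obtain ⟨c, hc⟩ := key _ (Iso.refl _)
  have h1 := hc (𝟙_ C)
  have h2 := key2 _ (Iso.refl (𝟙_ C))
  rw [h2] at h1
  have : c = 1 := mul_right_cancel₀ (dim_unit_ne_zero k C) (by rw [← h1, one_mul])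
  rw [hc, this, one_mul]
end premodular

namespace IrrData
variable {k : Type w} [Field k] [IsAlgClosed k] {C : Type u} [Category.{v} C] [Abelian C]
    [Linear k C] [MonoidalCategory C] [MonoidalPreadditive C] [MonoidalLinear k C]
    [BraidedCategory C] [RightRigidCategory C] [PremodularCategory k C]
  (D : IrrData k C)

theorem hom_ext_simple {V W : C} {f g : V ⟶ W} (h : ∀ i (s : D.X i ⟶ V), s ≫ f = s ≫ g) :
    f = g := by
  obtain ⟨n, T, b, hT, ⟨hb⟩, ⟨e⟩⟩ :=
    (PremodularCategory.semisimple (k := k) (C := C)).semisimple V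
  rw [← cancel_epi e.inv]
  apply hb.isColimit.hom_ext
  rintro ⟨j⟩
  have := hT j
  obtain ⟨i, ⟨a⟩⟩ := D.exists_iso (T j) this
  have := h i (a.inv ≫ b.ι j ≫ e.inv)
  simpa using this

theorem hom_eq_zero {i j : D.ι} (h : i ≠ j) (f : D.X i ⟶ D.X j) : f = 0 := by
  by_contra hf
  have := D.simple i
  have := D.simple j
  have := isIso_of_hom_simple hf
  exact h (D.eq_of_iso i j ⟨asIso f⟩)

theorem dim_X_ne_zero (i : D.ι) : dim k (D.X i) ≠ 0 := by
  have := D.simple i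
  exact dim_ne_zero

theorem tr_bas_dua (j : D.ι) (V : C) (α β) :
    tr k (D.bas j V α ≫ D.dua j V β) = if α = β then 1 else 0 :=
  (D.exists_dua j V).choose_spec α β

theorem endo_eq (j : D.ι) (f : D.X j ⟶ D.X j) : f = (tr k f / dim k (D.X j)) • 𝟙 _ := by
  have := D.simple j
  exact endo_simple f

theorem eq_sum_bas {j : D.ι} {V : C} (h : D.X j ⟶ V) :
    h = ∑ α, tr k (h ≫ D.dua j V α) • D.bas j V α := by
  have := (PremodularCategory.semisimple (k := k) (C := C)).finiteDimensional (D.X j) V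
  obtain ⟨c, hc⟩ : ∃ c : Fin (D.mult (D.X j) V) → k, h = ∑ α, c α • D.bas j V α :=
    ⟨(Module.finBasis k (D.X j ⟶ V)).repr h, ((Module.finBasis k (D.X j ⟶ V)).sum_repr h).symm⟩
  have hα : ∀ α, tr k (h ≫ D.dua j V α) = c α := by
    intro α
    rw [hc, Preadditive.sum_comp, tr_sum]
    simp [tr_smul', tr_bas_dua]
  simp only [hα]
  exact hc

theorem hom_to_simple_ext {j : D.ι} {V : C} {f g : V ⟶ D.X j}
    (h : ∀ α, tr k (D.bas j V α ≫ f) = tr k (D.bas j V α ≫ g)) : f = g := by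
  apply D.hom_ext_simple
  intro i s
  by_cases hij : i = j
  · subst hij
    rw [D.eq_sum_bas s, Preadditive.sum_comp, Preadditive.sum_comp]
    refine Finset.sum_congr rfl fun α _ => ?_
    rw [Linear.smul_comp, Linear.smul_comp, D.endo_eq _ (_ ≫ f), D.endo_eq _ (_ ≫ g), h α]
  · rw [D.hom_eq_zero hij (s ≫ f), D.hom_eq_zero hij (s ≫ g)]

theorem eq_sum_dua {j : D.ι} {V : C} (g : V ⟶ D.X j) :
    g = ∑ α, tr k (D.bas j V α ≫ g) • D.dua j V α := by
  apply D.hom_to_simple_ext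
  intro β
  simp only [Preadditive.comp_sum, Linear.comp_smul, tr_sum, tr_smul', tr_bas_dua]
  simp

/-- The Casimir element of a pair of dual bases is natural. -/
theorem casimir_natural {j : D.ι} {V W : C} {M : Type*} [AddCommGroup M] [Module k M]
    (T : (V ⟶ D.X j) →ₗ[k] (D.X j ⟶ W) →ₗ[k] M) (h : V ⟶ W) :
    ∑ α, T (h ≫ D.dua j W α) (D.bas j W α) = ∑ β, T (D.dua j V β) (D.bas j V β ≫ h) := by
  have h1 : ∀ α, T (h ≫ D.dua j W α) (D.bas j W α) =
      ∑ β, tr k (D.bas j V β ≫ h ≫ D.dua j W α) • T (D.dua j V β) (D.bas j W α) := by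
    intro α
    conv_lhs => rw [D.eq_sum_dua (h ≫ D.dua j W α)]
    simp
  have h2 : ∀ β, T (D.dua j V β) (D.bas j V β ≫ h) =
      ∑ α, tr k (D.bas j V β ≫ h ≫ D.dua j W α) • T (D.dua j V β) (D.bas j W α) := by
    intro β
    conv_lhs => rw [D.eq_sum_bas (D.bas j V β ≫ h)]
    simp
  simp only [h1, h2]
  exact Finset.sum_comm

/-- Any pair of dual families has the same Casimir element as the pair of dual bases. -/
theorem casimir_eq {j : D.ι} {V : C} {M : Type*} [AddCommGroup M] [Module k M] {A : Type*}
    [Fintype A] (f : A → (D.X j ⟶ V)) (g : A → (V ⟶ D.X j))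
    (hfg : ∀ h : D.X j ⟶ V, h = ∑ a, tr k (h ≫ g a) • f a)
    (T : (V ⟶ D.X j) →ₗ[k] (D.X j ⟶ V) →ₗ[k] M) :
    ∑ a, T (g a) (f a) = ∑ α, T (D.dua j V α) (D.bas j V α) := by
  have h1 : ∀ a, T (g a) (f a) = ∑ β, tr k (D.bas j V β ≫ g a) • T (D.dua j V β) (f a) := by
    intro a
    conv_lhs => rw [D.eq_sum_dua (g a)]
    simp
  have h2 : ∀ β, T (D.dua j V β) (D.bas j V β) =
      ∑ a, tr k (D.bas j V β ≫ g a) • T (D.dua j V β) (f a) := by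
    intro β
    conv_lhs => rw [hfg (D.bas j V β)]
    simp
  simp only [h1, h2]
  exact Finset.sum_comm

/-- The decomposition of the identity. -/
theorem sum_dua_bas (V : C) :
    ∑ j, dim k (D.X j) • ∑ α, D.dua j V α ≫ D.bas j V α = 𝟙 V := by
  apply D.hom_ext_simple
  intro i s
  rw [Category.comp_id, Preadditive.comp_sum, Finset.sum_eq_single i]
  · conv_rhs => rw [D.eq_sum_bas s]
    rw [Linear.comp_smul, Preadditive.comp_sum, Finset.smul_sum]
    refine Finset.sum_congr rfl fun α _ => ?_
    rw [← Category.assoc, D.endo_eq _ (s ≫ D.dua i V α), Linear.smul_comp, Category.id_comp,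
      smul_smul, mul_div_cancel₀ _ (D.dim_X_ne_zero i), ← D.endo_eq]
  · intro j _ hj
    rw [Linear.comp_smul, Preadditive.comp_sum, Finset.sum_eq_zero, smul_zero]
    intro α _
    rw [← Category.assoc, D.hom_eq_zero hj.symm (s ≫ _), zero_comp]
  · simp

/-- The decomposition of the identity by any pairs of dual families. -/
theorem sum_dual_families (V : C) {A : D.ι → Type*} [∀ j, Fintype (A j)]
    (f : ∀ j, A j → (D.X j ⟶ V)) (g : ∀ j, A j → (V ⟶ D.X j))
    (hfg : ∀ j, ∀ h : D.X j ⟶ V, h = ∑ a, tr k (h ≫ g j a) • f j a) :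
    ∑ j, dim k (D.X j) • ∑ a, g j a ≫ f j a = 𝟙 V := by
  rw [← D.sum_dua_bas V]
  refine Finset.sum_congr rfl fun j _ => ?_
  congr 1
  exact D.casimir_eq (f j) (g j) (hfg j) (Linear.comp V (D.X j) V)

/-- The trace of the decomposition of the identity: every pair of dual basis elements contributes
`1`, weighted by the dimension of the simple object. -/
theorem dim_eq_sum (V : C) : dim k V = ∑ j, dim k (D.X j) * D.mult (D.X j) V := by
  rw [dim, ← D.sum_dua_bas V, tr_sum]
  refine Finset.sum_congr rfl fun j _ => ?_
  rw [tr_smul', tr_sum]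
  congr 1
  simp only [fun α => tr_comp (k := k) (D.dua j V α) (D.bas j V α), tr_bas_dua]
  simp

/-- `Hom (V, X j)` has the dimension of `Hom (X j, V)`. -/
theorem finrank_hom_to (j : D.ι) (V : C) : Module.finrank k (V ⟶ D.X j) = D.mult (D.X j) V := by
  let L : (V ⟶ D.X j) ≃ₗ[k] (Fin (D.mult (D.X j) V) → k) :=
    { toFun := fun g α => tr k (D.bas j V α ≫ g)
      map_add' := fun f g => by ext; simp [tr_add]
      map_smul' := fun c f => by ext; simp [tr_smul']
      invFun := fun x => ∑ α, x α • D.dua j V α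
      left_inv := fun g => (D.eq_sum_dua g).symm
      right_inv := fun x => by
        ext β
        simp [Preadditive.comp_sum, tr_sum, tr_smul', tr_bas_dua] }
  simpa using L.finrank_eq

end IrrData

end

/-! ### Rotations of dual bases -/

section

namespace PivotalStructure
variable {C : Type u₁} [Category.{v₁} C] [MonoidalCategory C] [RightRigidCategory C]
  (P : PivotalStructure C)

/-- `f : W ⟶ U ⊗ B` rotated to `W ⊗ Bᘁ ⟶ U`. -/
def rotDown {W U B : C} (f : W ⟶ U ⊗ B) : W ⊗ (Bᘁ : C) ⟶ U :=
  f ▷ (Bᘁ : C) ⊗≫ U ◁ P.ev B ⊗≫ 𝟙 _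

/-- `g : U ⊗ B ⟶ W` rotated to `U ⟶ W ⊗ Bᘁ`. -/
def rotUp {W U B : C} (g : U ⊗ B ⟶ W) : U ⟶ W ⊗ (Bᘁ : C) :=
  𝟙 _ ⊗≫ U ◁ η_ B (Bᘁ) ⊗≫ g ▷ (Bᘁ : C)

/-- `h : U ⟶ W ⊗ Bᘁ` rotated to `U ⊗ B ⟶ W`. -/
def rotBack {W U B : C} (h : U ⟶ W ⊗ (Bᘁ : C)) : U ⊗ B ⟶ W :=
  h ▷ B ⊗≫ W ◁ ε_ B (Bᘁ) ⊗≫ 𝟙 _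

omit P in
theorem rotUp_rotBack {W U B : C} (h : U ⟶ W ⊗ (Bᘁ : C)) : rotUp (rotBack h) = h := by
  calc _ = 𝟙 _ ⊗≫ (U ◁ η_ B (Bᘁ) ≫ h ▷ (B ⊗ (Bᘁ : C))) ⊗≫ W ◁ ε_ B (Bᘁ) ▷ (Bᘁ : C) ⊗≫ 𝟙 _ := by
        dsimp only [rotUp, rotBack]; monoidal
    _ = h ⊗≫ W ◁ ((Bᘁ : C) ◁ η_ B (Bᘁ) ⊗≫ ε_ B (Bᘁ) ▷ (Bᘁ : C)) ⊗≫ 𝟙 _ := by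
        rw [whisker_exchange]; monoidal
    _ = _ := by rw [coevaluation_zigzag]; monoidal

omit P in
theorem rotBack_rotUp {W U B : C} (g : U ⊗ B ⟶ W) : rotBack (rotUp g) = g := by
  calc _ = 𝟙 _ ⊗≫ U ◁ η_ B (Bᘁ) ▷ B ⊗≫ (g ▷ ((Bᘁ : C) ⊗ B) ≫ W ◁ ε_ B (Bᘁ)) ⊗≫ 𝟙 _ := by
        dsimp only [rotUp, rotBack]; monoidal
    _ = 𝟙 _ ⊗≫ U ◁ (η_ B (Bᘁ) ▷ B ⊗≫ B ◁ ε_ B (Bᘁ)) ⊗≫ g := by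
        rw [← whisker_exchange]; monoidal
    _ = _ := by rw [evaluation_zigzag]; monoidal

/-- This is why rotated dual bases are again dual: a partial trace does not change the trace. -/
theorem partialTrace_rotBack_comp {W U B : C} (h : U ⟶ W ⊗ (Bᘁ : C)) (f : W ⟶ U ⊗ B) :
    P.partialTrace B (rotBack h ≫ f) = h ≫ P.rotDown f := by
  conv_rhs => rw [← rotUp_rotBack h]
  dsimp only [partialTrace, rotUp, rotDown]
  monoidal

end PivotalStructure

section linear
variable {k : Type w} [Field k] {C : Type u} [Category.{v} C] [Preadditive C]
    [Linear k C] [MonoidalCategory C] [MonoidalPreadditive C] [MonoidalLinear k C]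
    [RightRigidCategory C]
open PivotalStructure

variable (k) in
/-- `rotUp` as a linear equivalence. -/
def rotUpEquiv (U B W : C) : (U ⊗ B ⟶ W) ≃ₗ[k] (U ⟶ W ⊗ (Bᘁ : C)) where
  toFun g := rotUp g
  map_add' _ _ := by simp [rotUp, monoidalComp]
  map_smul' _ _ := by simp [rotUp, monoidalComp]
  invFun h := rotBack h
  left_inv g := rotBack_rotUp g
  right_inv h := rotUp_rotBack h

theorem finrank_rotUp (U B W : C) :
    Module.finrank k (U ⊗ B ⟶ W) = Module.finrank k (U ⟶ W ⊗ (Bᘁ : C)) :=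
  (rotUpEquiv k U B W).finrank_eq

theorem finrank_congr_left {X X' Y : C} (e : X ≅ X') :
    Module.finrank k (X ⟶ Y) = Module.finrank k (X' ⟶ Y) :=
  (Linear.homCongr k e (Iso.refl Y)).finrank_eq

theorem finrank_congr_right {X Y Y' : C} (e : Y ≅ Y') :
    Module.finrank k (X ⟶ Y) = Module.finrank k (X ⟶ Y') :=
  (Linear.homCongr k (Iso.refl X) e).finrank_eq

theorem finrank_rightDual_symm [BraidedCategory C] (X Y : C) :
    Module.finrank k (X ⟶ (Yᘁ : C)) = Module.finrank k (Y ⟶ (Xᘁ : C)) := by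
  rw [finrank_congr_right (λ_ (Yᘁ : C)).symm, ← finrank_rotUp, finrank_congr_left (β_ X Y),
    finrank_rotUp, finrank_congr_right (λ_ (Xᘁ : C))]

end linear

namespace IrrData
open PivotalStructure
variable {k : Type w} [Field k] [IsAlgClosed k] {C : Type u} [Category.{v} C] [Abelian C]
    [Linear k C] [MonoidalCategory C] [MonoidalPreadditive C] [MonoidalLinear k C]
    [BraidedCategory C] [RightRigidCategory C] [PremodularCategory k C]
  (D : IrrData k C)

/-- `Hom (X j, X i ⊗ B)` has the dimension of `Hom (X i ⊗ B, X j)` by trace duality, and `B` can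
then be rotated to the other side. -/
theorem mult_rotate (i j : D.ι) (B : C) :
    D.mult (D.X j) (D.X i ⊗ B) = D.mult (D.X i) (D.X j ⊗ (Bᘁ : C)) := by
  rw [← D.finrank_hom_to, finrank_rotUp]
  rfl

/-- The dimension vector is an eigenvector of the transposed fusion matrices too: after rotating
`B`, this is the dimension of `X j ⊗ Bᘁ`. -/
theorem sum_dim_mult (j : D.ι) (B : C) :
    ∑ i, dim k (D.X i) * D.mult (D.X j) (D.X i ⊗ B) = dim k (D.X j) * dim k B := by
  simp only [D.mult_rotate _ j B]
  rw [← D.dim_eq_sum, dim_tensor, dim_rightDual]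

/-- Invariance of the regular colour under duality, in terms of multiplicities; it rests on
`dim_rightDual`. -/
theorem sum_dim_mult_rightDual (j : D.ι) :
    ∑ i, dim k (D.X i) * D.mult (D.X j) ((D.X i)ᘁ) = dim k (D.X j) := by
  have : ∀ i, D.mult (D.X j) ((D.X i)ᘁ : C) = D.mult (D.X i) ((D.X j)ᘁ : C) := fun i =>
    finrank_rightDual_symm _ _
  simp only [this]
  rw [← D.dim_eq_sum, dim_rightDual]

theorem eq_sum_rotUp {i j : D.ι} {B : C} (h : D.X i ⟶ D.X j ⊗ (Bᘁ : C)) :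
    h = ∑ α, tr k (h ≫ (PremodularCategory.piv k).rotDown (D.bas j (D.X i ⊗ B) α)) •
      rotUp (D.dua j (D.X i ⊗ B) α) := by
  conv_lhs => rw [← rotUp_rotBack h, D.eq_sum_dua (rotBack h)]
  change rotUpEquiv k _ _ _ _ = _
  rw [map_sum]
  refine Finset.sum_congr rfl fun α _ => ?_
  rw [map_smul, tr_comp, ← tr_partialTrace, partialTrace_rotBack_comp]
  rfl

/-- The decomposition of the identity by rotated dual bases. -/
theorem sum_rotDown_rotUp (j : D.ι) (B : C) :
    ∑ i, dim k (D.X i) • ∑ α, (PremodularCategory.piv k).rotDown (D.bas j (D.X i ⊗ B) α) ≫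
      rotUp (D.dua j (D.X i ⊗ B) α) = 𝟙 (D.X j ⊗ (Bᘁ : C)) :=
  D.sum_dual_families _ _ _ fun _ => D.eq_sum_rotUp

/-- The index of the unit object. -/
theorem exists_unit_index : ∃ i, Nonempty (D.X i ≅ 𝟙_ C) := by
  obtain ⟨i, ⟨e⟩⟩ := D.exists_iso _ (PremodularCategory.simple_unit k (C := C))
  exact ⟨i, ⟨e.symm⟩⟩

theorem mult_self (i j : D.ι) [Decidable (i = j)] :
    D.mult (D.X j) (D.X i) = if i = j then 1 else 0 := by
  split_ifs with h
  · subst h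
    have := D.simple i
    have := (PremodularCategory.semisimple (k := k) (C := C)).finiteDimensional (D.X i) (D.X i)
    exact finrank_endomorphism_simple_eq_one k (D.X i)
  · have : Subsingleton (D.X j ⟶ D.X i) :=
      ⟨fun f g => by rw [D.hom_eq_zero (Ne.symm h) f, D.hom_eq_zero (Ne.symm h) g]⟩
    exact Module.finrank_zero_of_subsingleton

/-- The dimensions form an eigenvector, with eigenvalue `tot`, of the integer matrix `M = ∑ l, (A
l)ᵀ * A l` built from the fusion matrices. The summand of the unit object is the identity matrix, so
`M` is positive definite over the reals and its determinant is a nonzero integer. In characteristic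
zero the determinant stays nonzero in `k`, and `0` cannot be an eigenvalue. -/
theorem tot_ne_zero [CharZero k] : D.tot ≠ 0 := by
  classical
  obtain ⟨o, ⟨eo⟩⟩ := D.exists_unit_index
  let A : D.ι → Matrix D.ι D.ι ℤ := fun l i j => D.mult (D.X j) (D.X i ⊗ D.X l)
  let M : Matrix D.ι D.ι ℤ := ∑ l, (A l).transpose * A l
  let d : D.ι → k := fun i => dim k (D.X i)
  have hA : ∀ l, ((A l).map (Int.cast : ℤ → k)).mulVec d = d l • d := by
    intro l
    ext i
    change ∑ j, ((D.mult (D.X j) (D.X i ⊗ D.X l) : ℤ) : k) * dim k (D.X j) =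
      dim k (D.X l) * dim k (D.X i)
    rw [mul_comm, ← dim_tensor, D.dim_eq_sum]
    simp [mul_comm]
  have hAt : ∀ l, ((A l).transpose.map (Int.cast : ℤ → k)).mulVec d = d l • d := by
    intro l
    ext j
    change ∑ i, ((D.mult (D.X j) (D.X i ⊗ D.X l) : ℤ) : k) * dim k (D.X i) =
      dim k (D.X l) * dim k (D.X j)
    rw [mul_comm, ← D.sum_dim_mult]
    simp [mul_comm]
  have hM : (M.map (Int.cast : ℤ → k)).mulVec d = D.tot • d := by
    have h1 : M.map (Int.cast : ℤ → k) =
        ∑ l, (A l).transpose.map (Int.cast : ℤ → k) * (A l).map (Int.cast : ℤ → k) := by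
      have := map_sum ((Int.castRingHom k).mapMatrix (m := D.ι))
        (fun l => (A l).transpose * A l) Finset.univ
      simp only [map_mul] at this
      exact this
    rw [h1, Matrix.sum_mulVec]
    simp only [← Matrix.mulVec_mulVec, hA, Matrix.mulVec_smul, hAt, smul_smul]
    rw [← Finset.sum_smul]
    simp [tot, d, sq]
  have hAo : A o = 1 := by
    ext i j
    simp only [A, Matrix.one_apply]
    have : D.mult (D.X j) (D.X i ⊗ D.X o) = D.mult (D.X j) (D.X i) :=
      finrank_congr_right (MonoidalCategory.whiskerLeftIso _ eo ≪≫ ρ_ _)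
    rw [this, D.mult_self i j]
    split_ifs <;> simp
  -- There is no positivity in `k`; the real numbers serve only to show that the integer `M.det` is
  -- not zero.
  have hpos : (M.map (Int.cast : ℤ → ℝ)).PosDef := by
    have h1 : M.map (Int.cast : ℤ → ℝ) =
        ∑ l, ((A l).map (Int.cast : ℤ → ℝ)).conjTranspose * (A l).map (Int.cast : ℤ → ℝ) := by
      have := map_sum ((Int.castRingHom ℝ).mapMatrix (m := D.ι))
        (fun l => (A l).transpose * A l) Finset.univ
      simp only [map_mul] at this
      exact this
    rw [h1, ← Finset.add_sum_erase _ _ (Finset.mem_univ o), hAo]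
    apply Matrix.PosDef.add_posSemidef
    · have : ((1 : Matrix D.ι D.ι ℤ).map (Int.cast : ℤ → ℝ)) = 1 := by simp
      rw [this]
      simpa using Matrix.PosDef.one
    · exact Matrix.posSemidef_sum _ fun l _ => Matrix.posSemidef_conjTranspose_mul_self _
  have hdet : M.det ≠ 0 := by
    intro h
    have h1 := hpos.det_pos
    have h2 : (M.map (Int.cast : ℤ → ℝ)).det = ((M.det : ℤ) : ℝ) :=
      ((Int.castRingHom ℝ).map_det M).symm
    rw [h2, h] at h1
    simp at h1
  intro h0
  rw [h0, zero_smul] at hM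
  have hdet' : (M.map (Int.cast : ℤ → k)).det ≠ 0 := by
    have h2 : (M.map (Int.cast : ℤ → k)).det = ((M.det : ℤ) : k) :=
      ((Int.castRingHom k).map_det M).symm
    rw [h2]
    exact_mod_cast hdet
  have := Matrix.eq_zero_of_mulVec_eq_zero hdet' hM
  exact D.dim_X_ne_zero o (congrFun this o)

theorem sqrtTot_ne_zero [CharZero k] : D.sqrtTot ≠ 0 := fun h => D.tot_ne_zero (by
  rw [tot, ← D.sqrtTot_sq, h]; simp)

end IrrData

end

/-! ### The horizontal trace as a linear monoidal category -/

section

namespace HTr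
variable {k : Type w} [CommRing k] {C : Type u₁} [Category.{v₁} C] [MonoidalCategory C]
  [Preadditive C] [Linear k C]
section rep
variable [MonoidalPreadditive C] [MonoidalLinear k C]

theorem rep_comp {X Y Z A B : C} (φ : A ⊗ X ⟶ Y ⊗ A) (ψ : B ⊗ Y ⟶ Z ⊗ B) :
    rep k A φ ≫ rep k B ψ = rep k (B ⊗ A) (compAux φ ψ) := compₗ_cls φ ψ

theorem rep_comp_map {X Y Z A : C} (φ : A ⊗ X ⟶ Y ⊗ A) (f : Y ⟶ Z) :
    rep k A φ ≫ (htr k C).map f = rep k A (φ ≫ f ▷ A) := compₗ_incl φ f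

theorem map_comp_rep {X Y Z A : C} (f : X ⟶ Y) (φ : A ⊗ Y ⟶ Z ⊗ A) :
    (htr k C).map f ≫ rep k A φ = rep k A (A ◁ f ≫ φ) := incl_compₗ f φ

theorem rep_slide {X Y A B : C} (f : A ⟶ B) (g : B ⊗ X ⟶ Y ⊗ A) :
    rep k A (f ▷ X ≫ g) = rep k B (g ≫ Y ◁ f) := cls_slide f g

theorem rep_iso {X Y A B : C} (e : A ≅ B) (φ : A ⊗ X ⟶ Y ⊗ A) :
    rep k A φ = rep k B (e.inv ▷ X ≫ φ ≫ Y ◁ e.hom) := cls_iso e φ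

theorem rep_induction {X Y : HTr k C} {P : (X ⟶ Y) → Prop} (x : X ⟶ Y)
    (h : ∀ A φ, P (rep k A φ)) (h0 : P 0) (hadd : ∀ x y, P x → P y → P (x + y)) : P x :=
  induction x h h0 hadd

variable (k) in
/-- `rep` as a linear map. -/
def repₗ {X Y : C} (A : C) : (A ⊗ X ⟶ Y ⊗ A) →ₗ[k] ((⟨X⟩ : HTr k C) ⟶ ⟨Y⟩) := cls k A

theorem repₗ_apply {X Y A : C} (φ : A ⊗ X ⟶ Y ⊗ A) : repₗ k A φ = rep k A φ := rfl

theorem rep_smul {X Y A : C} (c : k) (φ : A ⊗ X ⟶ Y ⊗ A) :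
    rep k A (c • φ) = c • rep k A φ := (repₗ k A).map_smul c φ

theorem rep_sum {X Y A : C} {ι : Type*} (s : Finset ι) (φ : ι → (A ⊗ X ⟶ Y ⊗ A)) :
    rep k A (∑ i ∈ s, φ i) = ∑ i ∈ s, rep k A (φ i) := map_sum (repₗ k A) φ s

/-- `htr` is additive and linear. -/
instance : (htr k C).Additive where
  map_add {X Y f g} := by
    refine Eq.trans ?_ ((cls k (𝟙_ C)).map_add _ _)
    refine congrArg (cls k (𝟙_ C)) ?_
    simp
    rfl

instance : (htr k C).Linear k where
  map_smul {X Y} f r := by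
    refine Eq.trans ?_ ((cls k (𝟙_ C)).map_smul _ _)
    refine congrArg (cls k (𝟙_ C)) ?_
    simp
    rfl

/-- Every object is an image under the additive functor `htr`, which preserves biproducts. -/
instance [HasFiniteBiproducts C] : HasFiniteBiproducts (HTr k C) where
  out _ := ⟨fun F => ⟨⟨{
    bicone := (htr k C).mapBicone (biproduct.bicone fun j => (F j).obj)
    isBilimit := isBilimitOfPreserves (htr k C) (biproduct.isBilimit fun j => (F j).obj) }⟩⟩⟩

end rep

section tensor
variable [MonoidalPreadditive C] [MonoidalLinear k C] [BraidedCategory C]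

instance : MonoidalPreadditive (HTr k C) where
  whiskerLeft_zero := (leftₗ k _ _ _).map_zero
  zero_whiskerRight := (rightₗ k _ _ _).map_zero
  whiskerLeft_add f g := (leftₗ k _ _ _).map_add f g
  add_whiskerRight f g := (rightₗ k _ _ _).map_add f g

instance : MonoidalLinear k (HTr k C) where
  whiskerLeft_smul _ _ _ r f := (leftₗ k _ _ _).map_smul r f
  smul_whiskerRight r _ _ f _ := (rightₗ k _ _ _).map_smul r f

/-- Every morphism of the horizontal trace comes from those represented by identities. -/
theorem cls_eq_loop {X Y A B : C} [ExactPairing A B] (φ : A ⊗ X ⟶ Y ⊗ A) :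
    compₗ k X (A ⊗ (X ⊗ B)) Y
        (incl k (𝟙 _ ⊗≫ X ◁ η_ A B ⊗≫ (β_ X A).hom ▷ B ⊗≫ 𝟙 (A ⊗ (X ⊗ B))))
      (compₗ k (A ⊗ (X ⊗ B)) (A ⊗ (X ⊗ B)) Y (rightₗ k A A (X ⊗ B) (cls k A (𝟙 (A ⊗ A))))
        (incl k (𝟙 (A ⊗ (X ⊗ B)) ⊗≫ φ ▷ B ⊗≫ Y ◁ ((β_ A B).hom ≫ ε_ A B) ⊗≫ 𝟙 _))) =
    cls k A φ := by
  -- The braided cup and cap make `A` a dual of `B` with the sides exchanged; their zigzag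
  -- straightens the loop of `A`.
  have hz : A ◁ (η_ A B ≫ (β_ B A).inv) ⊗≫ ((β_ A B).hom ≫ ε_ A B) ▷ A =
      (ρ_ _).hom ≫ (λ_ _).inv := by
    let p : ExactPairing B A := BraidedCategory.exactPairing_swap A B
    exact coevaluation_zigzag B A
  rw [rightₗ_cls, compₗ_incl, incl_compₗ]
  congr 1
  dsimp only [rightAux]
  rw [BraidedCategory.braiding_tensor_left_inv]
  calc _ = 𝟙 _ ⊗≫ A ◁ X ◁ η_ A B ⊗≫ A ◁ ((β_ X A).hom ≫ (β_ X A).inv) ▷ B ⊗≫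
        (A ⊗ X) ◁ (β_ B A).inv ⊗≫ φ ▷ (B ⊗ A) ⊗≫ Y ◁ ((β_ A B).hom ≫ ε_ A B) ▷ A ⊗≫ 𝟙 _ := by
        monoidal
    _ = 𝟙 _ ⊗≫ ((A ⊗ X) ◁ (η_ A B ≫ (β_ B A).inv) ≫ φ ▷ (B ⊗ A)) ⊗≫
        Y ◁ ((β_ A B).hom ≫ ε_ A B) ▷ A ⊗≫ 𝟙 _ := by
        rw [Iso.hom_inv_id]; monoidal
    _ = φ ⊗≫ Y ◁ (A ◁ (η_ A B ≫ (β_ B A).inv) ⊗≫ ((β_ A B).hom ≫ ε_ A B) ▷ A) ⊗≫ 𝟙 _ := by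
        rw [whisker_exchange]; monoidal
    _ = φ := by rw [hz]; monoidal

variable [RightRigidCategory C]

/-- The morphism of `C` representing the mate of the class of `φ`. -/
def mateAux {X Y A : C} (φ : A ⊗ X ⟶ Y ⊗ A) : A ⊗ (Yᘁ : C) ⟶ (Xᘁ : C) ⊗ A :=
  (β_ A (Yᘁ)).hom ⊗≫ ((Yᘁ : C) ⊗ A) ◁ η_ X (Xᘁ) ⊗≫ (Yᘁ : C) ◁ φ ▷ (Xᘁ : C) ⊗≫
    ε_ Y (Yᘁ) ▷ (A ⊗ (Xᘁ : C)) ⊗≫ (β_ (Xᘁ : C) A).inv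

/-- Naturality of the inverse braiding for the evaluation: the strand `A` is pulled off the cap. -/
theorem braiding_inv_ev (X A : C) :
    (β_ (Xᘁ : C) A).inv ▷ X ⊗≫ (Xᘁ : C) ◁ (β_ X A).inv ⊗≫ ε_ X (Xᘁ) ▷ A =
      𝟙 _ ⊗≫ A ◁ ε_ X (Xᘁ) ⊗≫ 𝟙 _ := by
  have h := BraidedCategory.braiding_inv_naturality_right A (ε_ X (Xᘁ))
  rw [BraidedCategory.braiding_tensor_left_inv, braiding_inv_tensorUnit_left] at h
  calc _ = 𝟙 _ ⊗≫ (((α_ A _ X).inv ≫ (β_ (Xᘁ : C) A).inv ▷ X ≫ (α_ _ _ _).hom ≫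
        (Xᘁ : C) ◁ (β_ X A).inv ≫ (α_ _ _ _).inv) ≫ ε_ X (Xᘁ) ▷ A) := by monoidal
    _ = _ := by
      have h' := h.symm
      simp only [Category.assoc] at h' ⊢
      rw [h']; monoidal

/-- Whiskering in the horizontal trace makes the strand `A` cross the two dual objects, which
produces the two braidings of `mateAux`. Applied to a half-braiding this is the half-braiding of the
dual. -/
theorem mate_rep {X Y A : C} (φ : A ⊗ X ⟶ Y ⊗ A) :
    ((rep k A φ)ᘁ) = rep k A (mateAux φ) := by
  apply rightDual_hom_ext (X := (⟨X⟩ : HTr k C)) (Y := ((⟨X⟩ : HTr k C)ᘁ))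
  refine (rightAdjointMate_comp_evaluation (rep k A φ)).trans ?_
  change compₗ k _ _ _ (leftₗ k (Yᘁ) _ _ (cls k A φ)) (incl k (ε_ Y (Yᘁ))) =
    compₗ k _ _ _ (rightₗ k _ _ X (cls k A _)) (incl k (ε_ X (Xᘁ)))
  rw [rightₗ_cls, leftₗ_cls, compₗ_incl, compₗ_incl]
  congr 1
  symm
  calc _ = 𝟙 _ ⊗≫ (β_ A (Yᘁ)).hom ▷ X ⊗≫ ((Yᘁ : C) ⊗ A) ◁ η_ X (Xᘁ) ▷ X ⊗≫
        (Yᘁ : C) ◁ φ ▷ ((Xᘁ : C) ⊗ X) ⊗≫ ε_ Y (Yᘁ) ▷ (A ⊗ (Xᘁ : C) ⊗ X) ⊗≫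
        ((β_ (Xᘁ : C) A).inv ▷ X ⊗≫ (Xᘁ : C) ◁ (β_ X A).inv ⊗≫ ε_ X (Xᘁ) ▷ A) := by
        dsimp only [mateAux, rightAux]; monoidal
    _ = 𝟙 _ ⊗≫ (β_ A (Yᘁ)).hom ▷ X ⊗≫ ((Yᘁ : C) ⊗ A) ◁ η_ X (Xᘁ) ▷ X ⊗≫
        (Yᘁ : C) ◁ φ ▷ ((Xᘁ : C) ⊗ X) ⊗≫ (ε_ Y (Yᘁ) ▷ ((A ⊗ (Xᘁ : C)) ⊗ X) ≫
          𝟙_ C ◁ (𝟙 _ ⊗≫ A ◁ ε_ X (Xᘁ))) ⊗≫ 𝟙 _ := by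
        rw [braiding_inv_ev]; monoidal
    _ = 𝟙 _ ⊗≫ (β_ A (Yᘁ)).hom ▷ X ⊗≫ ((Yᘁ : C) ⊗ A) ◁ η_ X (Xᘁ) ▷ X ⊗≫
        (Yᘁ : C) ◁ (φ ▷ ((Xᘁ : C) ⊗ X) ≫ (Y ⊗ A) ◁ ε_ X (Xᘁ)) ⊗≫ ε_ Y (Yᘁ) ▷ A ⊗≫ 𝟙 _ := by
        rw [← whisker_exchange]; monoidal
    _ = 𝟙 _ ⊗≫ (β_ A (Yᘁ)).hom ▷ X ⊗≫ ((Yᘁ : C) ⊗ A) ◁ (η_ X (Xᘁ) ▷ X ⊗≫ X ◁ ε_ X (Xᘁ)) ⊗≫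
        (Yᘁ : C) ◁ φ ⊗≫ ε_ Y (Yᘁ) ▷ A ⊗≫ 𝟙 _ := by
        rw [← whisker_exchange]; monoidal
    _ = _ := by rw [evaluation_zigzag]; dsimp only [leftAux]; monoidal

theorem mate_map {X Y : C} (f : X ⟶ Y) :
    (((htr k C).map f)ᘁ) = (htr k C).map (fᘁ) := by
  apply rightDual_hom_ext (X := (⟨X⟩ : HTr k C)) (Y := ((⟨X⟩ : HTr k C)ᘁ))
  refine (rightAdjointMate_comp_evaluation ((htr k C).map f)).trans ?_
  have h := congrArg (htr k C).map (rightAdjointMate_comp_evaluation f)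
  rw [(htr k C).map_comp, (htr k C).map_comp, ← htr_whiskerLeft, ← htr_whiskerRight] at h
  exact h.symm

end tensor
end HTr

end

/-! ### The pivotal structure of the horizontal trace -/

section

instance {C : Type u₁} [Category.{v₁} C] [MonoidalCategory C] [RightRigidCategory C] (X Y : C) :
    IsIso (dualTensor X Y) :=
  isIso_of_comp_ev (X := X ⊗ Y) _ (dualTensor_comp_ev X Y)

section mate
variable {C : Type u₁} [Category.{v₁} C] [MonoidalCategory C] [RightRigidCategory C]
  [Preadditive C] [MonoidalPreadditive C]

theorem mate_add {X Y : C} (f g : X ⟶ Y) : ((f + g)ᘁ) = (fᘁ) + (gᘁ) := by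
  apply rightDual_hom_ext (X := X) (Y := Xᘁ)
  rw [rightAdjointMate_comp_evaluation]
  simp only [MonoidalPreadditive.whiskerLeft_add, MonoidalPreadditive.add_whiskerRight,
    Preadditive.add_comp, rightAdjointMate_comp_evaluation]

theorem mate_zero {X Y : C} : ((0 : X ⟶ Y)ᘁ) = 0 := by
  apply rightDual_hom_ext (X := X) (Y := Xᘁ)
  rw [rightAdjointMate_comp_evaluation]
  simp

end mate

namespace HTr
variable {k : Type w} [CommRing k] {C : Type u₁} [Category.{v₁} C] [MonoidalCategory C]
  [Preadditive C] [Linear k C] [MonoidalPreadditive C] [MonoidalLinear k C] [BraidedCategory C]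
  [RightRigidCategory C] (P : PivotalStructure C)

theorem dualTensor_eq (X Y : C) :
    dualTensor (⟨X⟩ : HTr k C) ⟨Y⟩ = (htr k C).map (dualTensor X Y) := by
  apply rightDual_hom_ext (X := (⟨X⟩ : HTr k C) ⊗ ⟨Y⟩) (Y := ((⟨X⟩ : HTr k C) ⊗ ⟨Y⟩)ᘁ)
  rw [dualTensor_comp_ev]
  have h := congrArg (htr k C).map (dualTensor_comp_ev X Y)
  rw [(htr k C).map_comp, ← htr_whiskerRight] at h
  refine Eq.trans ?_ h.symm
  have h1 : evPair X Y = (α_ _ _ _).hom ≫ (Yᘁ : C) ◁ ((α_ _ _ _).inv ≫ ε_ X (Xᘁ) ▷ Y ≫ (λ_ _).hom)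
      ≫ ε_ Y (Yᘁ) := by dsimp only [evPair]; monoidal
  have h2 : evPair (⟨X⟩ : HTr k C) ⟨Y⟩ = (α_ _ _ _).hom ≫ ((⟨Y⟩ : HTr k C)ᘁ : HTr k C) ◁
      ((α_ _ _ _).inv ≫ ε_ (⟨X⟩ : HTr k C) ((⟨X⟩ : HTr k C)ᘁ) ▷ (⟨Y⟩ : HTr k C) ≫ (λ_ _).hom)
      ≫ ε_ (⟨Y⟩ : HTr k C) ((⟨Y⟩ : HTr k C)ᘁ) := by dsimp only [evPair]; monoidal
  rw [h1, h2]
  simp only [Functor.map_comp, ← htr_whiskerLeft, ← htr_whiskerRight]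
  rfl

/-- The isomorphisms `X ≅ Xᘁᘁ` of the horizontal trace. -/
def pivotalIso (X : HTr k C) : X ≅ ((Xᘁ : HTr k C)ᘁ : HTr k C) := (htr k C).mapIso (P.iso X.obj)

theorem pivotalIso_tensor (X Y : HTr k C) :
    (pivotalIso P (X ⊗ Y)).hom ≫ ((dualTensor X Y)ᘁ) =
      ((pivotalIso P X).hom ⊗ₘ (pivotalIso P Y).hom) ≫ dualTensor (Yᘁ) (Xᘁ) := by
  have h := congrArg (htr k C).map (P.tensor X.obj Y.obj)
  rw [MonoidalCategory.tensorHom_def, Functor.map_comp, Functor.map_comp, Functor.map_comp,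
    ← mate_map, ← dualTensor_eq, ← htr_whiskerLeft, ← htr_whiskerRight] at h
  rw [MonoidalCategory.tensorHom_def]
  refine h.trans ?_
  congr 1
  exact (dualTensor_eq _ _).symm

/-- The naturality of `pivotalIso` with respect to a morphism. -/
def PivotalNatural {X Y : HTr k C} (f : X ⟶ Y) : Prop :=
  (pivotalIso P X).hom ≫ (fᘁᘁ) = f ≫ (pivotalIso P Y).hom

variable {P}

theorem PivotalNatural.comp {X Y Z : HTr k C} {f : X ⟶ Y} {g : Y ⟶ Z} (hf : PivotalNatural P f)
    (hg : PivotalNatural P g) : PivotalNatural P (f ≫ g) := by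
  rw [PivotalNatural, comp_rightAdjointMate, comp_rightAdjointMate, reassoc_of% hf, hg,
    Category.assoc]

theorem PivotalNatural.map {X Y : C} (f : X ⟶ Y) : PivotalNatural P ((htr k C).map f) := by
  have h := congrArg (htr k C).map (P.naturality f)
  rw [Functor.map_comp, Functor.map_comp, ← mate_map, ← mate_map] at h
  exact h

/-- Through `dualTensor`, monoidality of the pivotal isomorphism reduces naturality at `f ▷ Z` to
naturality at `f`. -/
theorem PivotalNatural.whiskerRight {X Y : HTr k C} {f : X ⟶ Y} (hf : PivotalNatural P f)
    (Z : HTr k C) : PivotalNatural P (f ▷ Z) := by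
  have h1 := dualTensor_natural f (𝟙 Z)
  rw [tensorHom_id, rightAdjointMate_id, id_tensorHom] at h1
  have h2 := dualTensor_natural (𝟙 (Zᘁ)) (fᘁ)
  rw [id_tensorHom, rightAdjointMate_id, tensorHom_id] at h2
  rw [PivotalNatural, ← cancel_mono ((dualTensor Y Z)ᘁ), Category.assoc, ← comp_rightAdjointMate,
    ← h1, comp_rightAdjointMate, reassoc_of% (pivotalIso_tensor P X Z), ← h2, Category.assoc,
    pivotalIso_tensor, ← Category.assoc, ← Category.assoc, ← tensorHom_id, ← tensorHom_id,
    tensorHom_comp_tensorHom, tensorHom_comp_tensorHom, hf, Category.comp_id, Category.id_comp]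

/-- The comparison of `A` with its double dual given by the braiding. -/
def drinfeld (A : C) : A ⟶ ((Aᘁ : C)ᘁ : C) :=
  𝟙 _ ⊗≫ A ◁ η_ (Aᘁ : C) ((Aᘁ)ᘁ) ⊗≫ ((β_ A (Aᘁ)).hom ≫ ε_ A (Aᘁ)) ▷ ((Aᘁ : C)ᘁ : C) ⊗≫ 𝟙 _

/-- The inverse of `drinfeld`. -/
def drinfeldInv (A : C) : ((Aᘁ : C)ᘁ : C) ⟶ A :=
  𝟙 _ ⊗≫ ((Aᘁ : C)ᘁ : C) ◁ (η_ A (Aᘁ) ≫ (β_ (Aᘁ) A).inv) ⊗≫ ε_ (Aᘁ : C) ((Aᘁ)ᘁ) ▷ A ⊗≫ 𝟙 _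

/-- The braiding makes `A` a dual of `Aᘁ`, next to `Aᘁᘁ`; the two morphisms are the comparisons of
these two duals. -/
theorem drinfeldInv_drinfeld (A : C) : drinfeldInv A ≫ drinfeld A = 𝟙 _ := by
  let p : ExactPairing (Aᘁ : C) A := BraidedCategory.exactPairing_swap A (Aᘁ)
  have h1 : drinfeld A ▷ (Aᘁ : C) ≫ ε_ (Aᘁ : C) ((Aᘁ)ᘁ) = (β_ A (Aᘁ)).hom ≫ ε_ A (Aᘁ) :=
    transpose_comp_ev _
  have h2 : drinfeldInv A ▷ (Aᘁ : C) ≫ ((β_ A (Aᘁ)).hom ≫ ε_ A (Aᘁ)) = ε_ (Aᘁ : C) ((Aᘁ)ᘁ) :=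
    transpose_comp_ev (X := (Aᘁ : C)) (Y := A) (ε_ (Aᘁ : C) ((Aᘁ)ᘁ))
  apply rightDual_hom_ext (X := (Aᘁ : C)) (Y := ((Aᘁ : C)ᘁ : C))
  rw [comp_whiskerRight, Category.assoc, h1, h2]
  simp

/-- The two strands are reconnected: the mate factors through the unit as a cap followed by a cup.
-/
theorem mateAux_id (A : C) : mateAux (𝟙 (A ⊗ A)) =
    ((β_ A (Aᘁ)).hom ≫ ε_ A (Aᘁ)) ≫ (η_ A (Aᘁ) ≫ (β_ (Aᘁ) A).inv) := by
  calc _ = (β_ A (Aᘁ)).hom ⊗≫ (((Aᘁ : C) ⊗ A) ◁ η_ A (Aᘁ) ≫ ε_ A (Aᘁ) ▷ (A ⊗ (Aᘁ : C))) ⊗≫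
        (β_ (Aᘁ : C) A).inv := by dsimp only [mateAux]; monoidal
    _ = _ := by rw [whisker_exchange]; monoidal

theorem mateAux_mateAux_id (A : C) : mateAux (mateAux (𝟙 (A ⊗ A))) =
    drinfeld A ▷ ((Aᘁ : C)ᘁ : C) ≫ ((Aᘁ : C)ᘁ : C) ◁ drinfeldInv A := by
  rw [mateAux_id]
  have h := BraidedCategory.braiding_naturality (drinfeld A) (drinfeldInv A)
  calc _ = (β_ A ((Aᘁ : C)ᘁ : C)).hom ≫ (drinfeldInv A ⊗ₘ drinfeld A) ≫
        (β_ ((Aᘁ : C)ᘁ : C) A).inv := by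
        dsimp only [mateAux]
        rw [MonoidalCategory.tensorHom_def']
        dsimp only [drinfeld, drinfeldInv]
        monoidal
    _ = _ := by
        rw [← reassoc_of% h]
        simp [MonoidalCategory.tensorHom_def]

/-- The double mate of this class is represented by `drinfeld` on one side and `drinfeldInv` on the
other; sliding the first around the loop cancels the two and leaves the class of an identity. The
same sliding applied to the pivotal isomorphism is the asserted naturality, so no relation between
it and `drinfeld` is needed. -/
theorem PivotalNatural.rep_id (A : C) : PivotalNatural P (rep k A (𝟙 (A ⊗ A))) := by
  have h1 : ((((rep k A (𝟙 (A ⊗ A)))ᘁ))ᘁ) =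
      rep k ((Aᘁ : C)ᘁ : C) (𝟙 (((Aᘁ : C)ᘁ : C) ⊗ ((Aᘁ : C)ᘁ : C))) := by
    rw [mate_rep]
    refine (mate_rep _).trans ?_
    rw [mateAux_mateAux_id, rep_slide, ← MonoidalCategory.whiskerLeft_comp, drinfeldInv_drinfeld,
      MonoidalCategory.whiskerLeft_id]
  rw [PivotalNatural, h1]
  refine (map_comp_rep _ _).trans (Eq.trans ?_ (rep_comp_map _ _).symm)
  have h2 := rep_slide (k := k) (P.iso A).hom (𝟙 (((Aᘁ : C)ᘁ : C) ⊗ A))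
  rw [Category.comp_id, Category.id_comp] at h2
  exact (congrArg (rep k ((Aᘁ : C)ᘁ : C)) (Category.comp_id _)).trans
    (h2.symm.trans (congrArg (rep k A) (Category.id_comp _).symm))

/-- By `cls_eq_loop`, the class of `φ` is composed of two morphisms of `C` and a whiskering of the
class of the identity of `A ⊗ A`. -/
theorem PivotalNatural.all {X Y : HTr k C} (f : X ⟶ Y) : PivotalNatural P f := by
  induction f using rep_induction with
  | h0 => rw [PivotalNatural, mate_zero, mate_zero, zero_comp, comp_zero]
  | hadd x y hx hy =>
    rw [PivotalNatural, mate_add, mate_add, Preadditive.comp_add, hx, hy, Preadditive.add_comp]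
  | h A φ =>
    have h : PivotalNatural P _ := (PivotalNatural.map (k := k) (P := P)
      (𝟙 X.obj ⊗≫ X.obj ◁ η_ A (Aᘁ) ⊗≫ (β_ X.obj A).hom ▷ (Aᘁ : C) ⊗≫ 𝟙 (A ⊗ (X.obj ⊗ (Aᘁ : C))))).comp
      (((PivotalNatural.rep_id A).whiskerRight ⟨X.obj ⊗ (Aᘁ : C)⟩).comp
        (PivotalNatural.map (k := k) (P := P) (𝟙 (A ⊗ (X.obj ⊗ (Aᘁ : C))) ⊗≫ φ ▷ (Aᘁ : C) ⊗≫
          Y.obj ◁ ((β_ A (Aᘁ)).hom ≫ ε_ A (Aᘁ)) ⊗≫ 𝟙 Y.obj)))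
    have h2 := cls_eq_loop (k := k) (B := (Aᘁ : C)) φ
    rw [show rep k A φ = _ from h2.symm]
    exact h

variable (k P) in
/-- The pivotal structure of the horizontal trace. -/
def pivotalStructure : PivotalStructure (HTr k C) where
  iso := pivotalIso P
  naturality f := PivotalNatural.all f
  tensor := pivotalIso_tensor P

end HTr

end

/-! ### Half-braidings -/

section

section halfBraiding
variable {C : Type u₁} [Category.{v₁} C] [MonoidalCategory C]
open IrrData

theorem hb_naturality (X : Center C) {A B : C} (f : A ⟶ B) :
    f ▷ X.1 ≫ hb X B = hb X A ≫ X.1 ◁ f := by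
  rw [Iso.comp_inv_eq, Category.assoc, X.2.naturality, Iso.inv_hom_id_assoc]

theorem hb_tensor (X : Center C) (A B : C) :
    hb X (A ⊗ B) = (α_ A B X.1).hom ≫ A ◁ hb X B ≫ (α_ A X.1 B).inv ≫ hb X A ▷ B ≫
      (α_ X.1 A B).hom := by
  rw [← cancel_epi (X.2.β (A ⊗ B)).hom, Iso.hom_inv_id, X.2.monoidal]
  simp

/-- Up to unitors `w` is an endomorphism `u` of `Y`. The hypothesis says that `u` is idempotent, and
an invertible idempotent is the identity. -/
theorem eq_unitors_of_multiplicative {Y : C} (w : 𝟙_ C ⊗ Y ⟶ Y ⊗ 𝟙_ C) [IsIso w]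
    (h : (λ_ (𝟙_ C)).hom ▷ Y ≫ w = ((α_ (𝟙_ C) (𝟙_ C) Y).hom ≫ 𝟙_ C ◁ w ≫ (α_ _ Y _).inv ≫
      w ▷ 𝟙_ C ≫ (α_ Y _ _).hom) ≫ Y ◁ (λ_ (𝟙_ C)).hom) : w = (λ_ Y).hom ≫ (ρ_ Y).inv := by
  obtain ⟨u, hu⟩ : ∃ u : Y ⟶ Y, w = (λ_ Y).hom ≫ u ≫ (ρ_ Y).inv :=
    ⟨(λ_ Y).inv ≫ w ≫ (ρ_ Y).hom, by simp⟩
  have h2 : u ≫ 𝟙 Y = u ≫ u := by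
    calc _ = 𝟙 _ ⊗≫ ((λ_ (𝟙_ C)).hom ▷ Y ≫ w) ⊗≫ 𝟙 _ := by rw [hu]; monoidal
      _ = _ := by rw [h, hu]; monoidal
  have hi : IsIso u := by
    have : u = (λ_ Y).inv ≫ w ≫ (ρ_ Y).hom := by rw [hu]; simp
    rw [this]; infer_instance
  rw [cancel_epi] at h2
  rw [hu, ← h2, Category.id_comp]

theorem hb_unit (X : Center C) : hb X (𝟙_ C) = (λ_ X.1).hom ≫ (ρ_ X.1).inv := by
  have h1 := hb_naturality X (λ_ (𝟙_ C)).hom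
  rw [hb_tensor] at h1
  exact eq_unitors_of_multiplicative _ h1

theorem Center.Hom.hb_comm {X Y : Center C} (f : X ⟶ Y) (A : C) :
    A ◁ f.f ≫ hb Y A = hb X A ≫ f.f ▷ A := by
  rw [Iso.comp_inv_eq, Category.assoc, f.comm, Iso.inv_hom_id_assoc]

/-- A morphism commuting with the half-braidings. -/
def Center.homOfHb {X Y : Center C} (f : X.1 ⟶ Y.1) (h : ∀ A, A ◁ f ≫ hb Y A = hb X A ≫ f ▷ A) :
    X ⟶ Y where
  f := f
  comm A := by
    have := h A
    rw [Iso.comp_inv_eq, Category.assoc, Iso.eq_inv_comp] at this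
    exact this.symm

/-- In a rigid category, a multiplicative natural family is a half-braiding. -/
def halfBraidingOfFamily [RightRigidCategory C] {Y : C} (φ : ∀ A : C, A ⊗ Y ⟶ Y ⊗ A)
    (nat : ∀ {A B : C} (f : A ⟶ B), f ▷ Y ≫ φ B = φ A ≫ Y ◁ f)
    (mul : ∀ A B : C, φ (A ⊗ B) = (α_ A B Y).hom ≫ A ◁ φ B ≫ (α_ A Y B).inv ≫ φ A ▷ B ≫
      (α_ Y A B).hom)
    (one : φ (𝟙_ C) = (λ_ Y).hom ≫ (ρ_ Y).inv) : HalfBraiding Y :=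
  -- The inverse of `φ A` is `φ (Aᘁ)` rotated by a cup and a cap: multiplicativity joins the two
  -- into `φ (Aᘁ ⊗ A)`, naturality passes it through the evaluation, and the zigzag finishes.
  have hi : ∀ A : C, φ A ≫ (𝟙 _ ⊗≫ η_ A (Aᘁ) ▷ (Y ⊗ A) ⊗≫ A ◁ φ (Aᘁ) ▷ A ⊗≫ (A ⊗ Y) ◁ ε_ A (Aᘁ) ⊗≫
      𝟙 (A ⊗ Y)) = 𝟙 _ := fun A => by
    calc _ = 𝟙 _ ⊗≫ (𝟙_ C ◁ φ A ≫ η_ A (Aᘁ) ▷ (Y ⊗ A)) ⊗≫ A ◁ φ (Aᘁ) ▷ A ⊗≫ (A ⊗ Y) ◁ ε_ A (Aᘁ) ⊗≫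
          𝟙 (A ⊗ Y) := by monoidal
      _ = 𝟙 _ ⊗≫ η_ A (Aᘁ) ▷ (A ⊗ Y) ⊗≫ A ◁ (φ ((Aᘁ : C) ⊗ A) ≫ Y ◁ ε_ A (Aᘁ)) ⊗≫
          𝟙 (A ⊗ Y) := by rw [whisker_exchange, mul]; monoidal
      _ = 𝟙 _ ⊗≫ (η_ A (Aᘁ) ▷ A ⊗≫ A ◁ ε_ A (Aᘁ)) ▷ Y ⊗≫ 𝟙 _ := by rw [← nat, one]; monoidal
      _ = _ := by rw [evaluation_zigzag]; monoidal
  have hi' : ∀ A : C, (𝟙 _ ⊗≫ η_ A (Aᘁ) ▷ (Y ⊗ A) ⊗≫ A ◁ φ (Aᘁ) ▷ A ⊗≫ (A ⊗ Y) ◁ ε_ A (Aᘁ) ⊗≫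
      𝟙 (A ⊗ Y)) ≫ φ A = 𝟙 _ := fun A => by
    calc _ = 𝟙 _ ⊗≫ η_ A (Aᘁ) ▷ (Y ⊗ A) ⊗≫ A ◁ φ (Aᘁ) ▷ A ⊗≫ ((A ⊗ Y) ◁ ε_ A (Aᘁ) ≫ φ A ▷ 𝟙_ C) ⊗≫
          𝟙 (Y ⊗ A) := by monoidal
      _ = 𝟙 _ ⊗≫ (η_ A (Aᘁ) ▷ Y ≫ φ (A ⊗ (Aᘁ : C))) ▷ A ⊗≫ (Y ⊗ A) ◁ ε_ A (Aᘁ) ⊗≫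
          𝟙 (Y ⊗ A) := by rw [whisker_exchange, mul]; monoidal
      _ = 𝟙 _ ⊗≫ Y ◁ (η_ A (Aᘁ) ▷ A ⊗≫ A ◁ ε_ A (Aᘁ)) ⊗≫ 𝟙 _ := by rw [nat, one]; monoidal
      _ = _ := by rw [evaluation_zigzag]; monoidal
  { β := fun A => ⟨_, φ A, hi' A, hi A⟩
    monoidal := fun A B => by
      have := mono_of_mono_fac (hi (A ⊗ B))
      rw [← cancel_mono (φ (A ⊗ B))]
      refine (hi' (A ⊗ B)).trans ?_
      rw [mul]
      simp only [Category.assoc, Iso.inv_hom_id_assoc]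
      rw [← MonoidalCategory.whiskerLeft_comp_assoc, hi' B]
      simp only [MonoidalCategory.whiskerLeft_id, Category.id_comp, Iso.hom_inv_id_assoc]
      rw [← comp_whiskerRight_assoc, hi' A]
      simp
    naturality := fun {A B} f => by
      have := mono_of_mono_fac (hi B)
      rw [← cancel_mono (φ B), Category.assoc, Category.assoc, nat, hi' B, reassoc_of% (hi' A),
        Category.comp_id] }

variable [BraidedCategory C] [RightRigidCategory C]

/-- The mate of a half-braiding. -/
def mateHb (X : Center C) (A : C) : ((X.1)ᘁ : C) ⊗ A ⟶ A ⊗ ((X.1)ᘁ : C) :=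
  𝟙 _ ⊗≫ (((X.1)ᘁ : C) ⊗ A) ◁ η_ X.1 ((X.1)ᘁ) ⊗≫
    ((X.1)ᘁ : C) ◁ hb X A ▷ ((X.1)ᘁ : C) ⊗≫ ε_ X.1 ((X.1)ᘁ) ▷ (A ⊗ ((X.1)ᘁ : C)) ⊗≫ 𝟙 _

theorem dualHb_eq (X : Center C) (A : C) :
    dualHb X A = (β_ A ((X.1)ᘁ)).hom ≫ mateHb X A ≫ (β_ ((X.1)ᘁ : C) A).inv := by
  dsimp only [dualHb, mateHb]; monoidal

theorem mateHb_naturality (X : Center C) {A B : C} (f : A ⟶ B) :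
    ((X.1)ᘁ : C) ◁ f ≫ mateHb X B = mateHb X A ≫ f ▷ ((X.1)ᘁ : C) := by
  set Y : C := ((X.1)ᘁ : C)
  calc _ = 𝟙 _ ⊗≫ Y ◁ (f ▷ 𝟙_ C ≫ B ◁ η_ X.1 Y) ⊗≫
        Y ◁ hb X B ▷ Y ⊗≫ ε_ X.1 Y ▷ (B ⊗ Y) ⊗≫ 𝟙 _ := by
        dsimp only [mateHb]; monoidal
    _ = 𝟙 _ ⊗≫ Y ◁ A ◁ η_ X.1 Y ⊗≫ Y ◁ (f ▷ X.1 ≫ hb X B) ▷ Y ⊗≫ ε_ X.1 Y ▷ (B ⊗ Y) ⊗≫ 𝟙 _ := by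
        rw [← whisker_exchange]; monoidal
    _ = 𝟙 _ ⊗≫ Y ◁ A ◁ η_ X.1 Y ⊗≫ Y ◁ hb X A ▷ Y ⊗≫ ((Y ⊗ X.1) ◁ (f ▷ Y) ≫ ε_ X.1 Y ▷ (B ⊗ Y)) ⊗≫
          𝟙 _ := by
        rw [hb_naturality]; monoidal
    _ = _ := by
        rw [whisker_exchange]; dsimp only [mateHb]; monoidal

/-- The two mates are joined by a cap followed by a cup of `X.1`; the interchange law brings these
together and the zigzag removes them. The order of the factors is opposite to that in `hb_tensor`.
-/
theorem mateHb_tensor (X : Center C) (A B : C) :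
    mateHb X (A ⊗ B) = (α_ _ A B).inv ≫ mateHb X A ▷ B ≫ (α_ A _ B).hom ≫ A ◁ mateHb X B ≫
      (α_ A B _).inv := by
  set Y : C := ((X.1)ᘁ : C) with hY
  symm
  calc _ = 𝟙 _ ⊗≫ Y ◁ A ◁ η_ X.1 Y ▷ B ⊗≫ Y ◁ hb X A ▷ (Y ⊗ B) ⊗≫
        (ε_ X.1 Y ▷ ((A ⊗ Y ⊗ B) ⊗ 𝟙_ C) ≫ 𝟙_ C ◁ ((A ⊗ Y ⊗ B) ◁ η_ X.1 Y)) ⊗≫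
        (A ⊗ Y) ◁ hb X B ▷ Y ⊗≫ A ◁ ε_ X.1 Y ▷ (B ⊗ Y) ⊗≫ 𝟙 _ := by
        dsimp only [mateHb]; monoidal
    _ = 𝟙 _ ⊗≫ Y ◁ A ◁ η_ X.1 Y ▷ B ⊗≫ Y ◁ (hb X A ▷ ((Y ⊗ B) ⊗ 𝟙_ C) ≫
        (X.1 ⊗ A) ◁ ((Y ⊗ B) ◁ η_ X.1 Y)) ⊗≫
        (ε_ X.1 Y ▷ (A ⊗ Y ⊗ (B ⊗ X.1) ⊗ Y) ≫ 𝟙_ C ◁ (A ◁ Y ◁ hb X B ▷ Y)) ⊗≫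
          A ◁ ε_ X.1 Y ▷ (B ⊗ Y) ⊗≫ 𝟙 _ := by
        rw [← whisker_exchange]; monoidal
    _ = 𝟙 _ ⊗≫ Y ◁ A ◁ (η_ X.1 Y ▷ (B ⊗ 𝟙_ C) ≫ (X.1 ⊗ Y) ◁ (B ◁ η_ X.1 Y)) ⊗≫
        Y ◁ (hb X A ▷ (Y ⊗ (B ⊗ X.1) ⊗ Y) ≫ (X.1 ⊗ A) ◁ (Y ◁ hb X B ▷ Y)) ⊗≫
        (ε_ X.1 Y ▷ (A ⊗ (Y ⊗ X.1) ⊗ B ⊗ Y) ≫ 𝟙_ C ◁ (A ◁ ε_ X.1 Y ▷ (B ⊗ Y))) ⊗≫ 𝟙 _ := by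
        rw [← whisker_exchange, ← whisker_exchange]; monoidal
    _ = 𝟙 _ ⊗≫ Y ◁ A ◁ B ◁ η_ X.1 Y ⊗≫ Y ◁ A ◁ (η_ X.1 Y ▷ ((B ⊗ X.1) ⊗ Y) ≫
          (X.1 ⊗ Y) ◁ (hb X B ▷ Y)) ⊗≫ Y ◁ (hb X A ▷ ((Y ⊗ X.1) ⊗ B ⊗ Y) ≫
          (X.1 ⊗ A) ◁ (ε_ X.1 Y ▷ (B ⊗ Y))) ⊗≫ ε_ X.1 Y ▷ (A ⊗ B ⊗ Y) ⊗≫ 𝟙 _ := by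
        rw [← whisker_exchange, ← whisker_exchange, ← whisker_exchange]; monoidal
    _ = 𝟙 _ ⊗≫ Y ◁ A ◁ B ◁ η_ X.1 Y ⊗≫ Y ◁ A ◁ hb X B ▷ Y ⊗≫
        Y ◁ A ◁ (η_ X.1 Y ▷ X.1 ⊗≫ X.1 ◁ ε_ X.1 Y) ▷ (B ⊗ Y) ⊗≫ Y ◁ hb X A ▷ (B ⊗ Y) ⊗≫
        ε_ X.1 Y ▷ (A ⊗ B ⊗ Y) ⊗≫ 𝟙 _ := by
        rw [← whisker_exchange, ← whisker_exchange]; monoidal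
    _ = _ := by
        rw [evaluation_zigzag]; dsimp only [mateHb]; rw [hb_tensor]; monoidal

theorem mateHb_unit (X : Center C) : mateHb X (𝟙_ C) = (ρ_ _).hom ≫ (λ_ _).inv := by
  calc _ = 𝟙 _ ⊗≫ (((X.1)ᘁ : C) ◁ η_ X.1 ((X.1)ᘁ) ⊗≫ ε_ X.1 ((X.1)ᘁ) ▷ ((X.1)ᘁ : C)) ⊗≫ 𝟙 _ := by
        dsimp only [mateHb]; rw [hb_unit]; monoidal
    _ = _ := by rw [coevaluation_zigzag]; monoidal

/-- `β ≫ p` is an endomorphism of `A ⊗ Y` and `q ≫ β⁻¹` one of `Y ⊗ B`; the hypothesis lets the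
strands `A` and `B` be exchanged, and naturality of the braiding then pulls one double crossing past
the other. -/
theorem braiding_comp_commute {Y A B : C} (p : Y ⊗ A ⟶ A ⊗ Y) (q : Y ⊗ B ⟶ B ⊗ Y)
    (h : Y ◁ (β_ A B).hom ≫ (α_ Y B A).inv ≫ q ▷ A ≫ (α_ B Y A).hom ≫ B ◁ p ≫ (α_ B A Y).inv =
      ((α_ Y A B).inv ≫ p ▷ B ≫ (α_ A Y B).hom ≫ A ◁ q ≫ (α_ A B Y).inv) ≫ (β_ A B).hom ▷ Y) :
    ((β_ A Y).hom ≫ p) ▷ B ⊗≫ A ◁ (q ≫ (β_ Y B).inv) =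
      𝟙 _ ⊗≫ A ◁ (q ≫ (β_ Y B).inv) ⊗≫ ((β_ A Y).hom ≫ p) ▷ B ⊗≫ 𝟙 _ := by
  have h2 := BraidedCategory.braiding_naturality_right A q
  have h3 := BraidedCategory.braiding_inv_naturality_right B ((β_ A Y).hom ≫ p)
  rw [BraidedCategory.braiding_tensor_right_hom, BraidedCategory.braiding_tensor_right_hom] at h2
  rw [BraidedCategory.braiding_tensor_left_inv] at h3
  calc _ = 𝟙 _ ⊗≫ (β_ A Y).hom ▷ B ⊗≫ (((α_ _ A B).inv ≫ p ▷ B ≫ (α_ A _ B).hom ≫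
        A ◁ q ≫ (α_ A B _).inv) ≫ (β_ A B).hom ▷ Y) ⊗≫ (β_ A B).inv ▷ Y ⊗≫
        A ◁ (β_ Y B).inv ⊗≫ 𝟙 _ := by
        simp [monoidalComp]
    _ = 𝟙 _ ⊗≫ (((α_ A Y B).inv ≫ (β_ A Y).hom ▷ B ≫ (α_ Y A B).hom ≫ Y ◁ (β_ A B).hom ≫
        (α_ Y B A).inv) ≫ q ▷ A) ⊗≫ B ◁ p ⊗≫ (β_ A B).inv ▷ Y ⊗≫
        A ◁ (β_ Y B).inv ⊗≫ 𝟙 _ := by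
        rw [← h]; monoidal
    _ = 𝟙 _ ⊗≫ A ◁ q ⊗≫ (β_ A B).hom ▷ Y ⊗≫ (B ◁ ((β_ A Y).hom ≫ p) ≫
        ((α_ B A Y).inv ≫ (β_ A B).inv ▷ Y ≫ (α_ A B Y).hom ≫ A ◁ (β_ Y B).inv ≫
          (α_ A Y B).inv)) ⊗≫ 𝟙 _ := by
        rw [← h2]; monoidal
    _ = 𝟙 _ ⊗≫ A ◁ q ⊗≫ ((β_ A B).hom ≫ (β_ A B).inv) ▷ Y ⊗≫ A ◁ (β_ Y B).inv ⊗≫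
        ((β_ A Y).hom ≫ p) ▷ B ⊗≫ 𝟙 _ := by
        rw [h3]; monoidal
    _ = _ := by rw [Iso.hom_inv_id]; monoidal

/-- The required compatibility is naturality of the mate at `β_ A B`, expanded by multiplicativity.
It restores the correct order of the factors in the half-braiding of the dual. -/
theorem mateHb_commute (X : Center C) (A B : C) :
    ((β_ A ((X.1)ᘁ)).hom ≫ mateHb X A) ▷ B ⊗≫ A ◁ (mateHb X B ≫ (β_ ((X.1)ᘁ : C) B).inv) =
      𝟙 _ ⊗≫ A ◁ (mateHb X B ≫ (β_ ((X.1)ᘁ : C) B).inv) ⊗≫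
        ((β_ A ((X.1)ᘁ)).hom ≫ mateHb X A) ▷ B ⊗≫ 𝟙 _ := by
  apply braiding_comp_commute
  have h1 := mateHb_naturality X (β_ A B).hom
  rwa [mateHb_tensor, mateHb_tensor] at h1

/-- The half-braiding of the dual for the reduced tensor product. -/
def dualHalfBraiding (X : Center C) : HalfBraiding ((X.1)ᘁ : C) :=
  halfBraidingOfFamily (dualHb X)
    (fun {A B} f => by
      rw [dualHb_eq, dualHb_eq, BraidedCategory.braiding_naturality_left_assoc,
        reassoc_of% (mateHb_naturality X f), BraidedCategory.braiding_inv_naturality_left]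
      simp)
    (fun A B => by
      set Y : C := ((X.1)ᘁ : C)
      simp only [dualHb_eq]
      rw [BraidedCategory.braiding_tensor_left_hom, mateHb_tensor,
        BraidedCategory.braiding_tensor_right_inv]
      calc _ = 𝟙 _ ⊗≫ A ◁ (β_ B Y).hom ⊗≫ (((β_ A Y).hom ≫ mateHb X A) ▷ B ⊗≫
            A ◁ (mateHb X B ≫ (β_ Y B).inv)) ⊗≫ (β_ Y A).inv ▷ B ⊗≫ 𝟙 _ := by monoidal
        _ = _ := by rw [mateHb_commute]; monoidal)
    (by
      rw [dualHb_eq, mateHb_unit, braiding_tensorUnit_left, braiding_inv_tensorUnit_right]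
      simp)

/-- The dual for the reduced tensor product. -/
def dualCenter (X : Center C) : Center C := ⟨((X.1)ᘁ : C), dualHalfBraiding X⟩

end halfBraiding

end

/-! ### The encircling idempotent -/

section

variable {k : Type w} [Field k] [IsAlgClosed k] {C : Type u} [Category.{v} C] [Abelian C]
    [Linear k C] [MonoidalCategory C] [MonoidalPreadditive C] [MonoidalLinear k C]
    [BraidedCategory C] [RightRigidCategory C] [PremodularCategory k C]
open HTr PivotalStructure

namespace HTr
variable {k : Type w} [CommRing k] {C : Type u₁} [Category.{v₁} C] [MonoidalCategory C]
  [Preadditive C] [Linear k C] [MonoidalPreadditive C] [MonoidalLinear k C]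

variable (k) in
/-- The image of a morphism of `C` in the horizontal trace, with the objects in canonical form. -/
def ofHom {X Y : C} (f : X ⟶ Y) : (⟨X⟩ : HTr k C) ⟶ ⟨Y⟩ := (htr k C).map f

theorem ofHom_id (X : C) : ofHom k (𝟙 X) = 𝟙 _ := rfl

theorem ofHom_comp {X Y Z : C} (f : X ⟶ Y) (g : Y ⟶ Z) :
    ofHom k (f ≫ g) = ofHom k f ≫ ofHom k g := (htr k C).map_comp f g

theorem ofHom_add {X Y : C} (f g : X ⟶ Y) : ofHom k (f + g) = ofHom k f + ofHom k g :=
  (htr k C).map_add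

theorem ofHom_smul {X Y : C} (c : k) (f : X ⟶ Y) : ofHom k (c • f) = c • ofHom k f :=
  (htr k C).map_smul c f

theorem ofHom_zero {X Y : C} : ofHom k (0 : X ⟶ Y) = 0 := (htr k C).map_zero X Y

theorem ofHom_sum {X Y : C} {ι : Type*} (s : Finset ι) (f : ι → (X ⟶ Y)) :
    ofHom k (∑ i ∈ s, f i) = ∑ i ∈ s, ofHom k (f i) := (htr k C).map_sum f s

theorem rep_comp_ofHom {X Y Z A : C} (φ : A ⊗ X ⟶ Y ⊗ A) (f : Y ⟶ Z) :
    rep k A φ ≫ ofHom k f = rep k A (φ ≫ f ▷ A) := compₗ_incl φ f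

theorem ofHom_comp_rep {X Y Z A : C} (f : X ⟶ Y) (φ : A ⊗ Y ⟶ Z ⊗ A) :
    ofHom k f ≫ rep k A φ = rep k A (A ◁ f ≫ φ) := incl_compₗ f φ

end HTr

namespace IrrData
variable (D : IrrData k C)

/-- The bases are dual for the trace, not for the scalar of an endomorphism of `X j`; hence the
inverse dimension. -/
theorem bas_comp_dua (j : D.ι) (V : C) (α) :
    D.bas j V α ≫ D.dua j V α = (dim k (D.X j))⁻¹ • 𝟙 (D.X j) := by
  rw [D.endo_eq j (_ ≫ _), tr_bas_dua, if_pos rfl, one_div]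

theorem sum_bas_comp_dua (j : D.ι) (V : C) :
    ∑ α, D.bas j V α ≫ D.dua j V α = (D.mult (D.X j) V * (dim k (D.X j))⁻¹) • 𝟙 (D.X j) := by
  simp [bas_comp_dua, mul_smul, Nat.cast_smul_eq_nsmul]

/-- Resolving the label of a class into simple objects. -/
theorem rep_eq_sum {V W U : C} (ψ : U ⊗ V ⟶ W ⊗ U) :
    rep k U ψ = ∑ j, dim k (D.X j) • ∑ α,
      rep k (D.X j) (D.bas j U α ▷ V ≫ ψ ≫ W ◁ D.dua j U α) := by
  have h : ψ = ∑ j, dim k (D.X j) • ∑ α, (D.dua j U α ▷ V ≫ D.bas j U α ▷ V ≫ ψ) := by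
    conv_lhs => rw [← Category.id_comp ψ, ← id_whiskerRight, ← D.sum_dua_bas U]
    simp [sum_whiskerRight, Preadditive.sum_comp]
  conv_lhs => rw [h]
  simp only [rep_sum, rep_smul]
  refine Finset.sum_congr rfl fun j _ => ?_
  congr 1
  refine Finset.sum_congr rfl fun α _ => ?_
  rw [rep_slide]
  simp

/-- By naturality of the half-braiding each basis element of `Hom (X j, U)` contributes the same
class, so only the multiplicities of the label matter. -/
theorem rep_hb_eq (X : Center C) (U : C) :
    rep k U (hb X U) = ∑ j, (D.mult (D.X j) U : k) • rep k (D.X j) (hb X (D.X j)) := by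
  rw [D.rep_eq_sum]
  refine Finset.sum_congr rfl fun j _ => ?_
  have : ∀ α, D.bas j U α ▷ X.1 ≫ hb X U ≫ X.1 ◁ D.dua j U α =
      (dim k (D.X j))⁻¹ • hb X (D.X j) := fun α => by
    rw [← Category.assoc, hb_naturality, Category.assoc, ← MonoidalCategory.whiskerLeft_comp,
      bas_comp_dua]
    simp
  simp only [this, rep_smul]
  rw [Finset.sum_const, Finset.card_univ, Fintype.card_fin, ← Nat.cast_smul_eq_nsmul k, smul_smul,
    smul_smul, mul_comm (dim k (D.X j)), mul_inv_cancel_right₀ (D.dim_X_ne_zero j)]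

/-- The idempotent of the horizontal trace encircling an object of the center by the regular
colour through its half-braiding. -/
def encircle (X : Center C) : (⟨X.1⟩ : HTr k C) ⟶ ⟨X.1⟩ :=
  (D.tot)⁻¹ • ∑ i, dim k (D.X i) • rep k (D.X i) (hb X (D.X i))

/-- The regular colour is invariant under duality. Labels in this form can be absorbed by
`rep_comp_encircle`. -/
theorem encircle_eq_dual (X : Center C) :
    D.encircle X = (D.tot)⁻¹ • ∑ i, dim k (D.X i) • rep k ((D.X i)ᘁ : C) (hb X ((D.X i)ᘁ)) := by
  rw [encircle]
  congr 1
  simp only [D.rep_hb_eq X ((D.X _)ᘁ : C), Finset.smul_sum, smul_smul]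
  rw [Finset.sum_comm]
  refine Finset.sum_congr rfl fun j _ => ?_
  rw [← Finset.sum_smul, D.sum_dim_mult_rightDual]

theorem ofHom_comp_encircle {X Y : Center C} (f : X ⟶ Y) :
    ofHom k f.f ≫ D.encircle Y = D.encircle X ≫ ofHom k f.f := by
  rw [encircle, encircle, Linear.comp_smul, Linear.smul_comp, Preadditive.comp_sum,
    Preadditive.sum_comp]
  congr 1
  refine Finset.sum_congr rfl fun i _ => ?_
  rw [Linear.comp_smul, Linear.smul_comp]
  congr 1
  rw [ofHom_comp_rep, rep_comp_ofHom, f.hb_comm]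

/-- The closure of a morphism over an object of the center, through the half-braiding. -/
def closure (Y : Center C) {V : C} (B : C) (ψ : (Bᘁ : C) ⊗ V ⟶ Y.1 ⊗ (Bᘁ : C)) : V ⟶ Y.1 :=
  𝟙 _ ⊗≫ η_ B (Bᘁ) ▷ V ⊗≫ B ◁ ψ ⊗≫ hb Y B ▷ (Bᘁ : C) ⊗≫
    Y.1 ◁ (PremodularCategory.piv k (C := C)).ev B ⊗≫ 𝟙 _

/-- The label is resolved by the rotations of dual bases for `X i ⊗ B`, so that a later sum over `j`
can be recognized as the decomposition of the identity of `X i ⊗ B`. -/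
theorem rep_eq_sum_rot {V W B : C} (j : D.ι)
    (χ : (D.X j ⊗ (Bᘁ : C)) ⊗ V ⟶ W ⊗ (D.X j ⊗ (Bᘁ : C))) :
    rep k (D.X j ⊗ (Bᘁ : C)) χ = ∑ i, dim k (D.X i) • ∑ α, rep k (D.X i)
      (rotUp (D.dua j (D.X i ⊗ B) α) ▷ V ≫ χ ≫
        W ◁ (PremodularCategory.piv k (C := C)).rotDown (D.bas j (D.X i ⊗ B) α)) := by
  conv_lhs => rw [← Category.id_comp χ, ← id_whiskerRight, ← D.sum_rotDown_rotUp j B]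
  simp only [sum_whiskerRight, Preadditive.sum_comp,
    MonoidalLinear.smul_whiskerRight, Linear.smul_comp, rep_sum, rep_smul]
  refine Finset.sum_congr rfl fun i _ => ?_
  congr 1
  refine Finset.sum_congr rfl fun α _ => ?_
  rw [comp_whiskerRight, Category.assoc, rep_slide, Category.assoc]

/-- Absorption. The composite has labels `X j ⊗ Bᘁ`; resolving them into simple labels `X i` by
rotated bases exchanges the roles of the sums. For fixed `i`, the sum over `j` is the decomposition
of the identity of `X i ⊗ B`, and multiplicativity of the half-braiding separates a loop `X i`
around `Y` from a closure of `ψ` along `B`. -/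
theorem rep_comp_encircle (Y : Center C) {V B : C} (ψ : (Bᘁ : C) ⊗ V ⟶ Y.1 ⊗ (Bᘁ : C)) :
    rep k (Bᘁ : C) ψ ≫ D.encircle Y = ofHom k (closure (k := k) Y B ψ) ≫ D.encircle Y := by
  set P := PremodularCategory.piv k (C := C)
  -- Naturality of the half-braiding brings the two members of a dual pair next to each other.
  have hmove : ∀ i j α, rotUp (D.dua j (D.X i ⊗ B) α) ▷ V ≫
        compAux ψ (hb Y (D.X j)) ≫ Y.1 ◁ P.rotDown (D.bas j (D.X i ⊗ B) α) =
      𝟙 _ ⊗≫ D.X i ◁ η_ B (Bᘁ) ▷ V ⊗≫ (D.X i ⊗ B) ◁ ψ ⊗≫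
        (D.dua j (D.X i ⊗ B) α ≫ D.bas j (D.X i ⊗ B) α) ▷ (Y.1 ⊗ (Bᘁ : C)) ⊗≫
        hb Y (D.X i ⊗ B) ▷ (Bᘁ : C) ⊗≫ (Y.1 ⊗ D.X i) ◁ P.ev B ⊗≫ 𝟙 _ := fun i j α => by
    generalize D.dua j (D.X i ⊗ B) α = g
    generalize D.bas j (D.X i ⊗ B) α = f
    calc _ = 𝟙 _ ⊗≫ D.X i ◁ η_ B (Bᘁ) ▷ V ⊗≫ (g ▷ ((Bᘁ : C) ⊗ V) ≫ D.X j ◁ ψ) ⊗≫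
          (hb Y (D.X j) ≫ Y.1 ◁ f) ▷ (Bᘁ : C) ⊗≫ (Y.1 ⊗ D.X i) ◁ P.ev B ⊗≫ 𝟙 _ := by
          dsimp only [rotUp, rotDown, compAux]; monoidal
      _ = _ := by rw [← whisker_exchange, ← hb_naturality]; monoidal
  -- The sum over `j` collapses by `sum_dua_bas`.
  have hcol : ∀ i, ∑ j, dim k (D.X j) • ∑ α, (rotUp (D.dua j (D.X i ⊗ B) α) ▷ V ≫
        compAux ψ (hb Y (D.X j)) ≫ Y.1 ◁ P.rotDown (D.bas j (D.X i ⊗ B) α)) =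
      D.X i ◁ closure (k := k) Y B ψ ≫ hb Y (D.X i) := fun i => by
    simp only [hmove]
    have h := D.sum_dua_bas (D.X i ⊗ B)
    calc _ = 𝟙 _ ⊗≫ D.X i ◁ η_ B (Bᘁ) ▷ V ⊗≫ (D.X i ⊗ B) ◁ ψ ⊗≫
          (∑ j, dim k (D.X j) • ∑ α, D.dua j (D.X i ⊗ B) α ≫ D.bas j (D.X i ⊗ B) α) ▷
            (Y.1 ⊗ (Bᘁ : C)) ⊗≫
          hb Y (D.X i ⊗ B) ▷ (Bᘁ : C) ⊗≫ (Y.1 ⊗ D.X i) ◁ P.ev B ⊗≫ 𝟙 _ := by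
          simp [monoidalComp, sum_whiskerRight, Preadditive.sum_comp, Preadditive.comp_sum,
            -whiskerRight_tensor]
      _ = 𝟙 _ ⊗≫ D.X i ◁ η_ B (Bᘁ) ▷ V ⊗≫ (D.X i ⊗ B) ◁ ψ ⊗≫ D.X i ◁ hb Y B ▷ (Bᘁ : C) ⊗≫
          (hb Y (D.X i) ▷ (B ⊗ (Bᘁ : C)) ≫ (Y.1 ⊗ D.X i) ◁ P.ev B) ⊗≫ 𝟙 _ := by
          rw [h, hb_tensor]; monoidal
      _ = _ := by rw [← whisker_exchange]; dsimp only [closure]; monoidal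
  rw [encircle, Linear.comp_smul, Linear.comp_smul, Preadditive.comp_sum, Preadditive.comp_sum]
  congr 1
  simp only [Linear.comp_smul]
  simp only [rep_comp, ofHom_comp_rep, rep_eq_sum_rot, ← hcol]
  simp only [rep_sum, rep_smul, Finset.smul_sum, smul_smul]
  rw [Finset.sum_comm]
  refine Finset.sum_congr rfl fun i _ => Finset.sum_congr rfl fun j _ => ?_
  rw [mul_comm]

/-- The closure of a half-braiding is a multiple of the identity. -/
theorem closure_hb (Y : Center C) (B : C) :
    closure (k := k) Y B (hb Y (Bᘁ : C)) = dim k B • 𝟙 Y.1 := by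
  have h1 := leftTrace_eq (k := k) (𝟙 B)
  rw [leftTrace, id_whiskerRight, Category.id_comp] at h1
  have h2 := hb_tensor Y B (Bᘁ)
  calc _ = 𝟙 _ ⊗≫ (η_ B (Bᘁ) ▷ Y.1 ≫ hb Y (B ⊗ (Bᘁ : C))) ⊗≫
        Y.1 ◁ (PremodularCategory.piv k (C := C)).ev B ⊗≫ 𝟙 _ := by
        dsimp only [closure]; rw [h2]; monoidal
    _ = 𝟙 _ ⊗≫ Y.1 ◁ (η_ B (Bᘁ) ≫ (PremodularCategory.piv k (C := C)).ev B) ⊗≫ 𝟙 _ := by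
        rw [hb_naturality, hb_unit]; monoidal
    _ = _ := by rw [h1]; simp [monoidalComp, dim]

variable [CharZero k]

/-- With dual labels in the first factor, each loop `X i` is absorbed at the cost of `dim (X i)`;
together with its weight this adds up to `tot`, which cancels one normalization. -/
theorem encircle_idem (Y : Center C) : D.encircle Y ≫ D.encircle Y = D.encircle Y := by
  conv_lhs => lhs; rw [D.encircle_eq_dual Y]
  rw [Linear.smul_comp, Preadditive.sum_comp]
  simp only [Linear.smul_comp, rep_comp_encircle, closure_hb, ofHom_smul, ofHom_id,
    Category.id_comp, smul_smul]
  rw [← Finset.sum_smul, smul_smul]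
  simp only [← pow_two]
  change ((D.tot)⁻¹ * D.tot) • _ = _
  rw [inv_mul_cancel₀ D.tot_ne_zero, one_smul]

end IrrData

end

/-! ### The embedding of the center in the Karoubi envelope of the horizontal trace -/

section

variable {k : Type w} [Field k] [IsAlgClosed k] {C : Type u} [Category.{v} C] [Abelian C]
    [Linear k C] [MonoidalCategory C] [MonoidalPreadditive C] [MonoidalLinear k C]
    [BraidedCategory C] [RightRigidCategory C] [PremodularCategory k C]
open HTr PivotalStructure

namespace HTr

theorem mate_ofHom {X Y : C} (f : X ⟶ Y) :
    ((ofHom k f)ᘁ) = ofHom k (fᘁ) := mate_map f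

theorem mate_smul {X Y : HTr k C} (c : k) (f : X ⟶ Y) : ((c • f)ᘁ) = c • (fᘁ) := by
  apply rightDual_hom_ext (X := X) (Y := Xᘁ)
  rw [rightAdjointMate_comp_evaluation]
  simp only [MonoidalLinear.whiskerLeft_smul, MonoidalLinear.smul_whiskerRight, Linear.smul_comp,
    rightAdjointMate_comp_evaluation]

theorem mate_sum {X Y : HTr k C} {ι : Type*} (s : Finset ι) (f : ι → (X ⟶ Y)) :
    ((∑ i ∈ s, f i)ᘁ) = ∑ i ∈ s, ((f i)ᘁ) :=
  map_sum (AddMonoidHom.mk' (fun f : X ⟶ Y => (fᘁ)) mate_add) f s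

end HTr

namespace IrrData
variable (D : IrrData k C)

theorem exists_comp_encircle (Y : Center C) {V : C} (x : (⟨V⟩ : HTr k C) ⟶ ⟨Y.1⟩) :
    ∃ f : V ⟶ Y.1, x ≫ D.encircle Y = ofHom k f ≫ D.encircle Y := by
  induction x using rep_induction with
  | h0 => exact ⟨0, by rw [ofHom_zero, zero_comp]⟩
  | hadd x y hx hy =>
    obtain ⟨f, hf⟩ := hx
    obtain ⟨g, hg⟩ := hy
    exact ⟨f + g, by rw [ofHom_add, Preadditive.add_comp, Preadditive.add_comp, hf, hg]⟩
  | h A φ =>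
    -- Absorption needs a label that is a right dual, and `A` is isomorphic to `Aᘁᘁ`.
    rw [rep_iso ((PremodularCategory.piv k (C := C)).iso A)]
    exact ⟨_, D.rep_comp_encircle Y _⟩

/-- `mateAux` of a half-braiding is, by its very formula, the half-braiding of the dual. -/
theorem mate_encircle (X : Center C) : ((D.encircle X)ᘁ) = D.encircle (dualCenter X) := by
  rw [encircle, mate_smul, mate_sum]
  simp only [mate_smul, mate_rep]
  rfl

/-- Duality exchanges the two sides of a composition, so this is `exists_comp_encircle` for the dual
of `X`. -/
theorem exists_encircle_comp (X : Center C) {V : C} (x : (⟨X.1⟩ : HTr k C) ⟶ ⟨V⟩) :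
    ∃ f : X.1 ⟶ V, D.encircle X ≫ x = D.encircle X ≫ ofHom k f := by
  obtain ⟨f', hf'⟩ := D.exists_comp_encircle (dualCenter X) (xᘁ)
  obtain ⟨f, rfl⟩ := mate_surjective f'
  refine ⟨f, mate_injective ?_⟩
  rw [comp_rightAdjointMate, mate_encircle, comp_rightAdjointMate, mate_encircle]
  exact hf'.trans (congrArg (· ≫ _) (mate_ofHom f).symm)

/-- The component at `X i` of a morphism of the horizontal trace. -/
def component (V W : C) (i : D.ι) :
    ((⟨V⟩ : HTr k C) ⟶ ⟨W⟩) →ₗ[k] (D.X i ⊗ V ⟶ W ⊗ D.X i) :=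
  HTr.lift (fun A =>
    { toFun := fun φ => ∑ α, D.bas i A α ▷ V ≫ φ ≫ W ◁ D.dua i A α
      map_add' := fun φ ψ => by simp [Finset.sum_add_distrib]
      map_smul' := fun c φ => by simp [Finset.smul_sum] })
    (fun A B f g => by
      -- Naturality of the Casimir element in the label is exactly invariance under the relations of
      -- the coend.
      let T : (A ⟶ D.X i) →ₗ[k] (D.X i ⟶ B) →ₗ[k] (D.X i ⊗ V ⟶ W ⊗ D.X i) :=
        LinearMap.mk₂ k (fun p q => q ▷ V ≫ g ≫ W ◁ p) (by simp) (by simp) (by simp) (by simp)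
      have h := D.casimir_natural T f
      simpa [T] using h.symm)

theorem component_rep {V W : C} (i : D.ι) (A : C) (φ : A ⊗ V ⟶ W ⊗ A) :
    D.component V W i (rep k A φ) = ∑ α, D.bas i A α ▷ V ≫ φ ≫ W ◁ D.dua i A α :=
  HTr.lift_cls _ _ _ _

/-- By naturality the summand `l` contributes its multiplicity of `X i`, so only `l = i` remains,
and the inverse dimension from `bas ≫ dua` cancels its weight. -/
theorem component_of_family {V W : C} (φ : ∀ A, A ⊗ V ⟶ W ⊗ A) (nat : ∀ {A B : C} (f : A ⟶ B),
    f ▷ V ≫ φ B = φ A ≫ W ◁ f) (i : D.ι) :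
    D.component V W i ((D.tot)⁻¹ • ∑ l, dim k (D.X l) • rep k (D.X l) (φ (D.X l))) =
      (D.tot)⁻¹ • φ (D.X i) := by
  classical
  rw [map_smul, map_sum]
  congr 1
  simp only [map_smul, component_rep]
  have h : ∀ l, ∑ α, D.bas i (D.X l) α ▷ V ≫ φ (D.X l) ≫ W ◁ D.dua i (D.X l) α =
      (D.mult (D.X i) (D.X l) * (dim k (D.X i))⁻¹) • φ (D.X i) := fun l => by
    rw [← Category.comp_id (φ (D.X i)), ← MonoidalCategory.whiskerLeft_id, ← Linear.comp_smul,
      ← MonoidalLinear.whiskerLeft_smul, ← sum_bas_comp_dua, whiskerLeft_sum, Preadditive.comp_sum]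
    refine Finset.sum_congr rfl fun α _ => ?_
    rw [reassoc_of% (nat (D.bas i (D.X l) α)), MonoidalCategory.whiskerLeft_comp]
  simp only [h, D.mult_self]
  rw [Finset.sum_eq_single i]
  · rw [if_pos rfl, smul_smul]
    simp [mul_inv_cancel₀ (D.dim_X_ne_zero i)]
  · intro l _ hl
    rw [if_neg hl]; simp
  · simp

theorem family_ext {V W : C} (φ ψ : ∀ A, A ⊗ V ⟶ W ⊗ A) (nat : ∀ {A B : C} (f : A ⟶ B),
    f ▷ V ≫ φ B = φ A ≫ W ◁ f) (nat' : ∀ {A B : C} (f : A ⟶ B), f ▷ V ≫ ψ B = ψ A ≫ W ◁ f)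
    (h : ∀ i, φ (D.X i) = ψ (D.X i)) (A : C) : φ A = ψ A := by
  have key : ∀ φ : (∀ A, A ⊗ V ⟶ W ⊗ A), (∀ {A B : C} (f : A ⟶ B),
      f ▷ V ≫ φ B = φ A ≫ W ◁ f) → φ A = ∑ j, dim k (D.X j) • ∑ α,
        (D.dua j A α ▷ V ≫ φ (D.X j) ≫ W ◁ D.bas j A α) := fun φ nat => by
    conv_lhs => rw [← Category.id_comp (φ A), ← id_whiskerRight, ← D.sum_dua_bas A]
    simp [sum_whiskerRight, Preadditive.sum_comp, nat]
  rw [key φ nat, key ψ nat']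
  simp only [h]

variable [CharZero k]

/-- Both sides are weighted sums of classes of families natural in the label. Their components give
the commutation on the simple objects, hence on all objects, and the label `𝟙_ C` gives `f = f'`.
Allowing `f` and `f'` to differ makes it possible to identify a central morphism with a formula
whose centrality is not yet known. -/
theorem central_of_eq {X Y : Center C} (f f' : X.1 ⟶ Y.1)
    (h : ofHom k f ≫ D.encircle Y = D.encircle X ≫ ofHom k f') :
    f = f' ∧ ∀ A, A ◁ f ≫ hb Y A = hb X A ≫ f ▷ A := by
  have h1 : ofHom k f ≫ D.encircle Y =
      (D.tot)⁻¹ • ∑ l, dim k (D.X l) • rep k (D.X l) (D.X l ◁ f ≫ hb Y (D.X l)) := by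
    simp only [encircle, Linear.comp_smul, Preadditive.comp_sum, ofHom_comp_rep]
  have h2 : D.encircle X ≫ ofHom k f' =
      (D.tot)⁻¹ • ∑ l, dim k (D.X l) • rep k (D.X l) (hb X (D.X l) ≫ f' ▷ D.X l) := by
    simp only [encircle, Linear.smul_comp, Preadditive.sum_comp, rep_comp_ofHom]
  have n1 : ∀ {A B : C} (g : A ⟶ B), g ▷ X.1 ≫ B ◁ f ≫ hb Y B = (A ◁ f ≫ hb Y A) ≫ Y.1 ◁ g := by
    intro A B g
    rw [← whisker_exchange_assoc, hb_naturality, Category.assoc]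
  have n2 : ∀ {A B : C} (g : A ⟶ B), g ▷ X.1 ≫ hb X B ≫ f' ▷ B = (hb X A ≫ f' ▷ A) ≫ Y.1 ◁ g := by
    intro A B g
    rw [Category.assoc, ← whisker_exchange, reassoc_of% (hb_naturality X g)]
  have h3 : ∀ A, A ◁ f ≫ hb Y A = hb X A ≫ f' ▷ A := by
    refine D.family_ext (fun A => A ◁ f ≫ hb Y A) (fun A => hb X A ≫ f' ▷ A) n1 n2 fun i => ?_
    have h4 := congrArg (D.component X.1 Y.1 i) (h1.symm.trans (h.trans h2))
    rw [D.component_of_family (fun A => A ◁ f ≫ hb Y A) n1,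
      D.component_of_family (fun A => hb X A ≫ f' ▷ A) n2] at h4
    exact smul_right_injective _ (inv_ne_zero D.tot_ne_zero) h4
  have h5 : f = f' := by
    have h6 := h3 (𝟙_ C)
    rw [hb_unit, hb_unit] at h6
    have h7 : (λ_ _).inv ≫ (𝟙_ C ◁ f ≫ (λ_ Y.1).hom ≫ (ρ_ Y.1).inv) ≫ (ρ_ _).hom =
      (λ_ _).inv ≫ (((λ_ X.1).hom ≫ (ρ_ X.1).inv) ≫ f' ▷ 𝟙_ C) ≫ (ρ_ _).hom := by rw [h6]
    simpa using h7
  exact ⟨h5, fun A => by rw [h3, h5]⟩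

theorem comp_encircle_injective {V : C} {Y : Center C} {f g : V ⟶ Y.1}
    (h : ofHom k f ≫ D.encircle Y = ofHom k g ≫ D.encircle Y) : f = g := by
  have h1 : ∀ f : V ⟶ Y.1, ofHom k f ≫ D.encircle Y =
      (D.tot)⁻¹ • ∑ l, dim k (D.X l) • rep k (D.X l) (D.X l ◁ f ≫ hb Y (D.X l)) := fun f => by
    simp only [encircle, Linear.comp_smul, Preadditive.comp_sum, ofHom_comp_rep]
  have n1 : ∀ (f : V ⟶ Y.1) {A B : C} (g : A ⟶ B),
      g ▷ V ≫ B ◁ f ≫ hb Y B = (A ◁ f ≫ hb Y A) ≫ Y.1 ◁ g := by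
    intro f A B g
    rw [← whisker_exchange_assoc, hb_naturality, Category.assoc]
  have h3 : 𝟙_ C ◁ f ≫ hb Y (𝟙_ C) = 𝟙_ C ◁ g ≫ hb Y (𝟙_ C) := by
    refine D.family_ext (fun A => A ◁ f ≫ hb Y A) (fun A => A ◁ g ≫ hb Y A) (n1 f) (n1 g)
      (fun i => ?_) _
    rw [h1, h1] at h
    have h4 := congrArg (D.component V Y.1 i) h
    rw [D.component_of_family (fun A => A ◁ f ≫ hb Y A) (n1 f),
      D.component_of_family (fun A => A ◁ g ≫ hb Y A) (n1 g)] at h4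
    exact smul_right_injective _ (inv_ne_zero D.tot_ne_zero) h4
  rw [cancel_mono] at h3
  simpa using h3

/-- A morphism of `C` whose composite with the encircling idempotent is fixed by that of the source
is central. -/
theorem central_of_comp_encircle {X Y : Center C} (f : X.1 ⟶ Y.1)
    (h : D.encircle X ≫ ofHom k f ≫ D.encircle Y = ofHom k f ≫ D.encircle Y) (A : C) :
    A ◁ f ≫ hb Y A = hb X A ≫ f ▷ A := by
  obtain ⟨f', hf'⟩ := D.exists_encircle_comp X (ofHom k f ≫ D.encircle Y)
  exact (D.central_of_eq f f' (h.symm.trans hf')).2 A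

theorem central_of_encircle_comp {X Y : Center C} (f : X.1 ⟶ Y.1)
    (h : (D.encircle X ≫ ofHom k f) ≫ D.encircle Y = D.encircle X ≫ ofHom k f) (A : C) :
    A ◁ f ≫ hb Y A = hb X A ≫ f ▷ A := by
  obtain ⟨f', hf'⟩ := D.exists_comp_encircle Y (D.encircle X ≫ ofHom k f)
  obtain ⟨rfl, h'⟩ := D.central_of_eq f' f (hf'.symm.trans h)
  exact h' A

/-- Fullness of `toKar`: absorption writes `x` as `encircle X` followed by a morphism of `C`, and
invariance under `encircle Y` makes that morphism central. -/
theorem exists_central {X Y : Center C} (x : (⟨X.1⟩ : HTr k C) ⟶ ⟨Y.1⟩)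
    (h : D.encircle X ≫ x ≫ D.encircle Y = x) :
    ∃ f : X ⟶ Y, x = D.encircle X ≫ ofHom k f.f := by
  have hx : D.encircle X ≫ x = x := by
    rw [← h, reassoc_of% (D.encircle_idem X)]
  have hy : x ≫ D.encircle Y = x := by
    rw [← h, Category.assoc, Category.assoc, D.encircle_idem]
  obtain ⟨f, hf⟩ := D.exists_encircle_comp X x
  rw [hx] at hf
  exact ⟨Center.homOfHb f (D.central_of_encircle_comp f (by rw [← hf, hy])), hf⟩

open Idempotents

/-- The functor from the center to the Karoubi envelope of the horizontal trace. -/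
def toKar : Center C ⥤ Karoubi (HTr k C) where
  obj X := ⟨⟨X.1⟩, D.encircle X, D.encircle_idem X⟩
  map {X Y} f := ⟨D.encircle X ≫ ofHom k f.f, by
    change D.encircle X ≫ (D.encircle X ≫ ofHom k f.f) ≫ D.encircle Y = _
    rw [Category.assoc, D.ofHom_comp_encircle, reassoc_of% (D.encircle_idem X),
      reassoc_of% (D.encircle_idem X)]⟩
  map_id X := Karoubi.hom_ext _ _ (by
    change D.encircle X ≫ ofHom k (𝟙 X.1) = D.encircle X
    rw [ofHom_id]; exact Category.comp_id _)
  map_comp {X Y Z} f g := Karoubi.hom_ext _ _ (by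
    change D.encircle X ≫ ofHom k (f.f ≫ g.f) =
      (D.encircle X ≫ ofHom k f.f) ≫ D.encircle Y ≫ ofHom k g.f
    rw [ofHom_comp, Category.assoc, reassoc_of% (D.ofHom_comp_encircle f),
      reassoc_of% (D.encircle_idem X)])

theorem toKar_map_f' {X Y : Center C} (f : X ⟶ Y) :
    (D.toKar.map f).f = ofHom k f.f ≫ D.encircle Y := (D.ofHom_comp_encircle f).symm

instance : D.toKar.Faithful where
  map_injective {X Y f g} h := by
    apply Center.ext
    have h1 := congrArg Karoubi.Hom.f h
    rw [toKar_map_f', toKar_map_f'] at h1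
    exact D.comp_encircle_injective h1

instance : D.toKar.Full where
  map_surjective {X Y} x := by
    obtain ⟨f, hf⟩ := D.exists_central (X := X) (Y := Y) x.f x.comm
    exact ⟨f, Karoubi.hom_ext _ _ hf.symm⟩

instance : D.toKar.Additive where
  map_add {X Y f g} := Karoubi.hom_ext _ _ (by
    change D.encircle X ≫ ofHom k (f.f + g.f) = D.encircle X ≫ ofHom k f.f + D.encircle X ≫ ofHom k g.f
    rw [ofHom_add, Preadditive.comp_add])

instance : D.toKar.Linear k where
  map_smul {X Y} f r := Karoubi.hom_ext _ _ (by
    change D.encircle X ≫ ofHom k (r • f.f) = r • (D.encircle X ≫ ofHom k f.f)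
    rw [ofHom_smul, Linear.comp_smul])

end IrrData

end

/-! ### Induced objects -/

section

variable {k : Type w} [Field k] [IsAlgClosed k] {C : Type u} [Category.{v} C] [Abelian C]
    [Linear k C] [MonoidalCategory C] [MonoidalPreadditive C] [MonoidalLinear k C]
    [BraidedCategory C] [RightRigidCategory C] [PremodularCategory k C]
open HTr PivotalStructure

attribute [local instance] Abelian.hasFiniteBiproducts

namespace IrrData
variable (D : IrrData k C)

theorem inI_prI (A : C) (i : D.ι) : D.inI A i ≫ D.prI A i = 𝟙 _ := biproduct.ι_π_self _ i

theorem inI_prI_ne (A : C) {i j : D.ι} (h : i ≠ j) : D.inI A i ≫ D.prI A j = 0 :=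
  biproduct.ι_π_ne _ h

theorem sum_prI_inI (A : C) : ∑ i, D.prI A i ≫ D.inI A i = 𝟙 (D.IObj A) := biproduct.total

theorem sqrtDim_mul_self (i : D.ι) : D.sqrtDim i * D.sqrtDim i = dim k (D.X i) := by
  rw [← pow_two, D.sqrtDim_sq]

/-- Rotation reverses the order; the intermediate strand `W` forms a zigzag and is straightened.
With `loopMap_comp` this is the source of multiplicativity for the induced half-braiding. -/
theorem rotOut_comp {B U W B' Z : C} (q : W ⟶ B ⊗ U) (p : Z ⟶ B' ⊗ W) :
    D.rotOut (p ≫ B' ◁ q ≫ (α_ _ _ _).inv) =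
      D.rotOut q ≫ D.rotOut p ▷ B ≫ (α_ _ _ _).hom := by
  symm
  calc _ = 𝟙 _ ⊗≫ (𝟙_ C ◁ (𝟙 (Uᘁ : C) ⊗≫ D.coevR W ▷ (Uᘁ : C) ⊗≫ (Wᘁ : C) ◁ (q ▷ (Uᘁ : C) ⊗≫ B ◁ D.evR U) ⊗≫
        𝟙 ((Wᘁ : C) ⊗ B)) ≫ D.coevR Z ▷ ((Wᘁ : C) ⊗ B)) ⊗≫ (Zᘁ : C) ◁ p ▷ ((Wᘁ : C) ⊗ B) ⊗≫
        ((Zᘁ : C) ⊗ B') ◁ D.evR W ▷ B ⊗≫ 𝟙 _ := by dsimp only [rotOut]; monoidal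
    _ = 𝟙 _ ⊗≫ D.coevR Z ▷ (Uᘁ : C) ⊗≫ (Zᘁ : C) ◁ (Z ◁ (𝟙 (Uᘁ : C) ⊗≫ D.coevR W ▷ (Uᘁ : C) ⊗≫
        (Wᘁ : C) ◁ (q ▷ (Uᘁ : C) ⊗≫ B ◁ D.evR U) ⊗≫ 𝟙 ((Wᘁ : C) ⊗ B)) ≫ p ▷ ((Wᘁ : C) ⊗ B)) ⊗≫
        ((Zᘁ : C) ⊗ B') ◁ D.evR W ▷ B ⊗≫ 𝟙 _ := by rw [whisker_exchange]; monoidal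
    _ = 𝟙 _ ⊗≫ D.coevR Z ▷ (Uᘁ : C) ⊗≫ (Zᘁ : C) ◁ p ▷ (Uᘁ : C) ⊗≫
        ((Zᘁ : C) ⊗ B' ⊗ W) ◁ D.coevR W ▷ (Uᘁ : C) ⊗≫ ((Zᘁ : C) ⊗ B') ◁ ((W ⊗ (Wᘁ : C)) ◁
        (q ▷ (Uᘁ : C) ⊗≫ B ◁ D.evR U) ≫ D.evR W ▷ (B ⊗ 𝟙_ C)) ⊗≫ 𝟙 _ := by
        rw [whisker_exchange]; monoidal
    _ = 𝟙 _ ⊗≫ D.coevR Z ▷ (Uᘁ : C) ⊗≫ (Zᘁ : C) ◁ p ▷ (Uᘁ : C) ⊗≫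
        ((Zᘁ : C) ⊗ B') ◁ (W ◁ D.coevR W ⊗≫ D.evR W ▷ W) ▷ (Uᘁ : C) ⊗≫ ((Zᘁ : C) ⊗ B') ◁
        (q ▷ (Uᘁ : C) ⊗≫ B ◁ D.evR U) ⊗≫ 𝟙 _ := by
        rw [whisker_exchange]; monoidal
    _ = _ := by rw [coev_zigzag]; dsimp only [rotOut]; monoidal

/-- A morphism of rotated pairs, from which the half-braiding of the induced object is made. -/
def loopMap (A : C) {B B' U W : C} (p : B ⊗ U ⟶ W) (q : W ⟶ B' ⊗ U) :
    B ⊗ (U ⊗ (A ⊗ (Uᘁ : C))) ⟶ (W ⊗ (A ⊗ (Wᘁ : C))) ⊗ B' :=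
  𝟙 _ ⊗≫ p ▷ (A ⊗ (Uᘁ : C)) ⊗≫ (W ⊗ A) ◁ D.rotOut q ⊗≫ 𝟙 _

theorem whiskerRight_loopMap (A : C) {B₀ B B' U W : C} (f : B₀ ⟶ B) (p : B ⊗ U ⟶ W)
    (q : W ⟶ B' ⊗ U) :
    f ▷ _ ≫ D.loopMap A p q = D.loopMap A (f ▷ U ≫ p) q := by
  dsimp only [loopMap]; monoidal

theorem loopMap_whiskerLeft (A : C) {B B' B₁ U W : C} (p : B ⊗ U ⟶ W)
    (q : W ⟶ B' ⊗ U) (f : B' ⟶ B₁) :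
    D.loopMap A p q ≫ _ ◁ f = D.loopMap A p (q ≫ f ▷ U) := by
  have h : D.rotOut (q ≫ f ▷ U) = D.rotOut q ≫ (Wᘁ : C) ◁ f := by
    calc _ = 𝟙 _ ⊗≫ D.coevR W ▷ (Uᘁ : C) ⊗≫ (Wᘁ : C) ◁ q ▷ (Uᘁ : C) ⊗≫
          (Wᘁ : C) ◁ (f ▷ (U ⊗ (Uᘁ : C)) ≫ B₁ ◁ D.evR U) ⊗≫ 𝟙 _ := by
          dsimp only [rotOut]; monoidal
      _ = _ := by rw [← whisker_exchange]; dsimp only [rotOut]; monoidal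
  dsimp only [loopMap]; rw [h]; monoidal

theorem loopMap_comp (A : C) {B B' B₁ B₁' U W Z : C} (p : B ⊗ U ⟶ W) (q : W ⟶ B' ⊗ U)
    (p₁ : B₁ ⊗ W ⟶ Z) (q₁ : Z ⟶ B₁' ⊗ W) :
    (α_ _ _ _).hom ≫ B₁ ◁ D.loopMap A p q ≫ (α_ _ _ _).inv ≫ D.loopMap A p₁ q₁ ▷ B' ≫
      (α_ _ _ _).hom =
    D.loopMap A ((α_ _ _ _).hom ≫ B₁ ◁ p ≫ p₁) (q₁ ≫ B₁' ◁ q ≫ (α_ _ _ _).inv) := by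
  calc _ = 𝟙 _ ⊗≫ B₁ ◁ p ▷ (A ⊗ (Uᘁ : C)) ⊗≫ ((B₁ ⊗ W) ◁ (A ◁ D.rotOut q) ≫
        p₁ ▷ (A ⊗ ((Wᘁ : C) ⊗ B'))) ⊗≫ (Z ⊗ A) ◁ D.rotOut q₁ ▷ B' ⊗≫ 𝟙 _ := by
        dsimp only [loopMap]; monoidal
    _ = _ := by
        rw [whisker_exchange]
        dsimp only [loopMap]; rw [rotOut_comp]; monoidal

theorem loopMap_unit (A U : C) : D.loopMap A (λ_ U).hom (λ_ U).inv = (λ_ _).hom ≫ (ρ_ _).inv := by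
  calc _ = 𝟙 _ ⊗≫ (U ⊗ A) ◁ (D.coevR U ▷ (Uᘁ : C) ⊗≫ (Uᘁ : C) ◁ D.evR U) ⊗≫ 𝟙 _ := by
        dsimp only [loopMap, rotOut]; monoidal
    _ = _ := by rw [ev_zigzag]; monoidal

/-- `loopMap` as a bilinear map. -/
def loopMapₗ (A B B' U W : C) : (B ⊗ U ⟶ W) →ₗ[k] (W ⟶ B' ⊗ U) →ₗ[k]
    (B ⊗ (U ⊗ (A ⊗ (Uᘁ : C))) ⟶ (W ⊗ (A ⊗ (Wᘁ : C))) ⊗ B') :=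
  LinearMap.mk₂ k (D.loopMap A) (by simp [loopMap, monoidalComp])
    (by simp [loopMap, monoidalComp]) (by simp [loopMap, rotOut, monoidalComp])
    (by simp [loopMap, rotOut, monoidalComp])

theorem gammaComp_eq (A B : C) (i j : D.ι) : D.gammaComp A B i j =
    (D.sqrtDim i * D.sqrtDim j) • ∑ α, D.loopMapₗ A B B (D.X i) (D.X j)
      (D.dua j (B ⊗ D.X i) α) (D.bas j (B ⊗ D.X i) α) := rfl

/-- The two members of a dual pair sit on the incoming and the outgoing strand, so this is
naturality of the Casimir element. -/
theorem gammaComp_natural (A : C) {B B' : C} (f : B ⟶ B') (i j : D.ι) :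
    f ▷ _ ≫ D.gammaComp A B' i j = D.gammaComp A B i j ≫ _ ◁ f := by
  rw [gammaComp_eq, gammaComp_eq, Linear.comp_smul, Linear.smul_comp, Preadditive.comp_sum,
    Preadditive.sum_comp]
  congr 1
  refine Eq.trans (Finset.sum_congr rfl fun α _ => D.whiskerRight_loopMap A f _ _) ?_
  refine Eq.trans ?_ (Finset.sum_congr rfl fun α _ => (D.loopMap_whiskerLeft A _ _ f).symm)
  exact D.casimir_natural (D.loopMapₗ A B B' (D.X i) (D.X j)) (f ▷ D.X i)

/-- In the composite through the colour `l`, the two factors `sqrtDim l` make up the weight `dim (X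
l)` of the decomposition of the identity of `B' ⊗ X i`. Naturality of the Casimir element moves one
member of the inner pair across the outer pair so that this decomposition appears. -/
theorem gammaComp_tensor (A B B' : C) (i j : D.ι) :
    D.gammaComp A (B ⊗ B') i j = ∑ l, (α_ _ _ _).hom ≫ B ◁ D.gammaComp A B' i l ≫ (α_ _ _ _).inv ≫
      D.gammaComp A B l j ▷ B' ≫ (α_ _ _ _).hom := by
  have h1 : ∀ l, (α_ _ _ _).hom ≫ B ◁ D.gammaComp A B' i l ≫ (α_ _ _ _).inv ≫
      D.gammaComp A B l j ▷ B' ≫ (α_ _ _ _).hom = (D.sqrtDim i * D.sqrtDim j) •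
      dim k (D.X l) • ∑ α, ∑ γ, D.loopMap A ((α_ B B' (D.X i)).hom ≫ D.dua j _ γ)
        (D.bas j _ γ ≫ B ◁ (D.dua l (B' ⊗ D.X i) α ≫ D.bas l (B' ⊗ D.X i) α) ≫ (α_ _ _ _).inv) :=
      fun l => by
    rw [gammaComp_eq, gammaComp_eq, MonoidalLinear.whiskerLeft_smul,
      MonoidalLinear.smul_whiskerRight]
    simp only [Linear.smul_comp, Linear.comp_smul, smul_smul]
    rw [show D.sqrtDim l * D.sqrtDim j * (D.sqrtDim i * D.sqrtDim l) =
      D.sqrtDim i * D.sqrtDim j * dim k (D.X l) by rw [← D.sqrtDim_mul_self]; ring]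
    congr 1
    simp only [whiskerLeft_sum, sum_whiskerRight, Preadditive.comp_sum, Preadditive.sum_comp]
    rw [Finset.sum_comm]
    refine Finset.sum_congr rfl fun α _ => ?_
    refine (Finset.sum_congr rfl fun β _ => D.loopMap_comp A _ _ _ _).trans ?_
    -- Casimir naturality along `B ◁ dua l`: this member moves to the outgoing side and meets `bas
    -- l`.
    let T : (B ⊗ B' ⊗ D.X i ⟶ D.X j) →ₗ[k] (D.X j ⟶ B ⊗ D.X l) →ₗ[k]
      ((B ⊗ B') ⊗ (D.X i ⊗ (A ⊗ ((D.X i)ᘁ : C))) ⟶ (D.X j ⊗ (A ⊗ ((D.X j)ᘁ : C))) ⊗ (B ⊗ B')) :=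
      (D.loopMapₗ A (B ⊗ B') (B ⊗ B') (D.X i) (D.X j)).compl₁₂
        (Linear.leftComp k _ (α_ B B' (D.X i)).hom)
        (Linear.rightComp k _ (B ◁ D.bas l (B' ⊗ D.X i) α ≫ (α_ _ _ _).inv))
    refine (D.casimir_natural T (B ◁ D.dua l (B' ⊗ D.X i) α)).trans ?_
    refine Finset.sum_congr rfl fun γ _ => ?_
    change D.loopMap A _ _ = D.loopMap A _ _
    simp
  simp only [h1]
  rw [← Finset.smul_sum, gammaComp_eq]
  congr 1
  -- Casimir naturality along the associator, since the two sides use dual bases for differently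
  -- bracketed products.
  let T : ((B ⊗ B') ⊗ D.X i ⟶ D.X j) →ₗ[k] (D.X j ⟶ B ⊗ B' ⊗ D.X i) →ₗ[k]
      ((B ⊗ B') ⊗ (D.X i ⊗ (A ⊗ ((D.X i)ᘁ : C))) ⟶ (D.X j ⊗ (A ⊗ ((D.X j)ᘁ : C))) ⊗ (B ⊗ B')) :=
    (D.loopMapₗ A (B ⊗ B') (B ⊗ B') (D.X i) (D.X j)).compl₂ (Linear.rightComp k _ (α_ _ _ _).inv)
  have h2 := D.casimir_natural T (α_ B B' (D.X i)).hom
  have h3 : ∀ γ, T (D.dua j _ γ) (D.bas j _ γ ≫ (α_ B B' (D.X i)).hom) =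
      D.loopMapₗ A (B ⊗ B') (B ⊗ B') (D.X i) (D.X j) (D.dua j _ γ) (D.bas j _ γ) := fun γ => by
    change D.loopMap A _ _ = D.loopMap A _ _
    simp
  rw [Finset.sum_congr rfl fun γ _ => (h3 γ).symm, ← h2]
  have h4 : ∀ γ, T ((α_ B B' (D.X i)).hom ≫ D.dua j _ γ) (D.bas j _ γ) =
      ∑ l, dim k (D.X l) • ∑ α, D.loopMap A ((α_ B B' (D.X i)).hom ≫ D.dua j _ γ)
        (D.bas j _ γ ≫ B ◁ (D.dua l (B' ⊗ D.X i) α ≫ D.bas l (B' ⊗ D.X i) α) ≫ (α_ _ _ _).inv) :=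
    fun γ => by
    let S : (B' ⊗ D.X i ⟶ B' ⊗ D.X i) →ₗ[k]
      ((B ⊗ B') ⊗ (D.X i ⊗ (A ⊗ ((D.X i)ᘁ : C))) ⟶ (D.X j ⊗ (A ⊗ ((D.X j)ᘁ : C))) ⊗ (B ⊗ B')) :=
      { toFun := fun x => D.loopMapₗ A _ _ _ _ ((α_ B B' (D.X i)).hom ≫ D.dua j _ γ)
          (D.bas j _ γ ≫ B ◁ x ≫ (α_ _ _ _).inv)
        map_add' := fun x y => by simp
        map_smul' := fun c x => by simp }
    have h5 := congrArg S (D.sum_dua_bas (B' ⊗ D.X i))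
    simp only [map_sum, map_smul] at h5
    refine Eq.trans ?_ h5.symm
    change D.loopMap A _ _ = D.loopMap A _ _
    simp
  rw [Finset.sum_congr rfl fun γ _ => h4 γ, Finset.sum_comm]
  refine Finset.sum_congr rfl fun l _ => ?_
  rw [← Finset.smul_sum, Finset.sum_comm]

theorem gammaComp_unit_ne (A : C) {i j : D.ι} (h : i ≠ j) : D.gammaComp A (𝟙_ C) i j = 0 := by
  have h1 : ∀ α, D.dua j (𝟙_ C ⊗ D.X i) α = 0 := fun α => by
    rw [← cancel_epi (λ_ (D.X i)).inv, comp_zero]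
    exact D.hom_eq_zero h _
  rw [gammaComp_eq]
  simp only [h1, map_zero, LinearMap.zero_apply, Finset.sum_const_zero, smul_zero]

/-- Morphisms `𝟙_ C ⊗ X i ⟶ X i` are multiples of the unitor, so both members of each pair can be
gathered on one side, where they form the only nonzero part of the decomposition of the identity. -/
theorem gammaComp_unit (A : C) (i : D.ι) :
    D.gammaComp A (𝟙_ C) i i = (λ_ _).hom ≫ (ρ_ _).inv := by
  have h0 : ∑ l, dim k (D.X l) • ∑ α, D.dua l (𝟙_ C ⊗ D.X i) α ≫ D.bas l (𝟙_ C ⊗ D.X i) α =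
      dim k (D.X i) • ∑ α, D.dua i (𝟙_ C ⊗ D.X i) α ≫ D.bas i (𝟙_ C ⊗ D.X i) α := by
    refine Finset.sum_eq_single i (fun l _ hl => ?_) (by simp)
    have h1 : ∀ α, D.dua l (𝟙_ C ⊗ D.X i) α = 0 := fun α => by
      rw [← cancel_epi (λ_ (D.X i)).inv, comp_zero]
      exact D.hom_eq_zero hl.symm _
    simp [h1]
  rw [D.sum_dua_bas] at h0
  rw [← D.loopMap_unit A (D.X i), gammaComp_eq, D.sqrtDim_mul_self]
  have h2 : ∀ α, D.loopMapₗ A (𝟙_ C) (𝟙_ C) (D.X i) (D.X i) (D.dua i (𝟙_ C ⊗ D.X i) α)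
      (D.bas i (𝟙_ C ⊗ D.X i) α) = D.loopMapₗ A (𝟙_ C) (𝟙_ C) (D.X i) (D.X i) (λ_ _).hom
      ((λ_ _).inv ≫ D.dua i (𝟙_ C ⊗ D.X i) α ≫ D.bas i (𝟙_ C ⊗ D.X i) α) := fun α => by
    obtain ⟨c, hc⟩ : ∃ c : k, (λ_ _).inv ≫ D.dua i (𝟙_ C ⊗ D.X i) α = c • 𝟙 _ :=
      ⟨_, D.endo_eq i _⟩
    have hc' : D.dua i (𝟙_ C ⊗ D.X i) α = c • (λ_ _).hom := by
      rw [← cancel_epi (λ_ (D.X i)).inv, hc]; simp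
    rw [reassoc_of% hc, hc']
    simp
  simp only [h2]
  rw [← map_sum, ← map_smul, ← Preadditive.comp_sum, ← Linear.comp_smul, ← h0, Category.comp_id]
  rfl

/-- The half-braiding of the induced object. -/
def indHalfBraiding (A : C) : HalfBraiding (D.IObj A) :=
  halfBraidingOfFamily (D.gammaRaw A)
    (fun {B B'} f => by
      rw [gammaRaw, gammaRaw]
      simp only [Preadditive.comp_sum, Preadditive.sum_comp]
      refine Finset.sum_congr rfl fun i _ => Finset.sum_congr rfl fun j _ => ?_
      rw [← whisker_exchange_assoc, reassoc_of% (D.gammaComp_natural A f i j)]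
      simp only [Category.assoc, whisker_exchange])
    (fun B B' => by
      rw [gammaRaw, gammaRaw, gammaRaw]
      simp only [gammaComp_tensor, Preadditive.comp_sum, Preadditive.sum_comp, whiskerLeft_sum,
        sum_whiskerRight]
      have h : ∀ i l j l', (α_ B B' (D.IObj A)).hom ≫ B ◁ (B' ◁ D.prI A i ≫
          D.gammaComp A B' i l ≫ D.inI A l ▷ B') ≫ (α_ B (D.IObj A) B').inv ≫
          (B ◁ D.prI A l' ≫ D.gammaComp A B l' j ≫ D.inI A j ▷ B) ▷ B' ≫
          (α_ (D.IObj A) B B').hom =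
        (B ⊗ B') ◁ D.prI A i ≫ ((α_ B B' _).hom ≫ B ◁ D.gammaComp A B' i l ≫ (α_ _ _ _).inv ≫
          (B ◁ (D.inI A l ≫ D.prI A l')) ▷ B' ≫
          D.gammaComp A B l' j ▷ B' ≫ (α_ _ _ _).hom) ≫ D.inI A j ▷ (B ⊗ B') := fun i l j l' => by
        monoidal
      have h' : ∀ l' j i, ∑ l, (α_ B B' (D.IObj A)).hom ≫ B ◁ (B' ◁ D.prI A i ≫
          D.gammaComp A B' i l ≫ D.inI A l ▷ B') ≫ (α_ B (D.IObj A) B').inv ≫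
          (B ◁ D.prI A l' ≫ D.gammaComp A B l' j ≫ D.inI A j ▷ B) ▷ B' ≫
          (α_ (D.IObj A) B B').hom = (B ⊗ B') ◁ D.prI A i ≫ ((α_ B B' _).hom ≫
          B ◁ D.gammaComp A B' i l' ≫ (α_ _ _ _).inv ≫
          D.gammaComp A B l' j ▷ B' ≫ (α_ _ _ _).hom) ≫ D.inI A j ▷ (B ⊗ B') := fun l' j i => by
        rw [Finset.sum_eq_single l' (fun l _ hl => by rw [h, inI_prI_ne _ _ hl]; simp) (by simp),
          h, inI_prI]
        simp
      simp only [h']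
      exact ((Finset.sum_congr rfl fun l _ => Finset.sum_comm).trans (Finset.sum_comm.trans
        (Finset.sum_congr rfl fun i _ => Finset.sum_comm))).symm)
    (by
      rw [gammaRaw]
      have h : ∀ i, ∑ j, 𝟙_ C ◁ D.prI A i ≫ D.gammaComp A (𝟙_ C) i j ≫ D.inI A j ▷ 𝟙_ C =
          (λ_ _).hom ≫ (D.prI A i ≫ D.inI A i) ≫ (ρ_ _).inv := fun i => by
        rw [Finset.sum_eq_single i (fun j _ hj => by rw [D.gammaComp_unit_ne A hj.symm]; simp)
          (by simp), gammaComp_unit]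
        monoidal
      simp only [h]
      rw [← Preadditive.comp_sum, ← Preadditive.sum_comp, sum_prI_inI, Category.id_comp])

/-- The induced object of the center. -/
def indCenter (A : C) : Center C := ⟨D.IObj A, D.indHalfBraiding A⟩

end IrrData

end

/-! ### Induced objects in the horizontal trace -/

section

variable {k : Type w} [Field k] [IsAlgClosed k] {C : Type u} [Category.{v} C] [Abelian C]
    [Linear k C] [MonoidalCategory C] [MonoidalPreadditive C] [MonoidalLinear k C]
    [BraidedCategory C] [RightRigidCategory C] [PremodularCategory k C]
open HTr PivotalStructure

attribute [local instance] Abelian.hasFiniteBiproducts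

namespace IrrData
variable (D : IrrData k C)

/-- A component of the morphism `fromInd`. -/
def fromIndAux (A : C) (i : D.ι) : ((D.X i)ᘁ : C) ⊗ D.IObj A ⟶ A ⊗ ((D.X i)ᘁ : C) :=
  ((D.X i)ᘁ : C) ◁ D.prI A i ⊗≫ ε_ (D.X i) ((D.X i)ᘁ) ▷ (A ⊗ ((D.X i)ᘁ : C)) ⊗≫ 𝟙 _

/-- A component of the morphism `toInd`. -/
def toIndAux (A : C) (i : D.ι) : D.X i ⊗ A ⟶ D.IObj A ⊗ D.X i :=
  𝟙 _ ⊗≫ (D.X i ⊗ A) ◁ D.coevR (D.X i) ⊗≫ D.inI A i ▷ D.X i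

/-- The projection of an induced object to the inducing object in the horizontal trace. -/
def fromInd (A : C) : (⟨D.IObj A⟩ : HTr k C) ⟶ ⟨A⟩ :=
  ∑ i, D.sqrtDim i • rep k ((D.X i)ᘁ : C) (D.fromIndAux A i)

/-- The inclusion of the inducing object in an induced object in the horizontal trace, up to the
factor `tot`. -/
def toInd (A : C) : (⟨A⟩ : HTr k C) ⟶ ⟨D.IObj A⟩ :=
  ∑ i, D.sqrtDim i • rep k (D.X i) (D.toIndAux A i)

theorem coev_ev (X : C) : D.coevR X ≫ ε_ X (Xᘁ) = dim k X • 𝟙 _ := by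
  have h := leftTrace_eq (k := k) (𝟙 X)
  rw [PremodularCategory.spherical, rightTrace, MonoidalCategory.whiskerLeft_id,
    Category.id_comp] at h
  exact h

/-- Different summands do not meet. On a common summand the label `(X i)ᘁ ⊗ X i` is slid along the
evaluation to the unit, leaving a closed loop of value `dim (X i)`; the weights complete the sum to
`∑ i, dim (X i) ^ 2`. -/
theorem toInd_fromInd (A : C) : D.toInd A ≫ D.fromInd A = D.tot • 𝟙 _ := by
  have h1 : ∀ i j, i ≠ j → compAux (D.toIndAux A i) (D.fromIndAux A j) = 0 := fun i j hij => by
    calc _ = 𝟙 _ ⊗≫ (((D.X j)ᘁ : C) ⊗ D.X i ⊗ A) ◁ D.coevR (D.X i) ⊗≫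
          ((D.X j)ᘁ : C) ◁ (D.inI A i ≫ D.prI A j) ▷ D.X i ⊗≫
          ε_ (D.X j) ((D.X j)ᘁ) ▷ (A ⊗ ((D.X j)ᘁ : C) ⊗ D.X i) ⊗≫ 𝟙 _ := by
          dsimp only [compAux, toIndAux, fromIndAux]; monoidal
      _ = 0 := by rw [inI_prI_ne _ _ hij]; simp [monoidalComp]
  have h2 : ∀ i, rep k _ (compAux (D.toIndAux A i) (D.fromIndAux A i)) =
      dim k (D.X i) • 𝟙 _ := fun i => by
    have : compAux (D.toIndAux A i) (D.fromIndAux A i) = ε_ (D.X i) ((D.X i)ᘁ) ▷ A ≫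
        ((λ_ A).hom ≫ (ρ_ A).inv) ≫ A ◁ D.coevR (D.X i) := by
      calc _ = 𝟙 _ ⊗≫ (((D.X i)ᘁ : C) ⊗ D.X i ⊗ A) ◁ D.coevR (D.X i) ⊗≫
            ((D.X i)ᘁ : C) ◁ (D.inI A i ≫ D.prI A i) ▷ D.X i ⊗≫
            ε_ (D.X i) ((D.X i)ᘁ) ▷ (A ⊗ ((D.X i)ᘁ : C) ⊗ D.X i) ⊗≫ 𝟙 _ := by
            dsimp only [compAux, toIndAux, fromIndAux]; monoidal
        _ = 𝟙 _ ⊗≫ ((((D.X i)ᘁ : C) ⊗ D.X i) ◁ (A ◁ D.coevR (D.X i)) ≫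
            ε_ (D.X i) ((D.X i)ᘁ) ▷ (A ⊗ ((D.X i)ᘁ : C) ⊗ D.X i)) ⊗≫ 𝟙 _ := by
            rw [inI_prI]; monoidal
        _ = _ := by rw [whisker_exchange]; monoidal
    rw [this, rep_slide, Category.assoc, Category.assoc, ← MonoidalCategory.whiskerLeft_comp,
      coev_ev, MonoidalLinear.whiskerLeft_smul, Linear.comp_smul, Linear.comp_smul, rep_smul]
    congr 1
    rw [MonoidalCategory.whiskerLeft_id, Category.comp_id]
    change _ = incl k (𝟙 A)
    rw [incl, Category.id_comp]
    rfl
  rw [toInd, fromInd, Preadditive.sum_comp]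
  simp only [Preadditive.comp_sum, Linear.comp_smul, Linear.smul_comp, rep_comp]
  rw [tot, Finset.sum_smul]
  refine Finset.sum_congr rfl fun i _ => ?_
  rw [Finset.sum_eq_single i (fun j _ hj => by rw [h1 i j hj.symm, ← repₗ_apply, map_zero]; simp) (by simp),
    h2, smul_smul, smul_smul, sqrtDim_mul_self, pow_two]

/-- The rotations straighten against the cap in `fromIndAux` and join the cup in `toIndAux`,
producing a summand of the induced half-braiding. -/
theorem rot_fromInd_toInd (A B : C) {i j : D.ι} (p : B ⊗ D.X i ⟶ D.X j) (q : D.X j ⟶ B ⊗ D.X i) :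
    rotUp p ▷ D.IObj A ≫ compAux (D.fromIndAux A i) (D.toIndAux A j) ≫
      D.IObj A ◁ (PremodularCategory.piv k (C := C)).rotDown q =
    B ◁ D.prI A i ≫ D.loopMap A p q ≫ D.inI A j ▷ B := by
  set Y : C := ((D.X i)ᘁ : C)
  calc _ = 𝟙 _ ⊗≫ B ◁ η_ (D.X i) Y ▷ D.IObj A ⊗≫ (p ▷ (Y ⊗ D.IObj A) ≫ D.X j ◁ (Y ◁ D.prI A i ⊗≫
        ε_ (D.X i) Y ▷ (A ⊗ Y))) ⊗≫ (D.X j ⊗ A) ◁ D.coevR (D.X j) ▷ Y ⊗≫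
        (D.inI A j ▷ (D.X j ⊗ Y) ≫ D.IObj A ◁ (q ▷ Y ⊗≫ B ◁ D.evR (D.X i))) ⊗≫ 𝟙 _ := by
        dsimp only [rotUp, rotDown, compAux, toIndAux, fromIndAux]; monoidal
    _ = 𝟙 _ ⊗≫ B ◁ (η_ (D.X i) Y ▷ D.IObj A ≫ (D.X i ⊗ Y) ◁ D.prI A i) ⊗≫
        (B ⊗ D.X i) ◁ ε_ (D.X i) Y ▷ (A ⊗ Y) ⊗≫ p ▷ (A ⊗ Y) ⊗≫
        (D.X j ⊗ A) ◁ D.coevR (D.X j) ▷ Y ⊗≫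
        (D.X j ⊗ A ⊗ ((D.X j)ᘁ : C)) ◁ (q ▷ Y ⊗≫ B ◁ D.evR (D.X i)) ⊗≫ D.inI A j ▷ B := by
        rw [← whisker_exchange, ← whisker_exchange]; monoidal
    _ = 𝟙 _ ⊗≫ B ◁ D.prI A i ⊗≫ B ◁ (η_ (D.X i) Y ▷ D.X i ⊗≫ D.X i ◁ ε_ (D.X i) Y) ▷ (A ⊗ Y) ⊗≫
        p ▷ (A ⊗ Y) ⊗≫ (D.X j ⊗ A) ◁ D.coevR (D.X j) ▷ Y ⊗≫
        (D.X j ⊗ A ⊗ ((D.X j)ᘁ : C)) ◁ (q ▷ Y ⊗≫ B ◁ D.evR (D.X i)) ⊗≫ D.inI A j ▷ B := by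
        rw [← whisker_exchange]; monoidal
    _ = _ := by
        rw [evaluation_zigzag]; dsimp only [loopMap, rotOut]; monoidal

variable [CharZero k]

/-- Resolving the labels `X j ⊗ (X i)ᘁ` into simple labels by rotated dual bases turns the composite
into the sum of the classes of the induced half-braiding, weighted by dimensions. -/
theorem fromInd_toInd (A : C) :
    D.fromInd A ≫ D.toInd A = D.tot • D.encircle (D.indCenter A) := by
  have h1 : ∀ i j, rep k _ (compAux (D.fromIndAux A i) (D.toIndAux A j)) =
      ∑ l, dim k (D.X l) • ∑ α, rep k (D.X l) (D.X l ◁ D.prI A i ≫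
        D.loopMap A (D.dua j (D.X l ⊗ D.X i) α) (D.bas j (D.X l ⊗ D.X i) α) ≫
          D.inI A j ▷ D.X l) := fun i j => by
    rw [rep_eq_sum_rot]
    simp only [rot_fromInd_toInd]
  have h0 : D.tot • D.encircle (D.indCenter A) =
      ∑ l, dim k (D.X l) • rep k (D.X l) (D.gammaRaw A (D.X l)) := by
    rw [encircle, smul_smul, mul_inv_cancel₀ D.tot_ne_zero, one_smul]
    rfl
  refine Eq.trans ?_ h0.symm
  rw [toInd, fromInd, Preadditive.sum_comp]
  simp only [Preadditive.comp_sum, Linear.comp_smul, Linear.smul_comp, rep_comp, h1]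
  have h2 : ∀ l, rep k (D.X l) (D.gammaRaw A (D.X l)) =
      ∑ i, ∑ j, (D.sqrtDim i * D.sqrtDim j) • ∑ α, rep k (D.X l) (D.X l ◁ D.prI A i ≫
        D.loopMap A (D.dua j (D.X l ⊗ D.X i) α) (D.bas j (D.X l ⊗ D.X i) α) ≫
          D.inI A j ▷ D.X l) := fun l => by
    rw [gammaRaw]
    simp only [gammaComp_eq, Linear.comp_smul, Linear.smul_comp, Preadditive.comp_sum,
      Preadditive.sum_comp, rep_sum, rep_smul]
    rfl
  simp only [h2, Finset.smul_sum, smul_smul]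
  refine Eq.trans (Finset.sum_congr rfl fun i _ => Finset.sum_comm) (Finset.sum_comm.trans ?_)
  refine Finset.sum_congr rfl fun l _ => Finset.sum_congr rfl fun i _ =>
    Finset.sum_congr rfl fun j _ => Finset.sum_congr rfl fun α _ => ?_
  congr 1
  ring

theorem rotIn_coev {A U W : C} (g : W ⊗ A ⟶ U) :
    A ◁ D.coevR U ⊗≫ D.rotIn g ▷ U = 𝟙 _ ⊗≫ D.coevR W ▷ A ⊗≫ (Wᘁ : C) ◁ g := by
  calc _ = 𝟙 _ ⊗≫ (𝟙_ C ◁ (A ◁ D.coevR U) ≫ D.coevR W ▷ (A ⊗ (Uᘁ : C) ⊗ U)) ⊗≫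
        (Wᘁ : C) ◁ g ▷ ((Uᘁ : C) ⊗ U) ⊗≫ (Wᘁ : C) ◁ D.evR U ▷ U ⊗≫ 𝟙 _ := by
        dsimp only [rotIn]; monoidal
    _ = 𝟙 _ ⊗≫ D.coevR W ▷ A ⊗≫ (Wᘁ : C) ◁ ((W ⊗ A) ◁ D.coevR U ≫ g ▷ ((Uᘁ : C) ⊗ U)) ⊗≫
        (Wᘁ : C) ◁ D.evR U ▷ U ⊗≫ 𝟙 _ := by
        rw [whisker_exchange]; monoidal
    _ = 𝟙 _ ⊗≫ D.coevR W ▷ A ⊗≫ (Wᘁ : C) ◁ g ⊗≫ (Wᘁ : C) ◁ (U ◁ D.coevR U ⊗≫ D.evR U ▷ U) ⊗≫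
        𝟙 _ := by
        rw [whisker_exchange]; monoidal
    _ = _ := by rw [coev_zigzag]; monoidal

/-- The components of the image of a class under the trace functor. -/
def traceMap {X X' : C} {A U W : C} (ψ : A ⊗ X ⟶ X' ⊗ A) (p : U ⟶ W ⊗ A) (q : W ⊗ A ⟶ U) :
    U ⊗ (X ⊗ (Uᘁ : C)) ⟶ W ⊗ (X' ⊗ (Wᘁ : C)) :=
  𝟙 _ ⊗≫ p ▷ (X ⊗ (Uᘁ : C)) ⊗≫ W ◁ ψ ▷ (Uᘁ : C) ⊗≫ (W ⊗ X') ◁ D.rotIn q ⊗≫ 𝟙 _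

theorem toIndAux_traceRaw {X X' : C} (A : C) (ψ : A ⊗ X ⟶ X' ⊗ A) (i : D.ι) :
    D.toIndAux X i ≫ D.traceRaw A ψ ▷ D.X i = ∑ j, (D.sqrtDim i * D.sqrtDim j) • ∑ α,
      D.bas i (D.X j ⊗ A) α ▷ X ≫ compAux ψ (D.toIndAux X' j) ≫
        D.IObj X' ◁ D.dua i (D.X j ⊗ A) α := by
  have h1 : ∀ l j, D.toIndAux X i ≫ (D.prI X l ≫ D.traceComp A ψ l j ≫ D.inI X' j) ▷ D.X i =
      𝟙 _ ⊗≫ (D.X i ⊗ X) ◁ D.coevR (D.X i) ⊗≫ ((D.inI X i ≫ D.prI X l) ≫ D.traceComp A ψ l j ≫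
        D.inI X' j) ▷ D.X i := fun l j => by
    dsimp only [toIndAux]; monoidal
  have h2 : ∀ j (p : D.X i ⟶ D.X j ⊗ A) (q : D.X j ⊗ A ⟶ D.X i),
      𝟙 (D.X i ⊗ X) ⊗≫ (D.X i ⊗ X) ◁ D.coevR (D.X i) ⊗≫ (D.traceMap ψ p q ≫ D.inI X' j) ▷ D.X i =
      p ▷ X ≫ compAux ψ (D.toIndAux X' j) ≫ D.IObj X' ◁ q := fun j p q => by
    calc _ = 𝟙 _ ⊗≫ ((D.X i ⊗ X) ◁ D.coevR (D.X i) ≫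
          (p ▷ X ⊗≫ D.X j ◁ ψ) ▷ (((D.X i)ᘁ : C) ⊗ D.X i)) ⊗≫
          (D.X j ⊗ X') ◁ D.rotIn q ▷ D.X i ⊗≫ D.inI X' j ▷ D.X i := by
          dsimp only [traceMap]; monoidal
      _ = p ▷ X ⊗≫ D.X j ◁ ψ ⊗≫ (D.X j ⊗ X') ◁ (A ◁ D.coevR (D.X i) ⊗≫ D.rotIn q ▷ D.X i) ⊗≫
          D.inI X' j ▷ D.X i := by
          rw [whisker_exchange]; monoidal
      _ = p ▷ X ⊗≫ D.X j ◁ ψ ⊗≫ (D.X j ⊗ X') ◁ D.coevR (D.X j) ▷ A ⊗≫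
          ((D.X j ⊗ X' ⊗ ((D.X j)ᘁ : C)) ◁ q ≫ D.inI X' j ▷ D.X i) := by
          rw [rotIn_coev]; monoidal
      _ = _ := by
          rw [whisker_exchange]; dsimp only [compAux, toIndAux]; monoidal
  rw [traceRaw]
  simp only [sum_whiskerRight, Preadditive.comp_sum]
  rw [Finset.sum_eq_single i]
  · refine Finset.sum_congr rfl fun j _ => ?_
    rw [h1, inI_prI, Category.id_comp]
    have h3 : D.traceComp A ψ i j = (D.sqrtDim i * D.sqrtDim j) • ∑ α,
      D.traceMap ψ (D.bas i (D.X j ⊗ A) α) (D.dua i (D.X j ⊗ A) α) := rfl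
    rw [h3]
    refine Eq.trans ?_ (congrArg _ (Finset.sum_congr rfl fun α _ => h2 j (D.bas i (D.X j ⊗ A) α)
      (D.dua i (D.X j ⊗ A) α)))
    simp [monoidalComp, sum_whiskerRight, Preadditive.comp_sum, Preadditive.sum_comp]
  · intro l _ hl
    refine Finset.sum_eq_zero fun j _ => ?_
    rw [h1, inI_prI_ne _ _ hl.symm]
    simp [monoidalComp]
  · simp

/-- `toInd` is natural: the right side has labels `X j ⊗ A`, and resolving them into simple objects
`X i` gives the sum over dual bases in the definition of `G`. -/
theorem toInd_traceRaw {X X' : C} (A : C) (ψ : A ⊗ X ⟶ X' ⊗ A) :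
    D.toInd X ≫ ofHom k (D.traceRaw A ψ) = rep k A ψ ≫ D.toInd X' := by
  have h : ∀ j, rep k A ψ ≫ rep k (D.X j) (D.toIndAux X' j) = ∑ i, dim k (D.X i) • ∑ α,
      rep k (D.X i) (D.bas i (D.X j ⊗ A) α ▷ X ≫ compAux ψ (D.toIndAux X' j) ≫
        D.IObj X' ◁ D.dua i (D.X j ⊗ A) α) := fun j => by
    rw [rep_comp, D.rep_eq_sum]
  rw [toInd, toInd, Preadditive.sum_comp]
  simp only [Preadditive.comp_sum, Linear.comp_smul, Linear.smul_comp, h, rep_comp_ofHom,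
    toIndAux_traceRaw, rep_sum, rep_smul]
  simp only [Finset.smul_sum (r := D.sqrtDim _), smul_smul]
  rw [Finset.sum_comm]
  refine Finset.sum_congr rfl fun j _ => Finset.sum_congr rfl fun i _ => ?_
  rw [← D.sqrtDim_mul_self i]
  congr 1
  ring

end IrrData

end

/-! ### Whiskering in the horizontal trace and twisted half-braidings -/

section

variable {k : Type w} [Field k] [IsAlgClosed k] {C : Type u} [Category.{v} C] [Abelian C]
    [Linear k C] [MonoidalCategory C] [MonoidalPreadditive C] [MonoidalLinear k C]
    [BraidedCategory C] [RightRigidCategory C] [PremodularCategory k C]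
open HTr PivotalStructure

namespace HTr
variable {k : Type w} [CommRing k] {C : Type u₁} [Category.{v₁} C] [MonoidalCategory C]
  [Preadditive C] [Linear k C] [MonoidalPreadditive C] [MonoidalLinear k C] [BraidedCategory C]

/-- Whiskering on the right in the horizontal trace, with the objects in canonical form. -/
def wr {X X' : C} (x : (⟨X⟩ : HTr k C) ⟶ ⟨X'⟩) (Y : C) : (⟨X ⊗ Y⟩ : HTr k C) ⟶ ⟨X' ⊗ Y⟩ :=
  x ▷ (⟨Y⟩ : HTr k C)

/-- Whiskering on the left in the horizontal trace, with the objects in canonical form. -/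
def wl (X : C) {Y Y' : C} (y : (⟨Y⟩ : HTr k C) ⟶ ⟨Y'⟩) : (⟨X ⊗ Y⟩ : HTr k C) ⟶ ⟨X ⊗ Y'⟩ :=
  (⟨X⟩ : HTr k C) ◁ y

section
variable {X X' X'' Y Y' Y'' : C}

theorem wr_comp (x : (⟨X⟩ : HTr k C) ⟶ ⟨X'⟩) (x' : (⟨X'⟩ : HTr k C) ⟶ ⟨X''⟩) (Y : C) :
    wr (x ≫ x') Y = wr x Y ≫ wr x' Y := comp_whiskerRight x x' (⟨Y⟩ : HTr k C)

theorem wl_comp (X : C) (y : (⟨Y⟩ : HTr k C) ⟶ ⟨Y'⟩) (y' : (⟨Y'⟩ : HTr k C) ⟶ ⟨Y''⟩) :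
    wl X (y ≫ y') = wl X y ≫ wl X y' := MonoidalCategory.whiskerLeft_comp (⟨X⟩ : HTr k C) y y'

theorem wl_wr (x : (⟨X⟩ : HTr k C) ⟶ ⟨X'⟩) (y : (⟨Y⟩ : HTr k C) ⟶ ⟨Y'⟩) :
    wl X y ≫ wr x Y' = wr x Y ≫ wl X' y := whisker_exchange x y

theorem tensorHom_eq_wr (x : (⟨X⟩ : HTr k C) ⟶ ⟨X'⟩) (y : (⟨Y⟩ : HTr k C) ⟶ ⟨Y'⟩) :
    x ⊗ₘ y = wr x Y ≫ wl X' y := MonoidalCategory.tensorHom_def x y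

theorem wr_ofHom (f : X ⟶ X') (Y : C) : wr (ofHom k f) Y = ofHom k (f ▷ Y) := rightₗ_incl k f Y

theorem wl_ofHom (X : C) (f : Y ⟶ Y') : wl X (ofHom k f) = ofHom k (X ◁ f) := leftₗ_incl k X f

theorem wr_rep {A : C} (φ : A ⊗ X ⟶ X' ⊗ A) (Y : C) :
    wr (rep k A φ) Y = rep k A (rightAux φ Y) := rightₗ_cls k Y φ

theorem wl_rep {B : C} (X : C) (ψ : B ⊗ Y ⟶ Y' ⊗ B) :
    wl X (rep k B ψ) = rep k B (leftAux X ψ) := leftₗ_cls k X ψ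

theorem wr_smul (c : k) (x : (⟨X⟩ : HTr k C) ⟶ ⟨X'⟩) (Y : C) : wr (c • x) Y = c • wr x Y :=
  (rightₗ k _ _ _).map_smul c x

theorem wl_smul (X : C) (c : k) (y : (⟨Y⟩ : HTr k C) ⟶ ⟨Y'⟩) : wl X (c • y) = c • wl X y :=
  (leftₗ k _ _ _).map_smul c y

theorem wr_sum {ι : Type*} (s : Finset ι) (x : ι → ((⟨X⟩ : HTr k C) ⟶ ⟨X'⟩)) (Y : C) :
    wr (∑ i ∈ s, x i) Y = ∑ i ∈ s, wr (x i) Y := map_sum (rightₗ k X X' Y) x s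

theorem wl_sum (X : C) {ι : Type*} (s : Finset ι) (y : ι → ((⟨Y⟩ : HTr k C) ⟶ ⟨Y'⟩)) :
    wl X (∑ i ∈ s, y i) = ∑ i ∈ s, wl X (y i) := map_sum (leftₗ k X Y Y') y s

end
end HTr

/-- The tensor product of an object of the center with an object of the category, with the
half-braiding under the latter. -/
def Center.twist (X : Center C) (Y : C) : Center C :=
  Center.tensorObj X (Center.ofBraidedObj Y)

/-- The half-braiding of `twist` is the one that right whiskering in the horizontal trace produces;
this is what makes `encircle_twist` true. -/
theorem hb_twist (X : Center C) (Y A : C) :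
    IrrData.hb (X.twist Y) A = rightAux (IrrData.hb X A) Y := by
  have h : rightAux (IrrData.hb X A) Y = ((((α_ A X.1 Y).inv ≫ (X.2.β A).inv ▷ Y) ≫ (α_ X.1 A Y).hom) ≫
      X.1 ◁ (β_ Y A).inv) ≫ (α_ X.1 Y A).inv := by
    dsimp only [rightAux]; monoidal
  rw [h]
  rfl

theorem braiding_coev (X B : C) :
    𝟙 X ⊗≫ η_ B (Bᘁ) ▷ X ⊗≫ B ◁ (β_ (Bᘁ : C) X).hom =
      𝟙 X ⊗≫ X ◁ η_ B (Bᘁ) ⊗≫ (β_ B X).inv ▷ (Bᘁ : C) ⊗≫ 𝟙 (B ⊗ (X ⊗ (Bᘁ : C))) := by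
  have h := BraidedCategory.braiding_naturality_left (η_ B (Bᘁ)) X
  rw [BraidedCategory.braiding_tensor_left_hom, braiding_tensorUnit_left] at h
  calc _ = 𝟙 X ⊗≫ (η_ B (Bᘁ) ▷ X ≫ (α_ _ _ _).hom ≫ B ◁ (β_ (Bᘁ : C) X).hom ≫ (α_ _ _ _).inv ≫
        (β_ B X).hom ▷ (Bᘁ : C) ≫ (α_ _ _ _).hom) ⊗≫ (β_ B X).inv ▷ (Bᘁ : C) ⊗≫
          𝟙 (B ⊗ (X ⊗ (Bᘁ : C))) := by simp [monoidalComp]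
    _ = _ := by rw [h]; monoidal

namespace IrrData
variable (D : IrrData k C)

theorem braiding_evR (Y B : C) :
    (β_ Y B).inv ▷ (Bᘁ : C) ⊗≫ Y ◁ D.evR B =
      𝟙 _ ⊗≫ B ◁ (β_ Y (Bᘁ : C)).hom ⊗≫ D.evR B ▷ Y ⊗≫ 𝟙 (Y ⊗ 𝟙_ C) := by
  have h := BraidedCategory.braiding_naturality_right Y (D.evR B)
  rw [BraidedCategory.braiding_tensor_right_hom, braiding_tensorUnit_right] at h
  calc _ = 𝟙 _ ⊗≫ (β_ Y B).inv ▷ (Bᘁ : C) ⊗≫ (Y ◁ D.evR B ≫ (ρ_ Y).hom ≫ (λ_ Y).inv) ⊗≫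
        𝟙 (Y ⊗ 𝟙_ C) := by monoidal
    _ = 𝟙 _ ⊗≫ ((β_ Y B).inv ≫ (β_ Y B).hom) ▷ (Bᘁ : C) ⊗≫
        B ◁ (β_ Y (Bᘁ : C)).hom ⊗≫ D.evR B ▷ Y ⊗≫ 𝟙 (Y ⊗ 𝟙_ C) := by rw [h]; monoidal
    _ = _ := by rw [Iso.inv_hom_id]; monoidal

theorem twist_evR (X : Center C) (Y B : C) :
    rightAux (hb X B) Y ▷ (Bᘁ : C) ⊗≫ (X.1 ⊗ Y) ◁ D.evR B =
      𝟙 _ ⊗≫ hb X B ▷ (Y ⊗ (Bᘁ : C)) ⊗≫ (X.1 ⊗ B) ◁ (β_ Y (Bᘁ : C)).hom ⊗≫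
        X.1 ◁ D.evR B ▷ Y ⊗≫ 𝟙 ((X.1 ⊗ Y) ⊗ 𝟙_ C) := by
  calc _ = 𝟙 _ ⊗≫ hb X B ▷ (Y ⊗ (Bᘁ : C)) ⊗≫ X.1 ◁ ((β_ Y B).inv ▷ (Bᘁ : C) ⊗≫ Y ◁ D.evR B) ⊗≫
        𝟙 ((X.1 ⊗ Y) ⊗ 𝟙_ C) := by dsimp only [rightAux]; monoidal
    _ = _ := by rw [braiding_evR]; monoidal

theorem rotOut_evR {A U W : C} (q : W ⟶ A ⊗ U) :
    W ◁ D.rotOut q ⊗≫ D.evR W ▷ A ⊗≫ 𝟙 A = q ▷ (Uᘁ : C) ⊗≫ A ◁ D.evR U ⊗≫ 𝟙 A := by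
  calc _ = 𝟙 _ ⊗≫ W ◁ D.coevR W ▷ (Uᘁ : C) ⊗≫ ((W ⊗ (Wᘁ : C)) ◁ (q ▷ (Uᘁ : C) ⊗≫ A ◁ D.evR U) ≫
        D.evR W ▷ (A ⊗ 𝟙_ C)) ⊗≫ 𝟙 A := by dsimp only [rotOut]; monoidal
    _ = 𝟙 _ ⊗≫ (W ◁ D.coevR W ⊗≫ D.evR W ▷ W) ▷ (Uᘁ : C) ⊗≫ q ▷ (Uᘁ : C) ⊗≫ A ◁ D.evR U ⊗≫ 𝟙 A := by
        rw [whisker_exchange]; monoidal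
    _ = _ := by rw [coev_zigzag]; monoidal

/-- The summands of `Q`. -/
def encirclePair (X Y : Center C) (B : C) : X.1 ⊗ Y.1 ⟶ X.1 ⊗ Y.1 :=
  𝟙 _ ⊗≫ X.1 ◁ η_ B (Bᘁ) ▷ Y.1 ⊗≫
      (β_ B X.1).inv ▷ ((Bᘁ : C) ⊗ Y.1) ⊗≫
      (B ⊗ X.1) ◁ hb Y (Bᘁ : C) ⊗≫
      hb X B ▷ (Y.1 ⊗ (Bᘁ : C)) ⊗≫
      (X.1 ⊗ B) ◁ (β_ Y.1 (Bᘁ : C)).hom ⊗≫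
      X.1 ◁ D.evR B ▷ Y.1 ⊗≫ 𝟙 _

/-- `closure` for an object of the form `X.twist Y`. -/
def closureTwist (X : Center C) (Y : C) {V B : C} (ψ : (Bᘁ : C) ⊗ V ⟶ (X.1 ⊗ Y) ⊗ (Bᘁ : C)) :
    V ⟶ X.1 ⊗ Y :=
  𝟙 V ⊗≫ η_ B (Bᘁ) ▷ V ⊗≫ B ◁ ψ ⊗≫
      rightAux (hb X B) Y ▷ (Bᘁ : C) ⊗≫ (X.1 ⊗ Y) ◁ D.evR B ⊗≫ 𝟙 (X.1 ⊗ Y)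

theorem closure_twist (X : Center C) (Y : C) {V B : C} (ψ : (Bᘁ : C) ⊗ V ⟶ (X.1 ⊗ Y) ⊗ (Bᘁ : C)) :
    closure (k := k) (X.twist Y) B ψ = D.closureTwist X Y ψ := by
  have h' : ∀ (Z : Center C) {V : C} (ψ : (Bᘁ : C) ⊗ V ⟶ Z.1 ⊗ (Bᘁ : C)), closure (k := k) Z B ψ =
      (λ_ V).inv ≫ η_ B (Bᘁ) ▷ V ≫ (α_ _ _ _).hom ≫ B ◁ ψ ≫ (α_ _ _ _).inv ≫ hb Z B ▷ (Bᘁ : C) ≫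
        (α_ _ _ _).hom ≫ Z.1 ◁ D.evR B ≫ (ρ_ _).hom := fun Z V ψ => by
    dsimp only [closure]; monoidal
  refine (h' (X.twist Y) _).trans ?_
  rw [hb_twist]
  refine Eq.trans (b := (λ_ V).inv ≫ η_ B (Bᘁ) ▷ V ≫ (α_ _ _ _).hom ≫
    B ◁ ψ ≫ (α_ _ _ _).inv ≫ rightAux (hb X B) Y ▷ (Bᘁ : C) ≫
        (α_ _ _ _).hom ≫ (X.1 ⊗ Y) ◁ D.evR B ≫ (ρ_ _).hom) rfl ?_
  dsimp only [closureTwist]; monoidal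

/-- In the closure, `X.1` is pulled across the cup of `B`, and the half-braiding of `X.twist Y.1`
ends with `Y.1` crossing the cap; this is a summand of `Q`. -/
theorem closureTwist_leftAux (X Y : Center C) (B : C) :
    D.closureTwist X Y.1 (leftAux X.1 (hb Y (Bᘁ : C))) = D.encirclePair X Y B := by
  calc _ = 𝟙 _ ⊗≫ (𝟙 X.1 ⊗≫ η_ B (Bᘁ) ▷ X.1 ⊗≫ B ◁ (β_ (Bᘁ : C) X.1).hom) ▷ Y.1 ⊗≫
          (B ⊗ X.1) ◁ hb Y (Bᘁ : C) ⊗≫ (rightAux (hb X B) Y.1 ▷ (Bᘁ : C) ⊗≫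
            (X.1 ⊗ Y.1) ◁ D.evR B) ⊗≫ 𝟙 _ := by
          dsimp only [closureTwist, leftAux]; monoidal
    _ = _ := by rw [braiding_coev, twist_evR]; dsimp only [encirclePair]; monoidal

theorem encircle_twist (X : Center C) (Y : C) : D.encircle (X.twist Y) = wr (D.encircle X) Y := by
  rw [encircle, encircle, wr_smul, wr_sum]
  simp only [wr_smul, wr_rep, hb_twist]
  rfl

theorem rep_comp_encircle_twist (X : Center C) (Y : C) {V B : C}
    (ψ : (Bᘁ : C) ⊗ V ⟶ (X.1 ⊗ Y) ⊗ (Bᘁ : C)) :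
    rep k (Bᘁ : C) ψ ≫ wr (D.encircle X) Y =
      ofHom k (D.closureTwist X Y ψ) ≫ wr (D.encircle X) Y := by
  rw [← D.encircle_twist, ← closure_twist]
  exact D.rep_comp_encircle (X.twist Y) ψ

theorem rep_leftAux_comp (X Y : Center C) (B : C) :
    rep k (Bᘁ : C) (leftAux X.1 (hb Y (Bᘁ : C))) ≫ wr (D.encircle X) Y.1 =
      ofHom k (D.encirclePair X Y B) ≫ wr (D.encircle X) Y.1 := by
  rw [← closureTwist_leftAux]
  exact D.rep_comp_encircle_twist X Y.1 _

/-- The loop around `Y`, written with dual labels, is absorbed in the loop around `X.twist Y.1`, and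
the closures add up to `Q`. This is the source of all properties of `Q`. -/
theorem wl_encircle_comp (X Y : Center C) :
    wl X.1 (D.encircle Y) ≫ wr (D.encircle X) Y.1 =
      ofHom k (D.Q X Y) ≫ wr (D.encircle X) Y.1 := by
  have h : D.Q X Y = (D.tot)⁻¹ • ∑ i, dim k (D.X i) • D.encirclePair X Y (D.X i) := rfl
  rw [encircle_eq_dual, h, wl_smul, wl_sum, ofHom_smul, ofHom_sum]
  simp only [wl_smul, wl_rep, ofHom_smul, Linear.smul_comp, Preadditive.sum_comp, rep_leftAux_comp]

end IrrData

end

/-! ### The projection of the reduced tensor product -/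

section

variable {k : Type w} [Field k] [IsAlgClosed k] {C : Type u} [Category.{v} C] [Abelian C]
    [Linear k C] [MonoidalCategory C] [MonoidalPreadditive C] [MonoidalLinear k C]
    [BraidedCategory C] [RightRigidCategory C] [PremodularCategory k C]
open HTr PivotalStructure

section split
variable {C : Type u₁} [Category.{v₁} C] [MonoidalCategory C] [RightRigidCategory C]
open IrrData

/-- The half-braiding on the image of a split idempotent of the center. -/
def splitHalfBraiding (W : Center C) {Z : C} (i : Z ⟶ W.1) (p : W.1 ⟶ Z) (h : i ≫ p = 𝟙 Z)
    (hc : ∀ A, A ◁ (p ≫ i) ≫ hb W A = hb W A ≫ (p ≫ i) ▷ A) : HalfBraiding Z :=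
  have hp : ∀ A, A ◁ (p ≫ i) ≫ hb W A ≫ p ▷ A = hb W A ≫ p ▷ A := fun A => by
    rw [← Category.assoc, hc, Category.assoc, ← comp_whiskerRight, Category.assoc, h,
      Category.comp_id]
  halfBraidingOfFamily (fun A => A ◁ i ≫ hb W A ≫ p ▷ A)
    (fun {A B} f => by
      calc _ = A ◁ i ≫ (f ▷ W.1 ≫ hb W B) ≫ p ▷ B := by
            rw [← whisker_exchange_assoc, Category.assoc]
        _ = _ := by rw [hb_naturality]; simp only [Category.assoc, whisker_exchange])
    (fun A B => by
      calc _ = 𝟙 _ ⊗≫ A ◁ (B ◁ i ≫ hb W B) ⊗≫ (hb W A ≫ p ▷ A) ▷ B ⊗≫ 𝟙 _ := by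
            rw [hb_tensor]; monoidal
        _ = 𝟙 _ ⊗≫ A ◁ (B ◁ i ≫ hb W B) ⊗≫ (A ◁ (p ≫ i) ≫ hb W A ≫ p ▷ A) ▷ B ⊗≫ 𝟙 _ := by
            rw [hp]
        _ = _ := by monoidal)
    (by
      calc _ = 𝟙 _ ⊗≫ (i ≫ p) ⊗≫ 𝟙 _ := by rw [hb_unit]; monoidal
        _ = _ := by rw [h]; monoidal)

variable (W : Center C) {Z : C} (i : Z ⟶ W.1) (p : W.1 ⟶ Z) (h : i ≫ p = 𝟙 Z)
    (hc : ∀ A, A ◁ (p ≫ i) ≫ hb W A = hb W A ≫ (p ≫ i) ▷ A)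

/-- The image of a split idempotent of the center. -/
def splitObj : Center C := ⟨Z, splitHalfBraiding W i p h hc⟩

/-- The inclusion of the image of a split idempotent of the center. -/
def splitι : splitObj W i p h hc ⟶ W :=
  Center.homOfHb i fun A => by
    change A ◁ i ≫ hb W A = (A ◁ i ≫ hb W A ≫ p ▷ A) ≫ i ▷ A
    rw [Category.assoc, Category.assoc, ← comp_whiskerRight, ← hc, ← Category.assoc,
      ← MonoidalCategory.whiskerLeft_comp, ← Category.assoc i, h,
      Category.id_comp]

/-- The projection to the image of a split idempotent of the center. -/
def splitπ : W ⟶ splitObj W i p h hc :=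
  Center.homOfHb p fun A => by
    change A ◁ p ≫ (A ◁ i ≫ hb W A ≫ p ▷ A) = hb W A ≫ p ▷ A
    rw [← Category.assoc, ← MonoidalCategory.whiskerLeft_comp, ← Category.assoc, hc,
      Category.assoc, ← comp_whiskerRight, Category.assoc, h, Category.comp_id]

end split

namespace IrrData
variable (D : IrrData k C) [CharZero k]

theorem Q_comp_encircle (X Y : Center C) :
    ofHom k (D.Q X Y) ≫ D.encircle (X.twist Y.1) =
      wl X.1 (D.encircle Y) ≫ wr (D.encircle X) Y.1 := by
  rw [encircle_twist]
  exact (D.wl_encircle_comp X Y).symm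

theorem wr_encircle_idem (X : Center C) (Y : C) :
    wr (D.encircle X) Y ≫ wr (D.encircle X) Y = wr (D.encircle X) Y := by
  rw [← wr_comp, encircle_idem]

theorem wl_encircle_idem (X : C) (Y : Center C) :
    wl X (D.encircle Y) ≫ wl X (D.encircle Y) = wl X (D.encircle Y) := by
  rw [← wl_comp, encircle_idem]

/-- `Q` followed by the idempotent of `X.twist Y.1` is a product of two commuting idempotents, so it
is fixed by the same idempotent from the left; `central_of_comp_encircle` applies. -/
theorem Q_central (X Y : Center C) (A : C) :
    A ◁ D.Q X Y ≫ hb (X.twist Y.1) A = hb (X.twist Y.1) A ≫ D.Q X Y ▷ A := by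
  refine D.central_of_comp_encircle (X := X.twist Y.1) (Y := X.twist Y.1) (D.Q X Y) ?_ A
  have h := D.Q_comp_encircle X Y
  refine (congrArg (_ ≫ ·) h).trans (Eq.trans ?_ h.symm)
  rw [encircle_twist, wl_wr]
  exact (Category.assoc _ _ _).symm.trans (congrArg (· ≫ _) (D.wr_encircle_idem X Y.1))

/-- The two loops commute and are idempotent, and a morphism of `C` is determined by its composite
with the loop around `X`. -/
theorem Q_idem (X Y : Center C) : D.Q X Y ≫ D.Q X Y = D.Q X Y := by
  have h := D.wl_encircle_comp X Y
  suffices h' : ofHom k (D.Q X Y ≫ D.Q X Y) ≫ wr (D.encircle X) Y.1 =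
      ofHom k (D.Q X Y) ≫ wr (D.encircle X) Y.1 by
    rw [← encircle_twist] at h'
    exact D.comp_encircle_injective (Y := X.twist Y.1) h'
  rw [ofHom_comp, Category.assoc, ← h, wl_wr, ← Category.assoc, ← h, Category.assoc, ← wl_wr, ← Category.assoc,
    wl_encircle_idem]

theorem redπ_redι (X Y : Center C) : D.redπ X Y ≫ D.redι X Y = D.Q X Y := image.fac _

theorem redι_redπ (X Y : Center C) : D.redι X Y ≫ D.redπ X Y = 𝟙 _ := by
  have h := D.Q_idem X Y
  rw [← redπ_redι, Category.assoc] at h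
  have : Epi (D.redπ X Y) := inferInstanceAs (Epi (factorThruImage _))
  have : Mono (D.redι X Y) := inferInstanceAs (Mono (image.ι _))
  rw [cancel_epi, ← Category.assoc] at h
  exact (cancel_mono (D.redι X Y)).1 (h.trans (Category.id_comp _).symm)

/-- The part of `encirclePair` before the strand `X` is crossed back. -/
def encircleIn (X Y : Center C) (B : C) : X.1 ⊗ Y.1 ⟶ (B ⊗ (X.1 ⊗ Y.1)) ⊗ (Bᘁ : C) :=
  𝟙 _ ⊗≫ X.1 ◁ η_ B (Bᘁ) ▷ Y.1 ⊗≫ (β_ B X.1).inv ▷ ((Bᘁ : C) ⊗ Y.1) ⊗≫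
      (B ⊗ X.1) ◁ hb Y (Bᘁ : C) ⊗≫ 𝟙 _

theorem encirclePair_eq (X Y : Center C) (B : C) : D.encirclePair X Y B =
    encircleIn X Y B ⊗≫ (rightAux (hb X B) Y.1 ▷ (Bᘁ : C) ⊗≫ (X.1 ⊗ Y.1) ◁ D.evR B) ⊗≫
      𝟙 (X.1 ⊗ Y.1) := by
  rw [twist_evR]; dsimp only [encirclePair, encircleIn]; monoidal

theorem rightAux_hb_naturality (X : Center C) (Y : C) {A B : C} (f : A ⟶ B) :
    f ▷ (X.1 ⊗ Y) ≫ rightAux (hb X B) Y = rightAux (hb X A) Y ≫ (X.1 ⊗ Y) ◁ f := by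
  rw [← hb_twist, ← hb_twist]; exact hb_naturality (X.twist Y) f

theorem rightAux_hb_tensor (X : Center C) (Y A B : C) :
    rightAux (hb X (A ⊗ B)) Y = (α_ A B (X.1 ⊗ Y)).hom ≫ A ◁ rightAux (hb X B) Y ≫
      (α_ A (X.1 ⊗ Y) B).inv ≫ rightAux (hb X A) Y ▷ B ≫ (α_ (X.1 ⊗ Y) A B).hom := by
  rw [← hb_twist, ← hb_twist, ← hb_twist]; exact hb_tensor (X.twist Y) A B

/-- Multiplicativity of the half-braiding fuses the strand `A` with the encircling strand `B`. -/
theorem encirclePair_hb (X Y : Center C) (A B : C) :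
    A ◁ D.encirclePair X Y B ≫ rightAux (hb X A) Y.1 =
      A ◁ encircleIn X Y B ⊗≫ rightAux (hb X (A ⊗ B)) Y.1 ▷ (Bᘁ : C) ⊗≫
        ((X.1 ⊗ Y.1) ⊗ A) ◁ D.evR B ⊗≫ 𝟙 ((X.1 ⊗ Y.1) ⊗ A) := by
  calc _ = A ◁ encircleIn X Y B ⊗≫ A ◁ rightAux (hb X B) Y.1 ▷ (Bᘁ : C) ⊗≫
        ((A ⊗ (X.1 ⊗ Y.1)) ◁ D.evR B ≫ rightAux (hb X A) Y.1 ▷ (𝟙_ C)) ⊗≫ 𝟙 _ := by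
        rw [encirclePair_eq]; monoidal
    _ = _ := by rw [whisker_exchange, rightAux_hb_tensor]; monoidal

/-- The summands of `redHb`. -/
def redHbAux (X Y : Center C) {A U W : C} (p : A ⊗ U ⟶ W) (q : W ⟶ A ⊗ U) :
    A ⊗ (X.1 ⊗ Y.1) ⟶ (X.1 ⊗ Y.1) ⊗ A :=
  𝟙 _ ⊗≫ A ◁ X.1 ◁ η_ U (Uᘁ) ▷ Y.1 ⊗≫
      A ◁ (β_ U X.1).inv ▷ ((Uᘁ : C) ⊗ Y.1) ⊗≫
      (A ⊗ U ⊗ X.1) ◁ hb Y (Uᘁ : C) ⊗≫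
      p ▷ ((X.1 ⊗ Y.1) ⊗ (Uᘁ : C)) ⊗≫
      (W ⊗ X.1 ⊗ Y.1) ◁ D.rotOut q ⊗≫
      hb X W ▷ (Y.1 ⊗ (Wᘁ : C) ⊗ A) ⊗≫
      (X.1 ⊗ W) ◁ (β_ Y.1 (Wᘁ : C)).hom ▷ A ⊗≫
      X.1 ◁ D.evR W ▷ (Y.1 ⊗ A) ⊗≫ 𝟙 _

theorem redHbAux_eq (X Y : Center C) {A U W : C} (p : A ⊗ U ⟶ W) (q : W ⟶ A ⊗ U) :
    D.redHbAux X Y p q = A ◁ encircleIn X Y U ⊗≫ (p ▷ (X.1 ⊗ Y.1) ≫ rightAux (hb X W) Y.1 ≫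
      (X.1 ⊗ Y.1) ◁ q) ▷ (Uᘁ : C) ⊗≫ ((X.1 ⊗ Y.1) ⊗ A) ◁ D.evR U ⊗≫ 𝟙 ((X.1 ⊗ Y.1) ⊗ A) := by
  symm
  calc _ = A ◁ encircleIn X Y U ⊗≫ p ▷ (X.1 ⊗ Y.1) ▷ (Uᘁ : C) ⊗≫ rightAux (hb X W) Y.1 ▷ (Uᘁ : C) ⊗≫
        (X.1 ⊗ Y.1) ◁ (q ▷ (Uᘁ : C) ⊗≫ A ◁ D.evR U ⊗≫ 𝟙 A) ⊗≫ 𝟙 ((X.1 ⊗ Y.1) ⊗ A) := by monoidal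
    _ = A ◁ encircleIn X Y U ⊗≫ p ▷ (X.1 ⊗ Y.1) ▷ (Uᘁ : C) ⊗≫ (rightAux (hb X W) Y.1 ▷ (Uᘁ : C) ≫
        ((X.1 ⊗ Y.1) ⊗ W) ◁ D.rotOut q) ⊗≫ (X.1 ⊗ Y.1) ◁ D.evR W ▷ A ⊗≫
          𝟙 ((X.1 ⊗ Y.1) ⊗ A) := by rw [← rotOut_evR]; monoidal
    _ = A ◁ encircleIn X Y U ⊗≫ p ▷ (X.1 ⊗ Y.1) ▷ (Uᘁ : C) ⊗≫ (W ⊗ (X.1 ⊗ Y.1)) ◁ D.rotOut q ⊗≫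
        (rightAux (hb X W) Y.1 ▷ (Wᘁ : C) ⊗≫ (X.1 ⊗ Y.1) ◁ D.evR W) ▷ A ⊗≫
          𝟙 ((X.1 ⊗ Y.1) ⊗ A) := by rw [← whisker_exchange]; monoidal
    _ = _ := by rw [twist_evR]; dsimp only [redHbAux, encircleIn]; monoidal

/-- The sum over the dual bases of `A ⊗ X i` is a decomposition of the identity, so the fusion of
`A` with the loop can be undone. What remains is `Q` followed by the half-braiding of `X.twist Y.1`,
which restricts to the image of a central idempotent. -/
theorem redHb_eq (X Y : Center C) (A : C) :
    D.redHb X Y A = A ◁ D.Q X Y ≫ rightAux (hb X A) Y.1 := by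
  have h : D.redHb X Y A = (D.tot)⁻¹ • ∑ i, ∑ j, (dim k (D.X i) * dim k (D.X j)) • ∑ α,
    D.redHbAux X Y (D.dua j (A ⊗ D.X i) α) (D.bas j (A ⊗ D.X i) α) := rfl
  have hQ : D.Q X Y = (D.tot)⁻¹ • ∑ i, dim k (D.X i) • D.encirclePair X Y (D.X i) := rfl
  rw [h, hQ]
  simp only [MonoidalLinear.whiskerLeft_smul, whiskerLeft_sum, Linear.smul_comp,
    Preadditive.sum_comp]
  congr 1
  refine Finset.sum_congr rfl fun i _ => ?_
  simp only [mul_smul, ← Finset.smul_sum]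
  congr 1
  rw [encirclePair_hb]
  have h1 : rightAux (hb X (A ⊗ D.X i)) Y.1 = ∑ j, dim k (D.X j) • ∑ α,
      D.dua j (A ⊗ D.X i) α ▷ (X.1 ⊗ Y.1) ≫ rightAux (hb X (D.X j)) Y.1 ≫
        (X.1 ⊗ Y.1) ◁ D.bas j (A ⊗ D.X i) α := by
    simp only [← rightAux_hb_naturality, ← comp_whiskerRight_assoc, ← Preadditive.sum_comp,
      ← sum_whiskerRight, ← Linear.smul_comp, ← MonoidalLinear.smul_whiskerRight]
    rw [sum_dua_bas, id_whiskerRight, Category.id_comp]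
  simp only [redHbAux_eq, h1]
  simp [monoidalComp, sum_whiskerRight, Preadditive.sum_comp, Preadditive.comp_sum,
    -whiskerRight_tensor]

end IrrData

end

/-! ### The reduced tensor product in the Karoubi envelope -/

section

variable {k : Type w} [Field k] [IsAlgClosed k] {C : Type u} [Category.{v} C] [Abelian C]
    [Linear k C] [MonoidalCategory C] [MonoidalPreadditive C] [MonoidalLinear k C]
    [BraidedCategory C] [RightRigidCategory C] [PremodularCategory k C]
open HTr PivotalStructure Idempotents

namespace IrrData
variable (D : IrrData k C) [CharZero k]

theorem redπ_redι_central (X Y : Center C) (A : C) :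
    A ◁ (D.redπ X Y ≫ D.redι X Y) ≫ hb (X.twist Y.1) A =
      hb (X.twist Y.1) A ≫ (D.redπ X Y ≫ D.redι X Y) ▷ A := by
  have h := D.Q_central X Y A
  rw [← redπ_redι] at h
  exact h

/-- The half-braiding of the reduced tensor product. -/
def redHalfBraiding (X Y : Center C) : HalfBraiding (D.redObj X Y) :=
  splitHalfBraiding (X.twist Y.1) (D.redι X Y) (D.redπ X Y) (D.redι_redπ X Y)
    (D.redπ_redι_central X Y)

theorem redHalfBraiding_inv (X Y : Center C) (A : C) : ((D.redHalfBraiding X Y).β A).inv =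
    A ◁ D.redι X Y ≫ D.redHb X Y A ≫ D.redπ X Y ▷ A := by
  have h : ((D.redHalfBraiding X Y).β A).inv =
    A ◁ D.redι X Y ≫ hb (X.twist Y.1) A ≫ D.redπ X Y ▷ A := rfl
  rw [h, redHb_eq, ← redπ_redι, hb_twist]
  simp only [Category.assoc, ← MonoidalCategory.whiskerLeft_comp_assoc]
  rw [reassoc_of% (D.redι_redπ X Y)]
  rfl

variable {D} in
/-- The half-braidings of the reduced tensor category. -/
def reducedObjects : ReducedObjects D where
  indHB := D.indHalfBraiding
  indHB_inv _ _ := rfl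
  tensorHB := D.redHalfBraiding
  tensorHB_inv := D.redHalfBraiding_inv
  dualHB := dualHalfBraiding
  dualHB_inv _ _ := rfl

/-- The reduced tensor product of objects of the center. -/
abbrev redTensor (X Y : Center C) : Center C := (reducedObjects (D := D)).tens X Y

/-- The inclusion of the reduced tensor product. -/
def redIncl (X Y : Center C) : D.redTensor X Y ⟶ X.twist Y.1 :=
  splitι (X.twist Y.1) (D.redι X Y) (D.redπ X Y) (D.redι_redπ X Y)
    (D.redπ_redι_central X Y)

/-- The projection to the reduced tensor product. -/
def redProj (X Y : Center C) : X.twist Y.1 ⟶ D.redTensor X Y :=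
  splitπ (X.twist Y.1) (D.redι X Y) (D.redπ X Y) (D.redι_redπ X Y)
    (D.redπ_redι_central X Y)

/-- The idempotent of the reduced tensor product. -/
def encircleRed (X Y : Center C) : (⟨D.redObj X Y⟩ : HTr k C) ⟶ ⟨D.redObj X Y⟩ :=
  D.encircle (D.redTensor X Y)

theorem encircleRed_idem (X Y : Center C) :
    D.encircleRed X Y ≫ D.encircleRed X Y = D.encircleRed X Y :=
  D.encircle_idem (D.redTensor X Y)

/-- The tensor product of the idempotents of two objects of the center. -/
def encircleTensor (X Y : Center C) : (⟨X.1 ⊗ Y.1⟩ : HTr k C) ⟶ ⟨X.1 ⊗ Y.1⟩ :=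
  D.encircle X ⊗ₘ D.encircle Y

theorem encircleTensor_eq_wr (X Y : Center C) :
    D.encircleTensor X Y = wr (D.encircle X) Y.1 ≫ wl X.1 (D.encircle Y) :=
  tensorHom_eq_wr _ _

theorem encircleTensor_idem (X Y : Center C) :
    D.encircleTensor X Y ≫ D.encircleTensor X Y = D.encircleTensor X Y := by
  have h := tensorHom_comp_tensorHom (D.encircle X) (D.encircle Y) (D.encircle X) (D.encircle Y)
  rw [encircle_idem, encircle_idem] at h
  exact h

theorem encircleTensor_eq (X Y : Center C) :
    D.encircleTensor X Y = ofHom k (D.Q X Y) ≫ wr (D.encircle X) Y.1 := by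
  rw [encircleTensor_eq_wr, ← wl_wr, wl_encircle_comp]

theorem Q_wr_encircle (X Y : Center C) : ofHom k (D.Q X Y) ≫ wr (D.encircle X) Y.1 =
    wr (D.encircle X) Y.1 ≫ ofHom k (D.Q X Y) := by
  rw [← encircle_twist]
  exact D.ofHom_comp_encircle (Center.homOfHb (X := X.twist Y.1) (Y := X.twist Y.1) (D.Q X Y)
    (D.Q_central X Y))

theorem redι_encircle (X Y : Center C) : ofHom k (D.redι X Y) ≫ wr (D.encircle X) Y.1 =
    D.encircleRed X Y ≫ ofHom k (D.redι X Y) := by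
  rw [← encircle_twist]
  exact D.ofHom_comp_encircle (D.redIncl X Y)

theorem redπ_encircle (X Y : Center C) : ofHom k (D.redπ X Y) ≫ D.encircleRed X Y =
    wr (D.encircle X) Y.1 ≫ ofHom k (D.redπ X Y) := by
  rw [← encircle_twist]
  exact D.ofHom_comp_encircle (D.redProj X Y)

/-- On the image of `Q`, the tensor product of the idempotents of `X` and `Y` is the idempotent of
the reduced tensor product. Together with `redι_encircleTensor` this makes the two formal images
isomorphic. -/
theorem encircleTensor_redπ (X Y : Center C) : D.encircleTensor X Y ≫ ofHom k (D.redπ X Y) =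
    ofHom k (D.redπ X Y) ≫ D.encircleRed X Y := by
  rw [encircleTensor_eq, Q_wr_encircle, Category.assoc, ← ofHom_comp, redπ_encircle,
    ← redπ_redι, Category.assoc, redι_redπ, Category.comp_id]

theorem redι_encircleTensor (X Y : Center C) : ofHom k (D.redι X Y) ≫ D.encircleTensor X Y =
    D.encircleRed X Y ≫ ofHom k (D.redι X Y) := by
  rw [encircleTensor_eq, ← Category.assoc, ← ofHom_comp, ← redι_encircle,
    ← redπ_redι, ← Category.assoc, redι_redπ, Category.id_comp]

/-- The comparison of tensor products for the functor `toKar`. -/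
def redIso (X Y : Center C) : D.toKar.obj X ⊗ D.toKar.obj Y ≅ D.toKar.obj (D.redTensor X Y) where
  hom := ⟨D.encircleTensor X Y ≫ ofHom k (D.redπ X Y), by
    change D.encircleTensor X Y ≫ (D.encircleTensor X Y ≫ ofHom k (D.redπ X Y)) ≫
      D.encircleRed X Y = D.encircleTensor X Y ≫ ofHom k (D.redπ X Y)
    rw [← Category.assoc, ← Category.assoc, encircleTensor_idem, encircleTensor_redπ,
      Category.assoc, encircleRed_idem]⟩
  inv := ⟨ofHom k (D.redι X Y) ≫ D.encircleTensor X Y, by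
    change D.encircleRed X Y ≫ (ofHom k (D.redι X Y) ≫ D.encircleTensor X Y) ≫
      D.encircleTensor X Y = ofHom k (D.redι X Y) ≫ D.encircleTensor X Y
    rw [Category.assoc, encircleTensor_idem, redι_encircleTensor, ← Category.assoc,
      encircleRed_idem]⟩
  hom_inv_id := Karoubi.hom_ext _ _ (by
    change (D.encircleTensor X Y ≫ ofHom k (D.redπ X Y)) ≫ ofHom k (D.redι X Y) ≫
      D.encircleTensor X Y = D.encircleTensor X Y
    have h : ofHom k (D.Q X Y) ≫ D.encircleTensor X Y = D.encircleTensor X Y := by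
      rw [encircleTensor_eq, ← Category.assoc, ← ofHom_comp, Q_idem]
    rw [Category.assoc, ← Category.assoc (ofHom k _), ← ofHom_comp, redπ_redι, h,
      encircleTensor_idem])
  inv_hom_id := Karoubi.hom_ext _ _ (by
    change (ofHom k (D.redι X Y) ≫ D.encircleTensor X Y) ≫ D.encircleTensor X Y ≫
      ofHom k (D.redπ X Y) = D.encircleRed X Y
    rw [Category.assoc, ← Category.assoc (D.encircleTensor X Y), encircleTensor_idem,
      encircleTensor_redπ]
    rw [← Category.assoc, ← ofHom_comp, redι_redπ, ofHom_id]
    exact Category.id_comp _)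

end IrrData

/-! ### Morphisms of formal images represented by morphisms of `C` -/

namespace HTr
/-- A morphism of formal images is represented by a morphism of `C`. -/
def Represents {P Q : Karoubi (HTr k C)} (F : P ⟶ Q) (g : P.X.obj ⟶ Q.X.obj) : Prop :=
  F.f = ofHom k g ≫ Q.p

variable {P P' Q Q' R : Karoubi (HTr k C)}

/-- The idempotent of the middle object is absorbed by `F'`, so representatives compose directly. -/
theorem Represents.comp {F : P ⟶ Q} {F' : Q ⟶ R} {g : P.X.obj ⟶ Q.X.obj} {g' : Q.X.obj ⟶ R.X.obj}
    (h : Represents F g) (h' : Represents F' g') : Represents (F ≫ F') (g ≫ g') := by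
  change F.f ≫ F'.f = _
  have h1 : F.f ≫ F'.f = ofHom k g ≫ F'.f := by
    rw [h]
    exact (Category.assoc _ _ _).trans (congrArg (_ ≫ ·) (Karoubi.p_comp F'))
  rw [h1, h', ofHom_comp]
  exact (Category.assoc _ _ _).symm

theorem represents_id (P : Karoubi (HTr k C)) : Represents (𝟙 P) (𝟙 P.X.obj) := by
  change P.p = ofHom k (𝟙 P.X.obj) ≫ P.p
  rw [ofHom_id]
  exact (Category.id_comp _).symm

theorem Represents.tensor {F : P ⟶ Q} {F' : P' ⟶ Q'} {g : P.X.obj ⟶ Q.X.obj}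
    {g' : P'.X.obj ⟶ Q'.X.obj} (h : Represents F g) (h' : Represents F' g') :
    Represents (F ⊗ₘ F') (g ⊗ₘ g') := by
  have h1 : ofHom k (g ⊗ₘ g') = ofHom k g ⊗ₘ ofHom k g' := by
    rw [tensorHom_eq_wr, wr_ofHom, wl_ofHom, ← ofHom_comp, MonoidalCategory.tensorHom_def]
  change F.f ⊗ₘ F'.f = ofHom k (g ⊗ₘ g') ≫ (Q.p ⊗ₘ Q'.p)
  rw [h, h', h1]
  exact (tensorHom_comp_tensorHom _ _ _ _).symm

theorem Represents.whiskerLeft {F : P ⟶ Q} {g : P.X.obj ⟶ Q.X.obj}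
    (h : Represents F g) (R : Karoubi (HTr k C)) : Represents (R ◁ F) (R.X.obj ◁ g) := by
  have := (represents_id R).tensor h
  rwa [id_tensorHom, id_tensorHom] at this

theorem Represents.whiskerRight {F : P ⟶ Q} {g : P.X.obj ⟶ Q.X.obj}
    (h : Represents F g) (R : Karoubi (HTr k C)) : Represents (F ▷ R) (g ▷ R.X.obj) := by
  have := h.tensor (represents_id R)
  rwa [tensorHom_id, tensorHom_id] at this

theorem represents_associator (P Q R : Karoubi (HTr k C)) :
    Represents (α_ P Q R).hom (α_ P.X.obj Q.X.obj R.X.obj).hom :=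
  Karoubi.associator_hom_f'

theorem represents_leftUnitor (P : Karoubi (HTr k C)) :
    Represents (λ_ P).hom (λ_ P.X.obj).hom :=
  Karoubi.leftUnitor_hom_f.trans (by
    change _ = (λ_ P.X).hom ≫ P.p
    simp)

theorem represents_rightUnitor (P : Karoubi (HTr k C)) :
    Represents (ρ_ P).hom (ρ_ P.X.obj).hom :=
  Karoubi.rightUnitor_hom_f.trans (by
    change _ = (ρ_ P.X).hom ≫ P.p
    simp)

end HTr

namespace IrrData
variable (D : IrrData k C) [CharZero k]

theorem represents_redIso_hom (X Y : Center C) : Represents (D.redIso X Y).hom (D.redπ X Y) :=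
  D.encircleTensor_redπ X Y

theorem represents_redIso_inv (X Y : Center C) : Represents (D.redIso X Y).inv (D.redι X Y) :=
  rfl

theorem represents_toKar_map {X Y : Center C} (f : X ⟶ Y) : Represents (D.toKar.map f) f.f :=
  D.toKar_map_f' f

-- The principle by which the formulas of the reduced structure are verified: a morphism of `C` has
-- at most one composite of this kind, so any representative is the underlying morphism.
variable {D} in
theorem f_eq_of_represents {X Y : Center C} {f : X ⟶ Y} {g : X.1 ⟶ Y.1}
    (h : Represents (D.toKar.map f) g) : f.f = g :=
  D.comp_encircle_injective ((D.toKar_map_f' f).symm.trans h)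

end IrrData

end

/-! ### The tensor structure of the induction functor -/

section

variable {k : Type w} [Field k] [IsAlgClosed k] {C : Type u} [Category.{v} C] [Abelian C]
    [Linear k C] [MonoidalCategory C] [MonoidalPreadditive C] [MonoidalLinear k C]
    [BraidedCategory C] [RightRigidCategory C] [PremodularCategory k C]
open HTr PivotalStructure Idempotents

section
variable {C : Type u₁} [Category.{v₁} C] [MonoidalCategory C] [BraidedCategory C]

/-- A strand crossing both legs of a pair is pulled off it, by naturality of the braiding. -/
theorem cup_braiding {a A : C} (c : 𝟙_ C ⟶ a ⊗ A) (W : C) :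
    (λ_ W).inv ≫ c ▷ W ≫ (α_ a A W).hom ≫ a ◁ (β_ W A).inv ≫ (α_ a W A).inv ≫ (β_ W a).inv ▷ A ≫
      (α_ W a A).hom = (ρ_ W).inv ≫ W ◁ c := by
  have h := BraidedCategory.braiding_inv_naturality_left c W
  rw [BraidedCategory.braiding_tensor_right_inv, braiding_inv_tensorUnit_right] at h
  rw [h]
  simp

/-- A pair created on the right of `X` by a morphism `c`. -/
def cupAux {a A : C} (c : 𝟙_ C ⟶ a ⊗ A) (X : C) : A ⊗ X ⟶ (A ⊗ (X ⊗ a)) ⊗ A :=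
  𝟙 _ ⊗≫ (A ⊗ X) ◁ c ⊗≫ 𝟙 _

/-- The braiding occurring in `JComp`. -/
def nestAux (A B a b X Y : C) :
    (A ⊗ (X ⊗ a)) ⊗ (B ⊗ (Y ⊗ b)) ⟶ (A ⊗ B) ⊗ ((X ⊗ Y) ⊗ (b ⊗ a)) :=
  𝟙 _ ⊗≫ A ◁ (β_ B (X ⊗ a)).inv ▷ (Y ⊗ b) ⊗≫ (A ⊗ B ⊗ X) ◁ (β_ (Y ⊗ b) a).inv ⊗≫ 𝟙 _

/-- The crossings of the tensor product of the horizontal trace cancel against those of `J`, and the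
cup `c` ends up nested inside the cup `d`. -/
theorem tensorAux_cups {a b A B : C} (c : 𝟙_ C ⟶ a ⊗ A) (d : 𝟙_ C ⟶ b ⊗ B) (X Y : C) :
    tensorAux (cupAux c X) (cupAux d Y) ≫ nestAux A B a b X Y ▷ (A ⊗ B) =
    𝟙 _ ⊗≫ (A ⊗ B ⊗ X ⊗ Y) ◁ (d ⊗≫ b ◁ c ▷ B) ⊗≫
      𝟙 (((A ⊗ B) ⊗ ((X ⊗ Y) ⊗ (b ⊗ a))) ⊗ (A ⊗ B)) := by
  have h := cup_braiding c (B ⊗ (Y ⊗ b))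
  rw [BraidedCategory.braiding_tensor_left_inv B (Y ⊗ b) a] at h
  calc _ = 𝟙 _ ⊗≫ A ◁ (β_ B X).hom ▷ Y ⊗≫ (A ⊗ X ⊗ B ⊗ Y) ◁ d ⊗≫
        (A ⊗ X) ◁ c ▷ (B ⊗ (Y ⊗ b)) ▷ B ⊗≫ (A ⊗ X ⊗ a) ◁ (β_ (B ⊗ (Y ⊗ b)) A).inv ▷ B ⊗≫
        (A ⊗ X) ◁ (β_ B a).inv ▷ (Y ⊗ b) ▷ (A ⊗ B) ⊗≫
        A ◁ ((β_ B X).inv ▷ (a ⊗ (Y ⊗ b)) ≫ (B ⊗ X) ◁ (β_ (Y ⊗ b) a).inv) ▷ (A ⊗ B) ⊗≫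
        𝟙 (((A ⊗ B) ⊗ ((X ⊗ Y) ⊗ (b ⊗ a))) ⊗ (A ⊗ B)) := by
        dsimp only [tensorAux, nestAux, cupAux]
        rw [MonoidalCategory.tensorHom_def', BraidedCategory.braiding_tensor_right_inv B X a]
        monoidal
    _ = 𝟙 _ ⊗≫ A ◁ (β_ B X).hom ▷ Y ⊗≫ (A ⊗ X ⊗ B ⊗ Y) ◁ d ⊗≫
        (A ⊗ X) ◁ ((λ_ _).inv ≫ c ▷ (B ⊗ (Y ⊗ b)) ≫ (α_ _ _ _).hom ≫ a ◁ (β_ (B ⊗ (Y ⊗ b)) A).inv ≫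
        (α_ _ _ _).inv ≫ ((α_ _ _ _).inv ≫ (β_ B a).inv ▷ (Y ⊗ b) ≫ (α_ _ _ _).hom ≫ B ◁ (β_ (Y ⊗ b) a).inv ≫
          (α_ _ _ _).inv) ▷ A ≫ (α_ _ _ _).hom) ▷ B ⊗≫
        A ◁ (β_ B X).inv ▷ (Y ⊗ b ⊗ a ⊗ A ⊗ B) ⊗≫
        𝟙 (((A ⊗ B) ⊗ ((X ⊗ Y) ⊗ (b ⊗ a))) ⊗ (A ⊗ B)) := by
        rw [← whisker_exchange]; monoidal
    _ = 𝟙 _ ⊗≫ A ◁ (β_ B X).hom ▷ Y ⊗≫ A ◁ ((X ⊗ B) ◁ (Y ◁ (d ⊗≫ b ◁ c ▷ B)) ≫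
        (β_ B X).inv ▷ (Y ⊗ (b ⊗ ((a ⊗ A) ⊗ B)))) ⊗≫
        𝟙 (((A ⊗ B) ⊗ ((X ⊗ Y) ⊗ (b ⊗ a))) ⊗ (A ⊗ B)) := by
        rw [h]; monoidal
    _ = 𝟙 _ ⊗≫ A ◁ ((β_ B X).hom ≫ (β_ B X).inv) ▷ Y ⊗≫ (A ⊗ B ⊗ X ⊗ Y) ◁ (d ⊗≫ b ◁ c ▷ B) ⊗≫
        𝟙 (((A ⊗ B) ⊗ ((X ⊗ Y) ⊗ (b ⊗ a))) ⊗ (A ⊗ B)) := by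
        rw [whisker_exchange]; monoidal
    _ = _ := by rw [Iso.hom_inv_id]; monoidal

theorem tensorAux_comp {X X' Y Y' A B V W : C} (φ : A ⊗ X ⟶ X' ⊗ A) (ψ : B ⊗ Y ⟶ Y' ⊗ B)
    (f : X' ⟶ V) (g : Y' ⟶ W) :
    tensorAux (φ ≫ f ▷ A) (ψ ≫ g ▷ B) = tensorAux φ ψ ≫ (f ⊗ₘ g) ▷ (A ⊗ B) := by
  have h : X' ◁ ((β_ Y' A).inv ≫ g ▷ A) = X' ◁ (A ◁ g ≫ (β_ W A).inv) := by
    rw [BraidedCategory.braiding_inv_naturality_right]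
  calc _ = 𝟙 _ ⊗≫ A ◁ (β_ B X).hom ▷ Y ⊗≫ (φ ⊗ₘ ψ) ⊗≫ (f ▷ (A ⊗ Y') ≫ V ◁ (A ◁ g ≫ (β_ W A).inv)) ▷ B
        ⊗≫ 𝟙 _ := by
        dsimp only [tensorAux]
        rw [← tensorHom_comp_tensorHom, MonoidalCategory.tensorHom_def (f ▷ A)]
        monoidal
    _ = 𝟙 _ ⊗≫ A ◁ (β_ B X).hom ▷ Y ⊗≫ (φ ⊗ₘ ψ) ⊗≫ X' ◁ ((β_ Y' A).inv ≫ g ▷ A) ▷ B ⊗≫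
        f ▷ (W ⊗ A ⊗ B) ⊗≫ 𝟙 _ := by
        rw [← whisker_exchange, ← h]; monoidal
    _ = _ := by
        rw [MonoidalCategory.tensorHom_def' f g]
        dsimp only [tensorAux]; monoidal

end

namespace IrrData
variable (D : IrrData k C)

theorem rotPair_cups {U V W : C} (f : W ⟶ U ⊗ V) :
    D.coevR V ⊗≫ (Vᘁ : C) ◁ D.coevR U ▷ V ⊗≫ D.rotPair f ▷ (U ⊗ V) =
      D.coevR W ≫ (Wᘁ : C) ◁ f := by
  calc _ = 𝟙 _ ⊗≫ (𝟙_ C ◁ (D.coevR V ⊗≫ (Vᘁ : C) ◁ D.coevR U ▷ V) ≫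
        D.coevR W ▷ ((Vᘁ : C) ⊗ (((Uᘁ : C) ⊗ U) ⊗ V))) ⊗≫
        (Wᘁ : C) ◁ f ▷ ((Vᘁ : C) ⊗ (Uᘁ : C) ⊗ U ⊗ V) ⊗≫
        ((Wᘁ : C) ⊗ U) ◁ D.evR V ▷ ((Uᘁ : C) ⊗ U ⊗ V) ⊗≫ (Wᘁ : C) ◁ D.evR U ▷ (U ⊗ V) ⊗≫ 𝟙 _ := by
        dsimp only [rotPair]; monoidal
    _ = 𝟙 _ ⊗≫ D.coevR W ⊗≫ (Wᘁ : C) ◁ (W ◁ (D.coevR V ⊗≫ (Vᘁ : C) ◁ D.coevR U ▷ V) ≫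
        f ▷ ((Vᘁ : C) ⊗ (((Uᘁ : C) ⊗ U) ⊗ V))) ⊗≫
        ((Wᘁ : C) ⊗ U) ◁ D.evR V ▷ ((Uᘁ : C) ⊗ U ⊗ V) ⊗≫ (Wᘁ : C) ◁ D.evR U ▷ (U ⊗ V) ⊗≫ 𝟙 _ := by
        rw [whisker_exchange]; monoidal
    _ = 𝟙 _ ⊗≫ D.coevR W ⊗≫ (Wᘁ : C) ◁ f ⊗≫ ((Wᘁ : C) ⊗ U) ◁ (V ◁ D.coevR V ⊗≫
        ((V ⊗ (Vᘁ : C)) ◁ D.coevR U ≫ D.evR V ▷ ((Uᘁ : C) ⊗ U)) ▷ V) ⊗≫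
        (Wᘁ : C) ◁ D.evR U ▷ (U ⊗ V) ⊗≫ 𝟙 _ := by
        rw [whisker_exchange]; monoidal
    _ = 𝟙 _ ⊗≫ D.coevR W ⊗≫ (Wᘁ : C) ◁ f ⊗≫ ((Wᘁ : C) ⊗ U) ◁ (V ◁ D.coevR V ⊗≫ D.evR V ▷ V) ⊗≫
        (Wᘁ : C) ◁ (U ◁ D.coevR U ⊗≫ D.evR U ▷ U) ▷ V ⊗≫ 𝟙 _ := by
        rw [whisker_exchange]; monoidal
    _ = _ := by rw [coev_zigzag, coev_zigzag]; monoidal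

/-- The summands of `JComp`. -/
def JAux (X Y : C) {A B W : C} (p : A ⊗ B ⟶ W) (q : W ⟶ A ⊗ B) :
    (A ⊗ (X ⊗ (Aᘁ : C))) ⊗ (B ⊗ (Y ⊗ (Bᘁ : C))) ⟶ W ⊗ ((X ⊗ Y) ⊗ (Wᘁ : C)) :=
  𝟙 _ ⊗≫ A ◁ (β_ B (X ⊗ (Aᘁ : C))).inv ▷ (Y ⊗ (Bᘁ : C)) ⊗≫
      (A ⊗ B ⊗ X) ◁ (β_ (Y ⊗ (Bᘁ : C)) (Aᘁ : C)).inv ⊗≫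
      p ▷ (X ⊗ Y ⊗ (Bᘁ : C) ⊗ (Aᘁ : C)) ⊗≫
      (W ⊗ X ⊗ Y) ◁ D.rotPair q ⊗≫ 𝟙 _

/-- The nested cups followed by `rotPair q` are the cup of `W` followed by `q` (`rotPair_cups`). Now
`p` and `q` stand at the two ends of the label, ready to be slid together. -/
theorem tensorAux_JAux (X Y : C) {A B W : C} (p : A ⊗ B ⟶ W) (q : W ⟶ A ⊗ B) :
    tensorAux (cupAux (D.coevR A) X) (cupAux (D.coevR B) Y) ≫ D.JAux X Y p q ▷ (A ⊗ B) =
      p ▷ (X ⊗ Y) ≫ cupAux (D.coevR W) (X ⊗ Y) ≫ (W ⊗ ((X ⊗ Y) ⊗ (Wᘁ : C))) ◁ q := by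
  have h := tensorAux_cups (D.coevR A) (D.coevR B) X Y
  calc _ = (tensorAux (cupAux (D.coevR A) X) (cupAux (D.coevR B) Y) ≫
        nestAux A B (Aᘁ : C) (Bᘁ : C) X Y ▷ (A ⊗ B)) ⊗≫
        p ▷ (X ⊗ Y ⊗ (Bᘁ : C) ⊗ (Aᘁ : C)) ▷ (A ⊗ B) ⊗≫
        (W ⊗ X ⊗ Y) ◁ D.rotPair q ▷ (A ⊗ B) ⊗≫ 𝟙 ((W ⊗ ((X ⊗ Y) ⊗ (Wᘁ : C))) ⊗ (A ⊗ B)) := by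
        dsimp only [JAux, nestAux]; monoidal
    _ = 𝟙 _ ⊗≫ ((A ⊗ B) ◁ ((X ⊗ Y) ◁ (D.coevR B ⊗≫ (Bᘁ : C) ◁ D.coevR A ▷ B)) ≫
        p ▷ ((X ⊗ Y) ⊗ ((Bᘁ : C) ⊗ (((Aᘁ : C) ⊗ A) ⊗ B)))) ⊗≫ (W ⊗ X ⊗ Y) ◁ D.rotPair q ▷ (A ⊗ B) ⊗≫
        𝟙 ((W ⊗ ((X ⊗ Y) ⊗ (Wᘁ : C))) ⊗ (A ⊗ B)) := by rw [h]; monoidal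
    _ = p ▷ (X ⊗ Y) ⊗≫ (W ⊗ X ⊗ Y) ◁ (D.coevR B ⊗≫ (Bᘁ : C) ◁ D.coevR A ▷ B ⊗≫
        D.rotPair q ▷ (A ⊗ B)) ⊗≫
        𝟙 ((W ⊗ ((X ⊗ Y) ⊗ (Wᘁ : C))) ⊗ (A ⊗ B)) := by rw [whisker_exchange]; monoidal
    _ = _ := by rw [rotPair_cups]; dsimp only [cupAux]; monoidal

theorem toIndAux_eq (X : C) (i : D.ι) :
    D.toIndAux X i = cupAux (D.coevR (D.X i)) X ≫ D.inI X i ▷ D.X i := by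
  dsimp only [toIndAux, cupAux]; monoidal

theorem inI_JRaw (X Y : C) (i l : D.ι) : (D.inI X i ⊗ₘ D.inI Y l) ≫ D.JRaw X Y =
    ∑ j, (D.sqrtDim i * D.sqrtDim j * D.sqrtDim l) • ∑ α,
      D.JAux X Y (D.dua j (D.X i ⊗ D.X l) α) (D.bas j (D.X i ⊗ D.X l) α) ≫ D.inI (X ⊗ Y) j := by
  have h : ∀ i' l' j, (D.inI X i ⊗ₘ D.inI Y l) ≫ (D.prI X i' ⊗ₘ D.prI Y l') ≫
      D.JComp X Y i' l' j ≫ D.inI (X ⊗ Y) j = ((D.inI X i ≫ D.prI X i') ⊗ₘ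
        (D.inI Y l ≫ D.prI Y l')) ≫ D.JComp X Y i' l' j ≫ D.inI (X ⊗ Y) j := fun i' l' j => by
    rw [tensorHom_comp_tensorHom_assoc]
  rw [JRaw]
  simp only [Preadditive.comp_sum, h]
  rw [Finset.sum_eq_single i, Finset.sum_eq_single l]
  · simp only [inI_prI, id_tensorHom_id, Category.id_comp]
    refine Finset.sum_congr rfl fun j _ => ?_
    have h3 : D.JComp X Y i l j = (D.sqrtDim i * D.sqrtDim j * D.sqrtDim l) • ∑ α,
      D.JAux X Y (D.dua j (D.X i ⊗ D.X l) α) (D.bas j (D.X i ⊗ D.X l) α) := rfl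
    rw [h3, Linear.smul_comp, Preadditive.sum_comp]
  · intro l' _ hl
    refine Finset.sum_eq_zero fun j _ => ?_
    rw [inI_prI_ne _ _ hl.symm, MonoidalPreadditive.tensor_zero, zero_comp]
  · simp
  · intro i' _ hi
    refine Finset.sum_eq_zero fun l' _ => Finset.sum_eq_zero fun j _ => ?_
    rw [inI_prI_ne _ _ hi.symm, MonoidalPreadditive.zero_tensor, zero_comp]
  · simp

theorem rep_tensor {X X' Y Y' A B : C} (φ : A ⊗ X ⟶ X' ⊗ A) (ψ : B ⊗ Y ⟶ Y' ⊗ B) :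
    wr (rep k A φ) Y ≫ wl X' (rep k B ψ) = rep k (A ⊗ B) (tensorAux φ ψ) :=
  (tensorHom_eq_wr _ _).symm.trans (tensorₗ_cls k φ ψ)

/-- Sliding the basis element around the loop brings it against its dual, so that each pair
contributes the inverse of `dim (X j)`, and there are `mult` of them. -/
theorem rep_toInd_JRaw (X Y : C) (i l : D.ι) :
    (wr (rep k (D.X i) (D.toIndAux X i)) Y ≫ wl _ (rep k (D.X l) (D.toIndAux Y l))) ≫
      ofHom k (D.JRaw X Y) =
    ∑ j, (D.sqrtDim i * D.sqrtDim l * ((dim k (D.X j))⁻¹ * D.mult (D.X j) (D.X i ⊗ D.X l))) •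
      D.sqrtDim j • rep k (D.X j) (D.toIndAux (X ⊗ Y) j) := by
  rw [rep_tensor, rep_comp_ofHom, toIndAux_eq, toIndAux_eq, tensorAux_comp, Category.assoc,
    ← comp_whiskerRight, inI_JRaw]
  simp only [sum_whiskerRight, Preadditive.comp_sum, MonoidalLinear.smul_whiskerRight,
    Linear.comp_smul, rep_sum, rep_smul]
  refine Finset.sum_congr rfl fun j _ => ?_
  have h : ∀ α, rep k (D.X i ⊗ D.X l) (tensorAux (cupAux (D.coevR (D.X i)) X)
      (cupAux (D.coevR (D.X l)) Y) ≫ (D.JAux X Y (D.dua j (D.X i ⊗ D.X l) α)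
        (D.bas j (D.X i ⊗ D.X l) α) ≫ D.inI (X ⊗ Y) j) ▷ (D.X i ⊗ D.X l)) =
      (dim k (D.X j))⁻¹ • rep k (D.X j) (D.toIndAux (X ⊗ Y) j) := fun α => by
    rw [comp_whiskerRight, ← Category.assoc, tensorAux_JAux, Category.assoc, Category.assoc,
      whisker_exchange, ← Category.assoc (cupAux _ _), ← toIndAux_eq, ← Category.assoc,
      ← rep_slide, ← comp_whiskerRight_assoc, bas_comp_dua]
    simp [rep_smul]
  simp only [h, Finset.sum_const, Finset.card_univ, Fintype.card_fin, smul_smul,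
    ← Nat.cast_smul_eq_nsmul k]
  congr 1
  ring

theorem sum_dim_dim_mult (j : D.ι) : ∑ i, ∑ l, dim k (D.X i) * dim k (D.X l) *
    D.mult (D.X j) (D.X i ⊗ D.X l) = D.tot * dim k (D.X j) := by
  rw [Finset.sum_comm]
  have h : ∀ l, ∑ i, dim k (D.X i) * dim k (D.X l) * D.mult (D.X j) (D.X i ⊗ D.X l) =
      dim k (D.X l) ^ 2 * dim k (D.X j) := fun l => by
    calc _ = dim k (D.X l) * ∑ i, dim k (D.X i) * D.mult (D.X j) (D.X i ⊗ D.X l) := by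
          rw [Finset.mul_sum]; exact Finset.sum_congr rfl fun i _ => by ring
      _ = _ := by rw [sum_dim_mult]; ring
  simp only [h]
  rw [← Finset.sum_mul]; rfl

/-- Multiplicativity of `toInd`: for fixed `j`, the sum over `i` and `l` of the weights and
multiplicities is evaluated by `sum_dim_dim_mult`. -/
theorem toInd_JRaw (X Y : C) : (wr (D.toInd X) Y ≫ wl _ (D.toInd Y)) ≫ ofHom k (D.JRaw X Y) =
    D.tot • D.toInd (X ⊗ Y) := by
  rw [toInd, toInd, toInd, wr_sum, wl_sum]
  simp only [wr_smul, wl_smul, Preadditive.sum_comp, Preadditive.comp_sum, Linear.smul_comp,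
    Linear.comp_smul, rep_toInd_JRaw, Finset.smul_sum, smul_smul]
  refine Eq.trans (Finset.sum_congr rfl fun i _ => Finset.sum_comm) (Finset.sum_comm.trans ?_)
  refine Finset.sum_congr rfl fun j _ => ?_
  simp only [← Finset.sum_smul]
  congr 1
  calc _ = (∑ i, ∑ l, dim k (D.X i) * dim k (D.X l) * D.mult (D.X j) (D.X i ⊗ D.X l)) *
        (dim k (D.X j))⁻¹ * D.sqrtDim j := by
        simp only [Finset.sum_mul, ← sqrtDim_mul_self]
        refine Finset.sum_comm.trans (Finset.sum_congr rfl fun i _ => Finset.sum_congr rfl fun l _ => ?_)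
        ring
    _ = _ := by rw [sum_dim_dim_mult, mul_assoc D.tot, mul_inv_cancel₀ (D.dim_X_ne_zero j), mul_one]

end IrrData

end

/-! ### Units, evaluations and coevaluations -/

section

variable {k : Type w} [Field k] [IsAlgClosed k] {C : Type u} [Category.{v} C] [Abelian C]
    [Linear k C] [MonoidalCategory C] [MonoidalPreadditive C] [MonoidalLinear k C]
    [BraidedCategory C] [RightRigidCategory C] [PremodularCategory k C]
open HTr PivotalStructure Idempotents

namespace IrrData
variable (D : IrrData k C)

theorem fromIndAux_pair {Z : C} (A : C) (i : D.ι) (g : A ⊗ ((D.X i)ᘁ : C) ⟶ Z) :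
    𝟙 (D.IObj A) ⊗≫ η_ (D.X i) ((D.X i)ᘁ) ▷ D.IObj A ⊗≫ D.X i ◁ (D.fromIndAux A i ≫ g) =
      D.prI A i ⊗≫ D.X i ◁ g := by
  calc _ = 𝟙 (D.IObj A) ⊗≫ (η_ (D.X i) ((D.X i)ᘁ) ▷ D.IObj A ≫ (D.X i ⊗ ((D.X i)ᘁ : C)) ◁ D.prI A i) ⊗≫
        D.X i ◁ ε_ (D.X i) ((D.X i)ᘁ) ▷ (A ⊗ ((D.X i)ᘁ : C)) ⊗≫ D.X i ◁ g := by
        dsimp only [fromIndAux]; monoidal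
    _ = D.prI A i ⊗≫ (η_ (D.X i) ((D.X i)ᘁ) ▷ D.X i ⊗≫ D.X i ◁ ε_ (D.X i) ((D.X i)ᘁ)) ▷ (A ⊗ ((D.X i)ᘁ : C)) ⊗≫ D.X i ◁ g := by
        rw [← whisker_exchange]; monoidal
    _ = _ := by rw [evaluation_zigzag]; monoidal

/-- Whiskered by `X`, the cap in `fromInd` is closed up by absorption; the resulting picture is the
one defining the left unit constraint. -/
theorem closure_leftUnit (X : Center C) (i : D.ι) :
    closure (k := k) X (D.X i) (rightAux (D.fromIndAux (𝟙_ C) i) X.1 ≫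
      (λ_ X.1).hom ▷ ((D.X i)ᘁ : C)) = D.prI (𝟙_ C) i ▷ X.1 ⊗≫ D.X i ◁ (β_ X.1 ((D.X i)ᘁ : C)).inv ⊗≫
      hb X (D.X i) ▷ ((D.X i)ᘁ : C) ⊗≫ X.1 ◁ D.evR (D.X i) ⊗≫ 𝟙 _ := by
  have h := D.fromIndAux_pair (𝟙_ C) i (𝟙 _)
  set B := D.X i
  calc _ = 𝟙 _ ⊗≫ (𝟙 (D.IObj (𝟙_ C)) ⊗≫ η_ B (Bᘁ) ▷ D.IObj (𝟙_ C) ⊗≫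
        B ◁ (D.fromIndAux (𝟙_ C) i ≫ 𝟙 _)) ▷ X.1 ⊗≫ B ◁ (β_ X.1 (Bᘁ : C)).inv ⊗≫
        hb X B ▷ (Bᘁ : C) ⊗≫ X.1 ◁ D.evR B ⊗≫ 𝟙 _ := by
        dsimp only [closure, rightAux]; monoidal
    _ = _ := by rw [h]; monoidal

/-- Here the label first crosses `X`, which after closure becomes the crossing of `X` over the
strand `X i`. -/
theorem closure_rightUnit (X : Center C) (i : D.ι) :
    closure (k := k) X (D.X i) (leftAux X.1 (D.fromIndAux (𝟙_ C) i) ≫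
      (ρ_ X.1).hom ▷ ((D.X i)ᘁ : C)) = X.1 ◁ D.prI (𝟙_ C) i ⊗≫ (β_ (D.X i) X.1).inv ▷ ((D.X i)ᘁ : C) ⊗≫
      hb X (D.X i) ▷ ((D.X i)ᘁ : C) ⊗≫ X.1 ◁ D.evR (D.X i) ⊗≫ 𝟙 _ := by
  have h := D.fromIndAux_pair (𝟙_ C) i (𝟙 _)
  set B := D.X i
  set I := D.IObj (𝟙_ C)
  calc _ = 𝟙 _ ⊗≫ (𝟙 X.1 ⊗≫ η_ B (Bᘁ) ▷ X.1 ⊗≫ B ◁ (β_ (Bᘁ : C) X.1).hom) ▷ I ⊗≫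
        (B ⊗ X.1) ◁ D.fromIndAux (𝟙_ C) i ⊗≫
        hb X B ▷ (Bᘁ : C) ⊗≫ X.1 ◁ D.evR B ⊗≫ 𝟙 _ := by
        dsimp only [closure, leftAux]; monoidal
    _ = 𝟙 _ ⊗≫ X.1 ◁ η_ B (Bᘁ) ▷ I ⊗≫ ((β_ B X.1).inv ▷ ((Bᘁ : C) ⊗ I) ≫
        (B ⊗ X.1) ◁ D.fromIndAux (𝟙_ C) i) ⊗≫
        hb X B ▷ (Bᘁ : C) ⊗≫ X.1 ◁ D.evR B ⊗≫ 𝟙 _ := by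
        rw [braiding_coev]; monoidal
    _ = 𝟙 _ ⊗≫ X.1 ◁ (𝟙 I ⊗≫ η_ B (Bᘁ) ▷ I ⊗≫ B ◁ (D.fromIndAux (𝟙_ C) i ≫ 𝟙 _)) ⊗≫
        (β_ B X.1).inv ▷ (Bᘁ : C) ⊗≫ hb X B ▷ (Bᘁ : C) ⊗≫ X.1 ◁ D.evR B ⊗≫ 𝟙 _ := by
        rw [← whisker_exchange]; monoidal
    _ = _ := by rw [h]; monoidal

theorem wr_fromInd_leftUnitor (X : Center C) :
    wr ((D.sqrtTot)⁻¹ • D.fromInd (𝟙_ C)) X.1 ≫ ofHom k (λ_ X.1).hom ≫ D.encircle X =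
      ofHom k (D.leftUnitRaw X) ≫ D.encircle X := by
  rw [leftUnitRaw, ofHom_sum, fromInd, wr_smul, wr_sum]
  simp only [wr_smul, wr_rep, Preadditive.sum_comp, Linear.smul_comp, ofHom_smul, Finset.smul_sum,
    smul_smul, ← closure_leftUnit, ← rep_comp_encircle, ← rep_comp_ofHom, Category.assoc]
  refine Finset.sum_congr rfl fun i _ => ?_
  rw [div_eq_inv_mul]

theorem wl_fromInd_rightUnitor (X : Center C) :
    wl X.1 ((D.sqrtTot)⁻¹ • D.fromInd (𝟙_ C)) ≫ ofHom k (ρ_ X.1).hom ≫ D.encircle X =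
      ofHom k (D.rightUnitRaw X) ≫ D.encircle X := by
  rw [rightUnitRaw, ofHom_sum, fromInd, wl_smul, wl_sum]
  simp only [wl_smul, wl_rep, Preadditive.sum_comp, Linear.smul_comp, ofHom_smul, Finset.smul_sum,
    smul_smul, ← closure_rightUnit, ← rep_comp_encircle, ← rep_comp_ofHom, Category.assoc]
  refine Finset.sum_congr rfl fun i _ => ?_
  rw [div_eq_inv_mul]

/-- A summand of `evRaw`. -/
def evAux (X : Center C) (B : C) : ((X.1)ᘁ : C) ⊗ X.1 ⟶ B ⊗ (𝟙_ C ⊗ (Bᘁ : C)) :=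
  𝟙 _ ⊗≫ ((X.1)ᘁ : C) ◁ η_ B (Bᘁ) ▷ X.1 ⊗≫
      (β_ B ((X.1)ᘁ)).inv ▷ ((Bᘁ : C) ⊗ X.1) ⊗≫
      (B ⊗ ((X.1)ᘁ : C)) ◁ hb X (Bᘁ : C) ⊗≫
      B ◁ ε_ X.1 ((X.1)ᘁ) ▷ (Bᘁ : C) ⊗≫ 𝟙 _

theorem evAux_pair (X : Center C) (B : C) :
    (Bᘁ : C) ◁ evAux X B ⊗≫ ε_ B (Bᘁ) ▷ (𝟙_ C ⊗ (Bᘁ : C)) ⊗≫ 𝟙 (𝟙_ C ⊗ (Bᘁ : C)) =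
      leftAux ((X.1)ᘁ : C) (hb X (Bᘁ : C)) ≫ ε_ X.1 ((X.1)ᘁ) ▷ (Bᘁ : C) := by
  set X' : C := ((X.1)ᘁ : C)
  calc _ = 𝟙 _ ⊗≫ (Bᘁ : C) ◁ (𝟙 X' ⊗≫ X' ◁ η_ B (Bᘁ) ⊗≫ (β_ B X').inv ▷ (Bᘁ : C) ⊗≫
        𝟙 (B ⊗ (X' ⊗ (Bᘁ : C)))) ▷ X.1 ⊗≫ (((Bᘁ : C) ⊗ B) ◁ (X' ◁ hb X (Bᘁ : C) ⊗≫
        ε_ X.1 X' ▷ (Bᘁ : C)) ≫ ε_ B (Bᘁ) ▷ (𝟙_ C ⊗ (Bᘁ : C))) ⊗≫ 𝟙 (𝟙_ C ⊗ (Bᘁ : C)) := by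
        dsimp only [evAux]; monoidal
    _ = 𝟙 _ ⊗≫ ((Bᘁ : C) ◁ η_ B (Bᘁ) ▷ X' ⊗≫ (((Bᘁ : C) ⊗ B) ◁ (β_ (Bᘁ : C) X').hom ≫
        ε_ B (Bᘁ) ▷ (X' ⊗ (Bᘁ : C)))) ▷ X.1 ⊗≫ X' ◁ hb X (Bᘁ : C) ⊗≫
        ε_ X.1 X' ▷ (Bᘁ : C) ⊗≫ 𝟙 (𝟙_ C ⊗ (Bᘁ : C)) := by
        rw [whisker_exchange, ← braiding_coev]; monoidal
    _ = 𝟙 _ ⊗≫ ((Bᘁ : C) ◁ η_ B (Bᘁ) ⊗≫ ε_ B (Bᘁ) ▷ (Bᘁ : C)) ▷ (X' ⊗ X.1) ⊗≫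
        (β_ (Bᘁ : C) X').hom ▷ X.1 ⊗≫ X' ◁ hb X (Bᘁ : C) ⊗≫
        ε_ X.1 X' ▷ (Bᘁ : C) ⊗≫ 𝟙 (𝟙_ C ⊗ (Bᘁ : C)) := by
        rw [whisker_exchange]; monoidal
    _ = _ := by rw [coevaluation_zigzag]; dsimp only [leftAux]; monoidal

theorem evRaw_eq (X : Center C) : D.evRaw X =
    ∑ i, (D.sqrtDim i / D.sqrtTot) • (evAux X (D.X i) ≫ D.inI (𝟙_ C) i) := by
  rw [evRaw]
  refine Finset.sum_congr rfl fun i _ => ?_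
  congr 1
  dsimp only [evAux]; monoidal

/-- The evaluation ends in the induced object instead of starting there, so it is tested by
composing with `fromInd`: the cap selects one summand and straightens its cup. -/
theorem evRaw_fromIndAux (X : Center C) (i : D.ι) :
    ((D.X i)ᘁ : C) ◁ D.evRaw X ≫ D.fromIndAux (𝟙_ C) i = (D.sqrtDim i / D.sqrtTot) •
      (leftAux ((X.1)ᘁ : C) (hb X ((D.X i)ᘁ : C)) ≫ ε_ X.1 ((X.1)ᘁ) ▷ ((D.X i)ᘁ : C)) := by
  have h : ∀ j, ((D.X i)ᘁ : C) ◁ (evAux X (D.X j) ≫ D.inI (𝟙_ C) j) ≫ D.fromIndAux (𝟙_ C) i =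
      ((D.X i)ᘁ : C) ◁ evAux X (D.X j) ⊗≫ ((D.X i)ᘁ : C) ◁ (D.inI (𝟙_ C) j ≫ D.prI (𝟙_ C) i) ⊗≫
        ε_ (D.X i) ((D.X i)ᘁ) ▷ (𝟙_ C ⊗ ((D.X i)ᘁ : C)) ⊗≫ 𝟙 _ := fun j => by
    dsimp only [fromIndAux]; monoidal
  rw [evRaw_eq, whiskerLeft_sum, Preadditive.sum_comp, Finset.sum_eq_single i]
  · rw [MonoidalLinear.whiskerLeft_smul, Linear.smul_comp, h, inI_prI, ← evAux_pair]
    congr 1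
    monoidal
  · intro j _ hj
    rw [MonoidalLinear.whiskerLeft_smul, Linear.smul_comp, h, inI_prI_ne _ _ hj]
    simp [monoidalComp]
  · simp

theorem closureTwist_coev (X : Center C) (i : D.ι) :
    D.closureTwist X ((X.1)ᘁ : C) (D.fromIndAux (𝟙_ C) i ≫
      η_ X.1 ((X.1)ᘁ) ▷ ((D.X i)ᘁ : C)) = D.prI (𝟙_ C) i ⊗≫ D.X i ◁ η_ X.1 ((X.1)ᘁ) ▷ ((D.X i)ᘁ : C) ⊗≫
      (D.X i ⊗ X.1) ◁ (β_ ((X.1)ᘁ : C) ((D.X i)ᘁ)).hom ⊗≫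
      hb X (D.X i) ▷ (((D.X i)ᘁ : C) ⊗ ((X.1)ᘁ : C)) ⊗≫
      X.1 ◁ D.evR (D.X i) ▷ ((X.1)ᘁ : C) ⊗≫ 𝟙 (X.1 ⊗ ((X.1)ᘁ : C)) := by
  have h := D.fromIndAux_pair (𝟙_ C) i (η_ X.1 ((X.1)ᘁ) ▷ ((D.X i)ᘁ : C))
  set B := D.X i
  set X' : C := ((X.1)ᘁ : C)
  calc _ = 𝟙 _ ⊗≫ (𝟙 (D.IObj (𝟙_ C)) ⊗≫ η_ B (Bᘁ) ▷ D.IObj (𝟙_ C) ⊗≫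
        B ◁ (D.fromIndAux (𝟙_ C) i ≫ η_ X.1 X' ▷ (Bᘁ : C))) ⊗≫ (rightAux (hb X B) X' ▷ (Bᘁ : C) ⊗≫
          (X.1 ⊗ X') ◁ D.evR B) ⊗≫ 𝟙 _ := by dsimp only [closureTwist]; monoidal
    _ = D.prI (𝟙_ C) i ⊗≫ B ◁ η_ X.1 X' ▷ (Bᘁ : C) ⊗≫ (hb X B ▷ (X' ⊗ (Bᘁ : C)) ≫
        (X.1 ⊗ B) ◁ (β_ X' (Bᘁ : C)).hom) ⊗≫ X.1 ◁ D.evR B ▷ X' ⊗≫ 𝟙 _ := by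
        rw [h, twist_evR]; monoidal
    _ = _ := by rw [← whisker_exchange]; monoidal

theorem fromInd_coev (X : Center C) :
    ((D.sqrtTot)⁻¹ • D.fromInd (𝟙_ C)) ≫ ofHom k (η_ X.1 ((X.1)ᘁ)) ≫ wr (D.encircle X) ((X.1)ᘁ : C) =
      ofHom k (D.coevRaw X) ≫ wr (D.encircle X) ((X.1)ᘁ : C) := by
  rw [coevRaw, ofHom_sum, fromInd]
  simp only [Preadditive.sum_comp, Linear.smul_comp, ofHom_smul, Finset.smul_sum,
    smul_smul, ← closureTwist_coev, ← rep_comp_encircle_twist, ← rep_comp_ofHom, Category.assoc]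
  refine Finset.sum_congr rfl fun i _ => ?_
  rw [div_eq_inv_mul]

variable [CharZero k]

theorem evRaw_fromInd (X : Center C) : ofHom k (D.evRaw X) ≫ D.fromInd (𝟙_ C) =
    (D.sqrtTot • wl ((X.1)ᘁ : C) (D.encircle X)) ≫ ofHom k (ε_ X.1 ((X.1)ᘁ)) := by
  -- This reconciles the normalization of `evRaw` with that of `encircle`.
  have hT : D.sqrtTot * (D.tot)⁻¹ = (D.sqrtTot)⁻¹ := by
    rw [tot, ← D.sqrtTot_sq, pow_two, mul_inv, mul_inv_cancel_left₀ D.sqrtTot_ne_zero]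
  rw [encircle_eq_dual, wl_smul, wl_sum, fromInd, Preadditive.comp_sum, smul_smul, hT,
    Finset.smul_sum, Preadditive.sum_comp]
  refine Finset.sum_congr rfl fun i _ => ?_
  rw [Linear.comp_smul, ofHom_comp_rep, evRaw_fromIndAux, rep_smul, wl_smul, wl_rep,
    Linear.smul_comp, Linear.smul_comp, rep_comp_ofHom, smul_smul, smul_smul, ← sqrtDim_mul_self]
  congr 1
  ring

end IrrData

end

/-! ### The reduced monoidal structure -/

section

variable {k : Type w} [Field k] [IsAlgClosed k] {C : Type u} [Category.{v} C] [Abelian C]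
    [Linear k C] [MonoidalCategory C] [MonoidalPreadditive C] [MonoidalLinear k C]
    [BraidedCategory C] [RightRigidCategory C] [PremodularCategory k C]
open HTr PivotalStructure Idempotents

namespace IrrData
variable (D : IrrData k C) [CharZero k]

/-- The idempotent of an induced object. -/
def encircleInd (A : C) : (⟨D.IObj A⟩ : HTr k C) ⟶ ⟨D.IObj A⟩ := D.encircle (D.indCenter A)

theorem fromInd_toInd' (A : C) : D.fromInd A ≫ D.toInd A = D.tot • D.encircleInd A :=
  D.fromInd_toInd A

theorem encircleInd_eq (A : C) : D.encircleInd A = (D.tot)⁻¹ • D.fromInd A ≫ D.toInd A := by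
  rw [fromInd_toInd', smul_smul, inv_mul_cancel₀ D.tot_ne_zero, one_smul]

theorem toInd_encircle (A : C) : D.toInd A ≫ D.encircleInd A = D.toInd A := by
  rw [encircleInd_eq, Linear.comp_smul, ← Category.assoc, toInd_fromInd, Linear.smul_comp,
    Category.id_comp, smul_smul, inv_mul_cancel₀ D.tot_ne_zero, one_smul]

theorem encircle_fromInd (A : C) : D.encircleInd A ≫ D.fromInd A = D.fromInd A := by
  rw [encircleInd_eq, Linear.smul_comp, Category.assoc, toInd_fromInd, Linear.comp_smul,
    Category.comp_id, smul_smul, inv_mul_cancel₀ D.tot_ne_zero, one_smul]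

/-- An induced object is isomorphic to the inducing object in the Karoubi envelope of the horizontal
trace; the isomorphism is normalised by a scalar. -/
def indIso (A : C) (c : k) (hc : c ≠ 0) :
    (toKaroubi (HTr k C)).obj ⟨A⟩ ≅ D.toKar.obj (D.indCenter A) where
  hom := ⟨c • D.toInd A, by
    change 𝟙 _ ≫ (c • D.toInd A) ≫ D.encircleInd A = _
    rw [Category.id_comp, Linear.smul_comp, toInd_encircle]⟩
  inv := ⟨(c * D.tot)⁻¹ • D.fromInd A, by
    change D.encircleInd A ≫ ((c * D.tot)⁻¹ • D.fromInd A) ≫ 𝟙 _ = _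
    rw [Category.comp_id, Linear.comp_smul, encircle_fromInd]⟩
  hom_inv_id := Karoubi.hom_ext _ _ (by
    change (c • D.toInd A) ≫ ((c * D.tot)⁻¹ • D.fromInd A) = 𝟙 _
    rw [Linear.smul_comp, Linear.comp_smul, toInd_fromInd, smul_smul, smul_smul, mul_inv]
    have := D.tot_ne_zero
    field_simp
    exact one_smul _ _)
  inv_hom_id := Karoubi.hom_ext _ _ (by
    change ((c * D.tot)⁻¹ • D.fromInd A) ≫ (c • D.toInd A) = D.encircleInd A
    rw [Linear.smul_comp, Linear.comp_smul, fromInd_toInd', smul_smul, smul_smul, mul_inv]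
    have := D.tot_ne_zero
    field_simp
    exact one_smul _ _)

theorem sqrtTot_mul_self : D.sqrtTot * D.sqrtTot = D.tot := by
  rw [tot, ← D.sqrtTot_sq, pow_two]

/-- The unit of the reduced tensor category in the Karoubi envelope. -/
def unitIso : 𝟙_ (Karoubi (HTr k C)) ≅ D.toKar.obj (D.indCenter (𝟙_ C)) :=
  D.indIso (𝟙_ C) (D.sqrtTot)⁻¹ (inv_ne_zero D.sqrtTot_ne_zero)

theorem unitIso_hom_f : D.unitIso.hom.f = (D.sqrtTot)⁻¹ • D.toInd (𝟙_ C) := rfl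

/-- For `c = (sqrtTot)⁻¹` the inverse scalar `(c * tot)⁻¹` is again `(sqrtTot)⁻¹`. This symmetric
choice is the normalization of the unit constraints, the evaluation and the coevaluation. -/
theorem unitIso_inv_f : D.unitIso.inv.f = (D.sqrtTot)⁻¹ • D.fromInd (𝟙_ C) := by
  change ((D.sqrtTot)⁻¹ * D.tot)⁻¹ • D.fromInd (𝟙_ C) = _
  rw [← sqrtTot_mul_self, inv_mul_cancel_left₀ D.sqrtTot_ne_zero]

/-- The idempotent of `X` is moved through the unitor to the end, where it absorbs the labels of
`fromInd`. -/
theorem represents_leftUnit (X : Center C) :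
    Represents ((D.unitIso.inv ▷ D.toKar.obj X) ≫ (λ_ _).hom) (D.leftUnitRaw X) := by
  have h1 : wl (𝟙_ C) (D.encircle X) ≫ ofHom k (λ_ X.1).hom =
      ofHom k (λ_ X.1).hom ≫ D.encircle X :=
    MonoidalCategory.leftUnitor_naturality (D.encircle X)
  have h2 : (wr ((D.sqrtTot)⁻¹ • D.fromInd (𝟙_ C)) X.1 ≫ wl (𝟙_ C) (D.encircle X)) ≫
      ofHom k (λ_ X.1).hom ≫ D.encircle X = ofHom k (D.leftUnitRaw X) ≫ D.encircle X := by
    rw [Category.assoc, ← Category.assoc (wl _ _), h1, Category.assoc, encircle_idem,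
      wr_fromInd_leftUnitor]
  change (D.unitIso.inv.f ⊗ₘ D.encircle X) ≫ (λ_ (D.toKar.obj X)).hom.f = _
  rw [represents_leftUnitor (D.toKar.obj X), unitIso_inv_f]
  exact (congrArg (· ≫ _) (tensorHom_eq_wr _ _)).trans h2

theorem represents_rightUnit (X : Center C) :
    Represents ((D.toKar.obj X ◁ D.unitIso.inv) ≫ (ρ_ _).hom) (D.rightUnitRaw X) := by
  have h1 : wr (D.encircle X) (𝟙_ C) ≫ ofHom k (ρ_ X.1).hom =
      ofHom k (ρ_ X.1).hom ≫ D.encircle X :=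
    MonoidalCategory.rightUnitor_naturality (D.encircle X)
  have h2 : (wr (D.encircle X) _ ≫ wl X.1 ((D.sqrtTot)⁻¹ • D.fromInd (𝟙_ C))) ≫
      ofHom k (ρ_ X.1).hom ≫ D.encircle X = ofHom k (D.rightUnitRaw X) ≫ D.encircle X := by
    rw [← wl_wr, Category.assoc, ← Category.assoc (wr _ _), h1, Category.assoc, encircle_idem,
      wl_fromInd_rightUnitor]
  change (D.encircle X ⊗ₘ D.unitIso.inv.f) ≫ (ρ_ (D.toKar.obj X)).hom.f = _
  rw [represents_rightUnitor (D.toKar.obj X), unitIso_inv_f]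
  exact (congrArg (· ≫ _) (tensorHom_eq_wr _ _)).trans h2

/-- The reduced tensor product of morphisms. -/
def redMap {X X' Y Y' : Center C} (f : X ⟶ X') (g : Y ⟶ Y') : D.redTensor X Y ⟶ D.redTensor X' Y' :=
  D.toKar.preimage ((D.redIso X Y).inv ≫ (D.toKar.map f ⊗ₘ D.toKar.map g) ≫ (D.redIso X' Y').hom)

theorem toKar_redMap {X X' Y Y' : Center C} (f : X ⟶ X') (g : Y ⟶ Y') : D.toKar.map (D.redMap f g) =
    (D.redIso X Y).inv ≫ (D.toKar.map f ⊗ₘ D.toKar.map g) ≫ (D.redIso X' Y').hom :=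
  D.toKar.map_preimage _

theorem toKar_redMap_id_left (X : Center C) {Y Y' : Center C} (g : Y ⟶ Y') :
    D.toKar.map (D.redMap (𝟙 X) g) =
      (D.redIso X Y).inv ≫ (D.toKar.obj X ◁ D.toKar.map g) ≫ (D.redIso X Y').hom := by
  rw [toKar_redMap, D.toKar.map_id, id_tensorHom]

theorem toKar_redMap_id_right {X X' : Center C} (f : X ⟶ X') (Y : Center C) :
    D.toKar.map (D.redMap f (𝟙 Y)) =
      (D.redIso X Y).inv ≫ (D.toKar.map f ▷ D.toKar.obj Y) ≫ (D.redIso X' Y).hom := by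
  rw [toKar_redMap, D.toKar.map_id, tensorHom_id]

theorem redMap_f {X X' Y Y' : Center C} (f : X ⟶ X') (g : Y ⟶ Y') :
    (D.redMap f g).f = D.redι X Y ≫ (f.f ⊗ₘ g.f) ≫ D.redπ X' Y' := by
  refine f_eq_of_represents (D := D) ?_
  rw [toKar_redMap]
  exact (D.represents_redIso_inv X Y).comp (((D.represents_toKar_map f).tensor
    (D.represents_toKar_map g)).comp (D.represents_redIso_hom X' Y'))

/-- The associativity constraint in the Karoubi envelope. -/
def redAssocKar (X Y Z : Center C) : D.toKar.obj (D.redTensor (D.redTensor X Y) Z) ≅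
    D.toKar.obj (D.redTensor X (D.redTensor Y Z)) :=
  (((D.redIso _ _).symm ≪≫ ((D.redIso _ _).symm ⊗ᵢ .refl _)) ≪≫
    α_ (D.toKar.obj X) (D.toKar.obj Y) (D.toKar.obj Z) ≪≫
      ((.refl _ ⊗ᵢ D.redIso _ _) ≪≫ D.redIso _ _))

/-- The associativity constraint of the reduced tensor product. -/
def redAssoc (X Y Z : Center C) : D.redTensor (D.redTensor X Y) Z ≅
    D.redTensor X (D.redTensor Y Z) := D.toKar.preimageIso (D.redAssocKar X Y Z)

theorem toKar_redAssoc (X Y Z : Center C) :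
    D.toKar.map (D.redAssoc X Y Z).hom = (D.redAssocKar X Y Z).hom :=
  D.toKar.map_preimage _

theorem redAssoc_hom_f (X Y Z : Center C) : (D.redAssoc X Y Z).hom.f =
    D.redι (D.redTensor X Y) Z ≫ D.redι X Y ▷ Z.1 ≫ (α_ X.1 Y.1 Z.1).hom ≫
      X.1 ◁ D.redπ Y Z ≫ D.redπ X (D.redTensor Y Z) := by
  refine f_eq_of_represents (D := D) ?_
  rw [toKar_redAssoc]
  have h : (D.redAssocKar X Y Z).hom = (D.redIso _ _).inv ≫ ((D.redIso X Y).inv ▷ D.toKar.obj Z) ≫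
      (α_ (D.toKar.obj X) (D.toKar.obj Y) (D.toKar.obj Z)).hom ≫
      (D.toKar.obj X ◁ (D.redIso Y Z).hom) ≫ (D.redIso _ _).hom := by
    simp [redAssocKar]
  rw [h]
  exact (D.represents_redIso_inv _ _).comp (((D.represents_redIso_inv X Y).whiskerRight _).comp
    ((represents_associator _ _ _).comp (((D.represents_redIso_hom Y Z).whiskerLeft _).comp
      (D.represents_redIso_hom _ _))))

/-- The left unit constraint in the Karoubi envelope. -/
def redLeftUnitKar (X : Center C) :
    D.toKar.obj (D.redTensor (D.indCenter (𝟙_ C)) X) ≅ D.toKar.obj X :=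
  (((D.redIso _ _).symm ≪≫ (D.unitIso.symm ⊗ᵢ .refl _)) ≪≫ λ_ (D.toKar.obj X))

/-- The right unit constraint in the Karoubi envelope. -/
def redRightUnitKar (X : Center C) :
    D.toKar.obj (D.redTensor X (D.indCenter (𝟙_ C))) ≅ D.toKar.obj X :=
  (((D.redIso _ _).symm ≪≫ (.refl _ ⊗ᵢ D.unitIso.symm)) ≪≫ ρ_ (D.toKar.obj X))

/-- The left unit constraint of the reduced tensor product. -/
def redLeftUnit (X : Center C) : D.redTensor (D.indCenter (𝟙_ C)) X ≅ X :=
  D.toKar.preimageIso (D.redLeftUnitKar X)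

/-- The right unit constraint of the reduced tensor product. -/
def redRightUnit (X : Center C) : D.redTensor X (D.indCenter (𝟙_ C)) ≅ X :=
  D.toKar.preimageIso (D.redRightUnitKar X)

theorem redLeftUnit_hom_f (X : Center C) : (D.redLeftUnit X).hom.f =
    D.redι (D.indCenter (𝟙_ C)) X ≫ D.leftUnitRaw X := by
  refine f_eq_of_represents (D := D) ?_
  have h : D.toKar.map (D.redLeftUnit X).hom = (D.redIso _ _).inv ≫
      (D.unitIso.inv ▷ D.toKar.obj X) ≫ (λ_ (D.toKar.obj X)).hom :=
    (D.toKar.map_preimage _).trans (by simp [redLeftUnitKar])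
  rw [h]
  exact (D.represents_redIso_inv _ _).comp (D.represents_leftUnit X)

theorem redRightUnit_hom_f (X : Center C) : (D.redRightUnit X).hom.f =
    D.redι X (D.indCenter (𝟙_ C)) ≫ D.rightUnitRaw X := by
  refine f_eq_of_represents (D := D) ?_
  have h : D.toKar.map (D.redRightUnit X).hom = (D.redIso _ _).inv ≫
      (D.toKar.obj X ◁ D.unitIso.inv) ≫ (ρ_ (D.toKar.obj X)).hom :=
    (D.toKar.map_preimage _).trans (by simp [redRightUnitKar])
  rw [h]
  exact (D.represents_redIso_inv _ _).comp (D.represents_rightUnit X)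

/-- A synonym for the center, carrying the operations of the reduced tensor product. -/
def RedCat (_ : IrrData k C) : Type (max u v) := Center C

instance : Category.{v} D.RedCat := inferInstanceAs (Category (Center C))

instance : MonoidalCategoryStruct D.RedCat where
  tensorObj X Y := D.redTensor X Y
  tensorHom f g := D.redMap f g
  whiskerLeft X _ _ f := D.redMap (𝟙 (X : Center C)) f
  whiskerRight f Y := D.redMap f (𝟙 (Y : Center C))
  tensorUnit := D.indCenter (𝟙_ C)
  associator X Y Z := D.redAssoc X Y Z
  leftUnitor X := D.redLeftUnit X
  rightUnitor X := D.redRightUnit X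

/-- The functor `toKar` on the synonym. -/
def redToKar : D.RedCat ⥤ Karoubi (HTr k C) := D.toKar

instance : D.redToKar.Faithful := inferInstanceAs D.toKar.Faithful

/-- The operations of the reduced tensor product correspond to those of the Karoubi envelope. -/
def redInducing : Monoidal.InducingFunctorData D.redToKar where
  μIso X Y := D.redIso X Y
  εIso := D.unitIso
  whiskerLeft_eq X _ _ f := D.toKar_redMap_id_left X f
  whiskerRight_eq f Y := D.toKar_redMap_id_right f Y
  tensorHom_eq f g := D.toKar_redMap f g
  associator_eq X Y Z := D.toKar_redAssoc X Y Z
  leftUnitor_eq _ := D.toKar.map_preimage _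
  rightUnitor_eq _ := D.toKar.map_preimage _

instance : MonoidalCategory D.RedCat := Monoidal.induced D.redToKar D.redInducing

/-- The monoidal structure of the reduced tensor product. -/
def reducedMonoidal : ReducedMonoidal D where
  toReducedObjects := reducedObjects
  tensorMap f g := D.redMap f g
  tensorMap_f f g := D.redMap_f f g
  assoc X Y Z := D.redAssoc X Y Z
  assoc_hom_f := D.redAssoc_hom_f
  leftUnit X := D.redLeftUnit X
  leftUnit_hom_f := D.redLeftUnit_hom_f
  rightUnit X := D.redRightUnit X
  rightUnit_hom_f := D.redRightUnit_hom_f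
  -- The axioms are those of the Karoubi envelope, pulled back along the faithful functor `toKar`.
  tensorMap_id X Y := MonoidalCategory.id_tensorHom_id (C := D.RedCat) X Y
  tensorMap_comp f f' g g' :=
    (MonoidalCategory.tensorHom_comp_tensorHom (C := D.RedCat) f g f' g').symm
  assoc_naturality f g h := MonoidalCategory.associator_naturality (C := D.RedCat) f g h
  leftUnit_naturality f := MonoidalCategory.leftUnitor_naturality (C := D.RedCat) f
  rightUnit_naturality f := MonoidalCategory.rightUnitor_naturality (C := D.RedCat) f
  pentagon W X Y Z := MonoidalCategory.pentagon (C := D.RedCat) W X Y Z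
  triangle X Y := MonoidalCategory.triangle (C := D.RedCat) X Y

end IrrData

end

/-! ### The reduced rigid structure -/

section

variable {k : Type w} [Field k] [IsAlgClosed k] {C : Type u} [Category.{v} C] [Abelian C]
    [Linear k C] [MonoidalCategory C] [MonoidalPreadditive C] [MonoidalLinear k C]
    [BraidedCategory C] [RightRigidCategory C] [PremodularCategory k C]
section karoubi
variable {E : Type u₁} [Category.{v₁} E] [MonoidalCategory E] [RightRigidCategory E]
open Idempotents Idempotents.Karoubi

/-- The dual of a formal image, with an idempotent that is only propositionally the mate. -/
@[reducible]
def karoubiPairing (P : Karoubi E) (q : ((P.X)ᘁ : E) ⟶ ((P.X)ᘁ : E)) (hq : ((P.p)ᘁ) = q)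
    (h : q ≫ q = q) : ExactPairing P ⟨((P.X)ᘁ : E), q, h⟩ := by
  subst hq
  exact HasRightDual.exact (X := P)

theorem karoubiPairing_coev_f (P : Karoubi E) (q : ((P.X)ᘁ : E) ⟶ ((P.X)ᘁ : E))
    (hq : ((P.p)ᘁ) = q) (h : q ≫ q = q) :
    (karoubiPairing P q hq h).coevaluation'.f = η_ P.X ((P.X)ᘁ) ≫ (P.p ⊗ₘ q) := by
  subst hq
  rfl

theorem karoubiPairing_ev_f (P : Karoubi E) (q : ((P.X)ᘁ : E) ⟶ ((P.X)ᘁ : E))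
    (hq : ((P.p)ᘁ) = q) (h : q ≫ q = q) :
    (karoubiPairing P q hq h).evaluation'.f = ((P.X)ᘁ : E) ◁ P.p ≫ ε_ P.X ((P.X)ᘁ) := by
  subst hq
  exact ev_mate' P

end karoubi

open HTr PivotalStructure Idempotents

namespace IrrData
variable (D : IrrData k C) [CharZero k]

/-- The functor `toKar` on the reduced tensor category. -/
def redKar : D.reducedMonoidal.Cat ⥤ Karoubi (HTr k C) := D.toKar

instance : D.redKar.Faithful := inferInstanceAs D.toKar.Faithful
instance : D.redKar.Full := inferInstanceAs D.toKar.Full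
instance : D.redKar.Additive := inferInstanceAs D.toKar.Additive
instance : D.redKar.Linear k := inferInstanceAs (D.toKar.Linear k)

/-- The monoidal structure of `redKar`. -/
def redKarCore : D.redKar.CoreMonoidal where
  εIso := D.unitIso
  μIso X Y := D.redIso X Y
  μIso_hom_natural_left :=
    (Monoidal.fromInducedCoreMonoidal D.redToKar D.redInducing).μIso_hom_natural_left
  μIso_hom_natural_right :=
    (Monoidal.fromInducedCoreMonoidal D.redToKar D.redInducing).μIso_hom_natural_right
  associativity := (Monoidal.fromInducedCoreMonoidal D.redToKar D.redInducing).associativity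
  left_unitality := (Monoidal.fromInducedCoreMonoidal D.redToKar D.redInducing).left_unitality
  right_unitality := (Monoidal.fromInducedCoreMonoidal D.redToKar D.redInducing).right_unitality

instance : D.redKar.Monoidal := D.redKarCore.toMonoidal

/-- The exact pairing in the Karoubi envelope. -/
@[reducible]
def karPairing (X : Center C) : ExactPairing (D.toKar.obj X) (D.toKar.obj (dualCenter X)) :=
  karoubiPairing (D.toKar.obj X) (D.encircle (dualCenter X)) (D.mate_encircle X) _

theorem karPairing_coev_f (X : Center C) : (D.karPairing X).coevaluation'.f =
    ofHom k (η_ X.1 ((X.1)ᘁ)) ≫ D.encircleTensor X (dualCenter X) :=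
  karoubiPairing_coev_f (D.toKar.obj X) _ _ _

theorem karPairing_ev_f (X : Center C) : (D.karPairing X).evaluation'.f =
    wl ((X.1)ᘁ : C) (D.encircle X) ≫ ofHom k (ε_ X.1 ((X.1)ᘁ)) :=
  karoubiPairing_ev_f (D.toKar.obj X) _ _ _

/-- The exact pairing of the reduced tensor category. -/
@[reducible]
def redPairing (X : D.reducedMonoidal.Cat) :
    @ExactPairing D.reducedMonoidal.Cat _ _ X (D.reducedMonoidal.dual X) :=
  let _ : ExactPairing (D.redKar.obj X) (D.redKar.obj (D.reducedMonoidal.dual X)) := D.karPairing X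
  ExactPairing.ofFullyFaithful D.redKar X (D.reducedMonoidal.dual X)

theorem toKar_redPairing_coev (X : Center C) : D.redKar.map (D.redPairing X).coevaluation' =
    D.unitIso.inv ≫ (D.karPairing X).coevaluation' ≫ (D.redIso X (dualCenter X)).hom :=
  D.redKar.map_preimage _

theorem toKar_redPairing_ev (X : Center C) : D.redKar.map (D.redPairing X).evaluation' =
    (D.redIso (dualCenter X) X).inv ≫ (D.karPairing X).evaluation' ≫ D.unitIso.hom :=
  D.redKar.map_preimage _

/-- Absorption into the idempotent of `X` gives the formula; the idempotent of the dual is composed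
afterwards. -/
theorem represents_coev (X : Center C) : Represents
    (D.unitIso.inv ≫ (D.karPairing X).coevaluation') (D.coevRaw X) := by
  have h : ((D.sqrtTot)⁻¹ • D.fromInd (𝟙_ C)) ≫ ofHom k (η_ X.1 ((X.1)ᘁ)) ≫
      D.encircleTensor X (dualCenter X) =
        ofHom k (D.coevRaw X) ≫ D.encircleTensor X (dualCenter X) := by
    have h := D.fromInd_coev X =≫ wl X.1 (D.encircle (dualCenter X))
    simp only [Category.assoc] at h
    rw [encircleTensor_eq_wr]
    exact h
  change D.unitIso.inv.f ≫ (D.karPairing X).coevaluation'.f = _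
  rw [unitIso_inv_f, karPairing_coev_f]
  exact h

/-- The idempotent of the unit object factors through `fromInd`, so `evRaw_fromInd` determines the
evaluation. -/
theorem evRaw_encircleInd (X : Center C) : ofHom k (D.evRaw X) ≫ D.encircleInd (𝟙_ C) =
    (wl ((X.1)ᘁ : C) (D.encircle X) ≫ ofHom k (ε_ X.1 ((X.1)ᘁ))) ≫
      ((D.sqrtTot)⁻¹ • D.toInd (𝟙_ C)) := by
  rw [encircleInd_eq, Linear.comp_smul, ← Category.assoc, evRaw_fromInd, Linear.smul_comp,
    Linear.smul_comp, smul_smul, ← sqrtTot_mul_self, mul_inv,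
    inv_mul_cancel_right₀ D.sqrtTot_ne_zero, Linear.comp_smul]

theorem represents_ev (X : Center C) : Represents
    ((D.karPairing X).evaluation' ≫ D.unitIso.hom) (D.evRaw X) := by
  change (D.karPairing X).evaluation'.f ≫ D.unitIso.hom.f = _
  rw [unitIso_hom_f, karPairing_ev_f]
  exact (D.evRaw_encircleInd X).symm

/-- The rigid structure of the reduced tensor product. -/
def reducedRigid : ReducedRigid D where
  toReducedMonoidal := D.reducedMonoidal
  pairing := D.redPairing
  coev_f X := f_eq_of_represents (D := D) (X := D.indCenter (𝟙_ C))
    (Y := D.redTensor X (dualCenter X)) (by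
      refine Eq.trans (congrArg Karoubi.Hom.f (D.toKar_redPairing_coev X)) ?_
      rw [← Category.assoc]
      exact (D.represents_coev X).comp (D.represents_redIso_hom X (dualCenter X)))
  ev_f X := f_eq_of_represents (D := D) (X := D.redTensor (dualCenter X) X)
    (Y := D.indCenter (𝟙_ C)) (by
      refine Eq.trans (congrArg Karoubi.Hom.f (D.toKar_redPairing_ev X)) ?_
      exact (D.represents_redIso_inv (dualCenter X) X).comp (D.represents_ev X))

end IrrData

end

/-! ### The functor from the horizontal trace -/

section

variable {k : Type w} [Field k] [IsAlgClosed k] {C : Type u} [Category.{v} C] [Abelian C]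
    [Linear k C] [MonoidalCategory C] [MonoidalPreadditive C] [MonoidalLinear k C]
    [BraidedCategory C] [RightRigidCategory C] [PremodularCategory k C]
open HTr PivotalStructure Idempotents

namespace IrrData
variable (D : IrrData k C) [CharZero k]

/-- The isomorphism between an induced object and the inducing object, in the normalisation of the
induction functor. -/
def traceIso (A : C) : (toKaroubi (HTr k C)).obj ⟨A⟩ ≅ D.toKar.obj (D.indCenter A) :=
  D.indIso A (D.tot)⁻¹ (inv_ne_zero D.tot_ne_zero)

theorem traceIso_hom_f (A : C) : (D.traceIso A).hom.f = (D.tot)⁻¹ • D.toInd A := rfl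

/-- For `c = tot⁻¹` the inverse is `fromInd` without a scalar. With this normalization `J`
corresponds to the identity of `X ⊗ Y`. -/
theorem traceIso_inv_f (A : C) : (D.traceIso A).inv.f = D.fromInd A := by
  change ((D.tot)⁻¹ * D.tot)⁻¹ • D.fromInd A = _
  rw [inv_mul_cancel₀ D.tot_ne_zero, inv_one, one_smul]

/-- The functor `G` on morphisms. -/
def indMap {X Y : HTr k C} (f : X ⟶ Y) : D.indCenter X.obj ⟶ D.indCenter Y.obj :=
  D.toKar.preimage ((D.traceIso X.obj).inv ≫ (toKaroubi (HTr k C)).map f ≫ (D.traceIso Y.obj).hom)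

theorem toKar_indMap {X Y : HTr k C} (f : X ⟶ Y) : D.toKar.map (D.indMap f) =
    (D.traceIso X.obj).inv ≫ (toKaroubi (HTr k C)).map f ≫ (D.traceIso Y.obj).hom :=
  D.toKar.map_preimage _

theorem indMap_add {X Y : HTr k C} (f g : X ⟶ Y) :
    D.indMap (f + g) = D.indMap f + D.indMap g := D.toKar.map_injective (by
  rw [D.toKar.map_add]
  simp only [toKar_indMap, ← Preadditive.comp_add, ← Preadditive.add_comp]
  rfl)

theorem indMap_smul {X Y : HTr k C} (c : k) (f : X ⟶ Y) :
    D.indMap (c • f) = c • D.indMap f := D.toKar.map_injective (by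
  have h : (toKaroubi (HTr k C)).map (c • f) = c • (toKaroubi (HTr k C)).map f := rfl
  rw [D.toKar.map_smul, toKar_indMap, toKar_indMap, h, Linear.smul_comp, Linear.comp_smul])

theorem encircleInd_traceRaw {X Y : C} (A : C) (ψ : A ⊗ X ⟶ Y ⊗ A) :
    D.encircleInd X ≫ ofHom k (D.traceRaw A ψ) =
      D.fromInd X ≫ rep k A ψ ≫ ((D.tot)⁻¹ • D.toInd Y) := by
  rw [encircleInd_eq, Linear.smul_comp, Category.assoc, toInd_traceRaw, Linear.comp_smul,
    Linear.comp_smul]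

/-- `central_of_eq` compares the central morphism composed with one idempotent with the formula
composed with the other; centrality of `traceRaw` is a consequence. -/
theorem indMap_rep {X Y : C} (A : C) (ψ : A ⊗ X ⟶ Y ⊗ A) :
    (D.indMap (rep k A ψ)).f = D.traceRaw A ψ := by
  refine (D.central_of_eq (X := D.indCenter X) (Y := D.indCenter Y) _ _ ?_).1
  have h := congrArg Karoubi.Hom.f (D.toKar_indMap (rep k A ψ))
  rw [toKar_map_f'] at h
  refine h.trans ?_
  change (D.traceIso X).inv.f ≫ rep k A ψ ≫ (D.traceIso Y).hom.f = _
  rw [traceIso_inv_f, traceIso_hom_f]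
  exact (D.encircleInd_traceRaw A ψ).symm

/-- The functor `G`. -/
def traceFunctor : TraceFunctor D.reducedRigid where
  map {X Y} :=
    { toFun := D.indMap
      map_add' := D.indMap_add
      map_smul' := D.indMap_smul }
  map_rep A ψ := D.indMap_rep A ψ
  map_id X := D.toKar.map_injective (by
    refine (D.toKar_indMap (𝟙 X)).trans ?_
    rw [(toKaroubi (HTr k C)).map_id, Category.id_comp, Iso.inv_hom_id]
    exact (D.toKar.map_id _).symm)
  map_comp f g := D.toKar.map_injective (by
    refine (D.toKar_indMap (f ≫ g)).trans ?_
    refine Eq.trans ?_ (D.toKar.map_comp (D.indMap f) (D.indMap g)).symm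
    rw [toKar_indMap, toKar_indMap]
    simp)

/-- The functor `G` agrees with the inclusion in the Karoubi envelope. -/
def traceFunctorRedKar : D.traceFunctor.functor ⋙ D.redKar ≅ toKaroubi (HTr k C) :=
  NatIso.ofComponents (fun X => (D.traceIso X.obj).symm) (fun {X Y} f => by
    have h := D.toKar_indMap f
    have h' : D.toKar.map (D.indMap f) ≫ (D.traceIso Y.obj).inv =
      (D.traceIso X.obj).inv ≫ (toKaroubi (HTr k C)).map f := by rw [h]; simp
    exact h')

theorem encircleRed_redι (X Y : Center C) {Z : C} (g : X.1 ⊗ Y.1 ⟶ Z) :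
    D.encircleRed X Y ≫ ofHom k (D.redι X Y ≫ g) =
      (ofHom k (D.redι X Y) ≫ D.encircleTensor X Y) ≫ D.encircleTensor X Y ≫ ofHom k g := by
  rw [ofHom_comp, ← Category.assoc, ← redι_encircleTensor, Category.assoc, Category.assoc,
    ← Category.assoc (D.encircleTensor X Y) (D.encircleTensor X Y), encircleTensor_idem]

/-- The two idempotents contribute `tot⁻¹` each and `toInd_JRaw` contributes `tot`, which leaves the
factor of `traceIso`. -/
theorem encircleInd_JRaw (X Y : C) :
    (D.encircleInd X ⊗ₘ D.encircleInd Y :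
      (⟨D.IObj X⟩ ⊗ ⟨D.IObj Y⟩ : HTr k C) ⟶ ⟨D.IObj X⟩ ⊗ ⟨D.IObj Y⟩) ≫ ofHom k (D.JRaw X Y) =
      (D.fromInd X ⊗ₘ D.fromInd Y) ≫ ((D.tot)⁻¹ • D.toInd (X ⊗ Y)) := by
  have h : (D.encircleInd X ⊗ₘ D.encircleInd Y :
      (⟨D.IObj X⟩ ⊗ ⟨D.IObj Y⟩ : HTr k C) ⟶ ⟨D.IObj X⟩ ⊗ ⟨D.IObj Y⟩) =
      ((D.tot)⁻¹ * (D.tot)⁻¹) • (D.fromInd X ⊗ₘ D.fromInd Y) ≫ (D.toInd X ⊗ₘ D.toInd Y) := by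
    rw [tensorHom_comp_tensorHom, encircleInd_eq, encircleInd_eq]
    simp [MonoidalCategory.tensorHom_def, smul_smul]
  have hJ : (D.toInd X ⊗ₘ D.toInd Y) ≫ ofHom k (D.JRaw X Y) = D.tot • D.toInd (X ⊗ Y) :=
    (congrArg (· ≫ _) (tensorHom_eq_wr _ _)).trans (D.toInd_JRaw X Y)
  have h' := congrArg (· ≫ ofHom k (D.JRaw X Y)) h
  refine h'.trans ?_
  simp only [Linear.smul_comp, Category.assoc]
  refine (congrArg (fun z => ((D.tot)⁻¹ * (D.tot)⁻¹) • ((D.fromInd X ⊗ₘ D.fromInd Y) ≫ z)) hJ).trans ?_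
  rw [Linear.comp_smul, smul_smul, Linear.comp_smul, mul_assoc, inv_mul_cancel₀ D.tot_ne_zero,
    mul_one]

/-- The tensor structure `J`, as determined in the Karoubi envelope. -/
theorem J_f (X Y : C)
    (f : D.redTensor (D.indCenter X) (D.indCenter Y) ⟶ D.indCenter (X ⊗ Y))
    (h : D.toKar.map f = (D.redIso _ _).inv ≫ ((D.traceIso X).inv ⊗ₘ (D.traceIso Y).inv) ≫
      Functor.LaxMonoidal.μ (toKaroubi (HTr k C)) ⟨X⟩ ⟨Y⟩ ≫ (D.traceIso (X ⊗ Y)).hom) :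
    f.f = D.redι (D.indCenter X) (D.indCenter Y) ≫ D.JRaw X Y := by
  refine (D.central_of_eq (X := D.redTensor (D.indCenter X) (D.indCenter Y))
    (Y := D.indCenter (X ⊗ Y)) _ _ ?_).1
  have h1 := congrArg Karoubi.Hom.f h
  rw [toKar_map_f'] at h1
  refine h1.trans (Eq.trans ?_ (D.encircleRed_redι (D.indCenter X) (D.indCenter Y) _).symm)
  refine congrArg (_ ≫ ·) (Eq.trans ?_ (D.encircleInd_JRaw X Y).symm)
  change ((D.traceIso X).inv.f ⊗ₘ (D.traceIso Y).inv.f) ≫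
    ((𝟙 (⟨X⟩ : HTr k C) ⊗ₘ 𝟙 (⟨Y⟩ : HTr k C)) ≫ 𝟙 (⟨X⟩ ⊗ ⟨Y⟩ : HTr k C)) ≫
      (D.traceIso (X ⊗ Y)).hom.f = _
  rw [traceIso_inv_f, traceIso_inv_f, traceIso_hom_f, Category.comp_id]
  have h2 : (𝟙 (⟨X⟩ : HTr k C) ⊗ₘ 𝟙 (⟨Y⟩ : HTr k C)) = 𝟙 _ := id_tensorHom_id _ _
  exact congrArg (_ ≫ ·) ((congrArg (· ≫ _) h2).trans (Category.id_comp _))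

end IrrData

end

/-! ### Factorization through a monoidal equivalence -/

section

variable {k : Type w} [Field k] [IsAlgClosed k] {C : Type u} [Category.{v} C] [Abelian C]
    [Linear k C] [MonoidalCategory C] [MonoidalPreadditive C] [MonoidalLinear k C]
    [BraidedCategory C] [RightRigidCategory C] [PremodularCategory k C]
section factorization
open Functor.LaxMonoidal Functor.OplaxMonoidal
variable {A : Type u₁} [Category.{v₁} A] [MonoidalCategory A]
  {B : Type u₂} [Category.{v₂} B] [MonoidalCategory B]
  {E : Type u₃} [Category.{v₃} E] [MonoidalCategory E]

theorem isMonoidal_inverseMonoidal (e : B ≌ E) [e.functor.Monoidal] :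
    letI := e.inverseMonoidal; e.IsMonoidal := by
  let := e.inverseMonoidal
  have h : @Adjunction.IsMonoidal _ _ _ _ _ _ _ _ e.toAdjunction _
    e.toAdjunction.rightAdjointLaxMonoidal := inferInstance
  exact h

/-- A functor that becomes monoidal after composition with a monoidal equivalence is monoidal, and
the inverse of the equivalence is monoidal and compatible with it. -/
theorem exists_monoidal_factorization (H : B ⥤ E) [H.Monoidal] [H.IsEquivalence] (J : A ⥤ E)
    [J.Monoidal] (G : A ⥤ B) (i : G ⋙ H ≅ J) :
    ∃ (_ : H.asEquivalence.inverse.Monoidal) (_ : G.Monoidal) (e : J ⋙ H.asEquivalence.inverse ≅ G)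
      (c : H.asEquivalence.inverse ⋙ H ≅ 𝟭 E), NatTrans.IsMonoidal e.hom ∧
        NatTrans.IsMonoidal c.hom ∧ ∀ X Y, H.map (μ G X Y) =
          δ H _ _ ≫ (i.hom.app X ⊗ₘ i.hom.app Y) ≫ μ J X Y ≫ i.inv.app (X ⊗ Y) := by
  let _ : H.asEquivalence.functor.Monoidal := inferInstanceAs H.Monoidal
  let _ := H.asEquivalence.inverseMonoidal
  have hE : H.asEquivalence.IsMonoidal :=
    isMonoidal_inverseMonoidal H.asEquivalence
  let K := H.asEquivalence.inverse
  let u : 𝟭 B ≅ H ⋙ K := H.asEquivalence.unitIso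
  let c : K ⋙ H ≅ 𝟭 E := H.asEquivalence.counitIso
  let e : J ⋙ K ≅ G := Functor.isoWhiskerRight i.symm K ≪≫ Functor.associator _ _ _ ≪≫
    Functor.isoWhiskerLeft G u.symm ≪≫ G.rightUnitor
  let _ : G.Monoidal := Functor.Monoidal.transport e
  have he : NatTrans.IsMonoidal e.hom := Functor.Monoidal.natTransIsMonoidal_of_transport e
  have hc : NatTrans.IsMonoidal c.hom :=
    inferInstanceAs (NatTrans.IsMonoidal H.asEquivalence.toAdjunction.counit)
  refine ⟨inferInstance, inferInstance, e, c, he, hc, fun X Y => ?_⟩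
  -- A triangle identity expresses `H` of the transport isomorphism through the counit; monoidality
  -- of `e` and of the counit then determines `H.map (μ G X Y)`.
  have hτ (X : A) : H.map (e.hom.app X) = c.hom.app (J.obj X) ≫ i.inv.app X := by
    have h1 : H.map (u.inv.app (G.obj X)) = c.hom.app (H.obj (G.obj X)) := by
      rw [← cancel_epi (H.map (u.hom.app (G.obj X))), ← H.map_comp, Iso.hom_inv_id_app]
      exact (H.map_id _).trans (H.asEquivalence.functor_unitIso_comp (G.obj X)).symm
    have h2 : H.map (K.map (i.inv.app X)) ≫ c.hom.app _ = c.hom.app _ ≫ i.inv.app X :=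
      c.hom.naturality (i.inv.app X)
    rw [← h2]
    change _ = _ ≫ c.hom.app (H.obj (G.obj X))
    rw [← h1, ← H.map_comp]
    simp [e]
  have hμ := NatTrans.IsMonoidal.tensor (τ := e.hom) X Y
  have hμc := NatTrans.IsMonoidal.tensor (τ := c.hom) (J.obj X) (J.obj Y)
  have hcn : H.map (K.map (μ J X Y)) ≫ c.hom.app _ = c.hom.app _ ≫ μ J X Y :=
    c.hom.naturality (μ J X Y)
  have hcI (Z : E) : IsIso (c.hom.app Z) := inferInstance
  have h3 : (H.map (e.hom.app X) ⊗ₘ H.map (e.hom.app Y)) ≫ μ H _ _ ≫ H.map (μ G X Y) =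
      (c.hom.app (J.obj X) ⊗ₘ c.hom.app (J.obj Y)) ≫ μ J X Y ≫ i.inv.app _ := by
    have := congrArg (fun z => μ H _ _ ≫ H.map z) hμ
    simp only [H.map_comp] at this
    rw [← μ_natural_assoc] at this
    rw [← this, hτ]
    simp only [comp_μ, H.map_comp, Category.assoc]
    rw [reassoc_of% hcn]
    simp only [comp_μ, id_μ, Category.assoc, Category.comp_id] at hμc
    change μ H _ _ ≫ H.map (μ K _ _) ≫ c.hom.app (J.obj X ⊗ J.obj Y) = _ at hμc
    change μ H (K.obj (J.obj X)) (K.obj (J.obj Y)) ≫ _ = _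
    rw [reassoc_of% hμc]
  rw [hτ, hτ, ← tensorHom_comp_tensorHom, Category.assoc, cancel_epi] at h3
  rw [← cancel_epi (μ H _ _), Functor.Monoidal.μ_δ_assoc,
    ← cancel_epi (i.inv.app X ⊗ₘ i.inv.app Y), h3, tensorHom_comp_tensorHom_assoc]
  simp

end factorization

end

/-! ### The equivalence and the pivotal structure -/

section

variable {k : Type w} [Field k] [IsAlgClosed k] {C : Type u} [Category.{v} C] [Abelian C]
    [Linear k C] [MonoidalCategory C] [MonoidalPreadditive C] [MonoidalLinear k C]
    [BraidedCategory C] [RightRigidCategory C] [PremodularCategory k C]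
section karoubi
variable {E : Type u₁} [Category.{v₁} E] [MonoidalCategory E] [RightRigidCategory E]
open Idempotents Idempotents.Karoubi

/-- In the reduced category the dual carries the idempotent of `dualCenter X`, in the Karoubi
envelope the mate of the idempotent of `X`. They agree by `mate_encircle`, and the comparison of the
two duals is this idempotent. -/
theorem exists_karoubi_comparison (P : Karoubi E) (q : ((P.X)ᘁ : E) ⟶ ((P.X)ᘁ : E))
    (hq : ((P.p)ᘁ) = q) (h : q ≫ q = q) :
    ∃ c : (⟨((P.X)ᘁ : E), q, h⟩ : Karoubi E) ⟶ (Pᘁ : Karoubi E), c.f = q ∧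
      c ▷ P ≫ ε_ P (Pᘁ) = (karoubiPairing P q hq h).evaluation' := by
  subst hq
  refine ⟨𝟙 (Pᘁ : Karoubi E), rfl, ?_⟩
  exact (congrArg (· ≫ _) (id_whiskerRight (Pᘁ : Karoubi E) P)).trans (Category.id_comp _)

end karoubi

open HTr PivotalStructure Idempotents

namespace IrrData
variable (D : IrrData k C) [CharZero k]

theorem exists_split (X : Center C) (g : X ⟶ X) (hg : g ≫ g = g) :
    ∃ (Z : Center C) (i : Z ⟶ X) (p : X ⟶ Z), i ≫ p = 𝟙 Z ∧ p ≫ i = g := by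
  obtain ⟨Z, i, p, hip, hpi⟩ := IsIdempotentComplete.idempotents_split X.1 g.f
    (congrArg Center.Hom.f hg)
  have hc (A : C) : A ◁ (p ≫ i) ≫ hb X A = hb X A ≫ (p ≫ i) ▷ A := by
    rw [hpi, g.hb_comm]
  exact ⟨splitObj X i p hip hc, splitι X i p hip hc, splitπ X i p hip hc,
    Center.ext _ _ hip, Center.ext _ _ hpi⟩

/-- A formal image `P` is a retract of the image of the induced object on `P.X`. Fullness lifts the
corresponding idempotent to the center, where it splits, and its image is sent to `P`. -/
instance : D.toKar.EssSurj where
  mem_essImage P := by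
    let I : Center C := D.indCenter P.X.obj
    let s : P ⟶ D.toKar.obj I := P.decompId_i ≫ (D.traceIso P.X.obj).hom
    let r : D.toKar.obj I ⟶ P := (D.traceIso P.X.obj).inv ≫ P.decompId_p
    have hsr : s ≫ r = 𝟙 P := by
      have h : P.decompId_i ≫ P.decompId_p = 𝟙 P := P.decompId.symm
      simp only [s, r, Category.assoc, Iso.hom_inv_id_assoc]
      exact h
    have hg : D.toKar.map (D.toKar.preimage (r ≫ s)) = r ≫ s := D.toKar.map_preimage _
    obtain ⟨Z, i, p, hip, hpi⟩ := exists_split I (D.toKar.preimage (r ≫ s))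
      (D.toKar.map_injective (by
        rw [D.toKar.map_comp, hg, Category.assoc, reassoc_of% hsr]))
    have h : D.toKar.map p ≫ D.toKar.map i = r ≫ s := by rw [← D.toKar.map_comp, hpi, hg]
    refine ⟨Z, ⟨⟨D.toKar.map i ≫ r, s ≫ D.toKar.map p, ?_, ?_⟩⟩⟩
    · have hi : D.toKar.map i ≫ D.toKar.map p = 𝟙 _ := by
        rw [← D.toKar.map_comp, hip, D.toKar.map_id]
      rw [Category.assoc, ← reassoc_of% h, hi, Category.comp_id, hi]
    · rw [Category.assoc, reassoc_of% h, hsr, Category.comp_id, hsr]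

instance : D.redKar.EssSurj := inferInstanceAs D.toKar.EssSurj

instance : D.redKar.IsEquivalence where

instance : RightRigidCategory D.reducedMonoidal.Cat :=
  inferInstanceAs (RightRigidCategory D.reducedRigid.Cat)

theorem dualComparison_redKar_f (X : D.reducedMonoidal.Cat) :
    (dualComparison D.redKar X).f = D.encircle (dualCenter X) := by
  obtain ⟨c, hcf, hc⟩ := exists_karoubi_comparison (D.toKar.obj X) (D.encircle (dualCenter X))
    (D.mate_encircle X) (D.encircle_idem _)
  have h2 : D.redKar.map (ε_ X (Xᘁ)) =
      (D.redIso (dualCenter X) X).inv ≫ (D.karPairing X).evaluation' ≫ D.unitIso.hom :=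
    D.toKar_redPairing_ev X
  have h3 : (D.karPairing X).evaluation' = (D.redIso (dualCenter X) X).hom ≫
      ((D.redIso (dualCenter X) X).inv ≫ (D.karPairing X).evaluation' ≫ D.unitIso.hom) ≫
        D.unitIso.inv := by simp
  rw [dualComparison_eq_of_ev D.redKar c]
  · exact hcf
  · rw [h2]
    exact hc.trans h3

/-- The pivotal structure of the Karoubi envelope of the horizontal trace. -/
def karPivotal : PivotalStructure (Karoubi (HTr k C)) :=
  Karoubi.pivotalStructure (HTr.pivotalStructure k (PremodularCategory.piv k (C := C)))

/-- The pivotal structure of the reduced tensor category. -/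
def redPivotal : PivotalStructure D.reducedMonoidal.Cat :=
  PivotalStructure.ofFullyFaithful D.redKar karPivotal

theorem mate_mate_encircle (X : Center C) :
    (((D.encircle X)ᘁ)ᘁ) = D.encircle (dualCenter (dualCenter X)) :=
  (congrArg rightAdjointMate (D.mate_encircle X)).trans (D.mate_encircle (dualCenter X))

/-- This is naturality of the pivotal structure of the horizontal trace at `encircle X`. -/
theorem encircle_piv (X : Center C) :
    (D.encircle X ≫ ofHom k ((PremodularCategory.piv k (C := C)).iso X.1).hom) =
      ofHom k ((PremodularCategory.piv k (C := C)).iso X.1).hom ≫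
        D.encircle (dualCenter (dualCenter X)) := by
  refine Eq.trans ?_ (congrArg (_ ≫ ·) (D.mate_mate_encircle X))
  exact ((HTr.pivotalStructure k (PremodularCategory.piv k (C := C))).naturality
    (D.encircle X)).symm

/-- In the Karoubi envelope the comparisons of duals are the idempotents themselves, so the defining
equation of the pulled-back structure reduces to an equality of two morphisms of `C` followed by the
idempotent of the double dual, and such morphisms are equal. -/
theorem redPivotal_isInduced : D.reducedRigid.IsInducedPivotal D.redPivotal := by
  intro X
  let Y : Center C := dualCenter (dualCenter X)
  let g : X ⟶ Y := (D.redPivotal.iso X).hom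
  have h : (D.toKar.map g).f ≫ (dualComparison D.redKar (dualCenter X)).f =
      (D.encircle X ≫ ofHom k ((PremodularCategory.piv k (C := C)).iso X.1).hom) ≫
        Karoubi.Hom.f ((dualComparison D.redKar X)ᘁ) := congrArg Karoubi.Hom.f
    (PivotalStructure.isPivotalFunctor_ofFullyFaithful D.redKar karPivotal X)
  have h1 : Karoubi.Hom.f ((dualComparison D.redKar X)ᘁ) = D.encircle Y :=
    (Karoubi.mate_f _).trans ((congrArg rightAdjointMate (D.dualComparison_redKar_f X)).trans
      (D.mate_encircle (dualCenter X)))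
  have h2 : (D.toKar.map g).f ≫ (dualComparison D.redKar (dualCenter X)).f =
      ofHom k g.f ≫ D.encircle Y ≫ D.encircle Y :=
    (congrArg₂ (· ≫ ·) (D.toKar_map_f' g) (D.dualComparison_redKar_f (dualCenter X))).trans
      (Category.assoc _ _ _)
  refine D.comp_encircle_injective (Y := Y) ?_
  rw [encircle_idem] at h2
  refine h2.symm.trans (h.trans ((congrArg₂ (· ≫ ·) (D.encircle_piv X) h1).trans ?_))
  exact (Category.assoc _ _ _).trans (congrArg (_ ≫ ·) (D.encircle_idem Y))

end IrrData

end

/-! ### Semisimplicity -/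

section

variable {k : Type w} [Field k] [IsAlgClosed k] {C : Type u} [Category.{v} C] [Abelian C]
    [Linear k C] [MonoidalCategory C] [MonoidalPreadditive C] [MonoidalLinear k C]
    [BraidedCategory C] [RightRigidCategory C] [PremodularCategory k C]
open HTr PivotalStructure Idempotents

theorem exists_linear_pseudoinverse {V W : Type*} [AddCommGroup V] [Module k V]
    [AddCommGroup W] [Module k W] (f : V →ₗ[k] W) : ∃ L : W →ₗ[k] V, f ∘ₗ L ∘ₗ f = f := by
  obtain ⟨s, hs⟩ := LinearMap.exists_rightInverse_of_surjective f.rangeRestrict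
    f.range_rangeRestrict
  obtain ⟨L, hL⟩ := LinearMap.exists_extend s
  refine ⟨L, LinearMap.ext fun x => ?_⟩
  have h1 : L (f x) = s (f.rangeRestrict x) := LinearMap.congr_fun hL (f.rangeRestrict x)
  have h2 := congrArg Subtype.val (LinearMap.congr_fun hs (f.rangeRestrict x))
  simp only [LinearMap.comp_apply, h1]
  exact h2

namespace IrrData
variable (D : IrrData k C)

/-- By semisimplicity, linear maps between the Hom spaces out of the simple objects are always
induced by a morphism. Assembling linear pseudoinverses in this way proves regularity of `C`. -/
theorem comp_sum_dua {X Y : C} (L : ∀ i, (D.X i ⟶ Y) →ₗ[k] (D.X i ⟶ X)) (i : D.ι)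
    (s : D.X i ⟶ Y) :
    s ≫ ∑ j, dim k (D.X j) • ∑ α, D.dua j Y α ≫ L j (D.bas j Y α) = L i s := by
  rw [Preadditive.comp_sum, Finset.sum_eq_single i]
  · conv_rhs => rw [D.eq_sum_bas s, map_sum]
    rw [Linear.comp_smul, Preadditive.comp_sum, Finset.smul_sum]
    refine Finset.sum_congr rfl fun α _ => ?_
    rw [← Category.assoc, D.endo_eq _ (s ≫ D.dua i Y α), Linear.smul_comp, Category.id_comp,
      smul_smul, mul_div_cancel₀ _ (D.dim_X_ne_zero i), ← D.endo_eq, map_smul]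
  · intro j _ hj
    rw [Linear.comp_smul, Preadditive.comp_sum, Finset.sum_eq_zero, smul_zero]
    intro α _
    rw [← Category.assoc, D.hom_eq_zero hj.symm (s ≫ _), zero_comp]
  · simp

include D in
theorem isRegularCat : IsRegularCat C := by
  intro X Y f
  have hL (i : D.ι) := exists_linear_pseudoinverse (k := k) (Linear.rightComp k (D.X i) f)
  choose L hL using hL
  refine ⟨_, D.hom_ext_simple (g := f)
    (f := f ≫ (∑ j, dim k (D.X j) • ∑ α, D.dua j Y α ≫ L j (D.bas j Y α)) ≫ f) fun i s => ?_⟩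
  rw [← Category.assoc, ← Category.assoc, comp_sum_dua]
  exact LinearMap.congr_fun (hL i) s

variable [CharZero k]

theorem finiteDimensional_center (X Y : Center C) : FiniteDimensional k (X ⟶ Y) := by
  have := (PremodularCategory.semisimple (k := k) (C := C)).finiteDimensional X.1 Y.1
  let L : (X ⟶ Y) →ₗ[k] (X.1 ⟶ Y.1) :=
    { toFun := fun f => f.f, map_add' := fun _ _ => rfl, map_smul' := fun _ _ => rfl }
  exact FiniteDimensional.of_injective L fun f g h => Center.ext _ _ h

instance : D.redKar.asEquivalence.functor.Additive := inferInstanceAs D.redKar.Additive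
instance : D.redKar.asEquivalence.functor.Linear k := inferInstanceAs (D.redKar.Linear k)

instance : (toKaroubi (HTr k C)).Linear k where
  map_smul _ _ := rfl

include D

/-- A Maschke argument: if `g` is a pseudoinverse in `C` of a central morphism `f`, then `encircle Y
≫ g ≫ encircle X` lifts to the center by fullness and is a pseudoinverse there, because `f` commutes
with the idempotents. Regularity then passes along the equivalence. -/
theorem isRegularCat_karoubi : IsRegularCat (Karoubi (HTr k C)) := by
  have h : IsRegularCat (Center C) := by
    intro X Y f
    obtain ⟨g, hg⟩ := D.isRegularCat f.f
    let x : D.toKar.obj Y ⟶ D.toKar.obj X := ⟨D.encircle Y ≫ ofHom k g ≫ D.encircle X, by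
      change D.encircle Y ≫ (D.encircle Y ≫ ofHom k g ≫ D.encircle X) ≫ D.encircle X = _
      simp only [Category.assoc, encircle_idem]
      rw [← Category.assoc, encircle_idem]
      rfl⟩
    refine ⟨D.toKar.preimage x, D.toKar.map_injective ?_⟩
    rw [D.toKar.map_comp, D.toKar.map_comp, D.toKar.map_preimage]
    apply Karoubi.hom_ext
    have h1 : D.encircle X ≫ ofHom k f.f = ofHom k f.f ≫ D.encircle Y :=
      (D.ofHom_comp_encircle f).symm
    have h3 : D.encircle X ≫ ofHom k f.f ≫ D.encircle Y = ofHom k f.f ≫ D.encircle Y := by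
      rw [← h1, ← Category.assoc, encircle_idem]
    have h4 : ofHom k f.f ≫ D.encircle Y ≫ D.encircle Y = D.encircle X ≫ ofHom k f.f := by
      rw [encircle_idem, h1]
    have h2 : (D.encircle X ≫ ofHom k f.f) ≫ (D.encircle Y ≫ ofHom k g ≫ D.encircle X) ≫
        D.encircle X ≫ ofHom k f.f = D.encircle X ≫ ofHom k f.f := by
      rw [h1]
      simp only [Category.assoc]
      rw [h3, reassoc_of% h4, ← Category.assoc (ofHom k g), ← ofHom_comp,
        ← Category.assoc (ofHom k f.f), ← ofHom_comp, hg, h3]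
    exact h2
  intro P Q f
  exact IsRegularCat.of_equivalence h D.toKar f

theorem finiteDimensional_karoubi (P Q : Karoubi (HTr k C)) : FiniteDimensional k (P ⟶ Q) := by
  let K := D.redKar.asEquivalence.inverse
  have : FiniteDimensional k (K.obj P ⟶ K.obj Q) :=
    finiteDimensional_center (k := k) (C := C) (K.obj P) (K.obj Q)
  exact FiniteDimensional.of_injective (K.mapLinearMap k (X := P) (Y := Q))
    fun f g h => K.map_injective h

/-- `P` is a retract of an object of `C`, whose identity is a sum of morphisms through the `X i`. If
every morphism from these to `P` vanished, so would the identity of `P`. -/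
theorem exists_toKaroubi_ne_zero (P : Karoubi (HTr k C)) (hP : 𝟙 P ≠ 0) :
    ∃ (i : D.ι) (f : (toKaroubi (HTr k C)).obj ⟨D.X i⟩ ⟶ P), f ≠ 0 := by
  by_contra! h
  apply hP
  let u (j : D.ι) (α) : (toKaroubi (HTr k C)).obj P.X ⟶ (toKaroubi (HTr k C)).obj ⟨D.X j⟩ :=
    (toKaroubi (HTr k C)).map (ofHom k (D.dua j P.X.obj α))
  let w (j : D.ι) (α) : (toKaroubi (HTr k C)).obj ⟨D.X j⟩ ⟶ (toKaroubi (HTr k C)).obj P.X :=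
    (toKaroubi (HTr k C)).map (ofHom k (D.bas j P.X.obj α))
  have h2 : ∑ j, dim k (D.X j) • ∑ α, u j α ≫ w j α = 𝟙 _ := by
    have h4 : ofHom k (∑ j, dim k (D.X j) • ∑ α, D.dua j P.X.obj α ≫ D.bas j P.X.obj α) = 𝟙 P.X := by
      rw [sum_dua_bas]
      exact ofHom_id _
    rw [← (toKaroubi (HTr k C)).map_id, ← h4]
    simp only [ofHom_sum, ofHom_smul, ofHom_comp, Functor.map_sum, Functor.map_smul,
      Functor.map_comp]
    rfl
  have h1 : P.decompId_p = 0 := by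
    refine Eq.trans (Eq.symm (Category.id_comp _)) ((congrArg (· ≫ P.decompId_p) h2.symm).trans ?_)
    simp only [Preadditive.sum_comp, Linear.smul_comp, Category.assoc]
    refine Finset.sum_eq_zero fun j _ => ?_
    rw [Finset.sum_eq_zero, smul_zero]
    intro α _
    have := h j (w j α ≫ P.decompId_p)
    exact (congrArg (u j α ≫ ·) this).trans comp_zero
  have h3 : P.decompId_i ≫ P.decompId_p = 𝟙 P := P.decompId.symm
  rw [← h3, h1, comp_zero]

end IrrData

end

/-! ### Multifusion structures -/

section

variable {k : Type w} [Field k] [IsAlgClosed k] {C : Type u} [Category.{v} C] [Abelian C]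
    [Linear k C] [MonoidalCategory C] [MonoidalPreadditive C] [MonoidalLinear k C]
    [BraidedCategory C] [RightRigidCategory C] [PremodularCategory k C]
open HTr PivotalStructure Idempotents

namespace Idempotents.Karoubi
variable {E : Type u₁} [Category.{v₁} E] [Preadditive E] [MonoidalCategory E]
  [MonoidalPreadditive E]

instance : MonoidalPreadditive (Karoubi E) where
  whiskerLeft_zero {P _ _} := Karoubi.hom_ext _ _ (MonoidalPreadditive.tensor_zero P.p)
  zero_whiskerRight {P _ _} := Karoubi.hom_ext _ _ (MonoidalPreadditive.zero_tensor P.p)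
  whiskerLeft_add {P _ _} f g := Karoubi.hom_ext _ _
    (MonoidalPreadditive.tensor_add P.p f.f g.f)
  add_whiskerRight {P _ _} f g := Karoubi.hom_ext _ _
    (MonoidalPreadditive.add_tensor f.f g.f P.p)

instance {R : Type w} [Ring R] [Linear R E] [MonoidalLinear R E] :
    MonoidalLinear R (Karoubi E) where
  whiskerLeft_smul P _ _ r f := Karoubi.hom_ext _ _ (by
    change P.p ⊗ₘ (r • f.f) = r • (P.p ⊗ₘ f.f)
    rw [MonoidalCategory.tensorHom_def, MonoidalLinear.whiskerLeft_smul, Linear.comp_smul,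
      ← MonoidalCategory.tensorHom_def])
  smul_whiskerRight r _ _ f P := Karoubi.hom_ext _ _ (by
    change (r • f.f) ⊗ₘ P.p = r • (f.f ⊗ₘ P.p)
    rw [MonoidalCategory.tensorHom_def, MonoidalLinear.smul_whiskerRight, Linear.smul_comp,
      ← MonoidalCategory.tensorHom_def])

end Idempotents.Karoubi

namespace IrrData
variable (D : IrrData k C) [CharZero k]

attribute [local instance] Abelian.hasFiniteBiproducts

include D in
theorem isMultifusion_karoubi : IsMultifusion k (Karoubi (HTr k C)) where
  toIsFiniteSemisimple := IsRegularCat.isFiniteSemisimple D.isRegularCat_karoubi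
    D.finiteDimensional_karoubi
    (fun i : D.ι => (toKaroubi (HTr k C)).obj ⟨D.X i⟩) D.exists_toKaroubi_ne_zero
  monoidalPreadditive := inferInstance
  monoidalLinear := inferInstance
  hasRightDual _ := ⟨inferInstance⟩
  hasLeftDual X := PivotalStructure.hasLeftDual _ karPivotal X

/-- Finite products, regularity and a finite generating family come from the Karoubi envelope along
the equivalence; left duals come from the pivotal structure. -/
theorem isMultifusion_reduced : IsMultifusion k D.reducedMonoidal.Cat := by
  have h1 : IsIdempotentComplete D.reducedMonoidal.Cat := ⟨fun X g hg => exists_split X g hg⟩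
  have h2 : HasFiniteProducts D.reducedMonoidal.Cat :=
    ⟨fun n => Adjunction.hasLimitsOfShape_of_equivalence D.redKar⟩
  have h3 : IsRegularCat D.reducedMonoidal.Cat := fun {X Y} f =>
    IsRegularCat.of_equivalence D.isRegularCat_karoubi D.redKar.asEquivalence.inverse f
  have h4 : MonoidalPreadditive D.reducedMonoidal.Cat := monoidalPreadditive_of_faithful D.redKar
  exact
    { toIsFiniteSemisimple := IsRegularCat.isFiniteSemisimple h3
        (fun X Y => finiteDimensional_center (k := k) (C := C) X Y)
        (fun i : D.ι => (D.indCenter (D.X i) : D.reducedMonoidal.Cat)) (fun Y hY => by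
          obtain ⟨i, f, hf⟩ := D.exists_toKaroubi_ne_zero (D.redKar.obj Y) (fun h => hY
            (D.redKar.map_injective (by rw [D.redKar.map_id, h, D.redKar.map_zero])))
          refine ⟨i, D.redKar.preimage ((D.traceIso (D.X i)).inv ≫ f), fun h => hf ?_⟩
          have h' := (D.redKar.map_preimage _).symm.trans
            ((congrArg D.redKar.map h).trans (D.redKar.map_zero _ _))
          rw [← cancel_epi (D.traceIso (D.X i)).inv, comp_zero]
          exact h')
      monoidalPreadditive := h4
      monoidalLinear := .ofFaithful k D.redKar
      hasRightDual := fun X => ⟨inferInstance⟩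
      hasLeftDual := fun X => PivotalStructure.hasLeftDual _ D.redPivotal X }

end IrrData

end

end CategoryTheory

end

/-! ### The proposition -/

theorem propositionp (k : Type w) [Field k] [IsAlgClosed k] [CharZero k]
    (C : Type u) [Category.{v} C] [Abelian C] [Linear k C]
    [MonoidalCategory C] [MonoidalPreadditive C] [MonoidalLinear k C] [BraidedCategory C]
    [RightRigidCategory C] [PremodularCategory k C] (D : IrrData k C) :
    ∃ R : ReducedRigid D, IsMultifusion k R.Cat ∧
    ∃ P : PivotalStructure R.Cat, R.IsInducedPivotal P ∧
    ∃ T : PivotalStructure (HTr k C), HTr.IsInducedPivotal T ∧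
    ∃ G : TraceFunctor R, ∃ _ : G.functor.Monoidal, G.HasTensorStructure ∧
      IsPivotalFunctor T P G.functor ∧
    IsMultifusion k (Idempotents.Karoubi (HTr k C)) ∧
    ∃ PK : PivotalStructure (Idempotents.Karoubi (HTr k C)),
      Idempotents.Karoubi.IsInducedPivotal T PK ∧
    ∃ (K : Idempotents.Karoubi (HTr k C) ⥤ R.Cat) (_ : K.Monoidal)
      (e : Idempotents.toKaroubi (HTr k C) ⋙ K ≅ G.functor),
      NatTrans.IsMonoidal e.hom ∧ K.Additive ∧ K.Linear k ∧
      IsPivotalFunctor PK P K ∧ K.IsEquivalence := by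
  -- The functor `K` is the inverse of `redKar`. The monoidal structure on `G` is transported from
  -- the inclusion in the Karoubi envelope followed by `K`, and `hμ` determines it after applying
  -- `redKar`.
  obtain ⟨hK, hG, e, c, he, hc, hμ⟩ := exists_monoidal_factorization D.redKar
    (Idempotents.toKaroubi (HTr k C)) (show HTr k C ⥤ D.reducedMonoidal.Cat from D.traceFunctor.functor)
    D.traceFunctorRedKar
  have hP : IsPivotalFunctor D.redPivotal IrrData.karPivotal D.redKar :=
    PivotalStructure.isPivotalFunctor_ofFullyFaithful D.redKar IrrData.karPivotal
  have hc' : NatTrans.IsMonoidal c.symm.hom := inferInstanceAs (NatTrans.IsMonoidal c.inv)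
  -- `redKar` is faithful and pivotal, and its composite with `K` is monoidally isomorphic to the
  -- identity; so `K` is pivotal.
  have hKP : IsPivotalFunctor IrrData.karPivotal D.redPivotal D.redKar.asEquivalence.inverse :=
    hP.of_comp (IsPivotalFunctor.of_iso c.symm (isPivotalFunctor_id IrrData.karPivotal))
  have hGP : IsPivotalFunctor (HTr.pivotalStructure k (PremodularCategory.piv k)) D.redPivotal
      D.traceFunctor.functor := IsPivotalFunctor.of_iso e
    ((Idempotents.Karoubi.isPivotalFunctor_toKaroubi (HTr.pivotalStructure k (PremodularCategory.piv k))).comp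
      hKP)
  have hA : D.redKar.asEquivalence.inverse.Additive := inferInstance
  have hL : D.redKar.asEquivalence.inverse.Linear k := inferInstance
  have hE : D.redKar.asEquivalence.inverse.IsEquivalence := inferInstance
  exact ⟨D.reducedRigid, D.isMultifusion_reduced, D.redPivotal, D.redPivotal_isInduced,
    HTr.pivotalStructure k (PremodularCategory.piv k), fun _ => rfl, D.traceFunctor, hG,
    fun X Y => D.J_f X Y _ (hμ ⟨X⟩ ⟨Y⟩), hGP, D.isMultifusion_karoubi, IrrData.karPivotal,
    Idempotents.Karoubi.pivotalStructure_isInducedPivotal _, D.redKar.asEquivalence.inverse, hK, e, he,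
    hA, hL, hKP, hE⟩
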